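/- **Setup.** Let $\mathfrak m>0$, $T^+=\mathbb R/\mathfrak m\mathbb Z\times(0,\pi)$ with bottom and top boundary circles $\{\Im z=0\}$ and $\{\Im z=\pi\}$, and let $\phi:T^+\to\Omega$ be a conformal isomorphism onto a bounded doubly connected domain $\Omega\subset\mathbb R/\mathbb Z\times\mathbb R$ with non-contractible boundary components $\partial_{\rm bot}\Omega$, $\partial_{\rm top}\Omega$ (bottom corresponding to bottom). A function on the double cover of $\Omega$ is called antiperiodic if its values on the two sheets are opposite. For $\eta\in\mathbb C$ and $z_1$ in the double cover of $\Omega$ let $f^{[\eta]}_\Omega(z_1,\cdot)$ be the antiperiodic holomorphic function on $\Omega\smallsetminus\{z_1\}$ such that * $f^{[\eta]}_\Omega(z_1,z_2)=\frac{1}{\pi i}\frac{\overline\eta}{z_2-z_1}+O(1)$ as $z_2\to z_1$; * $\Re f^{[\eta]}_\Omega(z_1,\cdot)$ is continuous up to $\partial_{\rm bot}\Omega$ and vanishes there; * near $\partial_{\rm top}\Omega$ there is a primitive of $f^{[\eta]}_\Omega(z_1,\cdot)$ whose imaginary part is continuous up to $\partial_{\rm top}\Omega$ and vanishes there. Put $f_\Omega^{[\pm+]}=f_\Omega^{[1]}\pm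 i f_\Omega^{[i]}$, $f_\Omega^{[\pm-]}=\overline{f_\Omega^{[\mp+]}}$, and $$\mathcal A_{n,\Omega}(z_1,\dots,z_n)=\frac1{4^n}\sum_{s_1,\dots,s_n\in\{\pm\}}\det\big[\mathbf 1_{j\ne k}f_\Omega^{[s_j,s_k]}(z_j,z_k)\big]_{j,k=1}^n\prod_{k=1}^n dz_k^{[s_k]},\qquad dz^{[+]}=dz,\ dz^{[-]}=d\bar z .$$ Let $\mathcal A_n=\phi^*\mathcal A_{n,\Omega}$ be its pullback to $T^+$ in each variable, and for pairwise distinct $z_1,\dots,z_n\in\overline{T^+}$ let $$h_n(z_1,\dots,z_n)=\int_{z_1^0}^{z_1}\!\!\cdots\int_{z_n^0}^{z_n}\mathcal A_n ,$$ where the integration is along pairwise non-intersecting $C^1$ paths which start at points $z_k^0$ of the bottom boundary and run through $T^+$. Let $M_n$ be the value of $h_n$ on the top boundary, let $\mathrm{hm}_{\rm top}(z)=\pi^{-1}\Im z$, and define the connected correlation functions by $$h_1^{\rm conn}=h_1,\qquad h^{\rm conn}_{|Z|}(Z)=h_{|Z|}(Z)-\sum h^{\rm conn}_{|Z_1|}(Z_1)\cdots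 h^{\rm conn}_{|Z_r|}(Z_r),$$ the sum being over all partitions $Z=Z_1\sqcup\dots\sqcup Z_r$ with $r\ge2$. Let $\wp$ be the Weierstrass function of the lattice $\Lambda=\mathfrak m\mathbb Z+2\pi i\mathbb Z$, and $z_\mu=(\frac12-\mu)\mathfrak m+\pi i$ for $\mu\in\mathbb R$. Let $G$ be the positive Green's function of $T^+$ with zero Dirichlet boundary values, $G(z_1,z_2)=-\frac1{2\pi}\log|z_2-z_1|+O(1)$. Finally, let $\xi_\mu$ be the centered discrete Gaussian variable, $\mathbb P[\xi_\mu=k-a_\mu]=Z_\mu^{-1}e^{-\frac12\mathfrak m(k-\mu)^2}$ for $k\in\mathbb Z$, with $Z_\mu$ the normalizing constant and $a_\mu$ such that $\mathbb E\,\xi_\mu=0$. **Statement.** The integrals defining $h_n$ converge absolutely and do not depend on the choice of the paths. There is a constant $c_{\mathfrak m}\in\mathbb R$ such that, for all $s_1,s_2\in\{\pm\}$ and all $z_1\ne z_2$ in $T^+$, $$-4\pi\,\partial^{[s_1]}_{z_1}\partial^{[s_2]}_{z_2}G(z_1,z_2)=s_1s_2\big(\wp(z_2^{[s_2]}-z_1^{[s_1]})+c_{\mathfrak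 m}\big),$$ where $\partial^{[+]}_z=\partial_z$, $\partial^{[-]}_z=\partial_{\bar z}$, $z^{[+]}=z$, $z^{[-]}=\bar z$; and with this constant the following holds. The functions $h_2$ and $h_3$ are constant on the top boundary, and there is $\mu\in\mathbb R$ with $$M_2=-\wp(z_\mu)-c_{\mathfrak m},\qquad M_3=\wp'(z_\mu).\tag{1}$$ For every $\mu\in\mathbb R$ satisfying (1), every $n\ge3$ and all pairwise distinct $z_1,\dots,z_n\in\overline{T^+}$, $$h_n^{\rm conn}(z_1,\dots,z_n)=(-1)^{n-1}\wp^{(n-2)}(z_\mu)\cdot\mathrm{hm}_{\rm top}(z_1)\cdots\mathrm{hm}_{\rm top}(z_n).$$ Moreover, for every $\mu\in\mathbb R$ and $n\ge3$, the number $(-1)^{n-1}\wp^{(n-2)}(z_\mu)$ is the $n$-th cumulant of $\xi_\mu$. -/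

import Mathlib

open Complex Set Filter Topology MeasureTheory

noncomputable section

namespace DimerCylinder

/-! ### The straight cylinder and the domain

Cylinders are described by their universal covers. The straight cylinder
`T⁺ = ℝ/mℤ × (0, π)` is the strip `0 < Im z < π` modulo `z ↦ z + m`; a cylindrical domain in
`ℝ/ℤ × ℝ` is its preimage `Ω ⊆ ℂ`, invariant under `z ↦ z + 1`. Functions on the double cover of
the cylindrical domain with opposite values on the two sheets ("antiperiodic" functions) are
functions `F` on `Ω` with `F (z + 1) = - F z`. -/

/-- The universal cover of the open straight cylinder `T⁺`. -/
def strip : Set ℂ := {z | 0 < z.im ∧ z.im < Real.pi}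

/-- The universal cover of the closed straight cylinder. -/
def closedStrip : Set ℂ := {z | 0 ≤ z.im ∧ z.im ≤ Real.pi}

/-- `z` and `w` represent the same point of the cylinder of circumference `m`. -/
def SamePoint (m : ℝ) (z w : ℂ) : Prop := ∃ l : ℤ, z = w + l * m

/-- `φ` induces a conformal isomorphism of `T⁺` onto the bounded doubly connected cylindrical
domain in `ℝ/ℤ × ℝ` with preimage `Ω`. The relation `φ (z + m) = φ z + 1` says that `φ` maps the
generating loop of `T⁺` to the generating loop of `ℝ/ℤ × ℝ`, so that the boundary components of
the domain are non-contractible and bottom corresponds to bottom and top to top. -/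
structure IsUniformization (m : ℝ) (φ : ℂ → ℂ) (Ω : Set ℂ) : Prop where
  differentiableOn : DifferentiableOn ℂ φ strip
  injOn : InjOn φ strip
  image_eq : φ '' strip = Ω
  map_add : ∀ z ∈ strip, φ (z + m) = φ z + 1
  bounded : ∃ R : ℝ, ∀ z ∈ Ω, |z.im| ≤ R

/-- The bottom boundary component of the domain: all limits of `φ ζ` along `Im ζ → 0`. -/
def bottomBoundary (φ : ℂ → ℂ) : Set ℂ :=
  {p | MapClusterPt p (comap Complex.im (𝓝[>] (0 : ℝ))) φ}

/-- The top boundary component of the domain: all limits of `φ ζ` along `Im ζ → π`. -/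
def topBoundary (φ : ℂ → ℂ) : Set ℂ :=
  {p | MapClusterPt p (comap Complex.im (𝓝[<] Real.pi)) φ}

/-! ### The boundary value problem and the functions `f^{[±±]}` -/

/-- `F` is a solution `f^{[η]}(z₁, ·)` of the boundary value problem: it is holomorphic and
antiperiodic on the domain punctured at `z₁`, equals `η̄ / (π i (z - z₁)) + O(1)` near `z₁`,
its real part vanishes continuously on the bottom boundary, and near the top boundary it has a
primitive whose imaginary part vanishes continuously on the top boundary. -/
structure IsBVPSolution (φ : ℂ → ℂ) (Ω : Set ℂ) (η z₁ : ℂ) (F : ℂ → ℂ) : Prop where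
  holomorphic : DifferentiableOn ℂ F {z | z ∈ Ω ∧ ¬ SamePoint 1 z z₁}
  antiperiodic : ∀ z ∈ Ω, ¬ SamePoint 1 z z₁ → F (z + 1) = - F z
  singularity : (fun z => F z - 1 / (Real.pi * I) * (starRingEnd ℂ η / (z - z₁)))
    =O[𝓝[≠] z₁] (fun _ => (1 : ℝ))
  bottom : ∀ p ∈ bottomBoundary φ, Tendsto (fun z => (F z).re) (𝓝[Ω] p) (𝓝 0)
  top : ∃ ε : ℝ, 0 < ε ∧ ∃ g : ℂ → ℂ,
    (∀ ζ ∈ strip, Real.pi - ε < ζ.im → HasDerivAt g (F (φ ζ)) (φ ζ)) ∧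
    ∀ p ∈ topBoundary φ, Tendsto (fun z => (g z).im) (𝓝[Ω] p) (𝓝 0)

/-- Signs `s ∈ {±}` are encoded by `Bool`, with `true` for `+`. -/
def sgn (s : Bool) : ℂ := if s then 1 else -1

/-- `w^{[+]} = w` and `w^{[-]} = w̄`. -/
def signConj (s : Bool) (w : ℂ) : ℂ := if s then w else starRingEnd ℂ w

/-- The functions `f^{[s₁,s₂]}(z₁, z₂)` built from `f η z₁ z₂ = f^{[η]}(z₁, z₂)`:
`f^{[±,+]} = f^{[1]} ± i f^{[i]}` and `f^{[±,-]}` is the complex conjugate of `f^{[∓,+]}`. -/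
def coupling (f : ℂ → ℂ → ℂ → ℂ) : Bool → Bool → ℂ → ℂ → ℂ
  | true, true, z₁, z₂ => f 1 z₁ z₂ + I * f I z₁ z₂
  | false, true, z₁, z₂ => f 1 z₁ z₂ - I * f I z₁ z₂
  | true, false, z₁, z₂ => starRingEnd ℂ (f 1 z₁ z₂ - I * f I z₁ z₂)
  | false, false, z₁, z₂ => starRingEnd ℂ (f 1 z₁ z₂ + I * f I z₁ z₂)

/-! ### The differential forms and the correlation functions -/

section forms

variable {ι : Type} [Fintype ι] [DecidableEq ι]

/-- The form `𝒜ₙ = 4⁻ⁿ ∑_s det[1_{j≠k} f^{[s_j,s_k]}(z_j, z_k)] ∏ₖ dz_k^{[s_k]}` of the domain,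
pulled back to `T⁺` by `φ`: its value at the points `z k` on the tangent vectors `v k`. The points
are indexed by a finite type `ι`. -/
def formA (φ : ℂ → ℂ) (f : ℂ → ℂ → ℂ → ℂ) (z v : ι → ℂ) : ℂ :=
  (1 / 4) ^ Fintype.card ι * ∑ s : ι → Bool,
    (Matrix.of fun j k : ι =>
      if j ≠ k then coupling f (s j) (s k) (φ (z j)) (φ (z k)) else 0).det *
    ∏ k, signConj (s k) (deriv φ (z k) * v k)

/-- `γ k`, `k ∈ ι`, are `C¹` paths in the closed cylinder, parametrized by `[0, 1]`, which run from
the bottom boundary to `z k` through the open cylinder and do not intersect each other. -/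
structure IsPathFamily (m : ℝ) (z : ι → ℂ) (γ : ι → ℝ → ℂ) : Prop where
  contDiffOn : ∀ k, ContDiffOn ℝ 1 (γ k) (Icc 0 1)
  source : ∀ k, (γ k 0).im = 0
  inside : ∀ k, ∀ t ∈ Ioo (0 : ℝ) 1, γ k t ∈ strip
  target : ∀ k, γ k 1 = z k
  disjoint : ∀ j k, j ≠ k → ∀ s ∈ Icc (0 : ℝ) 1, ∀ t ∈ Icc (0 : ℝ) 1,
    ¬ SamePoint m (γ j s) (γ k t)

/-- The pullback of `𝒜ₙ` to the cube of path parameters. -/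
def pathIntegrand (φ : ℂ → ℂ) (f : ℂ → ℂ → ℂ → ℂ) (γ : ι → ℝ → ℂ) (t : ι → ℝ) : ℂ :=
  formA φ f (fun k => γ k (t k)) (fun k => deriv (γ k) (t k))

/-- The multiple integral of `𝒜ₙ` along the paths `γ k`. -/
def pathIntegral (φ : ℂ → ℂ) (f : ℂ → ℂ → ℂ → ℂ) (γ : ι → ℝ → ℂ) : ℂ :=
  ∫ t in Icc (0 : ι → ℝ) 1, pathIntegrand φ f γ t

open Classical in
/-- The correlation function `hₙ` at the points `z k`: the integral of `𝒜ₙ` along some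
non-intersecting paths from the bottom boundary to the points `z k`. -/
def heightCorr (m : ℝ) (φ : ℂ → ℂ) (f : ℂ → ℂ → ℂ → ℂ) (z : ι → ℂ) : ℂ :=
  if h : ∃ γ : ι → ℝ → ℂ, IsPathFamily m z γ then pathIntegral φ f h.choose else 0

/-- The points `z k` lie in the closed cylinder and are pairwise distinct there. -/
def IsDistinctTuple (m : ℝ) (z : ι → ℂ) : Prop :=
  (∀ k, z k ∈ closedStrip) ∧ ∀ j k, j ≠ k → ¬ SamePoint m (z j) (z k)

end forms

/-- `hₙ` is identically equal to `M` on the top boundary, i.e. `Mₙ = M`. -/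
def IsTopMoment (m : ℝ) (φ : ℂ → ℂ) (f : ℂ → ℂ → ℂ → ℂ) (n : ℕ) (M : ℂ) : Prop :=
  ∀ z : Fin n → ℂ, IsDistinctTuple m z → (∀ k, (z k).im = Real.pi) → heightCorr m φ f z = M

/-! ### Connected correlation functions -/

section ursell

variable {ι : Type} [DecidableEq ι]

theorem card_lt_of_mem_parts {s B : Finset ι} (P : Finpartition s) (hB : B ∈ P.parts)
    (hP : P.parts ≠ {s}) : B.card < s.card := by
  refine Finset.card_lt_card ((P.le hB).lt_of_ne ?_)
  rintro rfl
  refine hP (Finset.eq_singleton_iff_unique_mem.2 ⟨hB, fun C hC => ?_⟩)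
  by_contra hne
  have h1 : Disjoint C B := P.disjoint hC hB hne
  exact P.ne_bot hC (disjoint_self.1 (h1.mono_right (P.le hC)))

/-- Ursell functions of a family `H s` of correlations indexed by finite sets of variables:
`Hᶜ(s) = H(s) - ∑ Hᶜ(s₁) ⋯ Hᶜ(s_r)`, the sum being over all partitions of `s` except `{s}`. -/
def ursell (H : Finset ι → ℂ) (s : Finset ι) : ℂ :=
  H s - ∑ P : {P : Finpartition s // P.parts ≠ {s}},
    ∏ B : {B : Finset ι // B ∈ P.1.parts}, ursell H B.1
termination_by s.card
decreasing_by exact card_lt_of_mem_parts P.1 B.2 P.2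

end ursell

/-- The connected correlation function `hₙᶜᵒⁿⁿ(z₁, …, zₙ)`. -/
def connectedCorr (m : ℝ) (φ : ℂ → ℂ) (f : ℂ → ℂ → ℂ → ℂ) {n : ℕ} (z : Fin n → ℂ) : ℂ :=
  ursell (fun s : Finset (Fin n) => heightCorr m φ f (fun k : s => z k)) Finset.univ

/-- The harmonic measure of the top boundary of `T⁺`. -/
def hmTop (z : ℂ) : ℝ := z.im / Real.pi

/-! ### The Weierstrass function, the Green's function and the parametrization -/

/-- The periods `m` and `2πi` of the torus obtained by doubling `T⁺`. -/
def periods (m : ℝ) (hm : 0 < m) : PeriodPair where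
  ω₁ := m
  ω₂ := 2 * Real.pi * I
  indep := by
    rw [LinearIndependent.pair_iff]
    intro s t h
    have h1 := congrArg Complex.re h
    have h2 := congrArg Complex.im h
    simp [hm.ne', Real.pi_ne_zero] at h1 h2
    exact ⟨h1, h2⟩

/-- The Weierstrass function `℘` of the lattice `mℤ + 2πiℤ`. -/
def wp (m : ℝ) (hm : 0 < m) : ℂ → ℂ := (periods m hm).weierstrassP

/-- The Green's function of `T⁺` with zero boundary values: positive, harmonic off the diagonal,
with singularity `-(2π)⁻¹ log |z₂ - z₁|`. -/
structure IsGreenFunction (m : ℝ) (G : ℂ → ℂ → ℝ) : Prop where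
  periodic_left : ∀ z w, G (z + m) w = G z w
  periodic_right : ∀ z w, G z (w + m) = G z w
  pos : ∀ z ∈ strip, ∀ w ∈ strip, ¬ SamePoint m w z → 0 < G z w
  harmonic : ∀ z ∈ strip,
    InnerProductSpace.HarmonicOnNhd (G z) {w | w ∈ strip ∧ ¬ SamePoint m w z}
  singularity : ∀ z ∈ strip,
    (fun w => G z w + (2 * Real.pi)⁻¹ * Real.log ‖w - z‖) =O[𝓝[≠] z] (fun _ => (1 : ℝ))
  boundary : ∀ z ∈ strip, ∀ p : ℂ, (p.im = 0 ∨ p.im = Real.pi) →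
    Tendsto (G z) (𝓝[strip] p) (𝓝 0)

/-- The Wirtinger derivatives `∂^{[+]} = ∂_z` and `∂^{[-]} = ∂_{z̄}`. -/
def wirtinger (s : Bool) (F : ℂ → ℂ) (z : ℂ) : ℂ :=
  (1 / 2) * (fderiv ℝ F z 1 - sgn s * I * fderiv ℝ F z I)

/-- `c` is the constant for which the mixed Wirtinger derivatives of the Green's function `G` are
`-4π ∂^{[s₁]}_{z₁} ∂^{[s₂]}_{z₂} G(z₁, z₂) = s₁ s₂ (℘(z₂^{[s₂]} - z₁^{[s₁]}) + c)`. -/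
def IsGreenConstant (m : ℝ) (hm : 0 < m) (c : ℝ) : Prop :=
  ∃ G : ℂ → ℂ → ℝ, IsGreenFunction m G ∧
    ∀ s₁ s₂ : Bool, ∀ z₁ ∈ strip, ∀ z₂ ∈ strip, ¬ SamePoint m z₂ z₁ →
      -4 * Real.pi * wirtinger s₁ (fun w₁ => wirtinger s₂ (fun w₂ => (G w₁ w₂ : ℂ)) z₂) z₁ =
        sgn s₁ * sgn s₂ * (wp m hm (signConj s₂ z₂ - signConj s₁ z₁) + c)

/-- The point `z_μ = (1/2 - μ) m + π i`. -/
def zPoint (m μ : ℝ) : ℂ := (1 / 2 - μ) * m + Real.pi * I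

/-- The moments `M₂`, `M₃` are parametrized by `μ`: `M₂ = -℘(z_μ) - c` and `M₃ = ℘'(z_μ)`. -/
def IsParameter (m : ℝ) (hm : 0 < m) (φ : ℂ → ℂ) (f : ℂ → ℂ → ℂ → ℂ) (c μ : ℝ) : Prop :=
  IsTopMoment m φ f 2 (-wp m hm (zPoint m μ) - c) ∧
  IsTopMoment m φ f 3 (deriv (wp m hm) (zPoint m μ))

/-- The coefficient `(-1)^(n-1) ℘^{(n-2)}(z_μ)`, for `n ≥ 2`. -/
def wpCoeff (m : ℝ) (hm : 0 < m) (μ : ℝ) (n : ℕ) : ℂ :=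
  (-1) ^ (n - 1) * iteratedDeriv (n - 2) (wp m hm) (zPoint m μ)

/-! ### The discrete Gaussian -/

/-- The weight `exp(-m (k - μ)² / 2)`. -/
def gaussWeight (m μ : ℝ) (k : ℤ) : ℝ := Real.exp (-(1 / 2) * m * ((k : ℝ) - μ) ^ 2)

/-- The normalizing constant. -/
def gaussZ (m μ : ℝ) : ℝ := ∑' k : ℤ, gaussWeight m μ k

/-- The shift that makes the discrete Gaussian centered. -/
def gaussShift (m μ : ℝ) : ℝ := ∑' k : ℤ, (k : ℝ) * (gaussWeight m μ k / gaussZ m μ)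

/-- The law of the centered discrete Gaussian `ξ_μ`: it takes the value `k - a_μ` with probability
`Z⁻¹ exp(-m (k - μ)² / 2)`, `k ∈ ℤ`. -/
def discreteGaussian (m μ : ℝ) : Measure ℝ :=
  Measure.sum fun k : ℤ =>
    ENNReal.ofReal (gaussWeight m μ k / gaussZ m μ) •
      Measure.dirac ((k : ℝ) - gaussShift m μ)

/-- The `n`-th cumulant of `ξ_μ`: the `n`-th derivative at `0` of `t ↦ log 𝔼[exp(t ξ_μ)]`. -/
def gaussCumulant (m μ : ℝ) (n : ℕ) : ℝ :=
  iteratedDeriv n (ProbabilityTheory.cgf id (discreteGaussian m μ)) 0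

end DimerCylinder

end

open DimerCylinder

open Complex Set Filter Topology MeasureTheory
noncomputable section
namespace DimerCylinder

section

/-! ### A theta function as an infinite product -/

/-! The coupling functions can be computed in closed form, the resulting determinants have explicit
joint cumulants, and integration along paths turns all but the second cumulant into a constant times
a product of harmonic measures.

Write `θ` for `theta`, `Z = θ'/θ` for `thetaLog` and `b = r + πi` with `r` real. The Kronecker
kernel `kern m r u = θ(u-b) θ'(0) / (θ(u) θ(-b))` has simple poles on the lattice, period `2πi` and
multiplier `e^{-b}` along `m`. For one real `r`, the functions `f^{[s₁,s₂]}` pulled back to the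
strip equal `kern m r (z₂^{[s₂]} - z₁^{[s₁]})` up to constants and a gauge factor that cancels in
determinants (`exists_coupling_eq`). Indeed, for a solution `F` the function `i e^{ζ/2} F(φ ζ)` is
real on the bottom line and becomes real on the top line after multiplication by `φ'`; by Schwarz
reflection (`exists_reflection`) it extends across both lines. Removing the pole and all zeros of
one solution leaves a nowhere vanishing real section `q`. Since `φ'` has an `m`-periodic logarithm
(`IsUniformization.exists_log_deriv`), `q` has degree zero and a positive multiplier, and that
multiplier defines `r` (`IsRealSection.degree_eq_zero`). Dividing any solution by `q` reduces to a
problem without `φ'`, which the kernel solves and which has no other solution because a section of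
degree zero with negative multiplier vanishes (`IsRealSection.eq_zero_of_neg`).

The algebra rests on two identities: the addition theorem `kern_mul_kern`, in which the derivative
of the kernel with respect to `r` appears, and `kern u · kern (-u) = ℘(b) - ℘(u)`
(`kern_mul_kern_neg`). Expanding the determinant of the points `X ∪ {y}` along the row and column of
`y` gives `-∂ᵣ det X + ∑_j (℘(x_y - x_j) - ℘(b)) det (X \ {j})` (`kernDet_insert`). By induction on
`X` this becomes the moment-cumulant recursion with joint cumulants `0` for one point, `℘(x_k - x_j)
- ℘(b)` for two and the constant `(-1)^(n-1) ℘^{(n-2)}(b)` for `n ≥ 3` points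
(`kernDet_insert_eq_sum`).

The sum over signs and the integral over path parameters form an expectation over independent
variables, one per point. The recursion therefore survives integration. Each differential integrates
to the harmonic measure of the top (`integral_extWeight`), and the pair term integrates to a
difference of values of `log |θ|` because `Z' = -℘ - c` (`exists_deriv_thetaLog_eq`). Only end
points enter, so the integrals do not depend on the paths, and the Ursell functions are the
integrated cumulants (`connectedCorr_eq`). At the top, orders two and three give `-℘(b) - c` and
`℘'(b)`; any `z_μ` with the same two values has the same higher derivatives of `℘` as `b`, by its
differential equation (`iteratedDeriv_wp_congr`).

The same `θ` settles the remaining claims. The Green's function is `-(2π)⁻¹ log |θ(w - z) / θ(w̄ -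
z)|`, whose mixed derivatives involve `Z'` and hence the same constant `c` (`isGreenConstant`). The
Gaussian sum `∑ exp(-m k²/2 + k u)` is, up to an exponential, `θ` shifted by the half period `m/2 +
πi`, so the derivative of the cumulant generating function of `ξ_μ` is a constant plus `Z(t - z_μ)`
(`wpCoeff_eq_gaussCumulant`). -/

/-- The infinite product `∏_{n ≥ 1} (1 - pⁿ w)`. -/
def qProd (p : ℝ) (w : ℂ) : ℂ := ∏' n : ℕ, (1 + -((p : ℂ) ^ (n + 1) * w))

section qProd

variable {p : ℝ}

theorem summable_qProd (h0 : 0 < p) (h1 : p < 1) (w : ℂ) :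
    Summable fun n : ℕ => ‖-((p : ℂ) ^ (n + 1) * w)‖ := by
  have : Summable fun n : ℕ => p ^ (n + 1) * ‖w‖ :=
    ((summable_nat_add_iff 1).mpr (summable_geometric_of_lt_one h0.le h1)).mul_right _
  simpa [abs_of_pos h0] using this

theorem multipliable_qProd (h0 : 0 < p) (h1 : p < 1) (w : ℂ) :
    Multipliable fun n : ℕ => (1 + -((p : ℂ) ^ (n + 1) * w)) :=
  multipliable_one_add_of_summable (summable_qProd h0 h1 w)

theorem differentiable_qProd (h0 : 0 < p) (h1 : p < 1) : Differentiable ℂ (qProd p) := by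
  have key : ∀ R : ℝ, DifferentiableOn ℂ (qProd p) (Metric.ball 0 R) := by
    intro R
    have hs : Summable fun n : ℕ => p ^ (n + 1) * R :=
      ((summable_nat_add_iff 1).mpr (summable_geometric_of_lt_one h0.le h1)).mul_right _
    have h := Summable.hasProdLocallyUniformlyOn_nat_one_add
      (f := fun n w => -((p : ℂ) ^ (n + 1) * w)) (K := Metric.ball 0 R) Metric.isOpen_ball hs
      (Eventually.of_forall fun n x hx => by
        have : ‖x‖ ≤ R := by simpa using (Metric.mem_ball.1 hx).le
        simp only [norm_neg, norm_mul, norm_pow, norm_real, Real.norm_eq_abs, abs_of_pos h0]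
        gcongr) (fun n => by fun_prop)
    exact TendstoLocallyUniformlyOn.differentiableOn h
      (.of_forall fun _ => by
        simpa [Finset.prod_fn] using DifferentiableOn.finsetProd (fun _ _ => by fun_prop))
      Metric.isOpen_ball
  intro w
  exact (key (‖w‖ + 1)).differentiableAt (Metric.isOpen_ball.mem_nhds (by simp))

theorem qProd_ne_zero (h0 : 0 < p) (h1 : p < 1) {w : ℂ}
    (hw : ∀ n : ℕ, (p : ℂ) ^ (n + 1) * w ≠ 1) : qProd p w ≠ 0 := by
  refine tprod_one_add_ne_zero_of_summable (fun n h => hw n ?_) (summable_qProd h0 h1 w)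
  linear_combination -h

/-- Dividing the argument by `p` shifts the index of the product by one and brings in the factor `1
- w`. This is the source of the quasi-period `m` of `theta`. -/
theorem qProd_div (h0 : 0 < p) (h1 : p < 1) (w : ℂ) :
    qProd p (w / p) = (1 - w) * qProd p w := by
  have hp : (p : ℂ) ≠ 0 := by exact_mod_cast h0.ne'
  have hA := (multipliable_qProd h0 h1 w).hasProd.tendsto_prod_nat
  have hB := (multipliable_qProd h0 h1 (w / p)).hasProd.tendsto_prod_nat
  have hB' := (tendsto_add_atTop_iff_nat 1).2 hB
  refine tendsto_nhds_unique hB' ?_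
  have := hA.const_mul (1 - w)
  refine this.congr fun n => ?_
  rw [Finset.prod_range_succ']
  rw [mul_comm]
  congr 1
  · refine Finset.prod_congr rfl fun i _ => ?_
    field_simp
    ring
  · field_simp
    ring

theorem qProd_conj (h0 : 0 < p) (h1 : p < 1) (w : ℂ) :
    qProd p (starRingEnd ℂ w) = starRingEnd ℂ (qProd p w) := by
  have hA := (multipliable_qProd h0 h1 w).hasProd.tendsto_prod_nat
  have hB := (multipliable_qProd h0 h1 (starRingEnd ℂ w)).hasProd.tendsto_prod_nat
  refine tendsto_nhds_unique hB ?_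
  refine ((continuous_conj.tendsto _).comp hA).congr fun n => ?_
  simp [map_prod]

theorem norm_qProd_mul_le (h0 : 0 < p) (h1 : p < 1) {a b c d : ℂ}
    (h : ∀ n : ℕ, ‖(1 - (p : ℂ) ^ (n + 1) * a)‖ * ‖1 - (p : ℂ) ^ (n + 1) * b‖ ≤
      ‖(1 - (p : ℂ) ^ (n + 1) * c)‖ * ‖1 - (p : ℂ) ^ (n + 1) * d‖) :
    ‖qProd p a * qProd p b‖ ≤ ‖qProd p c * qProd p d‖ := by
  have hA := ((multipliable_qProd h0 h1 a).hasProd.tendsto_prod_nat.mul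
    (multipliable_qProd h0 h1 b).hasProd.tendsto_prod_nat).norm
  have hB := ((multipliable_qProd h0 h1 c).hasProd.tendsto_prod_nat.mul
    (multipliable_qProd h0 h1 d).hasProd.tendsto_prod_nat).norm
  refine le_of_tendsto_of_tendsto' hA hB fun n => ?_
  rw [← Finset.prod_mul_distrib, ← Finset.prod_mul_distrib, norm_prod, norm_prod]
  refine Finset.prod_le_prod (fun _ _ => norm_nonneg _) fun i _ => ?_
  simpa [norm_mul, sub_eq_add_neg] using h i

end qProd

/-- The odd theta function with simple zeros at the lattice `mℤ + 2πiℤ`. -/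
def theta (m : ℝ) (u : ℂ) : ℂ :=
  2 * sinh (u / 2) * (qProd (Real.exp (-m)) (exp u) * qProd (Real.exp (-m)) (exp (-u)))

/-! ### Quasi-periods, zeros and size of the theta function. -/

section theta

variable {m : ℝ} (hm : 0 < m)

theorem mem_periods_iff {u : ℂ} :
    u ∈ (periods m hm).lattice ↔ ∃ k l : ℤ, u = k * m + l * (2 * Real.pi * I) := by
  rw [PeriodPair.mem_lattice]
  constructor
  · rintro ⟨k, l, h⟩
    exact ⟨k, l, h.symm⟩
  · rintro ⟨k, l, h⟩
    exact ⟨k, l, h.symm⟩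

theorem two_pi_I_mem_periods : 2 * Real.pi * I ∈ (periods m hm).lattice :=
  (periods m hm).ω₂_mem_lattice

theorem ofReal_mem_periods : (m : ℂ) ∈ (periods m hm).lattice :=
  (periods m hm).ω₁_mem_lattice

include hm in
theorem exp_neg_lt_one : Real.exp (-m) < 1 := by simpa using hm

include hm in
theorem differentiable_theta : Differentiable ℂ (theta m) := by
  have h := differentiable_qProd (Real.exp_pos (-m)) (exp_neg_lt_one hm)
  unfold theta
  have h2 : Differentiable ℂ fun u : ℂ => qProd (Real.exp (-m)) (exp u) :=
    h.comp differentiable_exp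
  have h3 : Differentiable ℂ fun u : ℂ => qProd (Real.exp (-m)) (exp (-u)) :=
    h.comp (differentiable_exp.comp differentiable_neg)
  have h4 : Differentiable ℂ fun u : ℂ => sinh (u / 2) :=
    differentiable_sinh.comp (by fun_prop)
  exact (h4.const_mul 2).mul (h2.mul h3)

theorem theta_neg (u : ℂ) : theta m (-u) = -theta m u := by
  simp only [theta, neg_div, sinh_neg, neg_neg]
  ring

theorem theta_zero : theta m 0 = 0 := by simp [theta]

theorem theta_add_two_pi_I (u : ℂ) : theta m (u + 2 * Real.pi * I) = -theta m u := by
  have h1 : sinh ((u + 2 * Real.pi * I) / 2) = - sinh (u / 2) := by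
    rw [show (u + 2 * Real.pi * I) / 2 = u / 2 + Real.pi * I by ring, sinh_add]
    simp [sinh_mul_I, cosh_mul_I]
  have h2 : exp (u + 2 * Real.pi * I) = exp u := exp_periodic u
  have h3 : exp (-(u + 2 * Real.pi * I)) = exp (-u) := by rw [exp_neg, h2, exp_neg]
  simp only [theta, h1, h2, h3]
  ring

include hm in
-- The shift moves one factor into the product in `exp u` and one out of the product in `exp (-u)`;
-- together with the two hyperbolic sines they leave only the exponential.
theorem theta_add_ofReal (u : ℂ) : theta m (u + m) = -exp (u + m / 2) * theta m u := by
  set p := Real.exp (-m) with hp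
  have hp0 : 0 < p := Real.exp_pos _
  have hp1 : p < 1 := exp_neg_lt_one hm
  have hpc : (p : ℂ) = exp (-m) := by simp [hp]
  have e1 : exp (u + m) = exp u / p := by rw [hpc, exp_neg, div_inv_eq_mul, exp_add]
  have e2 : exp (-(u + m)) * (p:ℂ)⁻¹ = exp (-u) := by
    rw [hpc, ← exp_neg, ← exp_add]; ring_nf
  have h1 := qProd_div hp0 hp1 (exp u)
  have h2 := qProd_div hp0 hp1 (exp (-(u + m)))
  rw [div_eq_mul_inv (exp (-(u+m))), e2] at h2
  simp only [theta, ← hp]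
  rw [e1, h1, h2]
  have e3 : 2 * sinh ((u + m) / 2) = exp ((u + m) / 2) * (1 - exp (-(u + m))) := by
    rw [two_sinh, mul_sub, ← exp_add]; ring_nf
  have e4 : 2 * sinh (u / 2) = exp (- u / 2) * (exp u - 1) := by
    rw [two_sinh, mul_sub, ← exp_add]; ring_nf
  have e5 : exp ((u + m) / 2) = exp (u + m / 2) * exp (- u / 2) := by
    rw [← exp_add]; ring_nf
  rw [e3, e4, e5]
  ring

include hm in
theorem theta_conj (u : ℂ) : theta m (starRingEnd ℂ u) = starRingEnd ℂ (theta m u) := by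
  have h := qProd_conj (Real.exp_pos (-m)) (exp_neg_lt_one hm)
  have h2 : starRingEnd ℂ 2 = 2 := Complex.conj_ofNat _
  simp only [theta, map_mul, ← h, ← exp_conj, map_neg, ← sinh_conj, map_div₀, h2]

/-- By quasi-periodicity only `|Re u| < m` matters. There `|p^(n+1) e^{±u}| < 1`, so both products
are nonzero and all zeros come from the hyperbolic sine. -/
theorem theta_eq_zero_iff (u : ℂ) : theta m u = 0 ↔ u ∈ (periods m hm).lattice := by
  have key : ∀ l : ℤ, ∀ v : ℂ, theta m (v + l * m) = 0 ↔ theta m v = 0 := by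
    have step : ∀ v : ℂ, theta m (v + m) = 0 ↔ theta m v = 0 := fun v => by
      rw [theta_add_ofReal hm]; simp [exp_ne_zero]
    intro l
    induction l using Int.induction_on with
    | zero => simp
    | succ n ih =>
      intro v
      rw [← ih v, ← step (v + (n : ℤ) * m)]
      push_cast; ring_nf
    | pred n ih =>
      intro v
      rw [← ih v, ← step]
      push_cast; ring_nf
  have strip : ∀ v : ℂ, -m < v.re → v.re < m → theta m v = 0 →
      ∃ l : ℤ, v = l * (2 * Real.pi * I) := by
    intro v hv1 hv2 h0
    have ne : ∀ w : ℂ, w.re < m → qProd (Real.exp (-m)) (exp w) ≠ 0 := by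
      intro w hw
      refine qProd_ne_zero (Real.exp_pos _) (exp_neg_lt_one hm) fun n h => ?_
      have h' := congrArg norm h
      rw [norm_mul, norm_pow, norm_real, norm_exp, norm_one, Real.norm_eq_abs,
        abs_of_pos (Real.exp_pos _), ← Real.exp_nat_mul, ← Real.exp_add,
        Real.exp_eq_one_iff] at h'
      push_cast at h'
      nlinarith [mul_nonneg (Nat.cast_nonneg n : (0:ℝ) ≤ n) hm.le]
    have hs : sinh (v / 2) = 0 := by
      simp only [theta, mul_eq_zero] at h0
      rcases h0 with (h | h) | h | h
      · norm_num at h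
      · exact h
      · exact absurd h (ne v hv2)
      · exact absurd h (ne (-v) (by simpa using by linarith))
    have : exp v = 1 := by
      have h2 : 2 * sinh (v / 2) = 0 := by rw [hs, mul_zero]
      rw [two_sinh, sub_eq_zero] at h2
      calc exp v = exp (v / 2) * exp (v / 2) := by rw [← exp_add]; ring_nf
        _ = exp (v / 2) * exp (-(v / 2)) := by rw [← h2]
        _ = 1 := by rw [← exp_add]; simp
    exact exp_eq_one_iff.1 this
  rw [mem_periods_iff]
  constructor
  · intro h0
    set k := ⌊u.re / m⌋ with hk
    have h1 : theta m (u + (-k : ℤ) * m) = 0 := (key _ _).2 h0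
    have hr : (u + (-k : ℤ) * m).re = m * (u.re / m - k) := by
      simp; field_simp; ring
    have f1 := Int.sub_one_lt_floor (u.re / m)
    have f2 := Int.floor_le (u.re / m)
    rw [← hk] at f1 f2
    obtain ⟨l, hl⟩ := strip _ (by rw [hr]; nlinarith) (by rw [hr]; nlinarith) h1
    refine ⟨k, l, ?_⟩
    rw [← hl]; push_cast; ring
  · rintro ⟨k, l, rfl⟩
    rw [add_comm, key]
    have : exp (l * (2 * Real.pi * I)) = 1 := exp_int_mul_two_pi_mul_I l
    have : sinh (l * (2 * Real.pi * I) / 2) = 0 := by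
      rw [show l * (2 * Real.pi * I) / 2 = (l * Real.pi : ℂ) * I by ring, sinh_mul_I,
        sin_int_mul_pi, zero_mul]
    simp [theta, this]

include hm in
theorem deriv_theta_zero_ne_zero : deriv (theta m) 0 ≠ 0 := by
  have h := differentiable_qProd (Real.exp_pos (-m)) (exp_neg_lt_one hm)
  have h2 : DifferentiableAt ℂ (fun u : ℂ => qProd (Real.exp (-m)) (exp u) *
      qProd (Real.exp (-m)) (exp (-u))) 0 :=
    ((h.comp differentiable_exp).mul
      (h.comp (differentiable_exp.comp differentiable_neg))).differentiableAt
  have h4 : HasDerivAt (fun u : ℂ => 2 * sinh (u / 2)) 1 0 := by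
    have := ((hasDerivAt_sinh ((0:ℂ) / 2)).comp 0 ((hasDerivAt_id (0:ℂ)).div_const 2)).const_mul 2
    simpa using this
  have h5 := (h4.mul h2.hasDerivAt).deriv
  have h6 : deriv (theta m) 0 = _ := h5
  rw [h6]
  have ne : qProd (Real.exp (-m)) 1 ≠ 0 := by
    refine qProd_ne_zero (Real.exp_pos _) (exp_neg_lt_one hm) fun n h => ?_
    have h' := congrArg norm h
    rw [mul_one, norm_pow, norm_real, norm_one, Real.norm_eq_abs,
      abs_of_pos (Real.exp_pos _), ← Real.exp_nat_mul, Real.exp_eq_one_iff] at h'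
    push_cast at h'
    nlinarith [mul_nonneg (Nat.cast_nonneg n : (0:ℝ) ≤ n) hm.le]
  simp [ne]

include hm in
/-- The theta function at a point below the diagonal is smaller than at its mirror image. -/
theorem norm_theta_sub_lt {z w : ℂ} (hz : z ∈ strip) (hw : w ∈ strip)
    (hzw : ¬ SamePoint m w z) :
    0 < ‖theta m (w - z)‖ ∧ ‖theta m (w - z)‖ < ‖theta m (w - starRingEnd ℂ z)‖ := by
  obtain ⟨hz1, hz2⟩ := hz
  obtain ⟨hw1, hw2⟩ := hw
  have hpi := Real.pi_pos
  have hne : theta m (w - z) ≠ 0 := by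
    rw [Ne, theta_eq_zero_iff hm, mem_periods_iff]
    rintro ⟨k, l, h⟩
    have him := congrArg Complex.im h
    simp at him
    have hl : l = 0 := by
      have a1 : (l : ℝ) < 1 := by nlinarith
      have a2 : (-1 : ℝ) < l := by nlinarith
      have b1 : l < 1 := by exact_mod_cast a1
      have b2 : -1 < l := by exact_mod_cast a2
      omega
    refine hzw ⟨k, ?_⟩
    rw [hl] at h
    linear_combination h
  refine ⟨norm_pos_iff.2 hne, ?_⟩
  -- The difference is `2 sin (Im w) sin (Im z)`, positive since both heights lie in `(0, π)`.
  have hcos : Real.cos (w.im + z.im) < Real.cos (w.im - z.im) := by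
    rw [Real.cos_add, Real.cos_sub]
    nlinarith [mul_pos (Real.sin_pos_of_pos_of_lt_pi hw1 hw2)
      (Real.sin_pos_of_pos_of_lt_pi hz1 hz2)]
  -- Each factor of `theta` has a modulus governed by `Re u` and `cos (Im u)`. The points `w - z`
  -- and `w - z̄` share the real part, so the factors can be compared one by one.
  have nsq : ∀ (a : ℝ) (u : ℂ), ‖1 - (a : ℂ) * exp u‖ ^ 2 =
      1 - 2 * a * Real.exp u.re * Real.cos u.im + (a * Real.exp u.re) ^ 2 := by
    intro a u
    rw [← normSq_eq_norm_sq, normSq_apply]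
    simp [exp_re, exp_im]
    nlinarith [Real.sin_sq_add_cos_sq u.im, Real.exp_pos u.re]
  have lt : ∀ (a : ℝ) (u v : ℂ), 0 < a → u.re = v.re → Real.cos v.im < Real.cos u.im →
      ‖1 - (a : ℂ) * exp u‖ < ‖1 - (a : ℂ) * exp v‖ := by
    intro a u v ha h1 h2
    refine lt_of_pow_lt_pow_left₀ 2 (norm_nonneg _) ?_
    rw [nsq, nsq, h1]
    nlinarith [mul_pos ha (Real.exp_pos v.re)]
  have hc' : Real.cos (-(w - starRingEnd ℂ z)).im < Real.cos (-(w - z)).im := by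
    rw [neg_im, neg_im, Real.cos_neg, Real.cos_neg]
    simpa using hcos
  have q : ‖qProd (Real.exp (-m)) (exp (w - z)) * qProd (Real.exp (-m)) (exp (-(w - z)))‖ ≤
      ‖qProd (Real.exp (-m)) (exp (w - starRingEnd ℂ z)) *
        qProd (Real.exp (-m)) (exp (-(w - starRingEnd ℂ z)))‖ := by
    refine norm_qProd_mul_le (Real.exp_pos _) (exp_neg_lt_one hm) fun n => ?_
    have hpos : 0 < Real.exp (-m) ^ (n + 1) := pow_pos (Real.exp_pos _) _
    have i1 := lt _ (w - z) (w - starRingEnd ℂ z) hpos (by simp) (by simpa using hcos)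
    have i2 := lt _ (-(w - z)) (-(w - starRingEnd ℂ z)) hpos (by simp) hc'
    rw [ofReal_pow] at i1 i2
    exact mul_le_mul i1.le i2.le (norm_nonneg _) (norm_nonneg _)
  have s : ‖2 * sinh ((w - z) / 2)‖ < ‖2 * sinh ((w - starRingEnd ℂ z) / 2)‖ := by
    have e : ∀ u : ℂ, ‖2 * sinh (u / 2)‖ = Real.exp (-u.re / 2) * ‖1 - ((1 : ℝ) : ℂ) * exp u‖ := by
      intro u
      have : 2 * sinh (u / 2) = - (exp (-u / 2) * (1 - ((1 : ℝ) : ℂ) * exp u)) := by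
        rw [two_sinh, ofReal_one, one_mul, mul_sub, ← exp_add]; ring_nf
      rw [this, norm_neg, norm_mul, norm_exp]
      simp
    rw [e, e]
    have i1 := lt 1 (w - z) (w - starRingEnd ℂ z) one_pos (by simp) (by simpa using hcos)
    have : (w - starRingEnd ℂ z).re = (w - z).re := by simp
    rw [this]
    exact mul_lt_mul_of_pos_left i1 (Real.exp_pos _)
  have hq0 : 0 < ‖qProd (Real.exp (-m)) (exp (w - z)) *
      qProd (Real.exp (-m)) (exp (-(w - z)))‖ := by
    refine norm_pos_iff.2 fun h => hne ?_
    rw [theta, h, mul_zero]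
  unfold theta
  rw [norm_mul, norm_mul (2 * sinh ((w - starRingEnd ℂ z) / 2))]
  exact mul_lt_mul s q hq0 (norm_nonneg _)

end theta

end

section

/-! ### Removable singularities -/

/-- Taking the punctured limit at every point patches all removable singularities at once, with no
choice of local representatives. Where `f` is already continuous nothing changes. -/
theorem exists_differentiableOn_of_eventuallyEq {U : Set ℂ} {f : ℂ → ℂ}
    (h : ∀ z ∈ U, ∃ g, AnalyticAt ℂ g z ∧ f =ᶠ[𝓝[≠] z] g) :
    ∃ F, DifferentiableOn ℂ F U ∧
      (∀ z ∈ U, ∀ g, AnalyticAt ℂ g z → f =ᶠ[𝓝[≠] z] g → F =ᶠ[𝓝 z] g) ∧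
      ∀ z ∈ U, ContinuousAt f z → F z = f z := by
  set F : ℂ → ℂ := fun z => limUnder (𝓝[≠] z) f with hF
  have lim : ∀ z g, AnalyticAt ℂ g z → f =ᶠ[𝓝[≠] z] g → F z = g z := fun z g hg hfg =>
    (Tendsto.congr' hfg.symm (hg.continuousAt.tendsto.mono_left nhdsWithin_le_nhds)).limUnder_eq
  have key : ∀ z ∈ U, ∀ g, AnalyticAt ℂ g z → f =ᶠ[𝓝[≠] z] g → F =ᶠ[𝓝 z] g := by
    intro z hz g hg hfg
    have h1 : ∀ᶠ w in 𝓝[≠] z, F w = g w := by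
      have e1 : ∀ᶠ w in 𝓝[≠] z, AnalyticAt ℂ g w :=
        hg.eventually_analyticAt.filter_mono nhdsWithin_le_nhds
      have e2 : ∀ᶠ w in 𝓝[≠] z, ∀ᶠ v in 𝓝[≠] w, f v = g v := by
        have := eventually_eventually_nhdsWithin.2 hfg
        filter_upwards [this, self_mem_nhdsWithin] with w hw hwz
        have hwz : w ∈ ({z}ᶜ : Set ℂ) := hwz
        rw [(isOpen_compl_singleton).nhdsWithin_eq hwz] at hw
        exact hw.filter_mono nhdsWithin_le_nhds
      filter_upwards [e1, e2] with w h1 h2 using lim w g h1 h2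
    rw [eventually_nhdsWithin_iff] at h1
    filter_upwards [h1] with w hw
    by_cases hwz : w = z
    · rw [hwz]; exact lim z g hg hfg
    · exact hw hwz
  refine ⟨F, fun z hz => ?_, key, fun z hz hc => ?_⟩
  · obtain ⟨g, hg, hfg⟩ := h z hz
    exact (hg.differentiableAt.congr_of_eventuallyEq (key z hz g hg hfg)).differentiableWithinAt
  · exact (hc.tendsto.mono_left nhdsWithin_le_nhds).limUnder_eq

/-- The quotient of two functions which vanish at a point, the denominator to first order, has a
removable singularity. -/
theorem exists_analyticAt_div {N Q : ℂ → ℂ} {z : ℂ} (hN : AnalyticAt ℂ N z) (hQ : AnalyticAt ℂ Q z)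
    (h : Q z ≠ 0 ∨ N z = 0 ∧ deriv Q z ≠ 0) :
    ∃ g, AnalyticAt ℂ g z ∧ (fun w => N w / Q w) =ᶠ[𝓝[≠] z] g := by
  by_cases hQz : Q z = 0
  · obtain ⟨hN0, hQ'⟩ := h.resolve_left (not_not.2 hQz)
    have a1 : AnalyticAt ℂ (dslope N z) z := by
      obtain ⟨p, hp⟩ := hN
      exact ⟨_, hp.has_fpower_series_dslope_fslope⟩
    have a2 : AnalyticAt ℂ (dslope Q z) z := by
      obtain ⟨p, hp⟩ := hQ
      exact ⟨_, hp.has_fpower_series_dslope_fslope⟩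
    refine ⟨fun w => dslope N z w / dslope Q z w, a1.div a2 (by simpa using hQ'), ?_⟩
    filter_upwards [self_mem_nhdsWithin] with w hw
    have hw : w ≠ z := hw
    have hwz : w - z ≠ 0 := sub_ne_zero.2 hw
    rw [dslope_of_ne _ hw, dslope_of_ne _ hw, slope_def_field, slope_def_field, hN0, hQz]
    field_simp
    simp
  · exact ⟨_, hN.div hQ hQz, EventuallyEq.rfl⟩

theorem frequently_ne_zero_of_simple_zeros {Q : ℂ → ℂ} (hQ : Differentiable ℂ Q)
    (hs : ∀ z, Q z = 0 → deriv Q z ≠ 0) (z : ℂ) : ∀ᶠ w in 𝓝[≠] z, Q w ≠ 0 := by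
  by_cases h : Q z = 0
  · have := (hQ z).hasDerivAt.eventually_ne (c := 0) (hs z h)
    exact this
  · exact ((hQ.continuous.continuousAt).eventually_ne h).filter_mono nhdsWithin_le_nhds

/-- This allows identities between quotients to be checked after clearing the denominator `Q`;
continuity recovers them at the zeros of `Q`. -/
theorem eq_zero_of_mul_eq_zero {Q h : ℂ → ℂ} (hQ : ∀ z, ∀ᶠ w in 𝓝[≠] z, Q w ≠ 0)
    (hh : Continuous h) (h0 : ∀ z, h z * Q z = 0) (z : ℂ) : h z = 0 := by
  have h1 : ∀ᶠ w in 𝓝[≠] z, h w = 0 := by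
    filter_upwards [hQ z] with w hw
    exact (mul_eq_zero.1 (h0 w)).resolve_right hw
  have h2 : Tendsto h (𝓝[≠] z) (𝓝 0) := tendsto_const_nhds.congr' (h1.mono fun w hw => hw.symm)
  exact tendsto_nhds_unique ((hh.tendsto z).mono_left nhdsWithin_le_nhds) h2

theorem exists_entire_quotient {N Q : ℂ → ℂ} (hN : Differentiable ℂ N) (hQ : Differentiable ℂ Q)
    (hs : ∀ z, Q z = 0 → N z = 0 ∧ deriv Q z ≠ 0) :
    ∃ g, Differentiable ℂ g ∧ ∀ z, N z = g z * Q z := by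
  obtain ⟨g, h1, -, h3⟩ := exists_differentiableOn_of_eventuallyEq (U := univ)
    (f := fun w => N w / Q w) fun z _ => exists_analyticAt_div (hN.analyticAt z) (hQ.analyticAt z)
      (by by_cases h : Q z = 0
          · exact Or.inr (hs z h)
          · exact Or.inl h)
  refine ⟨g, differentiableOn_univ.1 h1, fun z => ?_⟩
  by_cases h : Q z = 0
  · rw [h, (hs z h).1, mul_zero]
  · rw [h3 z (mem_univ z) ((hN.continuous.continuousAt).div hQ.continuous.continuousAt h)]
    field_simp

/-! ### Liouville's theorem on the torus -/

section liouville

variable {m : ℝ} (hm : 0 < m)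

theorem apply_add_of_mem_periods {α : Type*} {g : ℂ → α} (h1 : ∀ z, g (z + m) = g z)
    (h2 : ∀ z, g (z + 2 * Real.pi * I) = g z) (z : ℂ) {l : ℂ} (hl : l ∈ (periods m hm).lattice) :
    g (z + l) = g z := by
  obtain ⟨a, b, rfl⟩ := (mem_periods_iff hm).1 hl
  have p1 : Function.Periodic g m := h1
  have p2 : Function.Periodic g (2 * Real.pi * I) := h2
  rw [← add_assoc, p2.int_mul b, p1.int_mul a]

include hm in
-- Multipliers of modulus one make `‖D‖` doubly periodic, hence bounded, and Liouville's theorem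
-- applies.
theorem eq_of_quasiperiodic {D : ℂ → ℂ} (hD : Differentiable ℂ D) {a b : ℂ} (ha : ‖a‖ = 1)
    (hb : ‖b‖ = 1) (h1 : ∀ z, D (z + m) = a * D z) (h2 : ∀ z, D (z + 2 * Real.pi * I) = b * D z)
    (z w : ℂ) : D z = D w := by
  refine hD.apply_eq_apply_of_bounded ?_ z w
  have hc := IsZLattice.isCompact_range_of_periodic (periods m hm).lattice (fun z => ‖D z‖)
    hD.continuous.norm fun z l hl => apply_add_of_mem_periods (g := fun z => ‖D z‖) hm
      (fun z => by simp [h1, ha]) (fun z => by simp [h2, hb]) z hl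
  obtain ⟨C, hC⟩ := hc.isBounded.exists_norm_le
  refine isBounded_iff_forall_norm_le.2 ⟨C, ?_⟩
  rintro _ ⟨x, rfl⟩
  simpa using hC _ ⟨x, rfl⟩

include hm in
/-- Two entire functions with proportional quasi-periods are proportional if one has only simple
zeros and the other one vanishes there. -/
theorem exists_eq_const_mul_of_quasiperiodic {N Q : ℂ → ℂ} (hN : Differentiable ℂ N)
    (hQ : Differentiable ℂ Q) (hs : ∀ z, Q z = 0 → N z = 0 ∧ deriv Q z ≠ 0)
    {a b : ℂ} (ha : ‖a‖ = 1) (hb : ‖b‖ = 1) {r s : ℂ → ℂ}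
    (hr : Continuous r) (hs' : Continuous s) (hr0 : ∀ z, r z ≠ 0) (hs0 : ∀ z, s z ≠ 0)
    (hQ1 : ∀ z, Q (z + m) = r z * Q z) (hN1 : ∀ z, N (z + m) = a * r z * N z)
    (hQ2 : ∀ z, Q (z + 2 * Real.pi * I) = s z * Q z)
    (hN2 : ∀ z, N (z + 2 * Real.pi * I) = b * s z * N z) :
    ∃ C : ℂ, (∀ z, N z = C * Q z) ∧ a * C = C := by
  obtain ⟨g, hg, hgN⟩ := exists_entire_quotient hN hQ hs
  have hne := frequently_ne_zero_of_simple_zeros hQ fun z hz => (hs z hz).2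
  have g1 : ∀ z, g (z + m) = a * g z := by
    intro z
    have := eq_zero_of_mul_eq_zero (h := fun z => r z * (g (z + m) - a * g z)) hne
      (hr.mul ((hg.continuous.comp (by fun_prop)).sub (hg.continuous.const_mul a))) (fun z => by
        have e1 := hgN (z + m)
        rw [hN1, hgN z, hQ1] at e1
        linear_combination -e1) z
    exact sub_eq_zero.1 ((mul_eq_zero.1 this).resolve_left (hr0 z))
  have g2 : ∀ z, g (z + 2 * Real.pi * I) = b * g z := by
    intro z
    have := eq_zero_of_mul_eq_zero (h := fun z => s z * (g (z + 2 * Real.pi * I) - b * g z)) hne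
      (hs'.mul ((hg.continuous.comp (by fun_prop)).sub (hg.continuous.const_mul b))) (fun z => by
        have e1 := hgN (z + 2 * Real.pi * I)
        rw [hN2, hgN z, hQ2] at e1
        linear_combination -e1) z
    exact sub_eq_zero.1 ((mul_eq_zero.1 this).resolve_left (hs0 z))
  have hc := eq_of_quasiperiodic hm hg ha hb g1 g2
  -- The quotient is constant and yet has multiplier `a`. If `a ≠ 1` this forces the constant to be
  -- zero, which is how `kern_mul_kern` uses the second conclusion.
  refine ⟨g 0, fun z => by rw [hgN z, hc z 0], ?_⟩
  rw [← g1 0]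
  exact hc _ _

end liouville

/-! ### Logarithmic derivative of the theta function -/

section logDeriv

variable {m : ℝ} (hm : 0 < m)

/-- The logarithmic derivative of the theta function. -/
def thetaLog (m : ℝ) (u : ℂ) : ℂ := deriv (theta m) u / theta m u

/-- Only the shape `c exp (d u)` of the multiplier is needed later, so induction over the group
generated by the two periods suffices and the constants are never computed. -/
theorem theta_add_period {l : ℂ} (hl : l ∈ (periods m hm).lattice) :
    ∃ c d : ℂ, c ≠ 0 ∧ ∀ u, theta m (u + l) = c * exp (d * u) * theta m u := by
  have h : l ∈ AddSubgroup.closure {(m : ℂ), 2 * Real.pi * I} := by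
    rw [← Submodule.span_int_eq_addSubgroupClosure]
    exact hl
  induction h using AddSubgroup.closure_induction with
  | mem x hx =>
    rcases hx with rfl | hx
    · refine ⟨-exp (m / 2), 1, by simp [exp_ne_zero], fun u => ?_⟩
      rw [theta_add_ofReal hm, exp_add]; ring_nf
    · obtain rfl := hx
      exact ⟨-1, 0, by simp, fun u => by rw [theta_add_two_pi_I]; simp⟩
  | zero => exact ⟨1, 0, by simp, fun u => by simp⟩
  | add x y hx hy ihx ihy =>
    obtain ⟨c, d, hc, h1⟩ := ihx (by
      rwa [← Submodule.span_int_eq_addSubgroupClosure] at hx)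
    obtain ⟨c', d', hc', h2⟩ := ihy (by
      rwa [← Submodule.span_int_eq_addSubgroupClosure] at hy)
    refine ⟨c * c' * exp (d' * x), d + d', by simp [hc, hc', exp_ne_zero], fun u => ?_⟩
    rw [← add_assoc, h2, h1, mul_add, exp_add, add_mul, exp_add]; ring
  | neg x hx ih =>
    obtain ⟨c, d, hc, h1⟩ := ih (by
      rwa [← Submodule.span_int_eq_addSubgroupClosure] at hx)
    refine ⟨c⁻¹ * exp (d * x), -d, by simp [hc, exp_ne_zero], fun u => ?_⟩
    have := h1 (u + -x)
    rw [neg_add_cancel_right] at this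
    rw [this, mul_add, exp_add, neg_mul, mul_neg, exp_neg, exp_neg]
    have := exp_ne_zero (d * u)
    have := exp_ne_zero (d * x)
    field_simp

/-- Differentiating the multiplier relation at the zero `0` transports simplicity of that zero to
every lattice point. -/
theorem deriv_theta_ne_zero {l : ℂ} (hl : l ∈ (periods m hm).lattice) :
    deriv (theta m) l ≠ 0 := by
  obtain ⟨c, d, hc, h⟩ := theta_add_period hm hl
  have h1 : HasDerivAt (fun u => theta m (u + l)) (deriv (theta m) l) 0 := by
    have := (differentiable_theta hm (0 + l)).hasDerivAt.comp_add_const 0 l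
    simpa using this
  have h2 : HasDerivAt (fun u => c * exp (d * u) * theta m u) (c * deriv (theta m) 0) 0 := by
    have e1 : HasDerivAt (fun u : ℂ => c * exp (d * u)) (c * (d * 1) * exp (d * 0)) 0 := by
      have := (((hasDerivAt_id' (0:ℂ)).const_mul d).cexp).const_mul c
      exact this.congr_deriv (by ring)
    exact (e1.fun_mul (differentiable_theta hm 0).hasDerivAt).congr_deriv (by simp [theta_zero])
  rw [h1.unique (h2.congr_of_eventuallyEq (Eventually.of_forall h))]
  exact mul_ne_zero hc (deriv_theta_zero_ne_zero hm)

include hm in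
theorem theta_simple_zeros (z : ℂ) (hz : theta m z = 0) : deriv (theta m) z ≠ 0 :=
  deriv_theta_ne_zero hm ((theta_eq_zero_iff hm z).1 hz)

theorem theta_ne_zero {z : ℂ} (hz : z ∉ (periods m hm).lattice) : theta m z ≠ 0 :=
  fun h => hz ((theta_eq_zero_iff hm z).1 h)

include hm in
theorem deriv_theta_add_ofReal (u : ℂ) :
    deriv (theta m) (u + m) = -exp (u + m / 2) * (deriv (theta m) u + theta m u) := by
  have h1 := (differentiable_theta hm (u + m)).hasDerivAt.comp_add_const u (m : ℂ)
  have h2 : HasDerivAt (fun u => -exp (u + m / 2) * theta m u)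
      (-exp (u + m / 2) * theta m u + -exp (u + m / 2) * deriv (theta m) u) u := by
    have := (((hasDerivAt_id' u).add_const ((m : ℂ) / 2)).cexp.fun_neg).fun_mul
      (differentiable_theta hm u).hasDerivAt
    simpa using this
  rw [h1.unique (h2.congr_of_eventuallyEq (Eventually.of_forall fun u => theta_add_ofReal hm u))]
  ring

include hm in
theorem deriv_theta_add_two_pi_I (u : ℂ) :
    deriv (theta m) (u + 2 * Real.pi * I) = -deriv (theta m) u := by
  have h1 := (differentiable_theta hm (u + 2 * Real.pi * I)).hasDerivAt.comp_add_const u _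
  exact h1.unique ((differentiable_theta hm u).hasDerivAt.neg.congr_of_eventuallyEq
    (Eventually.of_forall fun u => theta_add_two_pi_I u))

include hm in
theorem deriv_theta_neg (u : ℂ) : deriv (theta m) (-u) = deriv (theta m) u := by
  have h1 := (differentiable_theta hm (-u)).hasDerivAt.comp u (hasDerivAt_neg u)
  have h2 := (differentiable_theta hm u).hasDerivAt.neg
  have := h1.unique (h2.congr_of_eventuallyEq (Eventually.of_forall fun u => theta_neg u))
  simpa using this

include hm in
theorem thetaLog_neg (u : ℂ) : thetaLog m (-u) = -thetaLog m u := by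
  rw [thetaLog, thetaLog, deriv_theta_neg hm, theta_neg, div_neg]

theorem analyticAt_thetaLog {u : ℂ} (hu : u ∉ (periods m hm).lattice) :
    AnalyticAt ℂ (thetaLog m) u :=
  (((differentiable_theta hm).analyticAt u).deriv).div ((differentiable_theta hm).analyticAt u)
    (theta_ne_zero hm hu)

theorem thetaLog_add_ofReal {u : ℂ} (hu : u ∉ (periods m hm).lattice) :
    thetaLog m (u + m) = thetaLog m u + 1 := by
  have := theta_ne_zero hm hu
  rw [thetaLog, thetaLog, deriv_theta_add_ofReal hm, theta_add_ofReal hm]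
  have := exp_ne_zero (u + m / 2)
  field_simp

include hm in
theorem thetaLog_add_two_pi_I (u : ℂ) : thetaLog m (u + 2 * Real.pi * I) = thetaLog m u := by
  rw [thetaLog, thetaLog, deriv_theta_add_two_pi_I hm, theta_add_two_pi_I, neg_div_neg_eq]

include hm in
theorem thetaLog_conj (u : ℂ) :
    thetaLog m (starRingEnd ℂ u) = starRingEnd ℂ (thetaLog m u) := by
  have h1 : deriv (theta m) (starRingEnd ℂ u) = starRingEnd ℂ (deriv (theta m) u) := by
    have h2 : (starRingEnd ℂ ∘ theta m ∘ starRingEnd ℂ) = theta m := by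
      ext v
      simp [theta_conj hm]
    have h3 := congrFun (deriv_conj_conj (f := theta m)) (starRingEnd ℂ u)
    rw [h2] at h3
    simpa using h3
  rw [thetaLog, h1, theta_conj hm, thetaLog, map_div₀]

theorem isOpen_compl_periods : IsOpen ((periods m hm).lattice : Set ℂ)ᶜ :=
  (periods m hm).isClosed_lattice.isOpen_compl

theorem deriv_thetaLog_add_ofReal {u : ℂ} (hu : u ∉ (periods m hm).lattice) :
    deriv (thetaLog m) (u + m) = deriv (thetaLog m) u := by
  have h : (fun v => thetaLog m (v + m)) =ᶠ[𝓝 u] fun v => thetaLog m v + 1 := by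
    filter_upwards [(isOpen_compl_periods hm).mem_nhds hu] with v hv
    exact thetaLog_add_ofReal hm hv
  have := h.deriv_eq
  rwa [deriv_comp_add_const, deriv_add_const] at this

include hm in
theorem deriv_thetaLog_add_two_pi_I (u : ℂ) :
    deriv (thetaLog m) (u + 2 * Real.pi * I) = deriv (thetaLog m) u := by
  have h : (fun v => thetaLog m (v + 2 * Real.pi * I)) = fun v => thetaLog m v :=
    funext fun v => thetaLog_add_two_pi_I hm v
  have := congrFun (congrArg deriv h) u
  rwa [deriv_comp_add_const] at this

/-- The second logarithmic derivative of the theta function is `-℘` up to a real constant. -/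
theorem exists_deriv_thetaLog_eq :
    ∃ c : ℝ, ∀ u, u ∉ (periods m hm).lattice → deriv (thetaLog m) u = -wp m hm u - c := by
  set Λ := (periods m hm).lattice with hΛ
  have hT := differentiable_theta hm
  obtain ⟨F, hF, -, hF2⟩ := exists_differentiableOn_of_eventuallyEq (U := univ)
    (f := fun u => deriv (thetaLog m) u + wp m hm u) (fun l _ => by
      by_cases hl : l ∈ Λ
      · have a2 : AnalyticAt ℂ (dslope (theta m) l) l := by
          obtain ⟨p, hp⟩ := hT.analyticAt l
          exact ⟨_, hp.has_fpower_series_dslope_fslope⟩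
        have ne : dslope (theta m) l l ≠ 0 := by simpa using deriv_theta_ne_zero hm hl
        -- Near `l` the theta function is `(u - l) E` with `E l ≠ 0`, so `Z' = -(u - l)⁻² +
        -- (E'/E)'`. The double pole cancels that of `℘`; `weierstrassPExcept` is `℘` with the
        -- summand of `l` omitted.
        set E := dslope (theta m) l with hE
        refine ⟨fun u => deriv (fun u => deriv E u / E u) u +
          ((periods m hm).weierstrassPExcept l u - 1 / l ^ 2),
          ((a2.deriv.div a2 ne).deriv).add
            ((((periods m hm).analyticAt_weierstrassPExcept l)).sub analyticAt_const), ?_⟩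
        have ev : ∀ᶠ u in 𝓝[≠] l, u ≠ l ∧ AnalyticAt ℂ E u ∧ E u ≠ 0 := by
          refine (eventually_mem_nhdsWithin).and (Eventually.and ?_ ?_)
          · exact a2.eventually_analyticAt.filter_mono nhdsWithin_le_nhds
          · exact (a2.continuousAt.eventually_ne ne).filter_mono nhdsWithin_le_nhds
        have hθ : ∀ u, theta m u = (u - l) * E u := fun u => by
          have := sub_smul_dslope (theta m) l u
          rw [(theta_eq_zero_iff hm l).2 hl, sub_zero] at this
          rw [← this, smul_eq_mul]
        have ev2 : ∀ᶠ u in 𝓝[≠] l, thetaLog m u = (u - l)⁻¹ + deriv E u / E u := by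
          filter_upwards [ev] with u ⟨h1, h2, h3⟩
          have d1 : HasDerivAt (theta m) (1 * E u + (u - l) * deriv E u) u :=
            (((hasDerivAt_id u).sub_const l).mul h2.differentiableAt.hasDerivAt).congr_of_eventuallyEq
              (Eventually.of_forall hθ)
          rw [thetaLog, d1.deriv, hθ]
          have := sub_ne_zero.2 h1
          field_simp
        have ev3 : ∀ᶠ u in 𝓝[≠] l, deriv (thetaLog m) u =
            -((u - l) ^ 2)⁻¹ + deriv (fun u => deriv E u / E u) u := by
          filter_upwards [ev, eventually_eventually_nhdsWithin.2 ev2] with u ⟨h1, h2, h3⟩ h4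
          have h1' : u ∈ ({l}ᶜ : Set ℂ) := h1
          rw [(isOpen_compl_singleton).nhdsWithin_eq h1'] at h4
          have h4' : thetaLog m =ᶠ[𝓝 u] fun u => (u - l)⁻¹ + deriv E u / E u := h4
          rw [h4'.deriv_eq]
          have d1 := ((hasDerivAt_id' u).sub_const l).fun_inv (sub_ne_zero.2 h1)
          have d2 := (h2.deriv.fun_div h2 h3).differentiableAt.hasDerivAt
          rw [(d1.fun_add d2).deriv]
          simp [neg_div, one_div]
        filter_upwards [ev3] with u h1
        rw [h1, wp, ← (periods m hm).weierstrassPExcept_add ⟨l, hl⟩ u]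
        simp only [one_div]
        ring
      · exact ⟨_, (analyticAt_thetaLog hm hl).deriv.add
          ((periods m hm).analyticOnNhd_weierstrassP l hl), EventuallyEq.rfl⟩)
  have hF := differentiableOn_univ.1 hF
  have hFeq : ∀ u, u ∉ Λ → F u = deriv (thetaLog m) u + wp m hm u := fun u hu =>
    hF2 u (mem_univ _) ((analyticAt_thetaLog hm hu).deriv.add
          ((periods m hm).analyticOnNhd_weierstrassP u hu)).continuousAt
  have notmem : ∀ {u l : ℂ}, l ∈ Λ → u ∉ Λ → u + l ∉ Λ := fun hl hu h =>
    hu (by simpa using sub_mem h hl)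
  have hne := frequently_ne_zero_of_simple_zeros hT (theta_simple_zeros hm)
  have per : ∀ l ∈ Λ, (∀ u, u ∉ Λ → deriv (thetaLog m) (u + l) = deriv (thetaLog m) u) →
      ∀ u, F (u + l) = F u := by
    intro l hl h u
    refine sub_eq_zero.1 (eq_zero_of_mul_eq_zero (h := fun u => F (u + l) - F u) hne
      ((hF.continuous.comp (by fun_prop)).sub hF.continuous) (fun z => ?_) u)
    by_cases hz : z ∈ Λ
    · rw [(theta_eq_zero_iff hm z).2 hz, mul_zero]
    · rw [hFeq z hz, hFeq _ (notmem hl hz), h z hz]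
      have : wp m hm (z + l) = wp m hm z := (periods m hm).weierstrassP_add_coe z ⟨l, hl⟩
      rw [this, sub_self, zero_mul]
  -- The extension of `Z' + ℘` is elliptic without poles, hence constant.
  have hc := eq_of_quasiperiodic hm hF (a := 1) (b := 1) (by simp) (by simp)
    (fun z => by rw [one_mul]
                 exact per _ (ofReal_mem_periods hm) (fun u hu => deriv_thetaLog_add_ofReal hm hu) z)
    (fun z => by rw [one_mul]
                 exact per _ (two_pi_I_mem_periods hm)
                   (fun u hu => deriv_thetaLog_add_two_pi_I hm u) z)
  -- the constant is real
  have hreal : starRingEnd ℂ (F 0) = F 0 := by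
    have hcl : ∀ u, u ∉ Λ → starRingEnd ℂ u ∉ Λ := by
      intro u hu h
      refine hu ?_
      have h1 := (theta_eq_zero_iff hm _).2 h
      rw [theta_conj hm] at h1
      exact (theta_eq_zero_iff hm _).1 (by simpa using h1)
    obtain ⟨u, hu⟩ : ∃ u, u ∉ Λ := by
      obtain ⟨u, hu⟩ := (hne 0).exists
      exact ⟨u, fun h => hu ((theta_eq_zero_iff hm u).2 h)⟩
    have h1 : starRingEnd ℂ (deriv (thetaLog m) u) = deriv (thetaLog m) (starRingEnd ℂ u) := by
      have h2 : (starRingEnd ℂ ∘ thetaLog m ∘ starRingEnd ℂ) = thetaLog m := by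
        ext v
        simp [thetaLog_conj hm]
      have h3 := congrFun (deriv_conj_conj (f := thetaLog m)) (starRingEnd ℂ u)
      rw [h2] at h3
      simpa using h3.symm
    have hinv : ∀ l : Λ, starRingEnd ℂ (l : ℂ) ∈ Λ := fun l => by
      have h1 := (theta_eq_zero_iff hm _).2 l.2
      refine (theta_eq_zero_iff hm _).1 ?_
      rw [theta_conj hm, h1, map_zero]
    let e : Λ ≃ Λ := ⟨fun l => ⟨_, hinv l⟩, fun l => ⟨_, hinv l⟩, fun l => by simp, fun l => by simp⟩
    have h2 : starRingEnd ℂ (wp m hm u) = wp m hm (starRingEnd ℂ u) := by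
      have s1 := (periods m hm).hasSum_weierstrassP u
      have s2 := (periods m hm).hasSum_weierstrassP (starRingEnd ℂ u)
      have s3 := s1.map (starRingEnd ℂ) continuous_conj
      have s4 := (Equiv.hasSum_iff e).2 s2
      refine s3.unique ?_
      have : (fun l : Λ => 1 / (starRingEnd ℂ u - l) ^ 2 - 1 / (l : ℂ) ^ 2) ∘ e =
          starRingEnd ℂ ∘ fun l : Λ => 1 / (u - l) ^ 2 - 1 / (l : ℂ) ^ 2 := by
        ext l
        simp [e]
      rw [← this]
      exact s4
    have h3 : starRingEnd ℂ (F u) = F (starRingEnd ℂ u) := by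
      rw [hFeq u hu, map_add, h1, h2, ← hFeq _ (hcl u hu)]
    rw [hc 0 u, h3]
    exact hc _ _
  refine ⟨-(F 0).re, fun u hu => ?_⟩
  have h1 := hFeq u hu
  rw [hc u 0] at h1
  have h2 : ((F 0).re : ℂ) = F 0 := conj_eq_iff_re.1 hreal
  push_cast
  rw [h2, h1]
  ring

end logDeriv

end

section

/-! ### The Kronecker kernel -/

section kernel

variable {m : ℝ} (hm : 0 < m)

/-- The points `r + πi`. -/
def midPoint (r : ℝ) : ℂ := r + Real.pi * I

theorem midPoint_notMem (r : ℝ) : midPoint r ∉ (periods m hm).lattice := by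
  rw [mem_periods_iff]
  rintro ⟨k, l, h⟩
  have h1 := congrArg Complex.im h
  simp [midPoint] at h1
  have h2 : (l : ℝ) * 2 = 1 := by
    have := Real.pi_pos
    field_simp at h1
    linarith
  have h3 : l * 2 = 1 := by exact_mod_cast h2
  omega

include hm in
theorem theta_midPoint_ne_zero (r : ℝ) : theta m (-midPoint r) ≠ 0 := by
  rw [theta_neg, neg_ne_zero]
  exact theta_ne_zero hm (midPoint_notMem hm r)

/-- The kernel with a simple pole of residue one at the lattice points, invariant under `2πi` and
with multiplier `e^{-b}` under `m`, where `b = r + πi`. -/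
def kern (m r : ℝ) (u : ℂ) : ℂ :=
  theta m (u - midPoint r) * deriv (theta m) 0 / (theta m u * theta m (-midPoint r))

/-- The derivative of the kernel with respect to its parameter. -/
def kernDeriv (m r : ℝ) (u : ℂ) : ℂ :=
  (theta m (u - midPoint r) * thetaLog m (-midPoint r) - deriv (theta m) (u - midPoint r)) *
    deriv (theta m) 0 / (theta m u * theta m (-midPoint r))

include hm in
theorem hasDerivAt_kern (r : ℝ) (u : ℂ) :
    HasDerivAt (fun r => kern m r u) (kernDeriv m r u) r := by
  have hb : HasDerivAt midPoint 1 r := by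
    exact ((hasDerivAt_id' r).ofReal_comp.add_const (Real.pi * I)).congr_deriv (by simp)
  have h1 : HasDerivAt (fun r => theta m (u - midPoint r))
      (deriv (theta m) (u - midPoint r) * -1) r :=
    (differentiable_theta hm _).hasDerivAt.comp r (by simpa using hb.const_sub u)
  have h2 : HasDerivAt (fun r => theta m (-midPoint r))
      (deriv (theta m) (-midPoint r) * -1) r :=
    (differentiable_theta hm _).hasDerivAt.comp r (by simpa using hb.fun_neg)
  have h0 := theta_midPoint_ne_zero hm r
  by_cases hu : theta m u = 0
  -- At lattice points the denominators vanish and both `kern` and `kernDeriv` are zero by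
  -- convention, so the formula holds there too.
  · have : (fun r => kern m r u) = fun _ => 0 := by ext; simp [kern, hu]
    rw [this]
    simpa [kernDeriv, hu] using hasDerivAt_const r (0 : ℂ)
  · have := (h1.mul_const (deriv (theta m) 0)).fun_div (h2.const_mul (theta m u))
      (mul_ne_zero hu h0)
    refine this.congr_deriv ?_
    rw [kernDeriv, thetaLog]
    field_simp
    ring

theorem deriv_theta_add_period {l : ℂ} {c d : ℂ}
    (h : ∀ u, theta m (u + l) = c * exp (d * u) * theta m u) (hm : 0 < m) (u : ℂ) :
    deriv (theta m) (u + l) = c * exp (d * u) * (deriv (theta m) u + d * theta m u) := by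
  have h1 : HasDerivAt (fun u => theta m (u + l)) (deriv (theta m) (u + l)) u :=
    (differentiable_theta hm (u + l)).hasDerivAt.comp_add_const u l
  have e1 : HasDerivAt (fun u : ℂ => c * exp (d * u)) (c * (d * exp (d * u))) u := by
    have := (((hasDerivAt_id' u).const_mul d).cexp).const_mul c
    exact this.congr_deriv (by ring)
  have h2 := e1.fun_mul (differentiable_theta hm u).hasDerivAt
  rw [h1.unique (h2.congr_of_eventuallyEq (Eventually.of_forall h))]
  ring

theorem differentiableAt_kern (r : ℝ) {u : ℂ} (hu : u ∉ (periods m hm).lattice) :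
    DifferentiableAt ℂ (kern m r) u := by
  have := differentiable_theta hm
  refine DifferentiableAt.div ?_ ?_ (mul_ne_zero (theta_ne_zero hm hu)
    (theta_midPoint_ne_zero hm r))
  · exact ((this.comp (differentiable_id.sub_const _)).mul_const _) u
  · exact (this.mul_const _) u

/-- The addition theorem for the kernel. -/
theorem kern_mul_kern (r : ℝ) {u v : ℂ} (hu : u ∉ (periods m hm).lattice)
    (hv : v ∉ (periods m hm).lattice) (huv : u + v ∉ (periods m hm).lattice) :
    kern m r u * kern m r v =
      kern m r (u + v) * (thetaLog m u + thetaLog m v) + kernDeriv m r (u + v) := by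
  set b := midPoint r with hb
  set c0 := deriv (theta m) 0 / theta m (-b) with hc0
  have hT := differentiable_theta hm
  have hT' : Differentiable ℂ (deriv (theta m)) := fun z =>
    (hT.analyticAt z).deriv.differentiableAt
  have hθb := theta_midPoint_ne_zero hm r
  rw [← hb] at hθb
  have hθv := theta_ne_zero hm hv
  set W := thetaLog m v + thetaLog m (-b) with hW
  -- This exponent normalizes the multiplier `e^{-b}` along `m` to have modulus one; being real, it
  -- also keeps the multiplier along `2πi` on the unit circle.
  set β : ℂ := r / m with hβ
  -- With `v` fixed, this is the difference of the two sides multiplied by `θ(u) θ(u + v)`, with a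
  -- constant factor removed and an exponential inserted. The goal is `N = 0`.
  set N : ℂ → ℂ := fun u => (c0 * theta m (u - b) * theta m (v - b) * theta m (u + v) / theta m v -
    theta m (u + v - b) * (deriv (theta m) u + theta m u * W) +
    theta m u * deriv (theta m) (u + v - b)) * exp (β * u) with hN
  set Q : ℂ → ℂ := fun u => theta m u * theta m (u + v) with hQ
  have dadd : ∀ a : ℂ, Differentiable ℂ fun u => theta m (u + a) := fun a =>
    hT.comp (differentiable_id.add_const a)
  have dadd' : ∀ a : ℂ, Differentiable ℂ fun u => deriv (theta m) (u + a) := fun a =>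
    hT'.comp (differentiable_id.add_const a)
  have dsub : Differentiable ℂ fun u => theta m (u - b) := hT.comp (differentiable_id.sub_const b)
  have dsub2 : Differentiable ℂ fun u => theta m (u + v - b) := by
    simpa [add_sub_assoc] using dadd (v - b)
  have dsub3 : Differentiable ℂ fun u => deriv (theta m) (u + v - b) := by
    simpa [add_sub_assoc] using dadd' (v - b)
  have hNd : Differentiable ℂ N := by
    have dv := dadd v
    refine ((((((dsub.const_mul c0).mul_const _).mul dv).div_const _).sub
      (dsub2.mul (hT'.add (hT.mul_const W)))).add (hT.mul dsub3)).mul ?_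
    exact (differentiable_id.const_mul β).cexp
  have hQd : Differentiable ℂ Q := hT.mul (dadd v)
  -- The zeros of `θ(u)` and of `θ(u + v)` are disjoint because `v` is not a period, so `Q` has
  -- simple zeros. The vanishing of `N` there says that the residues of the two sides agree.
  have hs : ∀ z, Q z = 0 → N z = 0 ∧ deriv Q z ≠ 0 := by
    intro z hz
    have hQ' : deriv Q z = deriv (theta m) z * theta m (z + v) +
        theta m z * deriv (theta m) (z + v) := by
      have h1 : HasDerivAt (fun u => theta m (u + v)) (deriv (theta m) (z + v)) z :=
        (hT (z + v)).hasDerivAt.comp_add_const z v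
      exact ((hT z).hasDerivAt.fun_mul h1).deriv
    rcases mul_eq_zero.1 hz with h | h
    · have hl := (theta_eq_zero_iff hm z).1 h
      have hzv : theta m (z + v) ≠ 0 := by
        refine theta_ne_zero hm fun h' => hv ?_
        simpa using sub_mem h' hl
      refine ⟨?_, ?_⟩
      · obtain ⟨c, d, hc, hper⟩ := theta_add_period hm hl
        have e1 : theta m (z - b) = c * exp (d * -b) * theta m (-b) := by
          rw [← hper]; ring_nf
        have e2 : theta m (z + v) = c * exp (d * v) * theta m v := by
          rw [← hper]; ring_nf
        have e3 : theta m (z + v - b) = c * (exp (d * v) * exp (d * -b)) * theta m (v - b) := by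
          rw [← exp_add, ← mul_add, ← sub_eq_add_neg, ← hper]; ring_nf
        have e4 : deriv (theta m) z = c * deriv (theta m) 0 := by
          have := deriv_theta_add_period hper hm 0
          simpa [theta_zero] using this
        simp only [hN, h, e1, e2, e3, e4, hc0]
        field_simp
        ring
      · rw [hQ', h, zero_mul, add_zero]
        exact mul_ne_zero (theta_simple_zeros hm z h) hzv
    · have hl := (theta_eq_zero_iff hm _).1 h
      have hz0 : theta m z ≠ 0 := by
        refine theta_ne_zero hm fun h' => hv ?_
        simpa using sub_mem hl h'
      refine ⟨?_, ?_⟩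
      · obtain ⟨c, d, hc, hper⟩ := theta_add_period hm hl
        have e1 : theta m z = c * exp (d * -v) * theta m (-v) := by
          rw [← hper]; ring_nf
        have e2 : deriv (theta m) z =
            c * exp (d * -v) * (deriv (theta m) (-v) + d * theta m (-v)) := by
          rw [← deriv_theta_add_period hper hm]; ring_nf
        have e3 : theta m (z + v - b) = c * exp (d * -b) * theta m (-b) := by
          rw [← hper]; ring_nf
        have e4 : deriv (theta m) (z + v - b) =
            c * exp (d * -b) * (deriv (theta m) (-b) + d * theta m (-b)) := by
          rw [← deriv_theta_add_period hper hm]; ring_nf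
        have e5 : thetaLog m (-v) = -thetaLog m v := thetaLog_neg hm v
        have hθv' : theta m (-v) ≠ 0 := by rwa [theta_neg, neg_ne_zero]
        have e6 : deriv (theta m) (-v) = -thetaLog m v * theta m (-v) := by
          rw [← e5, thetaLog]; field_simp
        have e7 : deriv (theta m) (-b) = thetaLog m (-b) * theta m (-b) := by
          rw [thetaLog]; field_simp
        simp only [hN, h, e1, e2, e3, e4, e6, e7, hW]
        ring
      · rw [hQ', h, mul_zero, zero_add]
        exact mul_ne_zero hz0 (theta_simple_zeros hm _ h)
  have ee : ∀ z : ℂ, exp (z - b + m / 2) = exp (-b) * exp (z + m / 2) := fun z => by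
    rw [← exp_add]; ring_nf
  -- The imaginary part `π` of `b` survives the normalization as the sign `-1`.
  have eb : exp (-b) * exp (β * m) = -1 := by
    have : (m : ℂ) ≠ 0 := by exact_mod_cast hm.ne'
    rw [← exp_add, hβ, div_mul_cancel₀ _ this, hb, midPoint,
      show -((r : ℂ) + Real.pi * I) + r = -(Real.pi * I) by ring, exp_neg, exp_pi_mul_I]
    norm_num
  obtain ⟨C, hC, hC0⟩ := exists_eq_const_mul_of_quasiperiodic hm hNd hQd hs (a := -1)
    (b := exp (β * (2 * Real.pi * I))) (by simp)
    (by
      have : β * (2 * Real.pi * I) = ((r / m * (2 * Real.pi) : ℝ) : ℂ) * I := by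
        rw [hβ]; push_cast; ring
      rw [this, norm_exp_ofReal_mul_I])
    (r := fun z => exp (z + m / 2) * exp (z + v + m / 2)) (s := fun _ => 1)
    (by fun_prop) continuous_const (fun z => mul_ne_zero (exp_ne_zero _) (exp_ne_zero _))
    (fun _ => one_ne_zero)
    (fun z => by
      simp only [hQ, add_right_comm z (m : ℂ) v, theta_add_ofReal hm]
      ring)
    (fun z => by
      simp only [hN]
      rw [add_right_comm z (m : ℂ) v, add_sub_right_comm z (m : ℂ) b,
        add_sub_right_comm (z + v) (m : ℂ) b, deriv_theta_add_ofReal hm (z + v - b),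
        deriv_theta_add_ofReal hm z, theta_add_ofReal hm z, theta_add_ofReal hm (z + v - b),
        theta_add_ofReal hm (z - b), theta_add_ofReal hm (z + v), ee z, ee (z + v), mul_add β,
        exp_add (β * z)]
      linear_combination (exp (z + m / 2) * exp (z + v + m / 2) * N z) * eb)
    (fun z => by
      simp only [hQ, add_right_comm z (2 * Real.pi * I) v, theta_add_two_pi_I]
      ring)
    (fun z => by
      simp only [hN]
      rw [add_right_comm z (2 * Real.pi * I) v, add_sub_right_comm z (2 * Real.pi * I) b,
        add_sub_right_comm (z + v) (2 * Real.pi * I) b, deriv_theta_add_two_pi_I hm (z + v - b),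
        deriv_theta_add_two_pi_I hm z, theta_add_two_pi_I z, theta_add_two_pi_I (z + v - b),
        theta_add_two_pi_I (z - b), theta_add_two_pi_I (z + v), mul_add β, exp_add (β * z)]
      ring)
  -- The quotient `N / Q` is a constant that changes sign along `m`.
  have hC0 : C = 0 := by
    have : (2 : ℂ) * C = 0 := by linear_combination -hC0
    simpa using this
  have h0 := hC u
  rw [hC0, zero_mul] at h0
  have h0 := (mul_eq_zero.1 h0).resolve_right (exp_ne_zero _)
  have hθu := theta_ne_zero hm hu
  have hθuv := theta_ne_zero hm huv
  have key : c0 * theta m (u - b) * theta m (v - b) / theta m v / theta m u =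
    (theta m (u + v - b) * (thetaLog m u + W) - deriv (theta m) (u + v - b)) / theta m (u + v) := by
    have e : deriv (theta m) u = thetaLog m u * theta m u := by rw [thetaLog]; field_simp
    rw [e] at h0
    field_simp
    field_simp at h0
    linear_combination h0
  simp only [kern, kernDeriv, ← hb]
  calc _ = c0 * (c0 * theta m (u - b) * theta m (v - b) / theta m v / theta m u) := by
        rw [hc0]; field_simp
    _ = _ := by
        rw [key, hc0, hW]; field_simp; ring

theorem wp_neg (u : ℂ) : wp m hm (-u) = wp m hm u := (periods m hm).weierstrassP_neg u

theorem neg_notMem {u : ℂ} (hu : u ∉ (periods m hm).lattice) : -u ∉ (periods m hm).lattice :=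
  fun h => hu (by simpa using neg_mem h)

/-- The limit `v → -u` of the addition theorem. The poles of the two terms at `u + v = 0` cancel,
and what remains is a derivative of `Z`, hence a difference of values of `℘`. -/
theorem kern_mul_kern_neg (r : ℝ) {u : ℂ} (hu : u ∉ (periods m hm).lattice) :
    kern m r u * kern m r (-u) = wp m hm (midPoint r) - wp m hm u := by
  obtain ⟨c, hc⟩ := exists_deriv_thetaLog_eq hm
  set b := midPoint r with hb
  have hT := differentiable_theta hm
  have hbn : b ∉ (periods m hm).lattice := midPoint_notMem hm r
  have hnu := neg_notMem hm hu
  have hnb := neg_notMem hm hbn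
  have hθb := theta_midPoint_ne_zero hm r
  rw [← hb] at hθb
  -- The numerator of the addition theorem for `v = s - u`, with denominator `θ(s)`. Both vanish at
  -- `s = 0`, so the limit is the quotient of the two derivatives.
  set n : ℂ → ℂ := fun s => theta m (s - b) * (thetaLog m u + thetaLog m (s - u) +
    thetaLog m (-b) - thetaLog m (s - b)) with hn
  have hn0 : n 0 = 0 := by
    simp only [hn, zero_sub, thetaLog_neg hm u]
    ring
  have hZ : ∀ a, a ∉ (periods m hm).lattice → HasDerivAt (fun s => thetaLog m (s - a))
      (-wp m hm a - c) 0 := by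
    intro a ha
    have h1 := (analyticAt_thetaLog hm (neg_notMem hm ha)).differentiableAt.hasDerivAt
    rw [hc _ (neg_notMem hm ha), wp_neg, ← zero_sub a] at h1
    exact h1.comp_sub_const 0 a
  have hnd : HasDerivAt n (theta m (-b) * (wp m hm b - wp m hm u)) 0 := by
    have h1 : HasDerivAt (fun s => theta m (s - b)) (deriv (theta m) (0 - b)) 0 :=
      (hT (0 - b)).hasDerivAt.comp_sub_const 0 b
    have h2 := h1.fun_mul ((((hZ u hu).const_add (thetaLog m u)).add_const (thetaLog m (-b))).fun_sub
      (hZ b hbn))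
    refine h2.congr_deriv ?_
    simp only [zero_sub, thetaLog_neg hm u]
    ring
  have hθ : HasDerivAt (theta m) (deriv (theta m) 0) 0 := (hT 0).hasDerivAt
  have l1 := hnd.tendsto_slope.div hθ.tendsto_slope (deriv_theta_zero_ne_zero hm)
  have l2 : Tendsto (fun s => kern m r u * kern m r (s - u)) (𝓝[≠] 0)
      (𝓝 (kern m r u * kern m r (-u))) := by
    have h1 := (differentiableAt_kern hm r hnu).continuousAt
    rw [← zero_sub] at h1
    have h2 : ContinuousAt (fun s => kern m r u * kern m r (s - u)) 0 :=
      continuousAt_const.mul (h1.comp (f := fun s => s - u) (by fun_prop))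
    have := h2.tendsto
    rw [zero_sub] at this
    exact this.mono_left nhdsWithin_le_nhds
  have hev : ∀ᶠ s in 𝓝[≠] (0 : ℂ), kern m r u * kern m r (s - u) =
      deriv (theta m) 0 / theta m (-b) * (slope n 0 s / slope (theta m) 0 s) := by
    have o := isOpen_compl_periods hm
    have e1 : ∀ᶠ s in 𝓝[≠] (0 : ℂ), s - u ∉ (periods m hm).lattice := by
      have : ContinuousAt (fun s : ℂ => s - u) 0 := by fun_prop
      exact (this.eventually (o.mem_nhds (by simpa using hnu))).filter_mono nhdsWithin_le_nhds
    have e2 : ∀ᶠ s in 𝓝[≠] (0 : ℂ), s - b ∉ (periods m hm).lattice := by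
      have : ContinuousAt (fun s : ℂ => s - b) 0 := by fun_prop
      exact (this.eventually (o.mem_nhds (by simpa using hnb))).filter_mono nhdsWithin_le_nhds
    have e3 := frequently_ne_zero_of_simple_zeros hT (theta_simple_zeros hm) 0
    filter_upwards [e1, e2, e3, self_mem_nhdsWithin] with s h1 h2 h3 h4
    have h4 : s ≠ 0 := h4
    have h5 := kern_mul_kern hm r (u := u) (v := s - u) hu h1
      (by rw [add_sub_cancel]; exact fun h => h3 ((theta_eq_zero_iff hm s).2 h))
    rw [h5, add_sub_cancel, slope_def_field, slope_def_field, hn0, theta_zero]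
    have hθs := theta_ne_zero hm h2
    have e : deriv (theta m) (s - b) = thetaLog m (s - b) * theta m (s - b) := by
      rw [thetaLog]; field_simp
    simp only [kern, kernDeriv, ← hb, hn, e, sub_zero]
    field_simp
    ring
  have l3 := (l1.const_mul (deriv (theta m) 0 / theta m (-b))).congr'
    (hev.mono fun s hs => hs.symm)
  rw [tendsto_nhds_unique l2 l3]
  have := deriv_theta_zero_ne_zero hm
  field_simp

end kernel

end

section

/-! ### Determinants -/

section det

variable {ι : Type} [Fintype ι] [DecidableEq ι]

theorem det_updateRow_eq_sum (A : Matrix ι ι ℂ) (y : ι) (ρ : ι → ℂ) :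
    (A.updateRow y ρ).det = ∑ k, ρ k * (A.updateRow y (Pi.single k 1)).det := by
  rw [Matrix.det_eq_sum_mul_adjugate_row _ y]
  refine Finset.sum_congr rfl fun k _ => ?_
  rw [Matrix.adjugate_apply, Matrix.updateRow_self, Matrix.updateRow_idem]

theorem det_updateCol_eq_sum (A : Matrix ι ι ℂ) (y : ι) (c : ι → ℂ) :
    (A.updateCol y c).det = ∑ j, c j * (A.updateRow j (Pi.single y 1)).det := by
  rw [← Matrix.cramer_apply, Matrix.cramer_eq_adjugate_mulVec, Matrix.mulVec, dotProduct]
  refine Finset.sum_congr rfl fun k _ => ?_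
  rw [Matrix.adjugate_apply, mul_comm]

/-- The determinant of a bordered matrix. -/
theorem det_border (A : Matrix ι ι ℂ) (y : ι) (hA : A y = Pi.single y 1) (ρ c : ι → ℂ)
    (hc : c y = 0) :
    ((A.updateRow y ρ).updateCol y c).det = -∑ j, ∑ k, c j * ρ k * A.adjugate k j := by
  rw [det_updateCol_eq_sum, ← Finset.sum_neg_distrib]
  refine Finset.sum_congr rfl fun j _ => ?_
  by_cases hj : j = y
  · simp [hj, hc]
  rw [Matrix.updateRow_comm _ (Ne.symm hj), det_updateRow_eq_sum, Finset.mul_sum,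
    ← Finset.sum_neg_distrib]
  refine Finset.sum_congr rfl fun k _ => ?_
  -- Row `y` of `A` is the unit vector at `y`. Swapping rows `j` and `y` turns the minor into an
  -- entry of the adjugate at the cost of a sign.
  have h1 := (Matrix.detRowAlternating (n := ι) (R := ℂ)).map_swap
    (A.updateRow j (Pi.single k 1)) hj
  have h2 : (A.updateRow j (Pi.single k 1)) ∘ Equiv.swap j y =
      (A.updateRow j (Pi.single y 1)).updateRow y (Pi.single k 1) := by
    funext i
    change (A.updateRow j (Pi.single k 1)) (Equiv.swap j y i) = _
    by_cases h : i = j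
    · rw [h, Equiv.swap_apply_left, Matrix.updateRow_ne (Ne.symm hj), Matrix.updateRow_ne hj,
        Matrix.updateRow_self, hA]
    · by_cases h' : i = y
      · rw [h', Equiv.swap_apply_right, Matrix.updateRow_self, Matrix.updateRow_self]
      · rw [Equiv.swap_apply_of_ne_of_ne h h', Matrix.updateRow_ne h, Matrix.updateRow_ne h',
          Matrix.updateRow_ne h]
  rw [h2] at h1
  have h3 : ((A.updateRow j (Pi.single y 1)).updateRow y (Pi.single k 1)).det =
      -A.adjugate k j := by
    rw [Matrix.adjugate_apply]
    exact h1
  rw [h3]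
  ring

theorem det_updateRow_updateCol_single (A : Matrix ι ι ℂ) (j : ι) :
    ((A.updateRow j (Pi.single j 1)).updateCol j (Pi.single j 1)).det = A.adjugate j j := by
  rw [det_updateCol_eq_sum, Finset.sum_eq_single j, Matrix.updateRow_idem, Matrix.adjugate_apply]
  · simp
  · intro k _ hk
    simp [hk]
  · simp

/-- Jacobi's formula, written with the adjugate so that the double sum matches the one in
`det_border`. -/
theorem hasDerivAt_det {M : ℝ → Matrix ι ι ℂ} {M' : Matrix ι ι ℂ} {r : ℝ}
    (h : ∀ j k, HasDerivAt (fun r => M r j k) (M' j k) r) :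
    HasDerivAt (fun r => (M r).det) (∑ j, ∑ k, M' j k * (M r).adjugate k j) r := by
  have h1 : ∀ σ : Equiv.Perm ι, HasDerivAt (fun r => (Equiv.Perm.sign σ : ℤ) • ∏ i, M r (σ i) i)
      ((Equiv.Perm.sign σ : ℤ) • ∑ i, (∏ j ∈ Finset.univ.erase i, M r (σ j) j) • M' (σ i) i) r :=
    fun σ => (HasDerivAt.fun_finsetProd fun i _ => h (σ i) i).const_smul _
  have h2 := HasDerivAt.fun_sum (u := Finset.univ) fun σ _ => h1 σ
  have h3 : (fun r => ∑ σ : Equiv.Perm ι, (Equiv.Perm.sign σ : ℤ) • ∏ i, M r (σ i) i) =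
      fun r => (M r).det := by
    ext r
    rw [Matrix.det_apply]
    rfl
  rw [h3] at h2
  refine h2.congr_deriv ?_
  have h4 : ∀ i, ∑ j, M' j i * (M r).adjugate i j =
      ∑ σ : Equiv.Perm ι, (Equiv.Perm.sign σ : ℤ) •
        ((∏ j ∈ Finset.univ.erase i, M r (σ j) j) • M' (σ i) i) := by
    intro i
    have := det_updateCol_eq_sum (M r) i (fun j => M' j i)
    simp only [← Matrix.adjugate_apply] at this
    rw [← this, Matrix.det_apply]
    refine Finset.sum_congr rfl fun σ _ => ?_
    rw [← Finset.mul_prod_erase _ _ (Finset.mem_univ i), Matrix.updateCol_self]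
    have : ∏ x ∈ Finset.univ.erase i, (M r).updateCol i (fun j => M' j i) (σ x) x =
        ∏ x ∈ Finset.univ.erase i, M r (σ x) x :=
      Finset.prod_congr rfl fun x hx => by
        rw [Matrix.updateCol_ne (Finset.ne_of_mem_erase hx)]
    rw [this, smul_eq_mul, mul_comm]
    rfl
  rw [Finset.sum_comm (γ := ι)]
  simp only [h4, Finset.smul_sum]
  rw [Finset.sum_comm]

end det

/-! ### The cumulant expansion of the determinants -/

section cumulants

variable {m : ℝ} (hm : 0 < m) {ι : Type} [Fintype ι] [DecidableEq ι]

/-- The matrix of the kernel at the points `x j`, `j ∈ X`, completed by the identity. -/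
def kernMatrix (m r : ℝ) (x : ι → ℂ) (X : Finset ι) : Matrix ι ι ℂ :=
  Matrix.of fun j k =>
    if j ∈ X ∧ k ∈ X then if j = k then 0 else kern m r (x k - x j) else if j = k then 1 else 0

/-- The derivative of `kernMatrix` with respect to the parameter. -/
def kernMatrixDeriv (m r : ℝ) (x : ι → ℂ) (X : Finset ι) : Matrix ι ι ℂ :=
  Matrix.of fun j k =>
    if j ∈ X ∧ k ∈ X then if j = k then 0 else kernDeriv m r (x k - x j) else 0

/-- The determinant of the kernel at the points `x j`, `j ∈ X`, with zeros on the diagonal. -/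
def kernDet (m r : ℝ) (x : ι → ℂ) (X : Finset ι) : ℂ := (kernMatrix m r x X).det

/-- The coefficient `(-1)^(n-1) ℘^{(n-2)}(r + πi)`, set to zero for `n ≤ 1`. -/
def cumCoeff (r : ℝ) : ℕ → ℂ
  | 0 => 0
  | 1 => 0
  | n + 2 => (-1) ^ (n + 1) * iteratedDeriv n (wp m hm) (midPoint r)

/-- The derivative of `cumCoeff` with respect to the parameter. -/
def cumCoeffDeriv (r : ℝ) : ℕ → ℂ
  | 0 => 0
  | 1 => 0
  | n + 2 => -cumCoeff hm r (n + 3)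

/-- The sum of a symmetric function over the pair of elements of a two-element set. -/
def pairSum (g : ι → ι → ℂ) (B : Finset ι) : ℂ :=
  if B.card = 2 then (1 / 2) * ∑ j ∈ B, ∑ k ∈ B.erase j, g j k else 0

/-- The joint cumulants of the determinants `kernDet`. -/
def cum (r : ℝ) (x : ι → ℂ) (B : Finset ι) : ℂ :=
  cumCoeff hm r B.card + pairSum (fun j k => wp m hm (x k - x j)) B

omit [Fintype ι] in
theorem pairSum_pair (g : ι → ι → ℂ) {j k : ι} (hjk : j ≠ k) (hg : g j k = g k j) :
    pairSum g {j, k} = g j k := by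
  have h1 : ({j, k} : Finset ι).erase j = {k} := by
    ext i; simp; grind
  have h2 : ({j, k} : Finset ι).erase k = {j} := by
    ext i; simp; grind
  rw [pairSum, if_pos (Finset.card_pair hjk), Finset.sum_pair hjk, h1, h2, Finset.sum_singleton,
    Finset.sum_singleton, hg]
  ring

theorem hasDerivAt_cumCoeff (r : ℝ) (n : ℕ) :
    HasDerivAt (fun r => cumCoeff hm r n) (cumCoeffDeriv hm r n) r := by
  match n with
  | 0 => exact hasDerivAt_const _ _
  | 1 => exact hasDerivAt_const _ _
  | n + 2 =>
    have hb : HasDerivAt midPoint 1 r :=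
      ((hasDerivAt_id' r).ofReal_comp.add_const (Real.pi * I)).congr_deriv (by simp)
    have h0 : AnalyticAt ℂ (iteratedDeriv n (wp m hm)) (midPoint r) := by
      rw [iteratedDeriv_eq_iterate]
      exact AnalyticAt.iterated_deriv
        ((periods m hm).analyticOnNhd_weierstrassP _ (midPoint_notMem hm r)) n
    have h1 := h0.differentiableAt.hasDerivAt
    rw [← iteratedDeriv_succ] at h1
    have h2 := (h1.comp (𝕜' := ℂ) r hb).const_mul ((-1 : ℂ) ^ (n + 1))
    refine h2.congr_deriv ?_
    rw [cumCoeffDeriv, cumCoeff, wp]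
    ring

omit [Fintype ι] in
theorem hasDerivAt_cum (r : ℝ) (x : ι → ℂ) (B : Finset ι) :
    HasDerivAt (fun r => cum hm r x B) (cumCoeffDeriv hm r B.card) r :=
  (hasDerivAt_cumCoeff hm r _).add_const _

include hm in
theorem hasDerivAt_kernDet (r : ℝ) (x : ι → ℂ) (X : Finset ι) :
    HasDerivAt (fun r => kernDet m r x X)
      (∑ j, ∑ k, kernMatrixDeriv m r x X j k * (kernMatrix m r x X).adjugate k j) r := by
  refine hasDerivAt_det fun j k => ?_
  simp only [kernMatrix, kernMatrixDeriv, Matrix.of_apply]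
  split_ifs
  · exact hasDerivAt_const _ _
  · exact hasDerivAt_kern hm r _
  · exact hasDerivAt_const _ _
  · exact hasDerivAt_const _ _

theorem kernDet_empty (r : ℝ) (x : ι → ℂ) : kernDet m r x ∅ = 1 := by
  have : kernMatrix m r x ∅ = (1 : Matrix ι ι ℂ) := by
    ext j k
    simp [kernMatrix, Matrix.one_apply]
  rw [kernDet, this, Matrix.det_one]

theorem kernDet_erase (r : ℝ) (x : ι → ℂ) {X : Finset ι} {j : ι} :
    kernDet m r x (X.erase j) = (kernMatrix m r x X).adjugate j j := by
  rw [← det_updateRow_updateCol_single, kernDet]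
  congr 1
  ext i k
  simp only [kernMatrix, Matrix.of_apply, Matrix.updateCol_apply, Matrix.updateRow_apply,
    Finset.mem_erase, Pi.single_apply]
  grind

/-- Bordering by `y` produces products `kern (x_y - x_j) · kern (x_k - x_y)`. Off the diagonal the
addition theorem turns them into `∂ᵣ kern (x_k - x_j)` plus terms with `Z` that cancel; on the
diagonal `kern_mul_kern_neg` gives the values of `℘`. -/
theorem kernDet_insert {x : ι → ℂ} (hx : ∀ j k, j ≠ k → x k - x j ∉ (periods m hm).lattice)
    (r : ℝ) {X : Finset ι} {y : ι} (hy : y ∉ X) :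
    kernDet m r x (insert y X) =
      -(∑ j, ∑ k, kernMatrixDeriv m r x X j k * (kernMatrix m r x X).adjugate k j) +
        ∑ j ∈ X, (wp m hm (x y - x j) - wp m hm (midPoint r)) * kernDet m r x (X.erase j) := by
  set A := kernMatrix m r x X with hA
  set ρ : ι → ℂ := fun k => if k ∈ X then kern m r (x k - x y) else 0 with hρ
  set c : ι → ℂ := fun j => if j ∈ X then kern m r (x y - x j) else 0 with hc
  set z : ι → ℂ := fun j => thetaLog m (x y - x j) with hz
  have e1 : kernMatrix m r x (insert y X) = (A.updateRow y ρ).updateCol y c := by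
    ext j k
    simp only [hA, kernMatrix, Matrix.of_apply, Matrix.updateCol_apply, Matrix.updateRow_apply,
      Finset.mem_insert, hρ, hc]
    grind
  have hAy : A y = Pi.single y 1 := by
    ext k
    simp [hA, kernMatrix, hy, Pi.single_apply, eq_comm]
  rw [kernDet, e1, det_border A y hAy ρ c (by simp [hc, hy])]
  -- Since `Z` is odd, the factor `Z(x_y - x_j) + Z(x_k - x_y)` splits as `z j - z k`, separating
  -- the dependence on `j` from that on `k`.
  have term : ∀ j k, c j * ρ k * A.adjugate k j =
      (if j = k then if j ∈ X then (wp m hm (midPoint r) - wp m hm (x y - x j)) *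
        A.adjugate j j else 0 else 0) +
      ((kernMatrixDeriv m r x X j k * A.adjugate k j) +
        (z j * (A j k * A.adjugate k j) - z k * (A.adjugate k j * A j k))) := by
    intro j k
    by_cases hj : j ∈ X
    · have hjy : j ≠ y := fun h => hy (h ▸ hj)
      by_cases hk : k ∈ X
      · have hky : k ≠ y := fun h => hy (h ▸ hk)
        by_cases hjk : j = k
        · subst hjk
          have := kern_mul_kern_neg hm r (hx j y hjy)
          rw [neg_sub] at this
          simp only [hA, kernMatrix, kernMatrixDeriv, hc, hρ, hj, if_true, Matrix.of_apply,
            and_self, ← this]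
          ring
        · have h1 := kern_mul_kern hm r (hx j y hjy) (hx y k hky.symm)
            (by rw [sub_add_sub_cancel']; exact hx j k hjk)
          have h2 := thetaLog_neg hm (x y - x k)
          rw [neg_sub] at h2
          rw [sub_add_sub_cancel', h2] at h1
          simp only [hA, kernMatrix, kernMatrixDeriv, hc, hρ, hj, hk, if_true, Matrix.of_apply,
            and_self, hjk, if_false, hz]
          rw [h1]
          ring
      · have hjk : j ≠ k := fun h => hk (h ▸ hj)
        simp [hA, kernMatrix, kernMatrixDeriv, hρ, hk, hjk]
    · by_cases hjk : j = k
      · subst hjk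
        simp [kernMatrixDeriv, hc, hj]
        ring
      · simp [hA, kernMatrix, kernMatrixDeriv, hc, hj, hjk]
  -- By `A · adj A = det A`, and by `adj A · A = det A` for `s2`, both sums of `Z`-terms equal `(∑
  -- z) det A`, so they cancel.
  have s1 : ∑ j, ∑ k, z j * (A j k * A.adjugate k j) = ∑ j, z j * A.det := by
    refine Finset.sum_congr rfl fun j _ => ?_
    rw [← Finset.mul_sum]
    congr 1
    have := congrFun (congrFun (Matrix.mul_adjugate A) j) j
    simpa [Matrix.mul_apply] using this
  have s2 : ∑ j, ∑ k, z k * (A.adjugate k j * A j k) = ∑ j, z j * A.det := by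
    rw [Finset.sum_comm]
    refine Finset.sum_congr rfl fun j _ => ?_
    rw [← Finset.mul_sum]
    congr 1
    have := congrFun (congrFun (Matrix.adjugate_mul A) j) j
    simpa [Matrix.mul_apply] using this
  simp only [term, Finset.sum_add_distrib, Finset.sum_sub_distrib, s1, s2, sub_self, add_zero,
    Finset.sum_ite_eq, Finset.mem_univ, if_true]
  rw [Finset.sum_ite_mem, Finset.univ_inter, neg_add, add_comm]
  congr 1
  rw [← Finset.sum_neg_distrib]
  refine Finset.sum_congr rfl fun j _ => ?_
  rw [kernDet_erase]
  ring

omit [Fintype ι] in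
-- One more point means one more derivative of `℘` at `b` with a change of sign. The one-element
-- case is separate: the coefficient of order one is zero, so `-℘(b)` has to enter there, along with
-- the pair term.
theorem cum_insert (r : ℝ) (x : ι → ℂ) {B : Finset ι} {y : ι} (hy : y ∉ B) :
    cum hm r x (insert y B) = -cumCoeffDeriv hm r B.card +
      if B.card = 1 then ∑ j ∈ B, (wp m hm (x y - x j) - wp m hm (midPoint r)) else 0 := by
  rw [cum, Finset.card_insert_of_notMem hy]
  rcases hB : B.card with _ | _ | n
  · simp [cumCoeff, cumCoeffDeriv, pairSum, Finset.card_insert_of_notMem hy, hB]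
  · obtain ⟨j, rfl⟩ := Finset.card_eq_one.1 hB
    have hyj : j ≠ y := fun h => hy (by simp [h])
    rw [Finset.pair_comm, pairSum_pair _ hyj (by rw [← wp_neg hm, neg_sub])]
    simp [cumCoeff, cumCoeffDeriv]
    ring
  · simp [cumCoeffDeriv, pairSum, Finset.card_insert_of_notMem hy, hB]

omit [Fintype ι] in
theorem sum_powerset_card_one (X : Finset ι) (g : ι → ℂ) (D : Finset ι → ℂ) :
    ∑ B ∈ X.powerset, (if B.card = 1 then ∑ j ∈ B, g j else 0) * D (X \ B) =
      ∑ j ∈ X, g j * D (X.erase j) := by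
  have : ∀ B ∈ X.powerset, (if B.card = 1 then ∑ j ∈ B, g j else 0) * D (X \ B) =
      if B.card = 1 then (∑ j ∈ B, g j) * D (X \ B) else 0 := fun B _ => by
    split_ifs <;> simp
  rw [Finset.sum_congr rfl this, ← Finset.sum_filter, ← Finset.powersetCard_eq_filter,
    Finset.powersetCard_one, Finset.sum_map]
  refine Finset.sum_congr rfl fun j _ => ?_
  simp [Finset.sdiff_singleton_eq_erase]

omit [Fintype ι] in
theorem sum_powerset_comm (X : Finset ι) (f : Finset ι → Finset ι → ℂ) :
    ∑ B ∈ X.powerset, ∑ C ∈ (X \ B).powerset, f B C =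
      ∑ C ∈ X.powerset, ∑ B ∈ (X \ C).powerset, f B C := by
  refine Finset.sum_comm' fun B C => ?_
  simp only [Finset.mem_powerset, Finset.subset_sdiff]
  constructor
  · rintro ⟨h1, h2, h3⟩
    exact ⟨⟨h1, h3.symm⟩, h2⟩
  · rintro ⟨⟨h1, h3⟩, h2⟩
    exact ⟨h1, h2, h3.symm⟩

/-- The two statements are proved together by induction on the cardinality. The derivative formula
for `X` turns `kernDet_insert` into the recursion for `insert y X`; differentiating the recursion in
`r` gives the derivative formula for the larger set. -/
theorem hasDerivAt_kernDet_eq_sum {x : ι → ℂ}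
    (hx : ∀ j k, j ≠ k → x k - x j ∉ (periods m hm).lattice) (n : ℕ) :
    ∀ X : Finset ι, X.card ≤ n →
      (∀ r, HasDerivAt (fun r => kernDet m r x X)
        (∑ B ∈ X.powerset, cumCoeffDeriv hm r B.card * kernDet m r x (X \ B)) r) ∧
      ∀ r, ∀ y ∉ X, kernDet m r x (insert y X) =
        ∑ B ∈ X.powerset, cum hm r x (insert y B) * kernDet m r x (X \ B) := by
  have step : ∀ X : Finset ι, (∀ r, HasDerivAt (fun r => kernDet m r x X)
        (∑ B ∈ X.powerset, cumCoeffDeriv hm r B.card * kernDet m r x (X \ B)) r) →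
      ∀ r, ∀ y ∉ X, kernDet m r x (insert y X) =
        ∑ B ∈ X.powerset, cum hm r x (insert y B) * kernDet m r x (X \ B) := by
    intro X h r y hy
    rw [kernDet_insert hm hx r hy, (hasDerivAt_kernDet hm r x X).unique (h r),
      ← sum_powerset_card_one X (fun j => wp m hm (x y - x j) - wp m hm (midPoint r)),
      ← Finset.sum_neg_distrib, ← Finset.sum_add_distrib]
    refine Finset.sum_congr rfl fun B hB => ?_
    rw [cum_insert hm r x fun h => hy (Finset.mem_powerset.1 hB h)]
    ring
  induction n with
  | zero =>
    intro X hX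
    have hX : X = ∅ := Finset.card_eq_zero.1 (Nat.le_zero.1 hX)
    have h1 : ∀ r, HasDerivAt (fun r => kernDet m r x X)
        (∑ B ∈ X.powerset, cumCoeffDeriv hm r B.card * kernDet m r x (X \ B)) r := by
      intro r
      subst hX
      simp only [kernDet_empty]
      simpa [cumCoeffDeriv] using hasDerivAt_const r (1 : ℂ)
    exact ⟨h1, step X h1⟩
  | succ n ih =>
    intro X hX
    have h1 : ∀ r, HasDerivAt (fun r => kernDet m r x X)
        (∑ B ∈ X.powerset, cumCoeffDeriv hm r B.card * kernDet m r x (X \ B)) r := by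
      rcases X.eq_empty_or_nonempty with rfl | ⟨y, hyX⟩
      · exact (ih ∅ (by simp)).1
      obtain ⟨Y, hyY, rfl⟩ : ∃ Y : Finset ι, y ∉ Y ∧ insert y Y = X :=
        ⟨X.erase y, Finset.notMem_erase _ _, Finset.insert_erase hyX⟩
      rw [Finset.card_insert_of_notMem hyY] at hX
      have hY : Y.card ≤ n := by omega
      have sub : ∀ B, (Y \ B).card ≤ n := fun B =>
        (Finset.card_le_card Finset.sdiff_subset).trans hY
      intro r
      have e : (fun r => kernDet m r x (insert y Y)) = fun r =>
          ∑ B ∈ Y.powerset, cum hm r x (insert y B) * kernDet m r x (Y \ B) :=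
        funext fun r => (ih Y hY).2 r y hyY
      rw [e]
      -- By Leibniz, `∂ᵣ` acts either on the block that contains `y` or on the complementary
      -- determinant. These two kinds of terms are the subsets of `insert y Y` with and without `y`.
      have d := HasDerivAt.fun_sum (u := Y.powerset) fun B _ =>
        (hasDerivAt_cum hm r x (insert y B)).fun_mul ((ih (Y \ B) (sub B)).1 r)
      refine d.congr_deriv ?_
      rw [Finset.sum_powerset_insert hyY, Finset.sum_add_distrib, add_comm]
      simp only [Finset.mul_sum]
      rw [sum_powerset_comm]
      congr 1
      · refine Finset.sum_congr rfl fun C hC => ?_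
        have hC := Finset.mem_powerset.1 hC
        rw [Finset.insert_sdiff_of_notMem _ fun h => hyY (hC h),
          (ih (Y \ C) (sub C)).2 r y fun h => hyY (Finset.sdiff_subset h), Finset.mul_sum]
        refine Finset.sum_congr rfl fun B _ => ?_
        rw [sdiff_right_comm]
        ring
      · refine Finset.sum_congr rfl fun B hB => ?_
        congr 2
        ext i
        simp only [Finset.mem_sdiff, Finset.mem_insert]
        grind
    exact ⟨h1, step X h1⟩

/-- The recursion which expresses the determinants through their joint cumulants. -/
theorem kernDet_insert_eq_sum {x : ι → ℂ}
    (hx : ∀ j k, j ≠ k → x k - x j ∉ (periods m hm).lattice) (r : ℝ) {X : Finset ι} {y : ι}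
    (hy : y ∉ X) :
    kernDet m r x (insert y X) =
      ∑ B ∈ X.powerset, cum hm r x (insert y B) * kernDet m r x (X \ B) :=
  (hasDerivAt_kernDet_eq_sum hm hx _ X le_rfl).2 r y hy

end cumulants

end

section

/-! ### Schwarz reflection for periodic functions -/

section reflection

variable {T δ : ℝ} {h : ℂ → ℂ}

theorem isOpen_im_lt_im (a b : ℝ) : IsOpen {ζ : ℂ | a < ζ.im ∧ ζ.im < b} :=
  (isOpen_lt continuous_const continuous_im).inter (isOpen_lt continuous_im continuous_const)

/-- Horizontal periods of a holomorphic function do not depend on the height. -/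
theorem integral_horizontal_eq {g : ℂ → ℂ} {a b : ℝ}
    (hd : DifferentiableOn ℂ g {ζ | a < ζ.im ∧ ζ.im < b})
    (hper : ∀ ζ : ℂ, a < ζ.im → ζ.im < b → g (ζ + T) = g ζ) {y₁ y₂ : ℝ} (h1 : a < y₁) (h1' : y₁ < b)
    (h2 : a < y₂) (h2' : y₂ < b) :
    ∫ x in (0 : ℝ)..T, g (x + y₁ * I) = ∫ x in (0 : ℝ)..T, g (x + y₂ * I) := by
  have key := Complex.integral_boundary_rect_eq_zero_of_differentiableOn g (y₁ * I) (T + y₂ * I)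
    (hd.mono fun ζ hζ => by
      have := hζ.2
      simp only [mem_preimage, mul_im, ofReal_re, I_im, mul_one, ofReal_im, I_re, mul_zero,
        add_zero, add_im, zero_add] at this
      rcases this with ⟨h3, h4⟩
      exact ⟨(lt_min h1 h2).trans_le h3, h4.trans_lt (max_lt h1' h2')⟩)
  have hv : ∫ y in (y₁)..y₂, g (T + y * I) = ∫ y in (y₁)..y₂, g (0 + y * I) := by
    refine intervalIntegral.integral_congr fun y hy => ?_
    have hy : y ∈ Icc (min y₁ y₂) (max y₁ y₂) := hy
    have : (T : ℂ) + y * I = (0 + y * I) + T := by ring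
    simp only [this]
    refine hper _ ?_ ?_
    · simpa using (lt_min h1 h2).trans_le hy.1
    · simpa using hy.2.trans_lt (max_lt h1' h2')
  simp only [mul_re, ofReal_re, I_re, mul_zero, ofReal_im, I_im, mul_one, sub_self, add_re, add_zero,
    mul_im, zero_add, add_im, ofReal_zero] at key
  rw [hv] at key
  simp only [zero_add] at key
  linear_combination key

/-- The Fourier coefficients of a periodic holomorphic function in a strip. -/
def stripCoeff (T : ℝ) (h : ℂ → ℂ) (y : ℝ) (n : ℤ) : ℂ :=
  (1 / T) * ∫ x in (0 : ℝ)..T,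
    h (x + y * I) * exp (-(2 * Real.pi * I * n / T) * (x + y * I))

/-- The integrand including its exponential is holomorphic and `T`-periodic, so Cauchy's theorem on
a rectangle of width `T` applies. -/
theorem stripCoeff_eq (hT : 0 < T) (hd : DifferentiableOn ℂ h {ζ | 0 < ζ.im ∧ ζ.im < δ})
    (hper : ∀ ζ : ℂ, 0 < ζ.im → ζ.im < δ → h (ζ + T) = h ζ) {y₁ y₂ : ℝ} (h1 : 0 < y₁)
    (h1' : y₁ < δ) (h2 : 0 < y₂) (h2' : y₂ < δ) (n : ℤ) :
    stripCoeff T h y₁ n = stripCoeff T h y₂ n := by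
  rw [stripCoeff, stripCoeff]
  congr 1
  refine integral_horizontal_eq (a := 0) (b := δ)
    (g := fun ζ => h ζ * exp (-(2 * Real.pi * I * n / T) * ζ)) (hd.mul (by fun_prop)) ?_ h1 h1' h2 h2'
  intro ζ h3 h4
  have hT' : (T : ℂ) ≠ 0 := by exact_mod_cast hT.ne'
  have : -(2 * Real.pi * I * n / T) * (ζ + T) =
      -(2 * Real.pi * I * n / T) * ζ + (-n : ℤ) * (2 * Real.pi * I) := by
    field_simp
    push_cast
    ring
  simp only [hper ζ h3 h4, this, exp_add, exp_int_mul_two_pi_mul_I, mul_one]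

theorem continuous_horizontal {g : ℂ → ℂ} {a b y : ℝ}
    (hd : DifferentiableOn ℂ g {ζ | a < ζ.im ∧ ζ.im < b}) (h1 : a < y) (h2 : y < b) :
    Continuous fun x : ℝ => g (x + y * I) := by
  refine continuous_iff_continuousAt.2 fun x => ?_
  have h3 : ContinuousAt g (x + y * I) :=
    (hd.differentiableAt ((isOpen_im_lt_im a b).mem_nhds (by simp [h1, h2]))).continuousAt
  exact h3.comp (f := fun x : ℝ => (x : ℂ) + y * I) (by fun_prop)

theorem norm_exp_fourier (n : ℤ) (ζ : ℂ) :
    ‖exp ((2 * Real.pi * I * n / T) * ζ)‖ = Real.exp (-(2 * Real.pi * n / T) * ζ.im) := by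
  rw [norm_exp]
  congr 1
  have : (2 * Real.pi * I * n / T) * ζ = ((2 * Real.pi * n / T : ℝ) : ℂ) * (I * ζ) := by
    push_cast; ring
  rw [this, re_ofReal_mul]
  simp

theorem norm_stripCoeff_le (hT : 0 < T) (hd : DifferentiableOn ℂ h {ζ | 0 < ζ.im ∧ ζ.im < δ})
    {y : ℝ} (h1 : 0 < y) (h2 : y < δ) :
    ∃ C, ∀ n, ‖stripCoeff T h y n‖ ≤ C * Real.exp ((2 * Real.pi * n / T) * y) := by
  have hc := continuous_horizontal hd h1 h2
  obtain ⟨C, hC⟩ := (isCompact_Icc (a := (0 : ℝ)) (b := T)).exists_bound_of_continuousOn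
    hc.continuousOn
  refine ⟨C, fun n => ?_⟩
  have hb : ∀ x ∈ Set.uIoc (0 : ℝ) T,
      ‖h (x + y * I) * exp (-(2 * Real.pi * I * n / T) * (x + y * I))‖ ≤
        C * Real.exp ((2 * Real.pi * n / T) * y) := by
    intro x hx
    rw [Set.uIoc_of_le hT.le] at hx
    have e := norm_exp_fourier (T := T) (-n) (x + y * I)
    have e' : -(2 * Real.pi * I * n / T) * ((x : ℂ) + y * I) =
        (2 * Real.pi * I * (-n : ℤ) / T) * (x + y * I) := by
      push_cast; ring
    rw [norm_mul, e', e]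
    have : -(2 * Real.pi * ((-n : ℤ) : ℝ) / T) * ((x : ℂ) + y * I).im =
        (2 * Real.pi * n / T) * y := by
      simp; ring
    rw [this]
    exact mul_le_mul_of_nonneg_right (hC x ⟨hx.1.le, hx.2⟩) (Real.exp_pos _).le
  have := intervalIntegral.norm_integral_le_of_norm_le_const hb
  rw [stripCoeff, norm_mul]
  rw [sub_zero, abs_of_pos hT] at this
  have hT1 : ‖(1 / T : ℂ)‖ = 1 / T := by
    rw [norm_div, norm_one, norm_real, Real.norm_of_nonneg hT.le]
  rw [hT1]
  calc 1 / T * _ ≤ 1 / T * (C * Real.exp ((2 * Real.pi * n / T) * y) * T) :=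
        mul_le_mul_of_nonneg_left this (by positivity)
    _ = _ := by field_simp

/-- At height `s` the `n`-th Fourier coefficient of `2 Re h` is `A e^{-ls} + B̄ e^{ls}`. It tends to
zero as `s → 0` since `Re h` does so uniformly, which leaves `A + B̄ = 0`. -/
theorem stripCoeff_symm (hT : 0 < T) (hδ : 0 < δ)
    (hd : DifferentiableOn ℂ h {ζ | 0 < ζ.im ∧ ζ.im < δ})
    (hper : ∀ ζ : ℂ, 0 < ζ.im → ζ.im < δ → h (ζ + T) = h ζ)
    (hre : Tendsto (fun ζ => (h ζ).re) (comap im (𝓝[>] 0)) (𝓝 0)) {y : ℝ} (h1 : 0 < y)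
    (h2 : y < δ) (n : ℤ) :
    stripCoeff T h y n = -(starRingEnd ℂ) (stripCoeff T h y (-n)) := by
  set A := stripCoeff T h y n
  set B := stripCoeff T h y (-n)
  set l : ℝ := 2 * Real.pi * n / T with hl
  have lim : Tendsto (fun s : ℝ => A * exp (-l * s) + (starRingEnd ℂ) B * exp (l * s)) (𝓝[>] (0 : ℝ))
      (𝓝 (A * exp (-l * (0 : ℝ)) + (starRingEnd ℂ) B * exp (l * (0 : ℝ)))) := by
    refine Tendsto.mono_left (Continuous.tendsto ?_ 0) nhdsWithin_le_nhds
    fun_prop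
  have lim0 : Tendsto (fun s : ℝ => A * exp (-l * s) + (starRingEnd ℂ) B * exp (l * s)) (𝓝[>] (0 : ℝ))
      (𝓝 0) := by
    rw [Metric.tendsto_nhds]
    intro ε hε
    have h3 : ∀ᶠ s : ℝ in 𝓝[>] (0 : ℝ), ∀ x : ℝ, |(h (x + s * I)).re| < ε / 4 := by
      have h4 := (Metric.tendsto_nhds.1 hre) (ε / 4) (by positivity)
      rw [eventually_comap] at h4
      filter_upwards [h4] with s hs x
      have := hs (x + s * I) (by simp)
      simpa [Real.dist_eq] using this
    filter_upwards [h3, Ioo_mem_nhdsGT hδ] with s hs hs'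
    have e1 : A = stripCoeff T h s n := stripCoeff_eq hT hd hper h1 h2 hs'.1 hs'.2 n
    have e2 : B = stripCoeff T h s (-n) := stripCoeff_eq hT hd hper h1 h2 hs'.1 hs'.2 (-n)
    have hc := continuous_horizontal hd hs'.1 hs'.2
    have e3 : A * exp (-l * s) = (1 / T) * ∫ x in (0 : ℝ)..T, h (x + s * I) * exp (-(I * l) * x) := by
      rw [e1, stripCoeff, mul_assoc, ← intervalIntegral.integral_mul_const]
      congr 1
      refine intervalIntegral.integral_congr fun x _ => ?_
      rw [mul_assoc, ← exp_add, hl]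
      congr 2
      push_cast
      linear_combination (-(2 * Real.pi * n / T * s) : ℂ) * I_sq
    have e4 : (starRingEnd ℂ) B * exp (l * s) =
        (1 / T) * ∫ x in (0 : ℝ)..T, (starRingEnd ℂ) (h (x + s * I)) * exp (-(I * l) * x) := by
      rw [e2, stripCoeff, map_mul, ← intervalIntegral.intervalIntegral_conj, mul_assoc,
        ← intervalIntegral.integral_mul_const]
      congr 1
      · simp
      refine intervalIntegral.integral_congr fun x _ => ?_
      change (starRingEnd ℂ) _ * _ = _
      rw [map_mul, mul_assoc, ← exp_conj, ← exp_add, hl]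
      congr 2
      simp only [map_mul, map_add, map_neg, map_div₀, conj_ofReal, conj_I, map_ofNat, map_intCast]
      push_cast
      linear_combination ((2 * Real.pi * n / T * s) : ℂ) * I_sq
    have i1 : Continuous fun x : ℝ => h (x + s * I) * exp (-(I * l) * x) := hc.mul (by fun_prop)
    have i2 : Continuous fun x : ℝ => (starRingEnd ℂ) (h (x + s * I)) * exp (-(I * l) * x) :=
      (continuous_conj.comp hc).mul (by fun_prop)
    rw [dist_zero_right, e3, e4, ← mul_add, ← intervalIntegral.integral_add
      (i1.intervalIntegrable _ _) (i2.intervalIntegrable _ _)]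
    have hb : ∀ x ∈ Set.uIoc (0 : ℝ) T, ‖h (x + s * I) * exp (-(I * l) * x) +
        (starRingEnd ℂ) (h (x + s * I)) * exp (-(I * l) * x)‖ ≤ ε / 2 := by
      intro x _
      have : ‖exp (-(I * l) * x)‖ = 1 := by
        have : -(I * l) * x = ((-(l * x) : ℝ) : ℂ) * I := by push_cast; ring
        rw [this, norm_exp_ofReal_mul_I]
      rw [← add_mul, add_conj, norm_mul, this, mul_one, norm_real, Real.norm_eq_abs, abs_mul,
        abs_two]
      linarith [hs x]
    have := intervalIntegral.norm_integral_le_of_norm_le_const hb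
    rw [norm_mul]
    rw [sub_zero, abs_of_pos hT] at this
    have hT1 : ‖(1 / T : ℂ)‖ = 1 / T := by
      rw [norm_div, norm_one, norm_real, Real.norm_of_nonneg hT.le]
    rw [hT1]
    calc 1 / T * _ ≤ 1 / T * (ε / 2 * T) := mul_le_mul_of_nonneg_left this (by positivity)
      _ = ε / 2 := by field_simp
      _ < ε := by linarith
  have := tendsto_nhds_unique lim lim0
  simp only [ofReal_zero, mul_zero, exp_zero, mul_one] at this
  linear_combination this

/-- Summability is a hypothesis because pointwise convergence of the Fourier series on the
horizontal circle relies on it; `exists_reflection` supplies it from exponential bounds. -/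
theorem hasSum_stripCoeff (hT : 0 < T) (hd : DifferentiableOn ℂ h {ζ | 0 < ζ.im ∧ ζ.im < δ})
    (hper : ∀ ζ : ℂ, 0 < ζ.im → ζ.im < δ → h (ζ + T) = h ζ) {ζ : ℂ} (h1 : 0 < ζ.im) (h2 : ζ.im < δ)
    (hs : Summable fun n : ℤ => stripCoeff T h ζ.im n * exp ((2 * Real.pi * I * n / T) * ζ)) :
    HasSum (fun n : ℤ => stripCoeff T h ζ.im n * exp ((2 * Real.pi * I * n / T) * ζ)) (h ζ) := by
  have : Fact (0 < T) := ⟨hT⟩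
  set y := ζ.im
  have hp : Function.Periodic (fun x : ℝ => h (x + y * I)) T := fun x => by
    have : ((x + T : ℝ) : ℂ) + y * I = (x + y * I) + T := by push_cast; ring
    simp only [this]
    exact hper _ (by simpa using h1) (by simpa using h2)
  have hcont : Continuous (hp.lift : AddCircle T → ℂ) :=
    continuous_coinduced_dom.2 (continuous_horizontal hd h1 h2)
  let f : C(AddCircle T, ℂ) := ⟨hp.lift, hcont⟩
  have hcoef : ∀ n : ℤ, fourierCoeff f n = stripCoeff T h y n *
      exp (-(2 * Real.pi * n / T) * y) := by
    intro n
    rw [fourierCoeff_eq_intervalIntegral _ _ 0, stripCoeff, mul_assoc,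
      ← intervalIntegral.integral_mul_const, zero_add, Complex.real_smul]
    congr 1
    · push_cast; rfl
    refine intervalIntegral.integral_congr fun x _ => ?_
    simp only [fourier_coe_apply, smul_eq_mul]
    change _ * h (x + y * I) = _
    rw [mul_assoc (h _), ← exp_add, mul_comm]
    congr 2
    push_cast
    linear_combination ((2 * Real.pi * n / T * y) : ℂ) * I_sq
  have hterm : ∀ n : ℤ, fourierCoeff f n • fourier n ((ζ.re : ℝ) : AddCircle T) =
      stripCoeff T h y n * exp ((2 * Real.pi * I * n / T) * ζ) := by
    intro n
    rw [hcoef, fourier_coe_apply, smul_eq_mul, mul_assoc, ← exp_add]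
    congr 2
    conv_rhs => rw [← re_add_im ζ]
    linear_combination (-(2 * Real.pi * n / T * y) : ℂ) * I_sq
  have hsum : Summable (fourierCoeff f) := by
    rw [← summable_norm_iff]
    have := hs.norm
    refine this.congr fun n => ?_
    rw [← hterm, norm_smul, fourier_apply, Circle.norm_coe, mul_one]
  have := has_pointwise_sum_fourier_series_of_summable hsum ((ζ.re : ℝ) : AddCircle T)
  simp only [hterm] at this
  convert this using 1
  change h ζ = h (ζ.re + y * I)
  rw [re_add_im]

theorem summable_exp_neg_abs {a : ℝ} (ha : 0 < a) :
    Summable fun n : ℤ => Real.exp (-a * |(n : ℝ)|) := by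
  have h1 : Summable fun n : ℕ => Real.exp (-a * (n : ℝ)) := by
    have : ∀ n : ℕ, Real.exp (-a * (n : ℝ)) = Real.exp (-a) ^ n := fun n => by
      rw [← Real.exp_nat_mul]; congr 1; ring
    simp only [this]
    exact summable_geometric_of_lt_one (Real.exp_pos _).le (by simpa using ha)
  refine Summable.of_nat_of_neg ?_ ?_
  · simpa using h1
  · simpa using h1

/-- **Schwarz reflection principle** for periodic functions whose real part vanishes on the real
axis. -/
theorem exists_reflection (hT : 0 < T) (hδ : 0 < δ)
    (hd : DifferentiableOn ℂ h {ζ | 0 < ζ.im ∧ ζ.im < δ})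
    (hper : ∀ ζ : ℂ, 0 < ζ.im → ζ.im < δ → h (ζ + T) = h ζ)
    (hre : Tendsto (fun ζ => (h ζ).re) (comap im (𝓝[>] 0)) (𝓝 0)) :
    ∃ H : ℂ → ℂ, DifferentiableOn ℂ H {ζ | -δ < ζ.im ∧ ζ.im < δ} ∧
      (∀ ζ : ℂ, 0 < ζ.im → ζ.im < δ → H ζ = h ζ) ∧
      ∀ ζ : ℂ, H (starRingEnd ℂ ζ) = -(starRingEnd ℂ) (H ζ) := by
  set A : ℤ → ℂ := stripCoeff T h (δ / 2) with hA
  have hA' : ∀ y, 0 < y → y < δ → ∀ n, stripCoeff T h y n = A n := fun y h1 h2 n =>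
    stripCoeff_eq hT hd hper h1 h2 (by linarith) (by linarith) n
  have hsymm : ∀ n, A n = -(starRingEnd ℂ) (A (-n)) :=
    fun n => stripCoeff_symm hT hδ hd hper hre (by linarith) (by linarith) n
  -- Holomorphy above the axis alone gives decay only as `n → -∞`. The symmetry `hsymm` carries it
  -- to `n → +∞`, and this makes the series converge below the axis.
  have hbound : ∀ y, 0 < y → y < δ → ∃ C, 0 ≤ C ∧
      ∀ n : ℤ, ‖A n‖ ≤ C * Real.exp (-(2 * Real.pi / T * y) * |(n : ℝ)|) := by
    intro y h1 h2
    obtain ⟨C, hC⟩ := norm_stripCoeff_le hT hd h1 h2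
    have hC0 : 0 ≤ C := by
      have := hC 0
      simp only [Int.cast_zero, mul_zero, zero_div, zero_mul, Real.exp_zero, mul_one] at this
      exact (norm_nonneg _).trans this
    refine ⟨C, hC0, fun n => ?_⟩
    rcases le_or_gt n 0 with hn | hn
    · have := hC n
      rw [hA' y h1 h2] at this
      refine this.trans_eq ?_
      have : |(n : ℝ)| = -n := abs_of_nonpos (by exact_mod_cast hn)
      rw [this]
      congr 2
      ring
    · have := hC (-n)
      rw [hA' y h1 h2] at this
      rw [hsymm n, norm_neg, RCLike.norm_conj]
      refine this.trans_eq ?_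
      have : |(n : ℝ)| = n := abs_of_pos (by exact_mod_cast hn)
      rw [this]
      congr 2
      push_cast
      ring
  set F : ℤ → ℂ → ℂ := fun n ζ => A n * exp ((2 * Real.pi * I * n / T) * ζ) with hF
  have hFb : ∀ y, 0 < y → y < δ → ∃ u : ℤ → ℝ, Summable u ∧
      ∀ n : ℤ, ∀ ζ ∈ {ζ : ℂ | -y < ζ.im ∧ ζ.im < y}, ‖F n ζ‖ ≤ u n := by
    intro y h1 h2
    obtain ⟨C, hC0, hC⟩ := hbound ((y + δ) / 2) (by linarith) (by linarith)
    have ha : 0 < 2 * Real.pi / T * ((δ - y) / 2) := by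
      have := Real.pi_pos
      have : 0 < δ - y := by linarith
      positivity
    refine ⟨_, (summable_exp_neg_abs ha).mul_left C, fun n ζ hζ => ?_⟩
    simp only [hF]
    rw [norm_mul, norm_exp_fourier]
    refine (mul_le_mul_of_nonneg_right (hC n) (Real.exp_pos _).le).trans ?_
    rw [mul_assoc, ← Real.exp_add]
    refine mul_le_mul_of_nonneg_left (Real.exp_le_exp.2 ?_) hC0
    have h3 : |(n : ℝ) * ζ.im| ≤ |(n : ℝ)| * y := by
      rw [abs_mul]
      exact mul_le_mul_of_nonneg_left (abs_le.2 ⟨hζ.1.le, hζ.2.le⟩) (abs_nonneg _)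
    have h4 : 2 * Real.pi / T * (-((n : ℝ) * ζ.im)) ≤ 2 * Real.pi / T * (|(n : ℝ)| * y) :=
      mul_le_mul_of_nonneg_left ((neg_le_abs _).trans h3) (by have := Real.pi_pos; positivity)
    have e1 : -(2 * Real.pi * (n : ℝ) / T) * ζ.im = 2 * Real.pi / T * (-((n : ℝ) * ζ.im)) := by ring
    have e2 : -(2 * Real.pi / T * ((δ - y) / 2)) * |(n : ℝ)| =
      -(2 * Real.pi / T * ((y + δ) / 2)) * |(n : ℝ)| + 2 * Real.pi / T * (|(n : ℝ)| * y) := by ring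
    rw [e1, e2]
    linarith
  -- The extension is the Fourier series itself; its symmetry under conjugation is `hsymm` read
  -- termwise.
  refine ⟨fun ζ => ∑' n, F n ζ, ?_, ?_, ?_⟩
  · intro ζ hζ
    obtain ⟨y, hy1, hy2⟩ := exists_between (show |ζ.im| < δ from abs_lt.2 hζ)
    have hy0 := (abs_nonneg _).trans_lt hy1
    obtain ⟨u, hu, hFu⟩ := hFb y hy0 hy2
    have := differentiableOn_tsum_of_summable_norm hu (F := F)
      (fun n => by simp only [hF]; fun_prop) (isOpen_im_lt_im (-y) y) hFu
    exact (this.differentiableAt ((isOpen_im_lt_im (-y) y).mem_nhds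
      (abs_lt.1 hy1))).differentiableWithinAt
  · intro ζ h1 h2
    obtain ⟨y, hy1, hy2⟩ := exists_between h2
    obtain ⟨u, hu, hFu⟩ := hFb y (h1.trans hy1) hy2
    have hs : Summable fun n => F n ζ :=
      Summable.of_norm_bounded hu fun n => hFu n ζ ⟨by linarith, hy1⟩
    have := hasSum_stripCoeff hT hd hper h1 h2 (by simpa only [hA' _ h1 h2] using hs)
    simp only [hA' _ h1 h2] at this
    exact this.tsum_eq
  · intro ζ
    simp only
    rw [Complex.conj_tsum, ← tsum_neg, ← (Equiv.neg ℤ).tsum_eq]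
    refine tsum_congr fun n => ?_
    simp only [hF, Equiv.neg_apply, map_mul, ← exp_conj]
    rw [hsymm (-n), neg_neg, neg_mul]
    congr 3
    simp only [map_mul, map_div₀, conj_ofReal, conj_I, map_ofNat, map_intCast]
    push_cast
    ring

end reflection

end

section

/-! ### Injective holomorphic functions and continuous logarithms -/

/-- At a critical point `f - f z₀ = kⁿ` with `n ≥ 2` and `k` a local coordinate, so points whose
`k`-values differ by an `n`-th root of unity have the same image. -/
theorem deriv_ne_zero_of_injOn {U : Set ℂ} {f : ℂ → ℂ} (hU : IsOpen U)
    (hd : DifferentiableOn ℂ f U) (hinj : InjOn f U) {z₀ : ℂ} (hz : z₀ ∈ U) : deriv f z₀ ≠ 0 := by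
  intro h0
  have ha : AnalyticAt ℂ f z₀ := hd.analyticAt (hU.mem_nhds hz)
  have hA : AnalyticAt ℂ (fun z => f z - f z₀) z₀ := ha.sub analyticAt_const
  have hnc : ¬∀ᶠ z in 𝓝 z₀, f z - f z₀ = 0 := by
    intro h
    have h1 : ∀ᶠ z in 𝓝[≠] z₀, f z - f z₀ = 0 ∧ z ∈ U ∧ z ≠ z₀ :=
      (h.filter_mono nhdsWithin_le_nhds).and
        (((hU.eventually_mem hz).filter_mono nhdsWithin_le_nhds).and
          self_mem_nhdsWithin)
    obtain ⟨z, h2, h3, h4⟩ := h1.exists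
    exact h4 (hinj h3 hz (sub_eq_zero.1 h2))
  obtain ⟨n, g, hg, hg0, hfg⟩ := hA.exists_eventuallyEq_pow_smul_nonzero_iff.2 hnc
  have hn0 : n ≠ 0 := by
    rintro rfl
    have := hfg.self_of_nhds
    simp at this
    exact hg0 this.symm
  have hn1 : n ≠ 1 := by
    rintro rfl
    have h1 : HasDerivAt (fun z => (z - z₀) ^ 1 • g z) (g z₀) z₀ := by
      have := ((hasDerivAt_id' z₀).sub_const z₀).fun_mul hg.differentiableAt.hasDerivAt
      simpa using this
    have h2 : HasDerivAt (fun z => f z - f z₀) (g z₀) z₀ := h1.congr_of_eventuallyEq hfg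
    have h3 := ha.differentiableAt.hasDerivAt.sub_const (f z₀)
    rw [h0] at h3
    exact hg0 (h2.unique h3)
  -- An analytic `n`-th root of `g` near `z₀`. Dividing by `g z₀` keeps the argument of the
  -- logarithm near one, away from the branch cut.
  set r : ℂ → ℂ := fun z => exp ((log (g z₀) + log (g z / g z₀)) / n) with hr
  have hnC : (n : ℂ) ≠ 0 := by exact_mod_cast hn0
  have hrA : AnalyticAt ℂ r z₀ := by
    have h1 : AnalyticAt ℂ (fun z => log (g z / g z₀)) z₀ :=
      (hg.div analyticAt_const hg0).clog (by simp [hg0])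
    exact ((analyticAt_const.add h1).div analyticAt_const hnC).cexp
  have hrn : ∀ᶠ z in 𝓝 z₀, r z ^ n = g z := by
    filter_upwards [hg.continuousAt.eventually_ne hg0] with z hz
    rw [hr]
    simp only
    rw [← exp_nat_mul, mul_div_cancel₀ _ hnC, exp_add, exp_log hg0, exp_log (div_ne_zero hz hg0)]
    field_simp
  have hr0 : r z₀ ≠ 0 := exp_ne_zero _
  set k : ℂ → ℂ := fun z => (z - z₀) * r z with hk
  have hkA : AnalyticAt ℂ k z₀ := (analyticAt_id.sub analyticAt_const).mul hrA
  have hkd : HasStrictDerivAt k (r z₀) z₀ := by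
    have h1 := ((hasDerivAt_id' z₀).sub_const z₀).fun_mul hrA.differentiableAt.hasDerivAt
    have h2 : HasDerivAt k (r z₀) z₀ := by simpa using h1
    have := hkA.hasStrictDerivAt
    rwa [h2.deriv] at this
  have hmap := hkd.map_nhds_eq hr0
  have hV : {z | z ∈ U ∧ f z - f z₀ = k z ^ n} ∈ 𝓝 z₀ := by
    filter_upwards [hU.mem_nhds hz, hfg, hrn] with z h1 h2 h3
    refine ⟨h1, ?_⟩
    rw [h2, hk]
    simp only [mul_pow, h3, smul_eq_mul]
  have himg : k '' {z | z ∈ U ∧ f z - f z₀ = k z ^ n} ∈ 𝓝 (0 : ℂ) := by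
    have : k z₀ = 0 := by simp [hk]
    rw [← this, ← hmap]
    exact image_mem_map hV
  obtain ⟨ω, hω, hω1⟩ : ∃ ω : ℂ, ω ^ n = 1 ∧ ω ≠ 1 := by
    have := Complex.isPrimitiveRoot_exp n hn0
    exact ⟨_, this.pow_eq_one, this.ne_one (by omega)⟩
  have hωt : Tendsto (fun w : ℂ => ω * w) (𝓝 0) (𝓝 0) := by
    have : Continuous fun w : ℂ => ω * w := by fun_prop
    simpa using this.tendsto 0
  have hev : ∀ᶠ w in 𝓝[≠] (0 : ℂ), w ≠ 0 ∧ w ∈ k '' {z | z ∈ U ∧ f z - f z₀ = k z ^ n} ∧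
      ω * w ∈ k '' {z | z ∈ U ∧ f z - f z₀ = k z ^ n} :=
    (show ∀ᶠ w in 𝓝[≠] (0 : ℂ), w ≠ 0 from self_mem_nhdsWithin).and
      (((show ∀ᶠ w in 𝓝 (0 : ℂ), _ from himg).filter_mono nhdsWithin_le_nhds).and
        ((hωt.eventually himg).filter_mono nhdsWithin_le_nhds))
  obtain ⟨w, hw0, ⟨z₁, ⟨h1U, h1⟩, h1k⟩, z₂, ⟨h2U, h2⟩, h2k⟩ := hev.exists
  have : z₁ = z₂ := hinj h1U h2U (by
    have : f z₁ - f z₀ = f z₂ - f z₀ := by rw [h1, h2, h1k, h2k, mul_pow, hω, one_mul]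
    exact sub_left_inj.1 this)
  rw [this, h2k] at h1k
  exact hω1 (mul_right_cancel₀ hw0 (by rw [h1k, one_mul]))

/-- A nonvanishing continuous function on a convex open set has a continuous logarithm. -/
theorem exists_log_of_convex {E : Type*} [NormedAddCommGroup E] [NormedSpace ℝ E] {U : Set E}
    (hU : IsOpen U) (hc : Convex ℝ U) (hne : U.Nonempty) {g : E → ℂ} (hg : ContinuousOn g U)
    (h0 : ∀ x ∈ U, g x ≠ 0) : ∃ L : E → ℂ, ContinuousOn L U ∧ ∀ x ∈ U, exp (L x) = g x := by
  have := hc.contractibleSpace hne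
  have hs : IsSimplyConnected U := SimplyConnectedSpace.ofContractible U
  obtain ⟨L, h1, h2⟩ := exists_continuousOn_eqOn_exp_comp hs hU hg (by
    rintro ⟨x, hx, h⟩
    exact h0 x hx h)
  exact ⟨L, h1, h2⟩

/-- A continuous function with real exponential has constant imaginary part. -/
theorem im_eq_of_exp_im_eq_zero {X : Type*} [TopologicalSpace X] {S : Set X}
    (hS : IsPreconnected S) {g : X → ℂ} (hg : ContinuousOn g S)
    (h : ∀ x ∈ S, (exp (g x)).im = 0) {x y : X} (hx : x ∈ S) (hy : y ∈ S) :
    (g x).im = (g y).im := by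
  have hint : ∀ x ∈ S, ∃ n : ℤ, (n : ℝ) * Real.pi = (g x).im := fun x hx => by
    have := h x hx
    rw [exp_im, mul_eq_zero, or_iff_right (Real.exp_pos _).ne', Real.sin_eq_zero_iff] at this
    exact this
  have key : ∀ x ∈ S, ∀ y ∈ S, ¬ (g x).im < (g y).im := by
    intro x hx y hy hlt
    obtain ⟨n, hn⟩ := hint x hx
    obtain ⟨k, hk⟩ := hint y hy
    rw [← hn, ← hk] at hlt
    have hnk : n < k := by
      have := lt_of_mul_lt_mul_right hlt Real.pi_pos.le
      exact_mod_cast this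
    have hnk' : (n : ℝ) + 1 ≤ k := by exact_mod_cast hnk
    -- If two different multiples of `π` occurred, a half-odd multiple would be attained in between,
    -- where the exponential is not real.
    have hmem : ((n : ℝ) + 1 / 2) * Real.pi ∈ Icc ((g x).im) ((g y).im) := by
      rw [← hn, ← hk]
      constructor <;> refine mul_le_mul_of_nonneg_right ?_ Real.pi_pos.le <;> linarith
    obtain ⟨w, hw, hwe⟩ := hS.intermediate_value hx hy (continuous_im.comp_continuousOn hg) hmem
    obtain ⟨l, hl⟩ := hint w hw
    have hwe : (g w).im = ((n : ℝ) + 1 / 2) * Real.pi := hwe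
    rw [← hl] at hwe
    have h3 : (l : ℝ) = n + 1 / 2 := mul_right_cancel₀ Real.pi_ne_zero hwe
    have h4 : (2 * l : ℝ) = 2 * n + 1 := by rw [h3]; ring
    have h5 : 2 * l = 2 * n + 1 := by exact_mod_cast h4
    omega
  exact le_antisymm (not_lt.1 (key y hy x hx)) (not_lt.1 (key x hx y hy))

/-- A continuous function with exponential one is constant. -/
theorem eq_of_exp_eq_one {X : Type*} [TopologicalSpace X] {S : Set X}
    (hS : IsPreconnected S) {g : X → ℂ} (hg : ContinuousOn g S)
    (h : ∀ x ∈ S, exp (g x) = 1) {x y : X} (hx : x ∈ S) (hy : y ∈ S) : g x = g y := by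
  have hre : ∀ x ∈ S, (g x).re = 0 := fun x hx => by
    have := congrArg norm (h x hx)
    rwa [norm_exp, norm_one, Real.exp_eq_one_iff] at this
  refine Complex.ext (by rw [hre x hx, hre y hy])
    (im_eq_of_exp_im_eq_zero hS hg (fun x hx => by rw [h x hx, one_im]) hx hy)

/-! ### The uniformization -/

theorem isOpen_strip : IsOpen strip := isOpen_im_lt_im 0 Real.pi

theorem convex_im_lt_im (a b : ℝ) : Convex ℝ {ζ : ℂ | a < ζ.im ∧ ζ.im < b} :=
  (convex_halfSpace_im_gt a).inter (convex_halfSpace_im_lt b)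

theorem strip_nonempty : strip.Nonempty :=
  ⟨I, by simp [strip, Real.pi_gt_three.trans' (by norm_num : (1 : ℝ) < 3)]⟩

theorem add_ofReal_mem_strip {z : ℂ} {x : ℝ} : z + x ∈ strip ↔ z ∈ strip := by
  simp [strip]

variable {m : ℝ} {φ : ℂ → ℂ} {Ω : Set ℂ}

namespace IsUniformization

variable (hφ : IsUniformization m φ Ω)
include hφ

theorem hasStrictDerivAt {z : ℂ} (hz : z ∈ strip) : HasStrictDerivAt φ (deriv φ z) z :=
  (hφ.differentiableOn.analyticAt (isOpen_strip.mem_nhds hz)).hasStrictDerivAt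

theorem deriv_ne_zero {z : ℂ} (hz : z ∈ strip) : deriv φ z ≠ 0 :=
  deriv_ne_zero_of_injOn isOpen_strip hφ.differentiableOn hφ.injOn hz

theorem map_nhds {z : ℂ} (hz : z ∈ strip) : map φ (𝓝 z) = 𝓝 (φ z) :=
  (hφ.hasStrictDerivAt hz).map_nhds_eq (hφ.deriv_ne_zero hz)

theorem mem {z : ℂ} (hz : z ∈ strip) : φ z ∈ Ω := hφ.image_eq ▸ mem_image_of_mem φ hz

theorem isOpen : IsOpen Ω := by
  rw [isOpen_iff_mem_nhds]
  intro w hw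
  rw [← hφ.image_eq] at hw ⊢
  obtain ⟨z, hz, rfl⟩ := hw
  rw [← hφ.map_nhds hz]
  exact image_mem_map (isOpen_strip.mem_nhds hz)

theorem map_add_int {z : ℂ} (hz : z ∈ strip) (l : ℤ) : φ (z + l * m) = φ z + l := by
  have hmem : ∀ l : ℤ, z + l * m ∈ strip := fun l => by
    have := (add_ofReal_mem_strip (z := z) (x := l * m)).2 hz
    push_cast at this
    exact this
  induction l using Int.induction_on with
  | zero => simp
  | succ n ih =>
    have := hφ.map_add _ (hmem n)
    have e : z + ((n + 1 : ℤ) : ℂ) * m = z + (n : ℤ) * m + m := by push_cast; ring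
    rw [e, this, ih]
    push_cast; ring
  | pred n ih =>
    have := hφ.map_add _ (hmem (-n - 1))
    have e : z + ((-n - 1 : ℤ) : ℂ) * m + m = z + (-n : ℤ) * m := by push_cast; ring
    rw [e, ih] at this
    push_cast at this ⊢
    linear_combination -this

theorem samePoint_iff {z w : ℂ} (hz : z ∈ strip) (hw : w ∈ strip) :
    SamePoint 1 (φ z) (φ w) ↔ SamePoint m z w := by
  constructor
  · rintro ⟨l, hl⟩
    refine ⟨l, hφ.injOn hz ?_ ?_⟩
    · have := (add_ofReal_mem_strip (z := w) (x := l * m)).2 hw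
      push_cast at this
      exact this
    · rw [hφ.map_add_int hw, hl]
      simp
  · rintro ⟨l, rfl⟩
    refine ⟨l, ?_⟩
    rw [hφ.map_add_int hw]
    simp

theorem deriv_add {z : ℂ} (hz : z ∈ strip) : deriv φ (z + m) = deriv φ z := by
  have h1 : (fun w => φ (w + m)) =ᶠ[𝓝 z] fun w => φ w + 1 := by
    filter_upwards [isOpen_strip.mem_nhds hz] with w hw
    exact hφ.map_add w hw
  have h2 := h1.deriv_eq
  rw [deriv_comp_add_const, deriv_add_const] at h2
  exact h2

theorem continuousOn_deriv : ContinuousOn (deriv φ) strip :=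
  (hφ.differentiableOn.deriv isOpen_strip).continuousOn

/-- The difference quotients of `φ` along the circles. -/
theorem continuousOn_slope : ContinuousOn
    (fun p : ℂ × ℝ => if p.2 = 0 then deriv φ p.1 else (φ (p.1 + p.2) - φ p.1) / p.2)
    (strip ×ˢ univ) := by
  rintro ⟨z, s⟩ ⟨hz, -⟩
  refine ContinuousAt.continuousWithinAt ?_
  have hcφ : ∀ w ∈ strip, ContinuousAt φ w := fun w hw => (hφ.hasStrictDerivAt hw).hasDerivAt.continuousAt
  by_cases hs : s = 0
  · subst hs
    rw [Metric.continuousAt_iff']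
    intro ε hε
    -- Joint continuity at `s = 0` is strict differentiability, as the base point of the quotient
    -- moves as well.
    have h1 := (hφ.hasStrictDerivAt hz).isLittleO.def (half_pos hε)
    have ht : Tendsto (fun p : ℂ × ℝ => (p.1 + p.2, p.1)) (𝓝 (z, 0)) (𝓝 (z, z)) := by
      have : Continuous fun p : ℂ × ℝ => (p.1 + p.2, p.1) := by fun_prop
      simpa using this.tendsto (z, 0)
    have h2 : ContinuousAt (fun p : ℂ × ℝ => deriv φ p.1) (z, 0) :=
      ((hφ.continuousOn_deriv.continuousAt (isOpen_strip.mem_nhds hz))).comp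
        (f := fun p : ℂ × ℝ => p.1) continuousAt_fst
    filter_upwards [ht.eventually h1, Metric.continuousAt_iff'.1 h2 ε hε] with p hp1 hp2
    simp only [if_true]
    by_cases hp : p.2 = 0
    · simpa [hp] using hp2
    · rw [if_neg hp, dist_eq_norm]
      simp only [add_sub_cancel_left] at hp1
      have hp' : (p.2 : ℂ) ≠ 0 := by exact_mod_cast hp
      have e : (φ (p.1 + p.2) - φ p.1) / p.2 - deriv φ z =
          (φ (p.1 + p.2) - φ p.1 - ContinuousLinearMap.toSpanSingleton ℂ (deriv φ z) (p.2 : ℂ)) /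
            p.2 := by
        simp
        field_simp
      rw [e, norm_div, div_lt_iff₀ (norm_pos_iff.2 hp')]
      refine hp1.trans_lt ?_
      exact mul_lt_mul_of_pos_right (by linarith) (norm_pos_iff.2 hp')
  · have h1 : ContinuousAt (fun p : ℂ × ℝ => (φ (p.1 + p.2) - φ p.1) / p.2) (z, s) := by
      refine ContinuousAt.div ?_ (by fun_prop) (by exact_mod_cast hs)
      refine ContinuousAt.sub ?_ ?_
      · exact ContinuousAt.comp (g := φ) (f := fun p : ℂ × ℝ => p.1 + p.2)
          (hcφ _ (add_ofReal_mem_strip.2 hz)) (by fun_prop)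
      · exact ContinuousAt.comp (g := φ) (f := fun p : ℂ × ℝ => p.1) (hcφ _ hz) (by fun_prop)
    refine h1.congr ?_
    have : ∀ᶠ p : ℂ × ℝ in 𝓝 (z, s), p.2 ≠ 0 :=
      (continuousAt_snd (p := (z, s))).eventually_ne hs
    filter_upwards [this] with p hp
    rw [if_neg hp]

/-- The derivative of the uniformization has a periodic logarithm. -/
theorem exists_log_deriv (hm : 0 < m) : ∃ M : ℂ → ℂ, ContinuousOn M strip ∧
    (∀ z ∈ strip, exp (M z) = deriv φ z) ∧ ∀ z ∈ strip, M (z + m) = M z := by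
  -- Injectivity of `φ` makes all horizontal difference quotients nonzero. They deform `φ'` at `s =
  -- 0` into the constant `1/m` at `s = m`, as in Hopf's proof of the Umlaufsatz.
  set D : ℂ × ℝ → ℂ :=
    fun p => if p.2 = 0 then deriv φ p.1 else (φ (p.1 + p.2) - φ p.1) / p.2 with hD
  have hUo : IsOpen (strip ×ˢ (univ : Set ℝ)) := isOpen_strip.prod isOpen_univ
  have hUc : Convex ℝ (strip ×ˢ (univ : Set ℝ)) := (convex_im_lt_im 0 Real.pi).prod convex_univ
  have hD0 : ∀ p ∈ strip ×ˢ (univ : Set ℝ), D p ≠ 0 := by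
    rintro ⟨z, s⟩ ⟨hz, -⟩
    by_cases hs : s = 0
    · simp only [hD, hs, if_true]
      exact hφ.deriv_ne_zero hz
    · simp only [hD, hs, if_false]
      refine div_ne_zero (sub_ne_zero.2 fun h => hs ?_) (by exact_mod_cast hs)
      have := hφ.injOn (add_ofReal_mem_strip.2 hz) hz h
      exact_mod_cast add_eq_left.1 this
  obtain ⟨L, hLc, hL⟩ := exists_log_of_convex hUo hUc (strip_nonempty.prod univ_nonempty)
    hφ.continuousOn_slope hD0
  have hshift : ∀ p ∈ strip ×ˢ (univ : Set ℝ), (p.1 + (m : ℂ), p.2) ∈ strip ×ˢ (univ : Set ℝ) :=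
    fun p hp => ⟨add_ofReal_mem_strip.2 hp.1, mem_univ _⟩
  have hDper : ∀ p ∈ strip ×ˢ (univ : Set ℝ), D (p.1 + m, p.2) = D p := by
    rintro ⟨z, s⟩ ⟨hz, -⟩
    simp only [hD]
    rw [hφ.deriv_add hz, add_right_comm, hφ.map_add _ (add_ofReal_mem_strip.2 hz), hφ.map_add _ hz,
      add_sub_add_right_eq_sub]
  -- The increment of the logarithm along `m` has exponential one, so it is the same for all `z` and
  -- all `s`.
  have hconst := fun {x y} hx hy => eq_of_exp_eq_one hUc.isPreconnected
    (g := fun p => L (p.1 + m, p.2) - L p)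
    ((hLc.comp (by fun_prop) hshift).sub hLc) (fun p hp => by
      have hL' : ∀ x ∈ strip ×ˢ (univ : Set ℝ), exp (L x) = D x := hL
      rw [exp_sub, hL' _ (hshift p hp), hL' p hp, hDper p hp]
      exact div_self (hD0 p hp)) (x := x) (y := y) hx hy
  -- At `s = m` the quotient is the constant `1/m`, so its logarithm is constant and the increment
  -- is zero.
  have hm' : ∀ z ∈ strip, L (z + m, m) = L (z, m) := by
    intro z hz
    refine eq_of_exp_eq_one (X := ℂ) (S := strip) (convex_im_lt_im 0 Real.pi).isPreconnected
      (g := fun z => L (z, m) - L (I, m)) ?_ ?_ (add_ofReal_mem_strip.2 hz) hz |> sub_left_inj.1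
    · exact (hLc.comp (by fun_prop) fun z hz => ⟨hz, mem_univ _⟩).sub continuousOn_const
    · have hI : I ∈ strip := by simp [strip, Real.pi_gt_three.trans' (by norm_num : (1 : ℝ) < 3)]
      have h1 : ∀ z ∈ strip, exp (L (z, m)) = 1 / m := fun z hz => by
        rw [hL (z, m) ⟨hz, mem_univ _⟩]
        simp [hm.ne', hφ.map_add z hz]
      intro z hz
      have hmC : (m : ℂ) ≠ 0 := by exact_mod_cast hm.ne'
      rw [exp_sub, h1 z hz, h1 I hI, div_self (by simpa using hmC)]
  refine ⟨fun z => L (z, 0), hLc.comp (by fun_prop) fun z hz => ⟨hz, mem_univ _⟩, fun z hz => ?_,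
    fun z hz => ?_⟩
  · rw [hL (z, 0) ⟨hz, mem_univ _⟩]
    simp
  · have := hconst (x := (z, 0)) (y := (z, m)) ⟨hz, mem_univ _⟩ ⟨hz, mem_univ _⟩
    simp only [hm' z hz, sub_self] at this
    exact sub_eq_zero.1 this

end IsUniformization

end

section

/-! ### Sections with real boundary values -/

/-- A function `u` on `-π < Im ζ < π` and a function `v = u * d` on `0 < Im ζ < 2π` which are real
on the lines `Im ζ = 0` and `Im ζ = π` respectively, with multiplier `c exp (N ζ)` along `m`. -/
structure IsRealSection (m : ℝ) (d u v : ℂ → ℂ) (c : ℝ) (N : ℤ) : Prop where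
  diff_left : DifferentiableOn ℂ u {ζ | -Real.pi < ζ.im ∧ ζ.im < Real.pi}
  diff_right : DifferentiableOn ℂ v {ζ | 0 < ζ.im ∧ ζ.im < 2 * Real.pi}
  eq_mul : ∀ ζ ∈ strip, v ζ = u ζ * d ζ
  symm_left : ∀ ζ : ℂ, -Real.pi < ζ.im → ζ.im < Real.pi → u (starRingEnd ℂ ζ) = starRingEnd ℂ (u ζ)
  symm_right : ∀ ζ : ℂ, 0 < ζ.im → ζ.im < 2 * Real.pi →
    v (starRingEnd ℂ ζ + 2 * Real.pi * I) = starRingEnd ℂ (v ζ)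
  quasi_left : ∀ ζ : ℂ, -Real.pi < ζ.im → ζ.im < Real.pi → u (ζ + m) = c * exp (N * ζ) * u ζ
  quasi_right : ∀ ζ : ℂ, 0 < ζ.im → ζ.im < 2 * Real.pi → v (ζ + m) = c * exp (N * ζ) * v ζ

/-- The local form of `eq_zero_of_mul_eq_zero`. It transfers each axiom of `IsRealSection` to a
quotient by `Q`. -/
theorem eq_of_eventually_mul_eq {A B Q : ℂ → ℂ} {z : ℂ} (hA : ContinuousAt A z)
    (hB : ContinuousAt B z) (hQ : ∀ᶠ w in 𝓝[≠] z, Q w ≠ 0)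
    (h : ∀ᶠ w in 𝓝 z, A w * Q w = B w * Q w) : A z = B z := by
  have h1 : ∀ᶠ w in 𝓝[≠] z, A w = B w := by
    filter_upwards [hQ, h.filter_mono nhdsWithin_le_nhds] with w h1 h2
    exact mul_right_cancel₀ h1 h2
  exact tendsto_nhds_unique_of_eventuallyEq (hA.tendsto.mono_left nhdsWithin_le_nhds)
    (hB.tendsto.mono_left nhdsWithin_le_nhds) h1

theorem exists_quotient_on {U : Set ℂ} (hU : IsOpen U) {u Q : ℂ → ℂ} (hu : DifferentiableOn ℂ u U)
    (hQ : Differentiable ℂ Q) (hz : ∀ z ∈ U, Q z = 0 → u z = 0 ∧ deriv Q z ≠ 0) :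
    ∃ u', DifferentiableOn ℂ u' U ∧ ∀ z ∈ U, u z = u' z * Q z := by
  obtain ⟨u', h1, -, h3⟩ := exists_differentiableOn_of_eventuallyEq (U := U)
    (f := fun z => u z / Q z) fun z h => exists_analyticAt_div (hu.analyticAt (hU.mem_nhds h))
      (hQ.analyticAt z) (by
        by_cases h0 : Q z = 0
        · exact Or.inr (hz z h h0)
        · exact Or.inl h0)
  refine ⟨u', h1, fun z h => ?_⟩
  by_cases h0 : Q z = 0
  · rw [(hz z h h0).1, h0, mul_zero]
  · rw [h3 z h ((hu.differentiableAt (hU.mem_nhds h)).continuousAt.div hQ.continuous.continuousAt h0),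
      div_mul_cancel₀ _ h0]

/-! ### Division of real sections by symmetric entire functions. -/

namespace IsRealSection

variable {m : ℝ} {d u v : ℂ → ℂ} {c : ℝ} {N : ℤ}

/-- Division of a section by a symmetric entire function. -/
theorem exists_div (hs : IsRealSection m d u v c N) {Q : ℂ → ℂ} {a : ℝ} {k : ℤ}
    (hQ : Differentiable ℂ Q) (ha : a ≠ 0) (hconj : ∀ z, Q (starRingEnd ℂ z) = starRingEnd ℂ (Q z))
    (hper : ∀ z, Q (z + 2 * Real.pi * I) = Q z) (hm : ∀ z, Q (z + m) = a * exp (k * z) * Q z)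
    (hQ' : ∀ z, Q z = 0 → deriv Q z ≠ 0)
    (hzu : ∀ z : ℂ, -Real.pi < z.im → z.im < Real.pi → Q z = 0 → u z = 0)
    (hzv : ∀ z : ℂ, 0 < z.im → z.im < 2 * Real.pi → Q z = 0 → v z = 0)
    (hd : ContinuousOn d strip) :
    ∃ u' v', IsRealSection m d u' v' (c / a) (N - k) ∧
      (∀ z : ℂ, -Real.pi < z.im → z.im < Real.pi → u z = u' z * Q z) ∧
      ∀ z : ℂ, 0 < z.im → z.im < 2 * Real.pi → v z = v' z * Q z := by
  have oU := isOpen_im_lt_im (-Real.pi) Real.pi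
  have oV := isOpen_im_lt_im 0 (2 * Real.pi)
  obtain ⟨u', hu', eu⟩ := exists_quotient_on oU hs.diff_left hQ
    fun z h h0 => ⟨hzu z h.1 h.2 h0, hQ' z h0⟩
  obtain ⟨v', hv', ev⟩ := exists_quotient_on oV hs.diff_right hQ
    fun z h h0 => ⟨hzv z h.1 h.2 h0, hQ' z h0⟩
  have hQn := frequently_ne_zero_of_simple_zeros hQ hQ'
  have cu : ∀ z : ℂ, -Real.pi < z.im → z.im < Real.pi → ContinuousAt u' z := fun z h1 h2 =>
    (hu'.differentiableAt (oU.mem_nhds ⟨h1, h2⟩)).continuousAt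
  have cv : ∀ z : ℂ, 0 < z.im → z.im < 2 * Real.pi → ContinuousAt v' z := fun z h1 h2 =>
    (hv'.differentiableAt (oV.mem_nhds ⟨h1, h2⟩)).continuousAt
  have haC : (a : ℂ) ≠ 0 := by exact_mod_cast ha
  have quasi : ∀ f f' : ℂ → ℂ, ∀ z, f (z + m) = c * exp (N * z) * f z → f z = f' z * Q z →
      f (z + m) = f' (z + m) * Q (z + m) →
      f' (z + m) * Q z = ((c / a : ℝ) : ℂ) * exp ((N - k : ℤ) * z) * f' z * Q z := by
    intro f f' z h1 h2 h3
    have he := exp_ne_zero (k * z)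
    have e1 : exp ((N - k : ℤ) * z) * exp (k * z) = exp (N * z) := by
      rw [← exp_add]; congr 1; push_cast; ring
    rw [h3, hm, h2, ← e1] at h1
    generalize exp ((N - k : ℤ) * z) = E at h1 ⊢
    have h4 : (a * exp (k * z)) * (f' (z + m) * Q z -
        ((c / a : ℝ) : ℂ) * E * f' z * Q z) = 0 := by
      push_cast at h1 ⊢
      field_simp
      linear_combination h1
    exact sub_eq_zero.1 ((mul_eq_zero.1 h4).resolve_left (mul_ne_zero haC he))
  refine ⟨u', v', ⟨hu', hv', fun z hz => ?_, fun z h1 h2 => ?_, fun z h1 h2 => ?_,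
    fun z h1 h2 => ?_, fun z h1 h2 => ?_⟩, fun z h1 h2 => eu z ⟨h1, h2⟩,
    fun z h1 h2 => ev z ⟨h1, h2⟩⟩
  · have hπ := Real.pi_pos
    refine eq_of_eventually_mul_eq (B := fun z => u' z * d z) (cv z hz.1 (by linarith [hz.2]))
      ((cu z (by linarith [hz.1]) hz.2).mul (hd.continuousAt (isOpen_strip.mem_nhds hz))) (hQn z) ?_
    filter_upwards [isOpen_strip.mem_nhds hz] with w hw
    have h1 := hs.eq_mul w hw
    rw [eu w ⟨by linarith [hw.1], hw.2⟩, ev w ⟨hw.1, by linarith [hw.2]⟩] at h1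
    linear_combination h1
  · refine eq_of_eventually_mul_eq (A := fun z => u' (starRingEnd ℂ z))
      (B := fun z => starRingEnd ℂ (u' z)) (Q := fun z => Q (starRingEnd ℂ z)) ?_
      (continuous_conj.continuousAt.comp (cu z h1 h2)) ?_ ?_
    · exact ContinuousAt.comp (cu _ (by simpa using neg_lt_neg h2) (by simpa using neg_lt_neg h1))
        continuous_conj.continuousAt
    · filter_upwards [hQn z] with w hw
      rw [hconj]
      simpa using hw
    · filter_upwards [oU.mem_nhds (show z ∈ {ζ : ℂ | -Real.pi < ζ.im ∧ ζ.im < Real.pi} from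
        ⟨h1, h2⟩)] with w hw
      rw [← eu _ ⟨by simpa using neg_lt_neg hw.2, by simpa using neg_lt_neg hw.1⟩,
        hs.symm_left w hw.1 hw.2, eu w hw, map_mul, hconj]
  · refine eq_of_eventually_mul_eq (A := fun z => v' (starRingEnd ℂ z + 2 * Real.pi * I))
      (B := fun z => starRingEnd ℂ (v' z)) (Q := fun z => Q (starRingEnd ℂ z)) ?_
      (continuous_conj.continuousAt.comp (cv z h1 h2)) ?_ ?_
    · exact ContinuousAt.comp (g := v') (f := fun z => starRingEnd ℂ z + 2 * Real.pi * I)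
        (cv _ (by simp; linarith) (by simp; linarith)) (by fun_prop)
    · filter_upwards [hQn z] with w hw
      rw [hconj]
      simpa using hw
    · filter_upwards [oV.mem_nhds (show z ∈ {ζ : ℂ | 0 < ζ.im ∧ ζ.im < 2 * Real.pi} from
        ⟨h1, h2⟩)] with w hw
      rw [← hper (starRingEnd ℂ w), ← ev _ ⟨by simp; linarith [hw.2], by simp; linarith [hw.1]⟩,
        hs.symm_right w hw.1 hw.2, ev w hw, map_mul, hper, hconj]
  · refine eq_of_eventually_mul_eq (A := fun z => u' (z + m))
      (B := fun z => ((c / a : ℝ) : ℂ) * exp ((N - k : ℤ) * z) * u' z) ?_ ?_ (hQn z) ?_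
    · exact ContinuousAt.comp (g := u') (f := fun z => z + (m : ℂ))
        (cu _ (by simpa using h1) (by simpa using h2)) (by fun_prop)
    · exact ContinuousAt.mul (by fun_prop) (cu z h1 h2)
    · filter_upwards [oU.mem_nhds (show z ∈ {ζ : ℂ | -Real.pi < ζ.im ∧ ζ.im < Real.pi} from
        ⟨h1, h2⟩)] with w hw
      exact quasi u u' w (hs.quasi_left w hw.1 hw.2) (eu w hw)
        (eu _ ⟨by simpa using hw.1, by simpa using hw.2⟩)
  · refine eq_of_eventually_mul_eq (A := fun z => v' (z + m))
      (B := fun z => ((c / a : ℝ) : ℂ) * exp ((N - k : ℤ) * z) * v' z) ?_ ?_ (hQn z) ?_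
    · exact ContinuousAt.comp (g := v') (f := fun z => z + (m : ℂ))
        (cv _ (by simpa using h1) (by simpa using h2)) (by fun_prop)
    · exact ContinuousAt.mul (by fun_prop) (cv z h1 h2)
    · filter_upwards [oV.mem_nhds (show z ∈ {ζ : ℂ | 0 < ζ.im ∧ ζ.im < 2 * Real.pi} from
        ⟨h1, h2⟩)] with w hw
      exact quasi v v' w (hs.quasi_right w hw.1 hw.2) (ev w hw)
        (ev _ ⟨by simpa using hw.1, by simpa using hw.2⟩)

theorem left_add_int (hs : IsRealSection m d u v c N) {z : ℂ} (h1 : -Real.pi < z.im)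
    (h2 : z.im < Real.pi) (hc : c ≠ 0) (k : ℤ) : u (z + k * m) = 0 ↔ u z = 0 := by
  have hcC : (c : ℂ) ≠ 0 := by exact_mod_cast hc
  induction k using Int.induction_on with
  | zero => simp
  | succ n ih =>
    have := hs.quasi_left (z + (n : ℤ) * m) (by simpa using h1) (by simpa using h2)
    have e : z + ((n + 1 : ℤ) : ℂ) * m = z + (n : ℤ) * m + m := by push_cast; ring
    refine Iff.trans ?_ ih
    rw [e, this]
    simp [hcC, exp_ne_zero]
  | pred n ih =>
    have := hs.quasi_left (z + (-n - 1 : ℤ) * m) (by simpa using h1) (by simpa using h2)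
    have e : z + ((-n - 1 : ℤ) : ℂ) * m + m = z + (-n : ℤ) * m := by push_cast; ring
    rw [e] at this
    refine Iff.trans ?_ ih
    rw [this]
    simp [hcC, exp_ne_zero]

theorem right_add_int (hs : IsRealSection m d u v c N) {z : ℂ} (h1 : 0 < z.im)
    (h2 : z.im < 2 * Real.pi) (hc : c ≠ 0) (k : ℤ) : v (z + k * m) = 0 ↔ v z = 0 := by
  have hcC : (c : ℂ) ≠ 0 := by exact_mod_cast hc
  induction k using Int.induction_on with
  | zero => simp
  | succ n ih =>
    have := hs.quasi_right (z + (n : ℤ) * m) (by simpa using h1) (by simpa using h2)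
    have e : z + ((n + 1 : ℤ) : ℂ) * m = z + (n : ℤ) * m + m := by push_cast; ring
    refine Iff.trans ?_ ih
    rw [e, this]
    simp [hcC, exp_ne_zero]
  | pred n ih =>
    have := hs.quasi_right (z + (-n - 1 : ℤ) * m) (by simpa using h1) (by simpa using h2)
    have e : z + ((-n - 1 : ℤ) : ℂ) * m + m = z + (-n : ℤ) * m := by push_cast; ring
    rw [e] at this
    refine Iff.trans ?_ ih
    rw [this]
    simp [hcC, exp_ne_zero]

end IsRealSection

/-! ### Factors with prescribed zeros -/

/-- The theta function made periodic along `2πi`. -/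
def eTheta (m : ℝ) (u : ℂ) : ℂ := exp (u / 2) * theta m u

section eTheta

variable {m : ℝ} (hm : 0 < m)

include hm in
theorem differentiable_eTheta : Differentiable ℂ (eTheta m) := by
  have := differentiable_theta hm
  unfold eTheta
  fun_prop

theorem eTheta_add_two_pi_I (u : ℂ) : eTheta m (u + 2 * Real.pi * I) = eTheta m u := by
  have : (u + 2 * Real.pi * I) / 2 = u / 2 + Real.pi * I := by ring
  rw [eTheta, theta_add_two_pi_I, this, exp_add, exp_pi_mul_I, eTheta]
  ring

include hm in
theorem eTheta_add_ofReal (u : ℂ) : eTheta m (u + m) = -exp (u + m) * eTheta m u := by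
  rw [eTheta, theta_add_ofReal hm, eTheta]
  have : exp ((u + m) / 2) * exp (u + m / 2) = exp (u + m) * exp (u / 2) := by
    rw [← exp_add, ← exp_add]; congr 1; ring
  linear_combination (-theta m u) * this

include hm in
theorem eTheta_conj (u : ℂ) : eTheta m (starRingEnd ℂ u) = starRingEnd ℂ (eTheta m u) := by
  rw [eTheta, theta_conj hm, eTheta, map_mul, ← exp_conj, map_div₀, Complex.conj_ofNat]

theorem eTheta_eq_zero_iff (u : ℂ) : eTheta m u = 0 ↔ u ∈ (periods m hm).lattice := by
  rw [eTheta, mul_eq_zero, or_iff_right (exp_ne_zero _), theta_eq_zero_iff hm]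

include hm in
theorem hasDerivAt_eTheta (u : ℂ) :
    HasDerivAt (eTheta m) (exp (u / 2) * (theta m u / 2 + deriv (theta m) u)) u := by
  have := (((hasDerivAt_id' u).div_const 2).cexp).fun_mul (differentiable_theta hm u).hasDerivAt
  exact this.congr_deriv (by ring)

include hm in
theorem deriv_eTheta_ne_zero {u : ℂ} (hu : eTheta m u = 0) : deriv (eTheta m) u ≠ 0 := by
  have h0 : theta m u = 0 := (mul_eq_zero.1 hu).resolve_left (exp_ne_zero _)
  rw [(hasDerivAt_eTheta hm u).deriv, h0, zero_div, zero_add]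
  exact mul_ne_zero (exp_ne_zero _) (theta_simple_zeros hm u h0)

/-- A symmetric entire function with simple zeros at `w` and its mirror images. -/
def zeroFactor (m : ℝ) (w ζ : ℂ) : ℂ :=
  if w.im = 0 ∨ w.im = Real.pi then eTheta m (ζ - w)
  else eTheta m (ζ - w) * eTheta m (ζ - starRingEnd ℂ w)

theorem zeroFactor_self (w : ℂ) : zeroFactor m w w = 0 := by
  have : eTheta m 0 = 0 := by simp [eTheta, theta_zero]
  rw [zeroFactor]
  split_ifs <;> simp [this]

include hm in
theorem differentiable_zeroFactor (w : ℂ) : Differentiable ℂ (zeroFactor m w) := by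
  have := differentiable_eTheta hm
  unfold zeroFactor
  split_ifs
  · exact this.comp (differentiable_id.sub_const w)
  · exact (this.comp (differentiable_id.sub_const w)).mul (this.comp (differentiable_id.sub_const _))

theorem zeroFactor_add_two_pi_I (w z : ℂ) :
    zeroFactor m w (z + 2 * Real.pi * I) = zeroFactor m w z := by
  simp only [zeroFactor, add_sub_right_comm, eTheta_add_two_pi_I]

include hm in
theorem zeroFactor_conj (w z : ℂ) :
    zeroFactor m w (starRingEnd ℂ z) = starRingEnd ℂ (zeroFactor m w z) := by
  have h1 : ∀ w, eTheta m (starRingEnd ℂ z - starRingEnd ℂ w) = starRingEnd ℂ (eTheta m (z - w)) :=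
    fun w => by rw [← eTheta_conj hm, map_sub]
  rw [zeroFactor]
  split_ifs with h
  · rw [zeroFactor, if_pos h, ← h1]
    rcases h with h | h
    · rw [conj_eq_iff_im.2 h]
    · have : starRingEnd ℂ z - starRingEnd ℂ w = (starRingEnd ℂ z - w) + 2 * Real.pi * I := by
        apply Complex.ext <;> simp [h]
        ring
      rw [this, eTheta_add_two_pi_I]
  · rw [zeroFactor, if_neg h, map_mul, ← h1, ← h1, conj_conj, mul_comm]

include hm in
theorem exists_zeroFactor_add_ofReal (w : ℂ) : ∃ a : ℝ, ∃ k : ℤ, a ≠ 0 ∧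
    ∀ z, zeroFactor m w (z + m) = a * exp (k * z) * zeroFactor m w z := by
  have h1 : ∀ w z, eTheta m (z + m - w) = -exp (z - w + m) * eTheta m (z - w) := fun w z => by
    rw [← eTheta_add_ofReal hm]; congr 1; ring
  by_cases h : w.im = 0 ∨ w.im = Real.pi
  · have h2 : ∃ a : ℝ, a ≠ 0 ∧ -exp (-w + m) = a := by
      rcases h with h | h
      · refine ⟨-Real.exp (-w.re + m), neg_ne_zero.2 (Real.exp_pos _).ne', ?_⟩
        have : w = w.re := by apply Complex.ext <;> simp [h]
        rw [this]
        simp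
      · refine ⟨Real.exp (-w.re + m), (Real.exp_pos _).ne', ?_⟩
        have : -w + m = ((-w.re + m : ℝ) : ℂ) - Real.pi * I := by
          apply Complex.ext <;> simp [h]
        rw [this, exp_sub, exp_pi_mul_I, div_neg, neg_neg, div_one, ofReal_exp]
    obtain ⟨a, ha, hae⟩ := h2
    refine ⟨a, 1, ha, fun z => ?_⟩
    simp only [zeroFactor, if_pos h, h1, ← hae]
    have : exp (z - w + m) = exp (-w + m) * exp ((1 : ℤ) * z) := by
      rw [← exp_add]; congr 1; push_cast; ring
    rw [this]
    ring
  · refine ⟨Real.exp (2 * m - 2 * w.re), 2, (Real.exp_pos _).ne', fun z => ?_⟩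
    simp only [zeroFactor, if_neg h, h1]
    have : exp (z - w + m) * exp (z - starRingEnd ℂ w + m) =
        (Real.exp (2 * m - 2 * w.re) : ℂ) * exp ((2 : ℤ) * z) := by
      rw [ofReal_exp, ← exp_add, ← exp_add]
      congr 1
      have := Complex.add_conj w
      push_cast at this ⊢
      linear_combination -this
    rw [← this]
    ring

include hm in
/-- The zeros of `zeroFactor`. -/
theorem exists_of_zeroFactor_eq_zero {w z : ℂ} (hw : w ∈ closedStrip) (hz : zeroFactor m w z = 0) :
    ∃ k l : ℤ, z = w + k * m + l * (2 * Real.pi * I) ∨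
      (0 < w.im ∧ w.im < Real.pi ∧ z = starRingEnd ℂ w + k * m + l * (2 * Real.pi * I)) := by
  by_cases h : w.im = 0 ∨ w.im = Real.pi
  · rw [zeroFactor, if_pos h, eTheta_eq_zero_iff hm, mem_periods_iff hm] at hz
    obtain ⟨k, l, hkl⟩ := hz
    exact ⟨k, l, Or.inl (by linear_combination hkl)⟩
  · rw [zeroFactor, if_neg h, mul_eq_zero, eTheta_eq_zero_iff hm, eTheta_eq_zero_iff hm,
      mem_periods_iff hm, mem_periods_iff hm] at hz
    rcases hz with ⟨k, l, hkl⟩ | ⟨k, l, hkl⟩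
    · exact ⟨k, l, Or.inl (by linear_combination hkl)⟩
    · exact ⟨k, l, Or.inr ⟨lt_of_le_of_ne hw.1 fun h' => h (Or.inl h'.symm),
        lt_of_le_of_ne hw.2 fun h' => h (Or.inr h'), by linear_combination hkl⟩⟩

theorem int_eq_zero_of_mul_two_pi_lt {l : ℤ} (h1 : -(2 * Real.pi) < l * (2 * Real.pi))
    (h2 : l * (2 * Real.pi) < 2 * Real.pi) : l = 0 := by
  have hπ := Real.two_pi_pos
  have h3 : (-1 : ℝ) < l := lt_of_mul_lt_mul_right (by linarith) hπ.le
  have h4 : (l : ℝ) < 1 := lt_of_mul_lt_mul_right (by linarith) hπ.le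
  have h5 : -1 < l := by exact_mod_cast h3
  have h6 : l < 1 := by exact_mod_cast h4
  omega

include hm in
-- For interior `w` the two factors have no common zero because `w - w̄ = 2i Im w` is not a period.
-- On the boundary `w` and `w̄` coincide modulo periods, hence the single factor in `zeroFactor`.
theorem deriv_zeroFactor_ne_zero {w : ℂ} (hw : w ∈ closedStrip) {z : ℂ}
    (hz : zeroFactor m w z = 0) : deriv (zeroFactor m w) z ≠ 0 := by
  have hd : ∀ w, HasDerivAt (fun z => eTheta m (z - w)) (deriv (eTheta m) (z - w)) z := fun w =>
    ((differentiable_eTheta hm (z - w)).hasDerivAt).comp_sub_const z w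
  by_cases h : w.im = 0 ∨ w.im = Real.pi
  · have e : zeroFactor m w = fun z => eTheta m (z - w) := by ext z; rw [zeroFactor, if_pos h]
    rw [e] at hz ⊢
    rw [(hd w).deriv]
    exact deriv_eTheta_ne_zero hm hz
  · have e : zeroFactor m w = fun z => eTheta m (z - w) * eTheta m (z - starRingEnd ℂ w) := by
      ext z; rw [zeroFactor, if_neg h]
    rw [e] at hz ⊢
    rw [((hd w).fun_mul (hd _)).deriv]
    have hnot : ¬ (eTheta m (z - w) = 0 ∧ eTheta m (z - starRingEnd ℂ w) = 0) := by
      rw [eTheta_eq_zero_iff hm, eTheta_eq_zero_iff hm]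
      rintro ⟨h1, h2⟩
      have h3 := Submodule.sub_mem _ h2 h1
      obtain ⟨k, l, hkl⟩ := (mem_periods_iff hm).1 h3
      have him := congrArg Complex.im hkl
      simp at him
      have hw0 : 0 < w.im := lt_of_le_of_ne hw.1 fun h' => h (Or.inl h'.symm)
      have hw1 : w.im < Real.pi := lt_of_le_of_ne hw.2 fun h' => h (Or.inr h')
      have hl := int_eq_zero_of_mul_two_pi_lt (l := l) (by linarith) (by linarith)
      rw [hl] at him
      simp at him
      linarith
    rcases mul_eq_zero.1 hz with h0 | h0
    · rw [h0, zero_mul, add_zero]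
      exact mul_ne_zero (deriv_eTheta_ne_zero hm h0) fun h' => hnot ⟨h0, h'⟩
    · rw [h0, mul_zero, zero_add]
      exact mul_ne_zero (fun h' => hnot ⟨h', h0⟩) (deriv_eTheta_ne_zero hm h0)

end eTheta

namespace IsRealSection

variable {m : ℝ} {d u v : ℂ → ℂ} {c : ℝ} {N : ℤ}

/-- Division of a section by a factor which vanishes at one of its zeros. -/
theorem exists_div_zeroFactor (hm : 0 < m) (hs : IsRealSection m d u v c N) (hc : c ≠ 0)
    (hd : ContinuousOn d strip) {w : ℂ} (hw : w ∈ closedStrip)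
    (hu : w.im < Real.pi → u w = 0) (hv : 0 < w.im → v w = 0) {a : ℝ} {k : ℤ} (ha : a ≠ 0)
    (hak : ∀ z, zeroFactor m w (z + m) = a * exp (k * z) * zeroFactor m w z) :
    ∃ u' v', IsRealSection m d u' v' (c / a) (N - k) ∧
      (∀ z : ℂ, -Real.pi < z.im → z.im < Real.pi → u z = u' z * zeroFactor m w z) ∧
      ∀ z : ℂ, 0 < z.im → z.im < 2 * Real.pi → v z = v' z * zeroFactor m w z := by
  have hπ := Real.pi_pos
  refine hs.exists_div (differentiable_zeroFactor hm w) ha (zeroFactor_conj hm w)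
    (zeroFactor_add_two_pi_I w) hak (fun z => deriv_zeroFactor_ne_zero hm hw) ?_ ?_ hd
  · intro z h1 h2 hz
    obtain ⟨k, l, rfl | ⟨hw0, hw1, rfl⟩⟩ := exists_of_zeroFactor_eq_zero hm hw hz
    · simp at h1 h2
      have hl : l = 0 := int_eq_zero_of_mul_two_pi_lt (by linarith [hw.1, hw.2])
        (by linarith [hw.1, hw.2])
      subst hl
      simp at h1 h2
      simp only [Int.cast_zero, zero_mul, add_zero]
      rw [hs.left_add_int h1 h2 hc]
      exact hu h2
    · simp at h1 h2
      have hl : l = 0 := int_eq_zero_of_mul_two_pi_lt (by linarith) (by linarith)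
      subst hl
      simp only [Int.cast_zero, zero_mul, add_zero]
      rw [hs.left_add_int (by simpa using hw1) (by simp; linarith) hc,
        hs.symm_left w (by linarith) hw1, hu hw1, map_zero]
  · intro z h1 h2 hz
    obtain ⟨k, l, rfl | ⟨hw0, hw1, rfl⟩⟩ := exists_of_zeroFactor_eq_zero hm hw hz
    · simp at h1 h2
      have hl : l = 0 := int_eq_zero_of_mul_two_pi_lt (by linarith [hw.1, hw.2])
        (by linarith [hw.1, hw.2])
      subst hl
      simp at h1 h2
      simp only [Int.cast_zero, zero_mul, add_zero]
      rw [hs.right_add_int h1 h2 hc]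
      exact hv h1
    · simp at h1 h2
      -- Between heights `0` and `2π` the mirror image of `w` is its reflection in the top line, `w̄
      -- + 2πi`.
      have hl : l - 1 = 0 := int_eq_zero_of_mul_two_pi_lt (by push_cast; linarith)
        (by push_cast; linarith)
      have hl : l = 1 := by omega
      subst hl
      have e : starRingEnd ℂ w + k * m + ((1 : ℤ) : ℂ) * (2 * Real.pi * I) =
          (starRingEnd ℂ w + 2 * Real.pi * I) + k * m := by push_cast; ring
      rw [e, hs.right_add_int (by simp; linarith) (by simp; linarith) hc,
        hs.symm_right w hw0 (by linarith), hv hw0, map_zero]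

end IsRealSection

end

/-! ### Zeros, degree and vanishing of real sections. -/

section

theorem exists_add_int_mul_mem {m : ℝ} (hm : 0 < m) (z : ℂ) :
    ∃ k : ℤ, 0 ≤ (z + k * m).re ∧ (z + k * m).re ≤ m := by
  refine ⟨-⌊z.re / m⌋, ?_⟩
  have h1 := Int.floor_le (z.re / m)
  have h2 := (Int.lt_floor_add_one (z.re / m)).le
  rw [le_div_iff₀ hm] at h1
  rw [div_le_iff₀ hm] at h2
  constructor <;> simp <;> linarith

theorem isCompact_fundamental (m : ℝ) :
    IsCompact {z : ℂ | z ∈ closedStrip ∧ 0 ≤ z.re ∧ z.re ≤ m} := by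
  have := (isCompact_Icc (a := (0 : ℝ)) (b := m)).reProdIm (isCompact_Icc (a := 0) (b := Real.pi))
  convert this using 1
  ext z
  simp only [mem_ofPred_eq, closedStrip, mem_reProdIm, mem_Icc]
  tauto

namespace IsRealSection

variable {m : ℝ} {d u v : ℂ → ℂ} {c : ℝ} {N : ℤ}

/-- The zeros of a section in a fundamental domain of the closed strip. -/
def zeroSet (m : ℝ) (u v : ℂ → ℂ) : Set ℂ :=
  {z | (z ∈ closedStrip ∧ 0 ≤ z.re ∧ z.re ≤ m) ∧ (z.im < Real.pi → u z = 0) ∧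
    (0 < z.im → v z = 0)}

section

variable (hs : IsRealSection m d u v c N)
include hs

theorem analyticOnNhd_left : AnalyticOnNhd ℂ u {ζ | -Real.pi < ζ.im ∧ ζ.im < Real.pi} :=
  hs.diff_left.analyticOnNhd (isOpen_im_lt_im _ _)

theorem analyticOnNhd_right : AnalyticOnNhd ℂ v {ζ | 0 < ζ.im ∧ ζ.im < 2 * Real.pi} :=
  hs.diff_right.analyticOnNhd (isOpen_im_lt_im _ _)

theorem left_frequently_ne (hne : ∃ z ∈ strip, u z ≠ 0) {w : ℂ} (h1 : -Real.pi < w.im)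
    (h2 : w.im < Real.pi) : ¬ ∃ᶠ z in 𝓝[≠] w, u z = 0 := by
  intro h
  obtain ⟨z, hz, hz0⟩ := hne
  refine hz0 (hs.analyticOnNhd_left.eqOn_zero_of_preconnected_of_frequently_eq_zero
    (convex_im_lt_im _ _).isPreconnected ⟨h1, h2⟩ h ⟨?_, hz.2⟩)
  linarith [hz.1, Real.pi_pos]

theorem right_frequently_ne (hd0 : ∀ z ∈ strip, d z ≠ 0) (hne : ∃ z ∈ strip, u z ≠ 0) {w : ℂ}
    (h1 : 0 < w.im) (h2 : w.im < 2 * Real.pi) : ¬ ∃ᶠ z in 𝓝[≠] w, v z = 0 := by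
  intro h
  obtain ⟨z, hz, hz0⟩ := hne
  have := hs.analyticOnNhd_right.eqOn_zero_of_preconnected_of_frequently_eq_zero
    (convex_im_lt_im _ _).isPreconnected ⟨h1, h2⟩ h
    (show z ∈ {ζ : ℂ | 0 < ζ.im ∧ ζ.im < 2 * Real.pi} from ⟨hz.1, by linarith [hz.2, Real.pi_pos]⟩)
  rw [hs.eq_mul z hz] at this
  exact mul_ne_zero hz0 (hd0 z hz) this

/-- Otherwise the zeros accumulate in a compact rectangle, and the identity theorem applies to `u`
below the top line or to `v` on it. -/
theorem finite_zeroSet (hd0 : ∀ z ∈ strip, d z ≠ 0) (hne : ∃ z ∈ strip, u z ≠ 0) :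
    (zeroSet m u v).Finite := by
  have hπ := Real.pi_pos
  by_contra hinf
  obtain ⟨x, hx, hacc⟩ := Set.Infinite.exists_accPt_of_subset_isCompact hinf
    (isCompact_fundamental m) fun z hz => hz.1
  rw [accPt_iff_frequently_nhdsNE] at hacc
  rcases hx.1.2.lt_or_eq with hlt | heq
  · refine hs.left_frequently_ne hne (w := x) (by linarith [hx.1.1]) hlt ?_
    have : ∀ᶠ z : ℂ in 𝓝[≠] x, z.im < Real.pi :=
      (continuous_im.continuousAt.eventually_lt continuousAt_const hlt).filter_mono
        nhdsWithin_le_nhds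
    exact (hacc.and_eventually this).mono fun z hz => hz.1.2.1 hz.2
  · have hx0 : 0 < x.im := by rw [heq]; exact hπ
    refine hs.right_frequently_ne hd0 hne hx0 (by rw [heq]; linarith) ?_
    have : ∀ᶠ z : ℂ in 𝓝[≠] x, 0 < z.im :=
      (continuousAt_const.eventually_lt continuous_im.continuousAt hx0).filter_mono
        nhdsWithin_le_nhds
    exact (hacc.and_eventually this).mono fun z hz => hz.1.2.2 hz.2

/-- The multiplier along `m` and the reflections in the two lines carry every zero into the
fundamental rectangle. -/
theorem ne_zero_of_zeroSet_eq_empty (hm : 0 < m) (hc : c ≠ 0) (hd0 : ∀ z ∈ strip, d z ≠ 0)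
    (he : zeroSet m u v = ∅) :
    (∀ z : ℂ, -Real.pi < z.im → z.im < Real.pi → u z ≠ 0) ∧
      ∀ z : ℂ, 0 < z.im → z.im < 2 * Real.pi → v z ≠ 0 := by
  have hπ := Real.pi_pos
  have h1 : ∀ z : ℂ, 0 ≤ z.im → z.im < Real.pi → u z ≠ 0 := by
    intro z h1 h2 h0
    obtain ⟨k, hk1, hk2⟩ := exists_add_int_mul_mem hm z
    have hu : u (z + k * m) = 0 := (hs.left_add_int (by linarith) h2 hc k).2 h0
    refine (he ▸ (⟨⟨⟨by simpa using h1, by simpa using h2.le⟩, hk1, hk2⟩, fun _ => hu, fun h => ?_⟩ :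
      z + k * m ∈ zeroSet m u v) : z + k * m ∈ (∅ : Set ℂ))
    rw [hs.eq_mul _ ⟨h, by simpa using h2⟩, hu, zero_mul]
  have h2 : ∀ z : ℂ, 0 < z.im → z.im ≤ Real.pi → v z ≠ 0 := by
    intro z h2 h3 h0
    rcases h3.lt_or_eq with h3 | h3
    · have := hs.eq_mul z ⟨h2, h3⟩
      rw [h0] at this
      exact mul_ne_zero (h1 z h2.le h3) (hd0 z ⟨h2, h3⟩) this.symm
    obtain ⟨k, hk1, hk2⟩ := exists_add_int_mul_mem hm z
    have hv : v (z + k * m) = 0 := (hs.right_add_int h2 (by linarith) hc k).2 h0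
    refine (he ▸ (⟨⟨⟨by simpa using h2.le, by simpa using h3.le⟩, hk1, hk2⟩, fun h => ?_,
      fun _ => hv⟩ : z + k * m ∈ zeroSet m u v) : z + k * m ∈ (∅ : Set ℂ))
    simp at h
    linarith
  constructor
  · intro z h3 h4 h0
    rcases le_or_gt 0 z.im with h5 | h5
    · exact h1 z h5 h4 h0
    · refine h1 (starRingEnd ℂ z) (by simpa using h5.le) (by simp; linarith) ?_
      rw [hs.symm_left z h3 h4, h0, map_zero]
  · intro z h3 h4 h0
    rcases le_or_gt z.im Real.pi with h5 | h5
    · exact h2 z h3 h5 h0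
    · refine h2 (starRingEnd ℂ z + 2 * Real.pi * I) (by simp; linarith) (by simp; linarith) ?_
      rw [hs.symm_right z h3 h4, h0, map_zero]

end

/-- A nonzero section can be replaced by a section without zeros. -/
theorem exists_nonvanishing (hm : 0 < m) (hd : ContinuousOn d strip) (hd0 : ∀ z ∈ strip, d z ≠ 0)
    (hs : IsRealSection m d u v c N) (hc : c ≠ 0) (hne : ∃ z ∈ strip, u z ≠ 0) :
    ∃ u' v', ∃ c' : ℝ, ∃ N' : ℤ, IsRealSection m d u' v' c' N' ∧ c' ≠ 0 ∧
      (∀ z : ℂ, -Real.pi < z.im → z.im < Real.pi → u' z ≠ 0) ∧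
      ∀ z : ℂ, 0 < z.im → z.im < 2 * Real.pi → v' z ≠ 0 := by
  have hπ := Real.pi_pos
  -- Induction on a finite set containing the zeros. The section is quantified inside, since it
  -- changes with each division.
  suffices key : ∀ T : Finset ℂ, ∀ u v : ℂ → ℂ, ∀ c : ℝ, ∀ N : ℤ, IsRealSection m d u v c N →
      c ≠ 0 → (∃ z ∈ strip, u z ≠ 0) → zeroSet m u v ⊆ T →
      ∃ u' v', ∃ c' : ℝ, ∃ N' : ℤ, IsRealSection m d u' v' c' N' ∧ c' ≠ 0 ∧
        (∀ z : ℂ, -Real.pi < z.im → z.im < Real.pi → u' z ≠ 0) ∧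
        ∀ z : ℂ, 0 < z.im → z.im < 2 * Real.pi → v' z ≠ 0 by
    have hfin := hs.finite_zeroSet hd0 hne
    exact key hfin.toFinset u v c N hs hc hne (by simp)
  intro T
  induction T using Finset.induction_on with
  | empty =>
    intro u v c N hs hc _ hT
    exact ⟨u, v, c, N, hs, hc, hs.ne_zero_of_zeroSet_eq_empty hm hc hd0
      (subset_empty_iff.1 (by simpa using hT))⟩
  | insert w T hwT ih =>
    -- An inner induction on the order of vanishing at `w`: each division by `zeroFactor` lowers it,
    -- and at order zero `w` leaves the set. The order is taken of `v` on the top line, where `u`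
    -- need not be holomorphic.
    have inner : ∀ n : ℕ, ∀ u v : ℂ → ℂ, ∀ c : ℝ, ∀ N : ℤ, IsRealSection m d u v c N →
        c ≠ 0 → (∃ z ∈ strip, u z ≠ 0) → zeroSet m u v ⊆ (insert w T : Finset ℂ) →
        (if w.im < Real.pi then analyticOrderAt u w else analyticOrderAt v w) ≤ (n : ℕ∞) →
        ∃ u' v', ∃ c' : ℝ, ∃ N' : ℤ, IsRealSection m d u' v' c' N' ∧ c' ≠ 0 ∧
          (∀ z : ℂ, -Real.pi < z.im → z.im < Real.pi → u' z ≠ 0) ∧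
          ∀ z : ℂ, 0 < z.im → z.im < 2 * Real.pi → v' z ≠ 0 := by
      intro n
      induction n with
      | zero =>
        intro u v c N hs hc hne hT hord
        refine ih u v c N hs hc hne fun z hz => ?_
        rcases Finset.mem_insert.1 (hT hz) with rfl | h
        · exfalso
          have h0 := hz.1.1.1
          have h1 := hz.1.1.2
          split_ifs at hord with h
          · have := analyticOrderAt_eq_zero.1 (nonpos_iff_eq_zero.1 hord)
            exact this.elim (fun h' => h' (hs.analyticOnNhd_left z ⟨by linarith, h⟩))
              fun h' => h' (hz.2.1 h)
          · have := analyticOrderAt_eq_zero.1 (nonpos_iff_eq_zero.1 hord)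
            exact this.elim (fun h' => h' (hs.analyticOnNhd_right z ⟨by linarith, by linarith⟩))
              fun h' => h' (hz.2.2 (by linarith))
        · exact h
      | succ n ihn =>
        intro u v c N hs hc hne hT hord
        by_cases hw : w ∈ zeroSet m u v
        · obtain ⟨a, k, ha, hak⟩ := exists_zeroFactor_add_ofReal hm w
          obtain ⟨u', v', hs', hu', hv'⟩ := hs.exists_div_zeroFactor hm hc hd hw.1.1 hw.2.1 hw.2.2
            ha hak
          have h0 := hw.1.1.1
          have h1 := hw.1.1.2
          have hQ := (differentiable_zeroFactor hm w).analyticAt w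
          have hQ1 : 1 ≤ analyticOrderAt (zeroFactor m w) w := by
            rw [Order.one_le_iff_ne_zero]
            intro h
            exact (analyticOrderAt_eq_zero.1 h).elim (fun h => h hQ) fun h => h (zeroFactor_self w)
          have order : ∀ f f' : ℂ → ℂ, AnalyticAt ℂ f' w →
              (f =ᶠ[𝓝 w] f' * zeroFactor m w) → analyticOrderAt f w ≤ ((n + 1 : ℕ) : ℕ∞) →
              analyticOrderAt f' w ≤ (n : ℕ∞) := by
            intro f f' hf' hff hle
            rw [analyticOrderAt_congr hff, analyticOrderAt_mul hf' hQ] at hle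
            have h2 : analyticOrderAt f' w + 1 ≤ (n : ℕ∞) + 1 :=
              (add_le_add_right hQ1 _).trans (by exact_mod_cast hle)
            exact (ENat.add_le_add_iff_right ENat.one_ne_top).1 h2
          refine ihn u' v' (c / a) (N - k) hs' (div_ne_zero hc ha) ?_ ?_ ?_
          · obtain ⟨z, hz, hz0⟩ := hne
            refine ⟨z, hz, fun h => hz0 ?_⟩
            rw [hu' z (by linarith [hz.1]) hz.2, h, zero_mul]
          · refine fun z hz => hT ⟨hz.1, fun h => ?_, fun h => ?_⟩
            · rw [hu' z (by linarith [hz.1.1.1]) h, hz.2.1 h, zero_mul]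
            · rw [hv' z h (by linarith [hz.1.1.2]), hz.2.2 h, zero_mul]
          · split_ifs at hord ⊢ with h
            · refine order u u' (hs'.analyticOnNhd_left w ⟨by linarith, h⟩) ?_ hord
              filter_upwards [(isOpen_im_lt_im (-Real.pi) Real.pi).mem_nhds
                (show w ∈ {ζ : ℂ | -Real.pi < ζ.im ∧ ζ.im < Real.pi} from ⟨by linarith, h⟩)]
                with z hz
              exact hu' z hz.1 hz.2
            · refine order v v' (hs'.analyticOnNhd_right w ⟨by linarith, by linarith⟩) ?_ hord
              filter_upwards [(isOpen_im_lt_im 0 (2 * Real.pi)).mem_nhds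
                (show w ∈ {ζ : ℂ | 0 < ζ.im ∧ ζ.im < 2 * Real.pi} from ⟨by linarith, by linarith⟩)]
                with z hz
              exact hv' z hz.1 hz.2
        · refine ih u v c N hs hc hne fun z hz => ?_
          rcases Finset.mem_insert.1 (hT hz) with rfl | h
          · exact absurd hz hw
          · exact h
    intro u v c N hs hc hne hT
    by_cases hw : w ∈ zeroSet m u v
    · have hfin : (if w.im < Real.pi then analyticOrderAt u w else analyticOrderAt v w) ≠ ⊤ := by
        have h0 := hw.1.1.1
        have h1 := hw.1.1.2
        split_ifs with h
        · intro htop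
          rw [analyticOrderAt_eq_top] at htop
          exact hs.left_frequently_ne hne (by linarith) h
            (htop.filter_mono nhdsWithin_le_nhds).frequently
        · intro htop
          rw [analyticOrderAt_eq_top] at htop
          exact hs.right_frequently_ne hd0 hne (w := w) (by linarith) (by linarith)
            (htop.filter_mono nhdsWithin_le_nhds).frequently
      obtain ⟨n, hn⟩ := ENat.ne_top_iff_exists.1 hfin
      exact inner n u v c N hs hc hne hT hn.ge
    · refine ih u v c N hs hc hne fun z hz => ?_
      rcases Finset.mem_insert.1 (hT hz) with rfl | h
      · exact absurd hz hw
      · exact h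

/-- The degree of a section without zeros vanishes if `d` has a periodic logarithm. -/
theorem degree_eq_zero (hs : IsRealSection m d u v c N) {M : ℂ → ℂ}
    (hMc : ContinuousOn M strip) (hM : ∀ z ∈ strip, exp (M z) = d z)
    (hMper : ∀ z ∈ strip, M (z + m) = M z)
    (hu : ∀ z : ℂ, -Real.pi < z.im → z.im < Real.pi → u z ≠ 0)
    (hv : ∀ z : ℂ, 0 < z.im → z.im < 2 * Real.pi → v z ≠ 0) : 0 < c ∧ N = 0 := by
  have hπ := Real.pi_pos
  have pU := convex_im_lt_im (-Real.pi) Real.pi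
  have pV := convex_im_lt_im 0 (2 * Real.pi)
  have hline : ∀ y : ℝ, IsPreconnected {z : ℂ | z.im = y} := fun y => by
    have : Convex ℝ {z : ℂ | z.im = y} := by
      have := (convex_halfSpace_im_ge y).inter (convex_halfSpace_im_le y)
      convert this using 1
      ext z
      simp only [mem_ofPred_eq, mem_inter_iff]
      exact ⟨fun h => ⟨h.ge, h.le⟩, fun h => le_antisymm h.2 h.1⟩
    exact this.isPreconnected
  obtain ⟨L, hLc, hL⟩ := exists_log_of_convex (isOpen_im_lt_im (-Real.pi) Real.pi) pU
    ⟨0, by simp [hπ]⟩ hs.diff_left.continuousOn fun z hz => hu z hz.1 hz.2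
  obtain ⟨P, hPc, hP⟩ := exists_log_of_convex (isOpen_im_lt_im 0 (2 * Real.pi)) pV
    ⟨Real.pi * I, by simp [hπ]⟩ hs.diff_right.continuousOn fun z hz => hv z hz.1 hz.2
  -- On the real axis `u` is real and nonzero, so the argument of `u` is constant. Hence `c`, the
  -- ratio of `u m` and `u 0`, is the exponential of a real number.
  have im0 : (L m).im = (L 0).im := by
    refine im_eq_of_exp_im_eq_zero (hline 0) (hLc.mono fun z hz => ?_) (fun z hz => ?_) (by simp)
      (by simp)
    · have hz : z.im = 0 := hz
      simp [hz, hπ]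
    · have hz : z.im = 0 := hz
      have hz' : -Real.pi < z.im ∧ z.im < Real.pi := by simp [hz, hπ]
      rw [hL z hz', ← conj_eq_iff_im, ← hs.symm_left z hz'.1 hz'.2, conj_eq_iff_im.2 hz]
  have hm0 : u m = c * u 0 := by
    have := hs.quasi_left 0 (by simp [hπ]) (by simp [hπ])
    simpa using this
  have hexp : exp (L m - L 0) = c := by
    rw [exp_sub, hL m (by simp [hπ]), hL 0 (by simp [hπ]), hm0,
      mul_div_cancel_right₀ _ (hu 0 (by simp [hπ]) (by simp [hπ]))]
  have hreal : L m - L 0 = ((L m - L 0).re : ℂ) := by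
    apply Complex.ext <;> simp [im0]
  have hcexp : Real.exp (L m - L 0).re = c := by
    rw [hreal, ← ofReal_exp] at hexp
    exact_mod_cast hexp
  refine ⟨hcexp ▸ Real.exp_pos _, ?_⟩
  have hcC : (c : ℂ) ≠ 0 := by rw [← hexp]; exact exp_ne_zero _
  have hI : I ∈ strip := by simp [strip, Real.pi_gt_three.trans' (by norm_num : (1 : ℝ) < 3)]
  have sU : ∀ z ∈ strip, z ∈ {ζ : ℂ | -Real.pi < ζ.im ∧ ζ.im < Real.pi} := fun z hz =>
    ⟨by linarith [hz.1], hz.2⟩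
  have sV : ∀ z ∈ strip, z ∈ {ζ : ℂ | 0 < ζ.im ∧ ζ.im < 2 * Real.pi} := fun z hz =>
    ⟨hz.1, by linarith [hz.2]⟩
  -- The logarithmic form of the multiplier; the integer ambiguity is fixed at `z = 0`.
  have eL : ∀ z ∈ {ζ : ℂ | -Real.pi < ζ.im ∧ ζ.im < Real.pi},
      L (z + m) - L z - (L m - L 0) - N * z = 0 := by
    intro z hz
    have := eq_of_exp_eq_one pU.isPreconnected
      (g := fun z => L (z + m) - L z - (L m - L 0) - N * z) ?_ ?_ hz (y := 0) (by simp [hπ])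
    · rw [this]
      simp
    · exact (((hLc.comp (by fun_prop) fun z hz => by simpa using hz).sub hLc).sub
        continuousOn_const).sub (by fun_prop)
    · intro z hz
      rw [exp_sub, exp_sub, exp_sub, hexp, hL z hz, hL (z + m) (by simpa using hz),
        hs.quasi_left z hz.1 hz.2]
      have := hu z hz.1 hz.2
      have := exp_ne_zero (N * z)
      field_simp
  -- The relation `v = u d` on logarithms. As `M` is periodic, `P` has the same increment along `m`
  -- as `L`.
  have eM : ∀ z ∈ strip, P z - L z - M z = P I - L I - M I := fun z hz => by
    refine eq_of_exp_eq_one (convex_im_lt_im 0 Real.pi).isPreconnected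
      (g := fun z => P z - L z - M z) ?_ ?_ hz hI
    · exact ((hPc.mono sV).sub (hLc.mono sU)).sub hMc
    · intro z hz
      rw [exp_sub, exp_sub, hP z (sV z hz), hL z (sU z hz), hM z hz, hs.eq_mul z hz]
      have h1 := hu z (sU z hz).1 (sU z hz).2
      have h2 : d z ≠ 0 := by rw [← hM z hz]; exact exp_ne_zero _
      field_simp
  have eP : ∀ z ∈ {ζ : ℂ | 0 < ζ.im ∧ ζ.im < 2 * Real.pi},
      P (z + m) - P z - (L m - L 0) - N * z = 0 := by
    intro z hz
    have := eq_of_exp_eq_one pV.isPreconnected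
      (g := fun z => P (z + m) - P z - (L m - L 0) - N * z) ?_ ?_ hz (sV I hI)
    · rw [this]
      have h1 := eM (I + m) (add_ofReal_mem_strip.2 hI)
      have h2 := eL I (sU I hI)
      have h3 := hMper I hI
      linear_combination h1 + h2 + h3
    · exact (((hPc.comp (by fun_prop) fun z hz => by simpa using hz).sub hPc).sub
        continuousOn_const).sub (by fun_prop)
    · intro z hz
      rw [exp_sub, exp_sub, exp_sub, hexp, hP z hz, hP (z + m) (by simpa using hz),
        hs.quasi_right z hz.1 hz.2]
      have := hv z hz.1 hz.2
      have := exp_ne_zero (N * z)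
      field_simp
  have im1 : (P (Real.pi * I + m)).im = (P (Real.pi * I)).im := by
    refine im_eq_of_exp_im_eq_zero (hline Real.pi) (hPc.mono fun z hz => ?_) (fun z hz => ?_)
      (by simp) (by simp)
    · have hz : z.im = Real.pi := hz
      simp [hz, hπ]
    · have hz : z.im = Real.pi := hz
      have hz' : 0 < z.im ∧ z.im < 2 * Real.pi := by simp [hz, hπ]
      have e : starRingEnd ℂ z + 2 * Real.pi * I = z := by
        apply Complex.ext <;> simp [hz]
        ring
      rw [hP z hz', ← conj_eq_iff_im, ← hs.symm_right z hz'.1 hz'.2, e]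
  -- On the top line `v` is real and nonzero, so this increment has no imaginary part at `πi`. The
  -- formula gives it the imaginary part `N π`.
  have h1 := congrArg Complex.im (eP (Real.pi * I) (by simp [hπ]))
  simp [im0, im1] at h1
  exact h1

/-- A section of degree zero with negative multiplier vanishes. -/
theorem eq_zero_of_neg (hm : 0 < m) (hs : IsRealSection m (fun _ => 1) u v c 0) (hc : c < 0)
    {z : ℂ} (hz : z ∈ strip) : u z = 0 := by
  have hπ := Real.pi_pos
  -- Chosen so that `exp (-β z)` turns the multiplier `c` into `-1`; negativity of `c` makes `β`
  -- real, so the symmetry is kept.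
  set β : ℝ := Real.log (-c) / m with hβ
  have hexp : exp (β * m) = -c := by
    have h1 : β * m = Real.log (-c) := div_mul_cancel₀ _ hm.ne'
    have h2 : (β : ℂ) * m = ((Real.log (-c) : ℝ) : ℂ) := by rw [← h1]; push_cast; rfl
    rw [h2, ← ofReal_exp, Real.exp_log (by linarith)]
    push_cast; rfl
  -- With `d = 1` the functions `u` and `v` agree on the strip and glue to one holomorphic function
  -- on `-π < Im z < 2π`.
  set f : ℂ → ℂ := fun z => (if z.im < Real.pi then u z else v z) * exp (-β * z) with hf
  have huv : ∀ z ∈ strip, v z = u z := fun z hz => by rw [hs.eq_mul z hz, mul_one]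
  have hfv : ∀ z : ℂ, 0 < z.im → f z = v z * exp (-β * z) := fun z h => by
    simp only [hf]
    split_ifs with h'
    · rw [huv z ⟨h, h'⟩]
    · rfl
  have hfu : ∀ z : ℂ, z.im < Real.pi → f z = u z * exp (-β * z) := fun z h => by
    simp only [hf, if_pos h]
  set U : Set ℂ := {ζ | -Real.pi < ζ.im ∧ ζ.im < 2 * Real.pi} with hU
  have oU : IsOpen U := isOpen_im_lt_im _ _
  have hd : DifferentiableOn ℂ f U := by
    intro w hw
    refine DifferentiableAt.differentiableWithinAt ?_
    by_cases h : w.im < Real.pi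
    · have h1 : DifferentiableAt ℂ (fun z => u z * exp (-β * z)) w :=
        (hs.diff_left.differentiableAt ((isOpen_im_lt_im _ _).mem_nhds ⟨hw.1, h⟩)).mul
          (by fun_prop)
      refine h1.congr_of_eventuallyEq ?_
      filter_upwards [continuous_im.continuousAt.eventually_lt continuousAt_const h] with z hz
      exact hfu z hz
    · have h0 : 0 < w.im := by linarith [not_lt.1 h]
      have h1 : DifferentiableAt ℂ (fun z => v z * exp (-β * z)) w :=
        (hs.diff_right.differentiableAt ((isOpen_im_lt_im _ _).mem_nhds ⟨h0, hw.2⟩)).mul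
          (by fun_prop)
      refine h1.congr_of_eventuallyEq ?_
      filter_upwards [continuousAt_const.eventually_lt continuous_im.continuousAt h0] with z hz
      exact hfv z hz
  have hnexp : ∀ z w : ℂ, z.re = w.re → ‖exp (-β * z)‖ = ‖exp (-β * w)‖ := fun z w h => by
    rw [norm_exp, norm_exp]
    simp [h]
  have anti : ∀ z ∈ U, f (z + m) = -f z := by
    intro z hz
    have he : exp (-β * (z + m)) * c = -exp (-β * z) := by
      have : -(β : ℂ) * (z + m) = -β * z - β * m := by ring
      have hcC : (c : ℂ) ≠ 0 := by exact_mod_cast hc.ne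
      rw [this, exp_sub, hexp]
      field_simp
    rcases lt_or_ge z.im Real.pi with h | h
    · rw [hfu z h, hfu _ (by simpa using h), hs.quasi_left z hz.1 h]
      simp only [Int.cast_zero, zero_mul, exp_zero, mul_one]
      linear_combination u z * he
    · have h0 : 0 < z.im := by linarith
      rw [hfv z h0, hfv _ (by simpa using h0), hs.quasi_right z h0 hz.2]
      simp only [Int.cast_zero, zero_mul, exp_zero, mul_one]
      linear_combination v z * he
  have hrefl : ∀ z ∈ U, ∃ w ∈ closedStrip, ‖f w‖ = ‖f z‖ := by
    intro z hz
    rcases lt_or_ge z.im 0 with h | h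
    · refine ⟨starRingEnd ℂ z, ⟨by simpa using h.le, by simp; linarith [hz.1]⟩, ?_⟩
      rw [hfu _ (by simp; linarith [hz.1]), hfu z (by linarith), hs.symm_left z hz.1 (by linarith),
        norm_mul, norm_mul, RCLike.norm_conj, hnexp (starRingEnd ℂ z) z (by simp)]
    rcases le_or_gt z.im Real.pi with h' | h'
    · exact ⟨z, ⟨h, h'⟩, rfl⟩
    · refine ⟨starRingEnd ℂ z + 2 * Real.pi * I, ⟨by simp; linarith [hz.2], by simp; linarith⟩, ?_⟩
      rw [hfv _ (by simp; linarith [hz.2]), hfv z (by linarith),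
        hs.symm_right z (by linarith) hz.2, norm_mul, norm_mul, RCLike.norm_conj,
        hnexp (starRingEnd ℂ z + 2 * Real.pi * I) z (by simp)]
  have hcs : closedStrip ⊆ U := fun z hz => ⟨by linarith [hz.1], by linarith [hz.2]⟩
  have hshift : ∀ z ∈ closedStrip, ∀ k : ℤ, ‖f (z + k * m)‖ = ‖f z‖ := by
    intro z hz k
    have hmem : ∀ k : ℤ, z + k * m ∈ U := fun k => by
      have := hcs hz
      simpa [hU] using this
    induction k using Int.induction_on with
    | zero => simp
    | succ n ih =>
      have e : z + ((n + 1 : ℤ) : ℂ) * m = z + (n : ℤ) * m + m := by push_cast; ring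
      rw [e, anti _ (hmem n), norm_neg, ih]
    | pred n ih =>
      have e : z + ((-n - 1 : ℤ) : ℂ) * m + m = z + (-n : ℤ) * m := by push_cast; ring
      rw [← ih, ← e, anti _ (hmem _), norm_neg]
  obtain ⟨z₀, hz₀, hmax⟩ := (isCompact_fundamental m).exists_isMaxOn
    ⟨0, by simp [closedStrip, hπ.le, hm.le]⟩
    ((hd.continuousOn.mono hcs).norm.mono fun z hz => hz.1)
  -- Reflection and translation preserve `‖f‖` and move every point into the compact rectangle. The
  -- maximum is thus attained in the open set `U`, so `f` is constant, and being antiperiodic it is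
  -- zero.
  have hmaxU : IsMaxOn (norm ∘ f) U z₀ := by
    intro z hz
    obtain ⟨w, hw, hwz⟩ := hrefl z hz
    obtain ⟨k, hk1, hk2⟩ := exists_add_int_mul_mem hm w
    have := hmax (show w + k * m ∈ _ from
      ⟨⟨by simpa using hw.1, by simpa using hw.2⟩, hk1, hk2⟩)
    simp only [mem_ofPred_eq, Function.comp_apply] at this ⊢
    rw [← hwz, ← hshift w hw k]
    exact this
  have hconst := Complex.eqOn_of_isPreconnected_of_isMaxOn_norm
    (convex_im_lt_im (-Real.pi) (2 * Real.pi)).isPreconnected oU hd (hcs hz₀.1) hmaxU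
  have hzU : z ∈ U := hcs ⟨hz.1.le, hz.2.le⟩
  have h1 := hconst hzU
  have h2 := hconst (show z + m ∈ U by simpa [hU] using hzU)
  rw [anti z hzU] at h2
  have h3 : f z = 0 := by
    have : -f z = f z := h2.trans h1.symm
    exact self_eq_neg.1 this.symm
  rw [hfu z hz.2] at h3
  exact (mul_eq_zero.1 h3).resolve_right (exp_ne_zero _)

end IsRealSection

end

section

/-! ### Solutions of the boundary value problem as sections -/

theorem zeroFactor_add_ofReal {m : ℝ} (hm : 0 < m) {w : ℂ} (hw : w ∈ strip) (z : ℂ) :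
    zeroFactor m w (z + m) =
      (Real.exp (2 * m - 2 * w.re) : ℂ) * exp ((2 : ℤ) * z) * zeroFactor m w z := by
  have h : ¬ (w.im = 0 ∨ w.im = Real.pi) := by
    rintro (h | h)
    · exact hw.1.ne' h
    · exact hw.2.ne h
  have h1 : ∀ w, eTheta m (z + m - w) = -exp (z - w + m) * eTheta m (z - w) := fun w => by
    rw [← eTheta_add_ofReal hm]; congr 1; ring
  simp only [zeroFactor, if_neg h, h1]
  have : exp (z - w + m) * exp (z - starRingEnd ℂ w + m) =
      (Real.exp (2 * m - 2 * w.re) : ℂ) * exp ((2 : ℤ) * z) := by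
    rw [ofReal_exp, ← exp_add, ← exp_add]
    congr 1
    have := Complex.add_conj w
    push_cast at this ⊢
    linear_combination -this
  rw [← this]
  ring

/-- An extension across a thin neighbourhood of the axis suffices: the function is `h` above, its
mirror image below, and `H` shows that the two fit together holomorphically. -/
theorem exists_glue {b δ : ℝ} {h H : ℂ → ℂ} (hδ : 0 < δ)
    (hh : DifferentiableOn ℂ h {ζ | 0 < ζ.im ∧ ζ.im < b})
    (hH : DifferentiableOn ℂ H {ζ | -δ < ζ.im ∧ ζ.im < δ})
    (hHh : ∀ ζ : ℂ, 0 < ζ.im → ζ.im < δ → H ζ = h ζ)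
    (hsymm : ∀ ζ : ℂ, -δ < ζ.im → ζ.im < δ → H (starRingEnd ℂ ζ) = starRingEnd ℂ (H ζ)) :
    ∃ u, DifferentiableOn ℂ u {ζ | -b < ζ.im ∧ ζ.im < b} ∧
      (∀ ζ : ℂ, 0 < ζ.im → ζ.im < b → u ζ = h ζ) ∧
      ∀ ζ : ℂ, -b < ζ.im → ζ.im < b → u (starRingEnd ℂ ζ) = starRingEnd ℂ (u ζ) := by
  set u : ℂ → ℂ := fun ζ =>
    if 0 < ζ.im then h ζ else if ζ.im < 0 then starRingEnd ℂ (h (starRingEnd ℂ ζ)) else H ζ with hu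
  have u1 : ∀ ζ : ℂ, 0 < ζ.im → u ζ = h ζ := fun ζ hζ => by simp only [hu, if_pos hζ]
  have u2 : ∀ ζ : ℂ, ζ.im < 0 → u ζ = starRingEnd ℂ (h (starRingEnd ℂ ζ)) := fun ζ hζ => by
    simp only [hu, if_neg (not_lt.2 hζ.le), if_pos hζ]
  have u3 : ∀ ζ : ℂ, -δ < ζ.im → ζ.im < δ → u ζ = H ζ := fun ζ h1 h2 => by
    rcases lt_trichotomy ζ.im 0 with h3 | h3 | h3
    · rw [u2 ζ h3, ← hHh _ (by simpa using h3) (by simp; linarith), hsymm ζ h1 h2, conj_conj]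
    · simp [hu, h3]
    · rw [u1 ζ h3, hHh ζ h3 h2]
  refine ⟨u, fun ζ hζ => DifferentiableAt.differentiableWithinAt ?_, fun ζ h1 _ => u1 ζ h1,
    fun ζ h1 h2 => ?_⟩
  · rcases lt_trichotomy ζ.im 0 with h3 | h3 | h3
    · have h4 : DifferentiableAt ℂ (starRingEnd ℂ ∘ h ∘ starRingEnd ℂ) ζ := by
        have := hh.differentiableAt ((isOpen_im_lt_im 0 b).mem_nhds
          (show starRingEnd ℂ ζ ∈ {ζ : ℂ | 0 < ζ.im ∧ ζ.im < b} from
            ⟨by simpa using h3, by simp; linarith [hζ.1]⟩))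
        have := this.conj_conj
        simpa using this
      refine h4.congr_of_eventuallyEq ?_
      filter_upwards [continuous_im.continuousAt.eventually_lt continuousAt_const h3] with w hw
      exact u2 w hw
    · have h4 := hH.differentiableAt ((isOpen_im_lt_im (-δ) δ).mem_nhds
        (show ζ ∈ {ζ : ℂ | -δ < ζ.im ∧ ζ.im < δ} by simp [h3, hδ]))
      refine h4.congr_of_eventuallyEq ?_
      filter_upwards [(isOpen_im_lt_im (-δ) δ).mem_nhds
        (show ζ ∈ {ζ : ℂ | -δ < ζ.im ∧ ζ.im < δ} by simp [h3, hδ])] with w hw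
      exact u3 w hw.1 hw.2
    · have h4 := hh.differentiableAt ((isOpen_im_lt_im 0 b).mem_nhds ⟨h3, hζ.2⟩)
      refine h4.congr_of_eventuallyEq ?_
      filter_upwards [continuousAt_const.eventually_lt continuous_im.continuousAt h3] with w hw
      exact u1 w hw
  · rcases lt_trichotomy ζ.im 0 with h3 | h3 | h3
    · rw [u1 _ (by simpa using h3), u2 ζ h3, conj_conj]
    · have h4 : -δ < ζ.im := by rw [h3]; linarith
      have h5 : ζ.im < δ := by rw [h3]; exact hδ
      rw [u3 _ (by simp; linarith) (by simp; linarith), u3 ζ h4 h5, hsymm ζ h4 h5]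
    · rw [u2 _ (by simpa using h3), u1 ζ h3, conj_conj]

variable {m : ℝ} {φ : ℂ → ℂ} {Ω : Set ℂ}

/-- Boundary convergence in the domain implies uniform convergence in the straight cylinder. -/
theorem IsUniformization.tendsto_comp (hφ : IsUniformization m φ Ω) {l : Filter ℝ}
    (hl : ∀ᶠ y in l, 0 < y ∧ y < Real.pi) {u : ℂ → ℝ}
    (hper : ∀ᶠ y in l, ∀ ζ : ℂ, ζ.im = y → u (φ ζ + 2) = u (φ ζ))
    (hb : ∀ p, MapClusterPt p (comap im l) φ → Tendsto u (𝓝[Ω] p) (𝓝 0)) :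
    Tendsto (fun ζ => u (φ ζ)) (comap im l) (𝓝 0) := by
  by_contra hnot
  rw [Metric.tendsto_nhds] at hnot
  push Not at hnot
  obtain ⟨ε, hε, hfreq⟩ := hnot
  obtain ⟨R, hR⟩ := hφ.bounded
  -- The bad points, translated into a bounded region. The period is `2` and not `1` because
  -- antiperiodic functions live on the double cover.
  set B : Set ℂ := {ζ | ζ ∈ strip ∧ ε ≤ |u (φ ζ)| ∧ 0 ≤ (φ ζ).re ∧ (φ ζ).re ≤ 2} with hB
  have hfB : ∃ᶠ ζ in comap im l, ζ ∈ B := by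
    rw [frequently_comap] at hfreq ⊢
    refine (hfreq.and_eventually (hl.and hper)).mono ?_
    rintro y ⟨⟨ζ, rfl, hζ⟩, hy, hp⟩
    have hζs : ζ ∈ strip := hy
    obtain ⟨k, hk1, hk2⟩ := exists_add_int_mul_mem (m := 2) two_pos (φ ζ)
    have hmem : ∀ k : ℤ, ζ + k * m ∈ strip := fun k => by
      have := (add_ofReal_mem_strip (z := ζ) (x := k * m)).2 hζs
      push_cast at this
      exact this
    have hφk : ∀ k : ℤ, φ (ζ + (2 * k : ℤ) * m) = φ ζ + k * (2 : ℝ) := fun k => by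
      rw [hφ.map_add_int hζs]; push_cast; ring
    have hstep : ∀ k : ℤ, u (φ ζ + (k + 1 : ℤ) * (2 : ℝ)) = u (φ ζ + k * (2 : ℝ)) := fun k => by
      have := hp (ζ + (2 * k : ℤ) * m) (by simp)
      rw [hφk] at this
      rw [← this]
      congr 1
      push_cast
      ring
    have huk : ∀ k : ℤ, u (φ ζ + k * (2 : ℝ)) = u (φ ζ) := fun k => by
      induction k using Int.induction_on with
      | zero => simp
      | succ n ih => rw [hstep, ih]
      | pred n ih =>
        have := hstep (-n - 1)
        rw [sub_add_cancel] at this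
        rw [← this, ih]
    refine ⟨ζ + (2 * k : ℤ) * m, by simp, hmem _, ?_, ?_, ?_⟩
    · rw [hφk, huk]
      simpa [Real.dist_eq] using hζ
    · rw [hφk]; exact hk1
    · rw [hφk]; exact hk2
  have hne : NeBot (comap im l ⊓ 𝓟 B) := by
    rwa [← frequently_mem_iff_neBot]
  have hK : IsCompact (Icc (0 : ℝ) 2 ×ℂ Icc (-R) R) := isCompact_Icc.reProdIm isCompact_Icc
  -- Boundedness of the domain provides a limit of the images of bad points. It lies on the boundary
  -- component, where `u` tends to zero.
  obtain ⟨p, -, hp⟩ := hK.exists_mapClusterPt (f := comap im l ⊓ 𝓟 B) (u := φ) (by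
    rw [le_principal_iff]
    have : ∀ᶠ ζ in comap im l ⊓ 𝓟 B, ζ ∈ B := mem_inf_of_right (mem_principal_self B)
    refine this.mono fun ζ hζ => ?_
    exact ⟨hζ.2.2, abs_le.1 (hR _ (hφ.mem hζ.1))⟩)
  have h1 := hb p (hp.mono inf_le_left)
  have h2 := (Metric.tendsto_nhds.1 h1) ε hε
  rw [eventually_nhdsWithin_iff] at h2
  have h3 := hp.frequently h2
  have h4 : ∀ᶠ ζ in comap im l ⊓ 𝓟 B, ζ ∈ B := mem_inf_of_right (mem_principal_self B)
  obtain ⟨ζ, h5, h6⟩ := (h3.and_eventually h4).exists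
  have h7 := h5 (hφ.mem h6.1)
  rw [Real.dist_eq, sub_zero] at h7
  exact absurd h6.2.1 (not_le.2 h7)

theorem not_samePoint_of_im_ne {z w : ℂ} (h : z.im ≠ w.im) : ¬ SamePoint m z w := by
  rintro ⟨l, rfl⟩
  simp at h

theorem isClosed_samePoint (hm : m ≠ 0) (w : ℂ) : IsClosed {z | SamePoint m z w} := by
  have h1 : {z | SamePoint m z w} =
      {z : ℂ | z.im = w.im} ∩ (fun z : ℂ => (z - w).re / m) ⁻¹' range ((↑) : ℤ → ℝ) := by
    ext z
    constructor
    · rintro ⟨l, rfl⟩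
      refine ⟨by simp, l, ?_⟩
      simp [hm]
    · rintro ⟨h1, l, hl⟩
      have h1 : z.im = w.im := h1
      have hl : (l : ℝ) = (z - w).re / m := hl
      refine ⟨l, ?_⟩
      rw [eq_div_iff hm] at hl
      apply Complex.ext
      · simp at hl ⊢; linarith
      · simp [h1]
  rw [h1]
  exact (isClosed_eq continuous_im continuous_const).inter
    (Int.isClosedEmbedding_coe_real.isClosed_range.preimage (by fun_prop))

theorem zeroFactor_eq_zero_of_samePoint (hm : 0 < m) {z w : ℂ} (h : SamePoint m z w) :
    zeroFactor m w z = 0 := by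
  obtain ⟨l, rfl⟩ := h
  have : eTheta m (w + l * m - w) = 0 := by
    rw [eTheta_eq_zero_iff hm, mem_periods_iff hm]
    exact ⟨l, 0, by push_cast; ring⟩
  rw [zeroFactor]
  split_ifs
  · exact this
  · rw [this, zero_mul]

theorem eventually_not_samePoint (hm : 0 < m) {w : ℂ} (hw : w ∈ closedStrip) (z : ℂ) :
    ∀ᶠ ζ in 𝓝[≠] z, ¬ SamePoint m ζ w := by
  filter_upwards [frequently_ne_zero_of_simple_zeros (differentiable_zeroFactor hm w)
    (fun z => deriv_zeroFactor_ne_zero hm hw) z] with ζ h h'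
  exact h (zeroFactor_eq_zero_of_samePoint hm h')

theorem strip_subset_closedStrip : strip ⊆ closedStrip := fun _ h => ⟨h.1.le, h.2.le⟩

/-! ### Extension of solutions across the two boundary lines. -/

namespace IsBVPSolution

variable {η ζ₁ : ℂ} {F : ℂ → ℂ} (hφ : IsUniformization m φ Ω) (hζ₁ : ζ₁ ∈ strip)
  (hF : IsBVPSolution φ Ω η (φ ζ₁) F)
include hφ hζ₁ hF

theorem differentiableAt {ζ : ℂ} (hζ : ζ ∈ strip) (hne : ¬ SamePoint m ζ ζ₁) :
    DifferentiableAt ℂ (fun ζ => F (φ ζ)) ζ := by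
  have hopen : IsOpen {z | z ∈ Ω ∧ ¬ SamePoint 1 z (φ ζ₁)} :=
    hφ.isOpen.inter (isClosed_samePoint one_ne_zero _).isOpen_compl
  have h2 : DifferentiableAt ℂ F (φ ζ) := hF.holomorphic.differentiableAt
    (hopen.mem_nhds ⟨hφ.mem hζ, fun h => hne ((hφ.samePoint_iff hζ hζ₁).1 h)⟩)
  exact h2.comp ζ (hφ.hasStrictDerivAt hζ).hasDerivAt.differentiableAt

theorem apply_add_one {ζ : ℂ} (hζ : ζ ∈ strip) (hne : ¬ SamePoint m ζ ζ₁) :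
    F (φ ζ + 1) = -F (φ ζ) :=
  hF.antiperiodic _ (hφ.mem hζ) fun h => hne ((hφ.samePoint_iff hζ hζ₁).1 h)

theorem apply_add {ζ : ℂ} (hζ : ζ ∈ strip) (hne : ¬ SamePoint m ζ ζ₁) :
    F (φ (ζ + m)) = -F (φ ζ) := by
  rw [hφ.map_add ζ hζ]
  exact hF.apply_add_one hφ hζ₁ hζ hne

/-- Extension of a solution across the bottom boundary. -/
theorem exists_extension_bottom (hm : 0 < m) :
    ∃ H : ℂ → ℂ, DifferentiableOn ℂ H {ζ | -ζ₁.im < ζ.im ∧ ζ.im < ζ₁.im} ∧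
      (∀ ζ : ℂ, 0 < ζ.im → ζ.im < ζ₁.im → H ζ = F (φ ζ)) ∧
      ∀ ζ : ℂ, H (starRingEnd ℂ ζ) = -starRingEnd ℂ (H ζ) := by
  have hs : ∀ ζ : ℂ, 0 < ζ.im → ζ.im < ζ₁.im → ζ ∈ strip := fun ζ h1 h2 => ⟨h1, h2.trans hζ₁.2⟩
  have hn : ∀ ζ : ℂ, ζ.im < ζ₁.im → ¬ SamePoint m ζ ζ₁ := fun ζ h => not_samePoint_of_im_ne h.ne
  -- `F ∘ φ` is antiperiodic along `m`, hence periodic along `2m`. Below the height of `ζ₁` there is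
  -- no pole.
  refine exists_reflection (T := 2 * m) (h := fun ζ => F (φ ζ)) (by positivity) hζ₁.1
    (fun ζ hζ => (hF.differentiableAt hφ hζ₁ (hs ζ hζ.1 hζ.2)
      (hn ζ hζ.2)).differentiableWithinAt) (fun ζ h1 h2 => ?_) ?_
  · have e : ζ + (2 * m : ℝ) = (ζ + m) + m := by push_cast; ring
    simp only [e]
    rw [hF.apply_add hφ hζ₁ (add_ofReal_mem_strip.2 (hs ζ h1 h2)) (hn _ (by simpa using h2)),
      hF.apply_add hφ hζ₁ (hs ζ h1 h2) (hn ζ h2), neg_neg]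
  · refine hφ.tendsto_comp (u := fun z => (F z).re) ?_ ?_ fun p hp => hF.bottom p hp
    · exact Ioo_mem_nhdsGT Real.pi_pos
    · filter_upwards [Ioo_mem_nhdsGT hζ₁.1] with y hy ζ hζ
      subst hζ
      have h1 := hs ζ hy.1 hy.2
      have e : φ ζ + 2 = φ (ζ + m) + 1 := by rw [hφ.map_add ζ h1]; ring
      rw [e, hF.apply_add_one hφ hζ₁ (add_ofReal_mem_strip.2 h1) (hn _ (by simpa using hy.2)),
        hF.apply_add hφ hζ₁ h1 (hn ζ hy.2), neg_neg]

/-- Extension of a solution, as a differential, across the top boundary. -/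
theorem exists_extension_top (hm : 0 < m) :
    ∃ δ : ℝ, 0 < δ ∧ δ ≤ Real.pi - ζ₁.im ∧ ∃ H : ℂ → ℂ,
      DifferentiableOn ℂ H {ζ | Real.pi - δ < ζ.im ∧ ζ.im < Real.pi + δ} ∧
      (∀ ζ : ℂ, Real.pi - δ < ζ.im → ζ.im < Real.pi → H ζ = F (φ ζ) * deriv φ ζ) ∧
      ∀ ζ : ℂ, H (starRingEnd ℂ ζ + 2 * Real.pi * I) = starRingEnd ℂ (H ζ) := by
  obtain ⟨ε, hε, g, hg, hgb⟩ := hF.top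
  have hπ := Real.pi_pos
  set δ := min ε (Real.pi - ζ₁.im) with hδ
  have hδ0 : 0 < δ := lt_min hε (by linarith [hζ₁.2])
  have hδ1 : δ ≤ Real.pi - ζ₁.im := min_le_right _ _
  have hs : ∀ ζ : ℂ, Real.pi - δ < ζ.im → ζ.im < Real.pi → ζ ∈ strip := fun ζ h1 h2 =>
    ⟨by linarith [hζ₁.1], h2⟩
  have hn : ∀ ζ : ℂ, Real.pi - δ < ζ.im → ¬ SamePoint m ζ ζ₁ := fun ζ h =>
    not_samePoint_of_im_ne (by linarith)
  have hG : ∀ ζ : ℂ, Real.pi - δ < ζ.im → ζ.im < Real.pi →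
      HasDerivAt (fun ζ => g (φ ζ)) (F (φ ζ) * deriv φ ζ) ζ := fun ζ h1 h2 =>
    (hg ζ (hs ζ h1 h2) (by linarith [min_le_left ε (Real.pi - ζ₁.im)])).comp ζ
      (hφ.hasStrictDerivAt (hs ζ h1 h2)).hasDerivAt
  set C : Set ℂ := {ζ | Real.pi - δ < ζ.im ∧ ζ.im < Real.pi} with hC
  -- The derivative of this sum vanishes because `F ∘ φ` is antiperiodic and `φ'` periodic. So the
  -- primitive is antiperiodic up to a constant, which makes it `2m`-periodic.
  have hsum : ∀ x ∈ C, ∀ y ∈ C, g (φ (x + m)) + g (φ x) = g (φ (y + m)) + g (φ y) := by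
    have hd : ∀ ζ ∈ C, HasDerivAt (fun ζ => g (φ (ζ + m)) + g (φ ζ)) 0 ζ := fun ζ hζ => by
      have h1 := (hG (ζ + m) (by simpa using hζ.1) (by simpa using hζ.2)).comp_add_const ζ (m : ℂ)
      refine (h1.fun_add (hG ζ hζ.1 hζ.2)).congr_deriv ?_
      rw [hF.apply_add hφ hζ₁ (hs ζ hζ.1 hζ.2) (hn ζ hζ.1), hφ.deriv_add (hs ζ hζ.1 hζ.2)]
      ring
    intro x hx y hy
    exact (isOpen_im_lt_im _ _).is_const_of_deriv_eq_zero (convex_im_lt_im _ _).isPreconnected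
      (fun ζ hζ => (hd ζ hζ).differentiableAt.differentiableWithinAt)
      (fun ζ hζ => (hd ζ hζ).deriv) hx hy
  have hper : ∀ ζ ∈ C, g (φ (ζ + m + m)) = g (φ ζ) := fun ζ hζ => by
    have := hsum (ζ + m) ⟨by simpa using hζ.1, by simpa using hζ.2⟩ ζ hζ
    linear_combination this
  have hrefl : ∀ ζ : ℂ, 0 < ζ.im → ζ.im < δ → Real.pi * I - ζ ∈ C := fun ζ h1 h2 => by
    constructor <;> simp <;> linarith
  have hlim : Tendsto (fun ζ => (g (φ ζ)).im) (comap im (𝓝[<] Real.pi)) (𝓝 0) := by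
    refine hφ.tendsto_comp (u := fun z => (g z).im) ?_ ?_ fun p hp => hgb p hp
    · exact Ioo_mem_nhdsLT hπ
    · filter_upwards [Ioo_mem_nhdsLT (show Real.pi - δ < Real.pi by linarith)] with y hy ζ hζ
      subst hζ
      have h1 := hs ζ hy.1 hy.2
      have e : φ ζ + 2 = φ (ζ + m + m) := by
        rw [hφ.map_add _ (add_ofReal_mem_strip.2 h1), hφ.map_add ζ h1]; ring
      rw [e, hper ζ hy]
  -- The substitution `ζ ↦ πi - ζ` moves the top line to the real axis, and the factor `i` turns a
  -- vanishing imaginary part into a vanishing real part. The primitive is reflected, not `F φ'`,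
  -- whose boundary values are unknown.
  obtain ⟨K, hK, hKg, hKs⟩ := exists_reflection (T := 2 * m) (δ := δ)
    (h := fun ζ => I * g (φ (Real.pi * I - ζ))) (by positivity) hδ0
    (fun ζ hζ => by
      have h1 := hrefl ζ hζ.1 hζ.2
      have h2 := (hG _ h1.1 h1.2).comp_const_sub (Real.pi * I) ζ
      exact (h2.const_mul I).differentiableAt.differentiableWithinAt)
    (fun ζ h1 h2 => by
      have h3 := hrefl ζ h1 h2
      have := hper (Real.pi * I - ζ - m - m) ⟨by simpa using h3.1, by simpa using h3.2⟩
      have e : Real.pi * I - (ζ + (2 * m : ℝ)) = Real.pi * I - ζ - m - m := by push_cast; ring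
      simp only [e]
      rw [← this]
      congr 3
      ring)
    (by
      have h1 : Tendsto (fun ζ : ℂ => Real.pi * I - ζ) (comap im (𝓝[>] 0))
          (comap im (𝓝[<] Real.pi)) := by
        rw [tendsto_comap_iff]
        have h2 : im ∘ (fun ζ : ℂ => Real.pi * I - ζ) = (fun y => Real.pi - y) ∘ im := by
          ext ζ; simp
        rw [h2]
        refine Tendsto.comp ?_ tendsto_comap
        refine tendsto_nhdsWithin_of_tendsto_nhds_of_eventually_within _ ?_ ?_
        · have : Tendsto (fun y : ℝ => Real.pi - y) (𝓝 0) (𝓝 (Real.pi - 0)) :=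
            (by fun_prop : Continuous fun y : ℝ => Real.pi - y).tendsto 0
          rw [sub_zero] at this
          exact this.mono_left nhdsWithin_le_nhds
        · filter_upwards [self_mem_nhdsWithin] with y hy
          have hy : 0 < y := hy
          simp [hy]
      have h3 := (hlim.comp h1).neg
      rw [neg_zero] at h3
      refine h3.congr fun ζ => ?_
      simp)
  have oS := isOpen_im_lt_im (Real.pi - δ) (Real.pi + δ)
  have hmapsS : ∀ ζ : ℂ, Real.pi - δ < ζ.im → ζ.im < Real.pi + δ →
      Real.pi * I - ζ ∈ {ζ : ℂ | -δ < ζ.im ∧ ζ.im < δ} := fun ζ h1 h2 => by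
    constructor <;> simp <;> linarith
  set G : ℂ → ℂ := fun ζ => -I * K (Real.pi * I - ζ) with hGdef
  have hGd : DifferentiableOn ℂ G {ζ | Real.pi - δ < ζ.im ∧ ζ.im < Real.pi + δ} := by
    refine DifferentiableOn.const_mul (hK.comp (by fun_prop) fun ζ hζ => hmapsS ζ hζ.1 hζ.2) _
  have hGs : ∀ ζ, starRingEnd ℂ (G (starRingEnd ℂ ζ + 2 * Real.pi * I)) = G ζ := fun ζ => by
    have e : Real.pi * I - (starRingEnd ℂ ζ + 2 * Real.pi * I) =
        starRingEnd ℂ (Real.pi * I - ζ) := by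
      simp only [map_sub, map_mul, conj_ofReal, conj_I]; ring
    simp only [hGdef, e, hKs, map_mul, map_neg, conj_I, conj_conj]
    ring
  refine ⟨δ, hδ0, hδ1, deriv G, hGd.deriv oS, fun ζ h1 h2 => ?_, fun ζ => ?_⟩
  · have h3 : G =ᶠ[𝓝 ζ] fun ζ => g (φ ζ) := by
      filter_upwards [(isOpen_im_lt_im (Real.pi - δ) Real.pi).mem_nhds ⟨h1, h2⟩] with w hw
      simp only [hGdef]
      rw [hKg _ (by simp; linarith [hw.2]) (by simp; linarith [hw.1]), sub_sub_cancel]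
      linear_combination (-g (φ w)) * I_sq
    rw [h3.deriv_eq, (hG ζ h1 h2).deriv]
  · have h1 : (starRingEnd ℂ ∘ (fun w => G (w + 2 * Real.pi * I)) ∘ starRingEnd ℂ) = G :=
      funext hGs
    have h2 := congrFun (deriv_conj_conj (f := fun w => G (w + 2 * Real.pi * I))) ζ
    rw [h1] at h2
    rw [h2]
    simp [deriv_comp_add_const]

end IsBVPSolution

end

/-! ### Removal of the pole: solutions as real sections. -/

section

variable {m : ℝ} {φ : ℂ → ℂ} {Ω : Set ℂ}

theorem analyticAt_dslope {f : ℂ → ℂ} {z : ℂ} (hf : AnalyticAt ℂ f z) :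
    AnalyticAt ℂ (dslope f z) z := by
  obtain ⟨p, hp⟩ := hf
  exact ⟨_, hp.has_fpower_series_dslope_fslope⟩

namespace IsBVPSolution

variable {η ζ₁ : ℂ} {F : ℂ → ℂ} (hφ : IsUniformization m φ Ω) (hζ₁ : ζ₁ ∈ strip)
  (hF : IsBVPSolution φ Ω η (φ ζ₁) F)
include hφ hζ₁ hF

/-- The residue of a solution in the coordinate of the straight cylinder. -/
theorem exists_analyticAt_mul_sub (hm : 0 < m) : ∃ K : ℂ → ℂ, AnalyticAt ℂ K ζ₁ ∧
    (fun ζ => (ζ - ζ₁) * F (φ ζ)) =ᶠ[𝓝[≠] ζ₁] K ∧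
    K ζ₁ = 1 / (Real.pi * I) * starRingEnd ℂ η / deriv φ ζ₁ := by
  have hd := (hφ.hasStrictDerivAt hζ₁).hasDerivAt
  have hd0 := hφ.deriv_ne_zero hζ₁
  set R : ℂ := 1 / (Real.pi * I) * starRingEnd ℂ η with hR
  -- The singular part becomes `R (ζ - ζ₁) / (φ ζ - φ ζ₁)`, with limit `R / φ'(ζ₁)`; the bounded
  -- remainder times `ζ - ζ₁` tends to zero.
  set K : ℂ → ℂ := Function.update (fun ζ => (ζ - ζ₁) * F (φ ζ)) ζ₁ (R / deriv φ ζ₁) with hK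
  have hKne : ∀ ζ, ζ ≠ ζ₁ → K ζ = (ζ - ζ₁) * F (φ ζ) := fun ζ h => Function.update_of_ne h _ _
  have hev : (fun ζ => (ζ - ζ₁) * F (φ ζ)) =ᶠ[𝓝[≠] ζ₁] K := by
    filter_upwards [self_mem_nhdsWithin] with ζ h
    exact (hKne ζ h).symm
  refine ⟨K, ?_, hev, Function.update_self _ _ _⟩
  refine analyticAt_of_differentiable_on_punctured_nhds_of_continuousAt ?_ ?_
  · filter_upwards [self_mem_nhdsWithin, eventually_not_samePoint hm
      (strip_subset_closedStrip hζ₁) ζ₁, (isOpen_strip.eventually_mem hζ₁).filter_mono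
      nhdsWithin_le_nhds] with ζ h1 h2 h3
    have h4 : DifferentiableAt ℂ (fun ζ => (ζ - ζ₁) * F (φ ζ)) ζ :=
      DifferentiableAt.mul (by fun_prop) (hF.differentiableAt hφ hζ₁ h3 h2)
    refine h4.congr_of_eventuallyEq ?_
    filter_upwards [isOpen_ne.mem_nhds h1] with w hw
    exact hKne w hw
  · rw [hK, continuousAt_update_same]
    have hne : ∀ᶠ ζ in 𝓝[≠] ζ₁, φ ζ ≠ φ ζ₁ := hd.eventually_ne hd0
    have ht : Tendsto φ (𝓝[≠] ζ₁) (𝓝[≠] (φ ζ₁)) :=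
      tendsto_nhdsWithin_of_tendsto_nhds_of_eventually_within _
        (hd.continuousAt.tendsto.mono_left nhdsWithin_le_nhds) hne
    have h1 := hF.singularity.comp_tendsto ht
    have h2 : Tendsto (fun ζ => ζ - ζ₁) (𝓝[≠] ζ₁) (𝓝 0) := by
      have : Continuous fun ζ : ℂ => ζ - ζ₁ := by fun_prop
      simpa using (this.tendsto ζ₁).mono_left nhdsWithin_le_nhds
    have h3 := (Asymptotics.isBigO_refl (fun ζ : ℂ => ζ - ζ₁) (𝓝[≠] ζ₁)).norm_right.mul h1
    have h4 : Tendsto (fun ζ => (ζ - ζ₁) * (F (φ ζ) - 1 / (Real.pi * I) *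
        (starRingEnd ℂ η / (φ ζ - φ ζ₁)))) (𝓝[≠] ζ₁) (𝓝 0) := by
      refine h3.trans_tendsto ?_
      simpa using h2.norm
    have h5 : Tendsto (fun ζ => R * (slope φ ζ₁ ζ)⁻¹) (𝓝[≠] ζ₁) (𝓝 (R * (deriv φ ζ₁)⁻¹)) :=
      ((hasDerivAt_iff_tendsto_slope.1 hd).inv₀ hd0).const_mul R
    have h6 := h4.add h5
    rw [zero_add] at h6
    rw [div_eq_mul_inv]
    refine h6.congr' ?_
    filter_upwards [hne, self_mem_nhdsWithin] with ζ h7 h8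
    have h8 : ζ - ζ₁ ≠ 0 := sub_ne_zero.2 h8
    have h7 : φ ζ - φ ζ₁ ≠ 0 := sub_ne_zero.2 h7
    rw [slope_def_field, hR]
    field_simp
    ring

theorem apply_add_int {ζ : ℂ} (hζ : ζ ∈ strip) (hne : ¬ SamePoint m ζ ζ₁) (l : ℤ) :
    F (φ (ζ + l * m)) = (-1) ^ l * F (φ ζ) := by
  have hmem : ∀ k : ℤ, ζ + k * m ∈ strip := fun k => by
    have := (add_ofReal_mem_strip (z := ζ) (x := k * m)).2 hζ
    push_cast at this
    exact this
  have hn : ∀ k : ℤ, ¬ SamePoint m (ζ + k * m) ζ₁ := by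
    rintro k ⟨j, hj⟩
    exact hne ⟨j - k, by push_cast; linear_combination hj⟩
  induction l using Int.induction_on with
  | zero => simp
  | succ n ih =>
    have e : ζ + ((n + 1 : ℤ) : ℂ) * m = ζ + (n : ℤ) * m + m := by push_cast; ring
    rw [e, hF.apply_add hφ hζ₁ (hmem n) (hn n), ih, zpow_add_one₀ (by norm_num)]
    ring
  | pred n ih =>
    have e : ζ + ((-n - 1 : ℤ) : ℂ) * m + m = ζ + (-n : ℤ) * m := by push_cast; ring
    have := hF.apply_add hφ hζ₁ (hmem (-n - 1)) (hn (-n - 1))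
    rw [e, ih] at this
    rw [zpow_sub_one₀ (by norm_num)]
    have e' : (-1 : ℂ)⁻¹ = -1 := by norm_num
    rw [e']
    linear_combination this

/-- Removal of the pole of a solution. -/
theorem exists_mul_zeroFactor (hm : 0 < m) : ∃ W : ℂ → ℂ, DifferentiableOn ℂ W strip ∧
    (∀ ζ ∈ strip, ¬ SamePoint m ζ ζ₁ → W ζ = F (φ ζ) * zeroFactor m ζ₁ ζ) ∧
    W ζ₁ = 1 / (Real.pi * I) * starRingEnd ℂ η / deriv φ ζ₁ * deriv (zeroFactor m ζ₁) ζ₁ := by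
  have hQ := differentiable_zeroFactor hm ζ₁
  have hc₁ := strip_subset_closedStrip hζ₁
  obtain ⟨K, hK, hKF, hK₁⟩ := hF.exists_analyticAt_mul_sub hφ hζ₁ hm
  -- On the universal cover the pole recurs at all translates `ζ₁ + l m`, with alternating residues.
  have hloc : ∀ l : ℤ, AnalyticAt ℂ (fun ζ => (-1) ^ l * K (ζ - l * m) *
      dslope (zeroFactor m ζ₁) (ζ₁ + l * m) ζ) (ζ₁ + l * m) ∧
      (fun ζ => F (φ ζ) * zeroFactor m ζ₁ ζ) =ᶠ[𝓝[≠] (ζ₁ + l * m)]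
        (fun ζ => (-1) ^ l * K (ζ - l * m) * dslope (zeroFactor m ζ₁) (ζ₁ + l * m) ζ) := by
    intro l
    have hsub : Tendsto (fun ζ : ℂ => ζ - l * m) (𝓝[≠] (ζ₁ + l * m)) (𝓝[≠] ζ₁) := by
      refine tendsto_nhdsWithin_of_tendsto_nhds_of_eventually_within _ ?_ ?_
      · have : Continuous fun ζ : ℂ => ζ - l * m := by fun_prop
        have := this.tendsto (ζ₁ + l * m)
        rw [add_sub_cancel_right] at this
        exact this.mono_left nhdsWithin_le_nhds
      · filter_upwards [self_mem_nhdsWithin] with ζ h h'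
        have h' : ζ - l * m = ζ₁ := h'
        exact h (show ζ = ζ₁ + l * m by linear_combination h')
    have hmem : ∀ {ζ : ℂ}, ζ + l * m ∈ strip ↔ ζ ∈ strip := fun {ζ} => by
      have := add_ofReal_mem_strip (z := ζ) (x := l * m)
      push_cast at this
      exact this
    refine ⟨?_, ?_⟩
    · refine (analyticAt_const.mul ?_).mul (analyticAt_dslope (hQ.analyticAt _))
      refine AnalyticAt.fun_comp (g := K) ?_ (by fun_prop)
      rwa [add_sub_cancel_right]
    · filter_upwards [hsub.eventually hKF, hsub.eventually (eventually_not_samePoint hm hc₁ ζ₁),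
        self_mem_nhdsWithin, (isOpen_strip.eventually_mem (hmem.2 hζ₁)).filter_mono
        nhdsWithin_le_nhds] with ζ h1 h2 h3 h4
      have h5 : ζ - l * m ∈ strip := hmem.1 (by rwa [sub_add_cancel])
      have h6 := hF.apply_add_int hφ hζ₁ h5 h2 l
      rw [sub_add_cancel] at h6
      have h7 : ζ - (ζ₁ + l * m) ≠ 0 := sub_ne_zero.2 h3
      rw [dslope_of_ne _ h3, slope_def_field, zeroFactor_eq_zero_of_samePoint hm ⟨l, rfl⟩, sub_zero,
        ← h1, h6]
      have h8 : ζ - l * m - ζ₁ = ζ - (ζ₁ + l * m) := by ring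
      rw [h8]
      field_simp
  obtain ⟨W, hW1, hW2, hW3⟩ := exists_differentiableOn_of_eventuallyEq (U := strip)
    (f := fun ζ => F (φ ζ) * zeroFactor m ζ₁ ζ) fun ζ hζ => by
      by_cases h : SamePoint m ζ ζ₁
      · obtain ⟨l, rfl⟩ := h
        exact ⟨_, (hloc l).1, (hloc l).2⟩
      · refine ⟨_, DifferentiableOn.analyticAt (s := strip ∩ {z | SamePoint m z ζ₁}ᶜ)
          (fun w hw => ?_) ?_, EventuallyEq.rfl⟩
        · exact ((hF.differentiableAt hφ hζ₁ hw.1 hw.2).mul (hQ w)).differentiableWithinAt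
        · exact (isOpen_strip.inter (isClosed_samePoint hm.ne' ζ₁).isOpen_compl).mem_nhds ⟨hζ, h⟩
  refine ⟨W, hW1, fun ζ hζ h => hW3 ζ hζ
    ((hF.differentiableAt hφ hζ₁ hζ h).continuousAt.mul hQ.continuous.continuousAt), ?_⟩
  have h0 := hloc 0
  simp only [Int.cast_zero, zero_mul, add_zero, zpow_zero, one_mul, sub_zero] at h0
  have := (hW2 ζ₁ hζ₁ _ h0.1 h0.2).self_of_nhds
  rw [this]
  change K ζ₁ * dslope _ ζ₁ ζ₁ = _
  rw [dslope_same, hK₁]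

/-- A solution multiplied by a symmetric factor which removes its pole is a real section. -/
theorem exists_section (hm : 0 < m) : ∃ u v : ℂ → ℂ,
    IsRealSection m (deriv φ) u v (-(Real.exp (m / 2) * Real.exp (2 * m - 2 * ζ₁.re))) 2 ∧
    (∀ ζ ∈ strip, ¬ SamePoint m ζ ζ₁ →
      u ζ = I * exp (ζ / 2) * (F (φ ζ) * zeroFactor m ζ₁ ζ)) ∧
    u ζ₁ = I * exp (ζ₁ / 2) * (1 / (Real.pi * I) * starRingEnd ℂ η / deriv φ ζ₁ *
      deriv (zeroFactor m ζ₁) ζ₁) := by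
  have hπ := Real.pi_pos
  have hQ := differentiable_zeroFactor hm ζ₁
  obtain ⟨W, hW, hWF, hW₁⟩ := hF.exists_mul_zeroFactor hφ hζ₁ hm
  obtain ⟨H, hH, hHF, hHs⟩ := hF.exists_extension_bottom hφ hζ₁ hm
  obtain ⟨δ, hδ, hδ1, T, hT, hTF, hTs⟩ := hF.exists_extension_top hφ hζ₁ hm
  have expc : ∀ ζ : ℂ, exp (starRingEnd ℂ ζ / 2) = starRingEnd ℂ (exp (ζ / 2)) := fun ζ => by
    rw [← exp_conj, map_div₀, Complex.conj_ofNat]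
  have hfree : ∀ ζ : ℂ, ζ.im ≠ ζ₁.im → ¬ SamePoint m ζ ζ₁ := fun ζ h => not_samePoint_of_im_ne h
  -- The factor `i e^{ζ/2}` is imaginary on the bottom line, where `F ∘ φ` is imaginary too, and
  -- real on the top line, where `(F ∘ φ) φ'` is real.
  obtain ⟨u, hu1, hu2, hu3⟩ := exists_glue (b := Real.pi) (δ := ζ₁.im)
    (h := fun ζ => I * exp (ζ / 2) * W ζ)
    (H := fun ζ => I * exp (ζ / 2) * (H ζ * zeroFactor m ζ₁ ζ)) hζ₁.1
    (DifferentiableOn.mul (by fun_prop) hW)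
    (DifferentiableOn.mul (by fun_prop) (hH.mul hQ.differentiableOn))
    (fun ζ h1 h2 => by
      rw [hHF ζ h1 h2, hWF ζ ⟨h1, h2.trans hζ₁.2⟩ (hfree ζ h2.ne)])
    (fun ζ _ _ => by
      simp only [map_mul, conj_I, expc, hHs, zeroFactor_conj hm]
      ring)
  -- The top line is treated in the coordinate `πi - ζ`, in which it becomes the real axis.
  obtain ⟨v', hv1, hv2, hv3⟩ := exists_glue (b := Real.pi) (δ := δ)
    (h := fun ζ => I * exp ((Real.pi * I - ζ) / 2) * W (Real.pi * I - ζ) *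
      deriv φ (Real.pi * I - ζ))
    (H := fun ζ => I * exp ((Real.pi * I - ζ) / 2) *
      (T (Real.pi * I - ζ) * zeroFactor m ζ₁ (Real.pi * I - ζ))) hδ
    (by
      have hmaps : ∀ ζ ∈ {ζ : ℂ | 0 < ζ.im ∧ ζ.im < Real.pi}, Real.pi * I - ζ ∈ strip :=
        fun ζ hζ => by constructor <;> simp <;> linarith [hζ.1, hζ.2]
      refine (DifferentiableOn.mul (by fun_prop) (hW.comp (by fun_prop) hmaps)).mul ?_
      exact (hφ.differentiableOn.deriv isOpen_strip).comp (by fun_prop) hmaps)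
    (by
      refine DifferentiableOn.mul (by fun_prop) (DifferentiableOn.mul ?_ ?_)
      · refine hT.comp (by fun_prop) fun ζ hζ => ?_
        constructor <;> simp <;> linarith [hζ.1, hζ.2]
      · exact (hQ.comp (by fun_prop)).differentiableOn)
    (fun ζ h1 h2 => by
      have h3 : (Real.pi * I - ζ).im = Real.pi - ζ.im := by simp
      rw [hTF _ (by rw [h3]; linarith) (by rw [h3]; linarith),
        hWF (Real.pi * I - ζ) ⟨by rw [h3]; linarith [hζ₁.1], by rw [h3]; linarith⟩
          (hfree _ (by rw [h3]; linarith))]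
      ring)
    (fun ζ _ _ => by
      have e : Real.pi * I - starRingEnd ℂ ζ =
          starRingEnd ℂ (Real.pi * I - ζ) + 2 * Real.pi * I := by
        simp only [map_sub, map_mul, conj_ofReal, conj_I]; ring
      have e2 : exp ((starRingEnd ℂ (Real.pi * I - ζ) + 2 * Real.pi * I) / 2) =
          -starRingEnd ℂ (exp ((Real.pi * I - ζ) / 2)) := by
        rw [← expc, add_div, exp_add, show (2 * Real.pi * I) / 2 = Real.pi * I by ring,
          exp_pi_mul_I]
        ring
      simp only [e]
      rw [e2, hTs, zeroFactor_add_two_pi_I, zeroFactor_conj hm]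
      simp only [map_mul, conj_I]
      ring)
  have huS : ∀ ζ ∈ strip, u ζ = I * exp (ζ / 2) * W ζ := fun ζ hζ => hu2 ζ hζ.1 hζ.2
  have hvS : ∀ ζ ∈ strip, v' (Real.pi * I - ζ) = u ζ * deriv φ ζ := fun ζ hζ => by
    rw [hv2 _ (by simp; linarith [hζ.2]) (by simp; linarith [hζ.1]), sub_sub_cancel, huS ζ hζ]
  have hquasi : ∀ ζ ∈ strip, ζ.im ≠ ζ₁.im → u (ζ + m) =
      ((-(Real.exp (m / 2) * Real.exp (2 * m - 2 * ζ₁.re)) : ℝ) : ℂ) * exp ((2 : ℤ) * ζ) *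
        u ζ := by
    intro ζ hζ hne
    have h1 := add_ofReal_mem_strip (x := m).2 hζ
    rw [huS _ h1, huS ζ hζ, hWF _ h1 (hfree _ (by simpa using hne)), hWF ζ hζ (hfree ζ hne),
      hF.apply_add hφ hζ₁ hζ (hfree ζ hne), zeroFactor_add_ofReal hm hζ₁, add_div, exp_add]
    push_cast
    ring
  have hmapsv : ∀ ζ ∈ {ζ : ℂ | 0 < ζ.im ∧ ζ.im < 2 * Real.pi},
      Real.pi * I - ζ ∈ {ζ : ℂ | -Real.pi < ζ.im ∧ ζ.im < Real.pi} := fun ζ hζ => by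
    constructor <;> simp <;> linarith [hζ.1, hζ.2]
  have hvd : DifferentiableOn ℂ (fun ζ => v' (Real.pi * I - ζ))
      {ζ | 0 < ζ.im ∧ ζ.im < 2 * Real.pi} := hv1.comp (by fun_prop) hmapsv
  refine ⟨u, fun ζ => v' (Real.pi * I - ζ), ⟨hu1, hvd, hvS, hu3, fun ζ h1 h2 => ?_, ?_, ?_⟩,
    fun ζ hζ h => by rw [huS ζ hζ, hWF ζ hζ h], by rw [huS ζ₁ hζ₁, hW₁]⟩
  · have h3 := hmapsv ζ ⟨h1, h2⟩
    rw [← hv3 _ h3.1 h3.2]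
    congr 1
    simp only [map_sub, map_mul, conj_ofReal, conj_I]; ring
  · intro ζ h1 h2
    set c : ℂ := ((-(Real.exp (m / 2) * Real.exp (2 * m - 2 * ζ₁.re)) : ℝ) : ℂ)
    have o := isOpen_im_lt_im (-Real.pi) Real.pi
    have a1 : AnalyticOnNhd ℂ (fun ζ => u (ζ + m)) {ζ | -Real.pi < ζ.im ∧ ζ.im < Real.pi} :=
      DifferentiableOn.analyticOnNhd (hu1.comp (by fun_prop) fun ζ hζ => by simpa using hζ) o
    have a2 : AnalyticOnNhd ℂ (fun ζ => c * exp ((2 : ℤ) * ζ) * u ζ)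
        {ζ | -Real.pi < ζ.im ∧ ζ.im < Real.pi} :=
      DifferentiableOn.analyticOnNhd (DifferentiableOn.mul (by fun_prop) hu1) o
    have hy : (0 : ℝ) < ζ₁.im / 2 ∧ ζ₁.im / 2 < ζ₁.im := ⟨by linarith [hζ₁.1], by linarith [hζ₁.1]⟩
    -- The multiplier is known below the height of the pole and spreads by the identity theorem.
    refine a1.eqOn_of_preconnected_of_eventuallyEq a2 (convex_im_lt_im _ _).isPreconnected
      (z₀ := ((ζ₁.im / 2 : ℝ) : ℂ) * I) ?_ ?_ ⟨h1, h2⟩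
    · have : (((ζ₁.im / 2 : ℝ) : ℂ) * I).im = ζ₁.im / 2 := by simp
      exact ⟨by rw [this]; linarith, by rw [this]; linarith [hζ₁.2]⟩
    · have h0 : (((ζ₁.im / 2 : ℝ) : ℂ) * I) ∈ {ζ : ℂ | 0 < ζ.im ∧ ζ.im < ζ₁.im} := by
        have : (((ζ₁.im / 2 : ℝ) : ℂ) * I).im = ζ₁.im / 2 := by simp
        exact ⟨by rw [this]; linarith, by rw [this]; linarith [hζ₁.1]⟩
      filter_upwards [(isOpen_im_lt_im 0 ζ₁.im).mem_nhds h0] with w hw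
      exact hquasi w ⟨hw.1, hw.2.trans hζ₁.2⟩ hw.2.ne
  · intro ζ h1 h2
    set c : ℂ := ((-(Real.exp (m / 2) * Real.exp (2 * m - 2 * ζ₁.re)) : ℝ) : ℂ)
    have o := isOpen_im_lt_im 0 (2 * Real.pi)
    have a1 : AnalyticOnNhd ℂ (fun ζ => v' (Real.pi * I - (ζ + m)))
        {ζ | 0 < ζ.im ∧ ζ.im < 2 * Real.pi} :=
      DifferentiableOn.analyticOnNhd
        (hvd.comp (f := fun ζ : ℂ => ζ + m) (by fun_prop) fun ζ hζ => by simpa using hζ) o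
    have a2 : AnalyticOnNhd ℂ (fun ζ => c * exp ((2 : ℤ) * ζ) * v' (Real.pi * I - ζ))
        {ζ | 0 < ζ.im ∧ ζ.im < 2 * Real.pi} :=
      DifferentiableOn.analyticOnNhd (DifferentiableOn.mul (by fun_prop) hvd) o
    refine a1.eqOn_of_preconnected_of_eventuallyEq a2 (convex_im_lt_im _ _).isPreconnected
      (z₀ := ((ζ₁.im / 2 : ℝ) : ℂ) * I) ?_ ?_ ⟨h1, h2⟩
    · have : (((ζ₁.im / 2 : ℝ) : ℂ) * I).im = ζ₁.im / 2 := by simp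
      exact ⟨by rw [this]; linarith [hζ₁.1], by rw [this]; linarith [hζ₁.2]⟩
    · have h0 : (((ζ₁.im / 2 : ℝ) : ℂ) * I) ∈ {ζ : ℂ | 0 < ζ.im ∧ ζ.im < ζ₁.im} := by
        have : (((ζ₁.im / 2 : ℝ) : ℂ) * I).im = ζ₁.im / 2 := by simp
        exact ⟨by rw [this]; linarith [hζ₁.1], by rw [this]; linarith [hζ₁.1]⟩
      filter_upwards [(isOpen_im_lt_im 0 ζ₁.im).mem_nhds h0] with w hw
      have hw' : w ∈ strip := ⟨hw.1, hw.2.trans hζ₁.2⟩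
      rw [hvS w hw', hvS _ (add_ofReal_mem_strip.2 hw'), hquasi w hw' hw.2.ne, hφ.deriv_add hw']
      ring

end IsBVPSolution

end

section

/-! ### The solution of the boundary value problem -/

section kernelConj

variable {m : ℝ} (hm : 0 < m)

include hm in
-- The points `b` and `b̄` differ by the quasi-period `2πi`. This is why a parameter on the line `Im
-- b = π` gives a kernel with real structure, as in `kern_conj`.
theorem theta_conj_sub_midPoint (r : ℝ) (u : ℂ) :
    theta m (starRingEnd ℂ u - midPoint r) = -starRingEnd ℂ (theta m (u - midPoint r)) := by
  have e : u - midPoint r = starRingEnd ℂ (starRingEnd ℂ u - midPoint r + 2 * Real.pi * I) := by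
    simp only [midPoint, map_add, map_sub, conj_conj, map_mul, conj_ofReal, conj_I, conj_ofNat]
    ring
  rw [e, theta_conj hm, conj_conj, theta_add_two_pi_I, neg_neg]

include hm in
theorem theta_neg_midPoint_conj (r : ℝ) :
    theta m (-midPoint r) = -starRingEnd ℂ (theta m (-midPoint r)) := by
  simpa using theta_conj_sub_midPoint hm r 0

include hm in
theorem deriv_theta_zero_conj : starRingEnd ℂ (deriv (theta m) 0) = deriv (theta m) 0 := by
  have h1 : (starRingEnd ℂ) ∘ theta m ∘ (starRingEnd ℂ) = theta m := by
    ext u; simp [theta_conj hm]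
  have h2 := deriv_conj_conj (𝕜 := ℂ) (f := theta m)
  rw [h1] at h2
  have := congrFun h2 0
  simpa using this.symm

include hm in
theorem kern_conj (r : ℝ) (u : ℂ) :
    kern m r (starRingEnd ℂ u) = starRingEnd ℂ (kern m r u) := by
  rw [kern, kern, theta_conj_sub_midPoint hm, theta_conj hm, map_div₀, map_mul, map_mul,
    deriv_theta_zero_conj hm, theta_neg_midPoint_conj hm]
  simp only [map_neg, conj_conj]
  rw [← theta_neg_midPoint_conj hm, mul_neg, neg_mul, neg_div, div_neg]

/-- The numerator of the kernel, normalized to have the multipliers of `eTheta`. -/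
def eKern (m r : ℝ) (u : ℂ) : ℂ :=
  exp u * theta m (u - midPoint r) * deriv (theta m) 0 / theta m (-midPoint r)

include hm in
theorem differentiable_eKern (r : ℝ) : Differentiable ℂ (eKern m r) := by
  have := differentiable_theta hm
  unfold eKern
  fun_prop

include hm in
theorem eKern_zero (r : ℝ) : eKern m r 0 = deriv (theta m) 0 := by
  rw [eKern, exp_zero, zero_sub, one_mul, mul_div_cancel_left₀ _ (theta_midPoint_ne_zero hm r)]

theorem eKern_add_two_pi_I (r : ℝ) (u : ℂ) :
    eKern m r (u + 2 * Real.pi * I) = -eKern m r u := by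
  rw [eKern, eKern, add_sub_right_comm, theta_add_two_pi_I, exp_add, exp_two_pi_mul_I]
  ring

include hm in
theorem eKern_add_ofReal (r : ℝ) (u : ℂ) :
    eKern m r (u + m) = (Real.exp (3 * m / 2 - r) : ℂ) * exp u * eKern m r u := by
  have e : exp (u + m) * -exp (u - midPoint r + m / 2) =
      (Real.exp (3 * m / 2 - r) : ℂ) * exp u * exp u := by
    have : u - midPoint r + m / 2 = (u + (m / 2 - r)) - Real.pi * I := by rw [midPoint]; ring
    rw [this, exp_sub, exp_pi_mul_I, ofReal_exp, ← exp_add, ← exp_add, div_neg, div_one, neg_neg,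
      ← exp_add]
    push_cast
    ring_nf
  rw [eKern, eKern, add_sub_right_comm, theta_add_ofReal hm]
  linear_combination (theta m (u - midPoint r) * deriv (theta m) 0 / theta m (-midPoint r)) * e

include hm in
theorem eKern_eq (r : ℝ) {u : ℂ} (hu : u ∉ (periods m hm).lattice) :
    eKern m r u = exp (u / 2) * kern m r u * eTheta m u := by
  have h1 := theta_ne_zero hm hu
  have h2 := theta_midPoint_ne_zero hm r
  have e : exp u = exp (u / 2) * exp (u / 2) := by rw [← exp_add]; ring_nf
  rw [eKern, kern, eTheta, e]
  field_simp

include hm in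
theorem eKern_conj (r : ℝ) (u : ℂ) :
    eKern m r (starRingEnd ℂ u) = starRingEnd ℂ (eKern m r u) := by
  have : starRingEnd ℂ (theta m (-midPoint r)) = -theta m (-midPoint r) := by
    rw [eq_neg_iff_add_eq_zero, add_comm, ← eq_neg_iff_add_eq_zero]
    exact theta_neg_midPoint_conj hm r
  rw [eKern, eKern, theta_conj_sub_midPoint hm, map_div₀, map_mul, map_mul,
    deriv_theta_zero_conj hm, ← exp_conj, this, div_neg]
  ring

include hm in
theorem deriv_eTheta_zero : deriv (eTheta m) 0 = deriv (theta m) 0 := by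
  rw [(hasDerivAt_eTheta hm 0).deriv, theta_zero]
  simp

end kernelConj

/-! ### Differences and quotients of sections, and the explicit solution. -/

namespace IsRealSection

variable {m : ℝ} {d u v u' v' : ℂ → ℂ} {c c' : ℝ} {N N' : ℤ}

theorem sub (h : IsRealSection m d u v c N) (h' : IsRealSection m d u' v' c N) :
    IsRealSection m d (fun ζ => u ζ - u' ζ) (fun ζ => v ζ - v' ζ) c N where
  diff_left := h.diff_left.sub h'.diff_left
  diff_right := h.diff_right.sub h'.diff_right
  eq_mul ζ hζ := by rw [h.eq_mul ζ hζ, h'.eq_mul ζ hζ]; ring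
  symm_left ζ h1 h2 := by rw [h.symm_left ζ h1 h2, h'.symm_left ζ h1 h2, map_sub]
  symm_right ζ h1 h2 := by rw [h.symm_right ζ h1 h2, h'.symm_right ζ h1 h2, map_sub]
  quasi_left ζ h1 h2 := by rw [h.quasi_left ζ h1 h2, h'.quasi_left ζ h1 h2]; ring
  quasi_right ζ h1 h2 := by rw [h.quasi_right ζ h1 h2, h'.quasi_right ζ h1 h2]; ring

theorem div (h : IsRealSection m d u v c N) (h' : IsRealSection m d u' v' c' N')
    (hd : ∀ z ∈ strip, d z ≠ 0)
    (hu : ∀ z : ℂ, -Real.pi < z.im → z.im < Real.pi → u' z ≠ 0)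
    (hv : ∀ z : ℂ, 0 < z.im → z.im < 2 * Real.pi → v' z ≠ 0) :
    IsRealSection m (fun _ => 1) (fun ζ => u ζ / u' ζ) (fun ζ => v ζ / v' ζ) (c / c') (N - N') where
  diff_left := h.diff_left.div h'.diff_left fun z hz => hu z hz.1 hz.2
  diff_right := h.diff_right.div h'.diff_right fun z hz => hv z hz.1 hz.2
  eq_mul ζ hζ := by
    rw [h.eq_mul ζ hζ, h'.eq_mul ζ hζ, mul_div_mul_right _ _ (hd ζ hζ), mul_one]
  symm_left ζ h1 h2 := by rw [h.symm_left ζ h1 h2, h'.symm_left ζ h1 h2, map_div₀]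
  symm_right ζ h1 h2 := by rw [h.symm_right ζ h1 h2, h'.symm_right ζ h1 h2, map_div₀]
  quasi_left ζ h1 h2 := by
    rw [h.quasi_left ζ h1 h2, h'.quasi_left ζ h1 h2, mul_div_mul_comm, mul_div_mul_comm,
      ← exp_sub]
    push_cast
    ring_nf
  quasi_right ζ h1 h2 := by
    rw [h.quasi_right ζ h1 h2, h'.quasi_right ζ h1 h2, mul_div_mul_comm, mul_div_mul_comm,
      ← exp_sub]
    push_cast
    ring_nf

end IsRealSection

/-- The section with the prescribed value `I exp (w / 2) A θ'(0) eTheta (w - w̄)` at `w`. -/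
def poleSection (m r : ℝ) (A w ζ : ℂ) : ℂ :=
  I * exp (ζ / 2) * (A * eKern m r (ζ - w) * eTheta m (ζ - starRingEnd ℂ w) -
    starRingEnd ℂ A * eKern m r (ζ - starRingEnd ℂ w) * eTheta m (ζ - w))

/-- The two terms are exchanged by conjugation, so `i` times their difference is real. Along `2πi`
the sign of `exp (ζ/2)` cancels that of `eKern`, so the same function is real on the top line. -/
theorem isRealSection_poleSection {m : ℝ} (hm : 0 < m) (r : ℝ) (A w : ℂ) :
    IsRealSection m (fun _ => 1) (poleSection m r A w) (poleSection m r A w)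
      (-Real.exp (3 * m - r - 2 * w.re)) 2 := by
  have hE := differentiable_eTheta hm
  have hK := differentiable_eKern hm r
  have hdiff : Differentiable ℂ (poleSection m r A w) := by
    unfold poleSection
    fun_prop
  have expc : ∀ ζ : ℂ, exp (starRingEnd ℂ ζ / 2) = starRingEnd ℂ (exp (ζ / 2)) := fun ζ => by
    rw [← exp_conj, map_div₀, Complex.conj_ofNat]
  have hconj : ∀ ζ, poleSection m r A w (starRingEnd ℂ ζ) =
      starRingEnd ℂ (poleSection m r A w ζ) := fun ζ => by
    have e1 : ∀ w, starRingEnd ℂ ζ - w = starRingEnd ℂ (ζ - starRingEnd ℂ w) := fun w => by simp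
    rw [poleSection, poleSection, e1, e1, conj_conj, eKern_conj hm, eKern_conj hm, eTheta_conj hm,
      eTheta_conj hm, expc]
    simp only [map_mul, map_sub, conj_I, conj_conj]
    ring
  have hper : ∀ ζ, poleSection m r A w (ζ + 2 * Real.pi * I) = poleSection m r A w ζ := fun ζ => by
    rw [poleSection, poleSection, add_div, exp_add,
      show (2 * Real.pi * I) / 2 = Real.pi * I by ring, exp_pi_mul_I, add_sub_right_comm,
      add_sub_right_comm, eKern_add_two_pi_I, eKern_add_two_pi_I, eTheta_add_two_pi_I,
      eTheta_add_two_pi_I]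
    ring
  have hquasi : ∀ ζ, poleSection m r A w (ζ + m) =
      ((-Real.exp (3 * m - r - 2 * w.re) : ℝ) : ℂ) * exp ((2 : ℤ) * ζ) *
        poleSection m r A w ζ := fun ζ => by
    have e : exp ((m : ℂ) / 2) * (Real.exp (3 * m / 2 - r) : ℂ) * exp (ζ - w) *
        exp (ζ - starRingEnd ℂ w + m) =
        (Real.exp (3 * m - r - 2 * w.re) : ℂ) * exp ((2 : ℤ) * ζ) := by
      have hw : (w.re : ℂ) = (w + starRingEnd ℂ w) / 2 := re_eq_add_conj w
      simp only [ofReal_exp, ← exp_add]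
      push_cast
      rw [hw]
      ring_nf
    have e' : exp ((m : ℂ) / 2) * (Real.exp (3 * m / 2 - r) : ℂ) * exp (ζ - starRingEnd ℂ w) *
        exp (ζ - w + m) =
        (Real.exp (3 * m - r - 2 * w.re) : ℂ) * exp ((2 : ℤ) * ζ) := by
      rw [← e]
      simp only [ofReal_exp, ← exp_add]
      ring_nf
    rw [poleSection, poleSection, add_div, exp_add, add_sub_right_comm, add_sub_right_comm,
      eKern_add_ofReal hm, eKern_add_ofReal hm, eTheta_add_ofReal hm, eTheta_add_ofReal hm]
    push_cast at e e' ⊢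
    linear_combination (-I * exp (ζ / 2) * A * eKern m r (ζ - w) *
      eTheta m (ζ - starRingEnd ℂ w)) * e + (I * exp (ζ / 2) * starRingEnd ℂ A *
      eKern m r (ζ - starRingEnd ℂ w) * eTheta m (ζ - w)) * e'
  exact ⟨hdiff.differentiableOn, hdiff.differentiableOn, fun ζ _ => (mul_one _).symm,
    fun ζ _ _ => hconj ζ, fun ζ _ _ => by rw [hper, hconj], fun ζ _ _ => hquasi ζ,
    fun ζ _ _ => hquasi ζ⟩

variable {m : ℝ} {φ : ℂ → ℂ} {Ω : Set ℂ}

theorem sub_notMem_of_not_samePoint (hm : 0 < m) {z w : ℂ} (hz : z ∈ strip) (hw : w ∈ strip)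
    (h : ¬ SamePoint m z w) : z - w ∉ (periods m hm).lattice := by
  rw [mem_periods_iff hm]
  rintro ⟨k, l, hkl⟩
  have him := congrArg Complex.im hkl
  simp at him
  have hl := int_eq_zero_of_mul_two_pi_lt (l := l) (by linarith [hz.1, hw.2, Real.pi_pos])
    (by linarith [hz.2, hw.1, Real.pi_pos])
  rw [hl] at hkl
  exact h ⟨k, by push_cast at hkl; linear_combination hkl⟩

theorem sub_conj_notMem (hm : 0 < m) {z w : ℂ} (hz : z ∈ strip) (hw : w ∈ strip) :
    z - starRingEnd ℂ w ∉ (periods m hm).lattice := by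
  rw [mem_periods_iff hm]
  rintro ⟨k, l, hkl⟩
  have him := congrArg Complex.im hkl
  simp at him
  have hl := int_eq_zero_of_mul_two_pi_lt (l := l) (by linarith [hz.1, hw.1, Real.pi_pos])
    (by linarith [hz.2, hw.2, Real.pi_pos])
  rw [hl] at him
  simp at him
  linarith [hz.1, hw.1]

theorem zeroFactor_of_mem_strip {w : ℂ} (hw : w ∈ strip) (ζ : ℂ) :
    zeroFactor m w ζ = eTheta m (ζ - w) * eTheta m (ζ - starRingEnd ℂ w) :=
  if_neg fun h => h.elim hw.1.ne' hw.2.ne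

/-- A nowhere vanishing section for the derivative of the uniformization. -/
theorem exists_nonvanishing_section (hm : 0 < m) (hφ : IsUniformization m φ Ω)
    {F : ℂ → ℂ → ℂ} (hF : ∀ z₁ ∈ Ω, IsBVPSolution φ Ω 1 z₁ (F z₁)) :
    ∃ q p, ∃ C : ℝ, IsRealSection m (deriv φ) q p C 0 ∧ 0 < C ∧
      (∀ z : ℂ, -Real.pi < z.im → z.im < Real.pi → q z ≠ 0) ∧
      ∀ z : ℂ, 0 < z.im → z.im < 2 * Real.pi → p z ≠ 0 := by
  have hI : I ∈ strip := ⟨by simp, by simp; linarith [Real.pi_gt_three]⟩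
  obtain ⟨u, v, hs, -, hu⟩ := (hF (φ I) (hφ.mem hI)).exists_section hφ hI hm
  -- The value at the former pole is a nonzero multiple of the residue, so the section does not
  -- vanish identically.
  have hne : ∃ z ∈ strip, u z ≠ 0 := by
    refine ⟨I, hI, ?_⟩
    rw [hu]
    refine mul_ne_zero (mul_ne_zero I_ne_zero (exp_ne_zero _)) (mul_ne_zero (div_ne_zero ?_
      (hφ.deriv_ne_zero hI)) (deriv_zeroFactor_ne_zero hm (strip_subset_closedStrip hI)
      (zeroFactor_self _)))
    simp [Real.pi_ne_zero]
  obtain ⟨q, p, C, N, hqp, -, hq, hp⟩ := hs.exists_nonvanishing hm hφ.continuousOn_deriv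
    (fun z hz => hφ.deriv_ne_zero hz) (neg_ne_zero.2 (by positivity)) hne
  obtain ⟨M, hMc, hM, hMp⟩ := hφ.exists_log_deriv hm
  obtain ⟨hC, rfl⟩ := hqp.degree_eq_zero hMc hM hMp hq hp
  exact ⟨q, p, C, hqp, hC, hq, hp⟩

/-- The explicit solution of the boundary value problem in terms of the kernel. -/
theorem IsBVPSolution.eq_kern (hm : 0 < m) (hφ : IsUniformization m φ Ω) {q p : ℂ → ℂ} {r : ℝ}
    (hqp : IsRealSection m (deriv φ) q p (Real.exp (r - m / 2)) 0)
    (hq : ∀ z : ℂ, -Real.pi < z.im → z.im < Real.pi → q z ≠ 0)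
    (hp : ∀ z : ℂ, 0 < z.im → z.im < 2 * Real.pi → p z ≠ 0)
    {η ζ₁ : ℂ} (hζ₁ : ζ₁ ∈ strip) {F : ℂ → ℂ} (hF : IsBVPSolution φ Ω η (φ ζ₁) F)
    {ζ : ℂ} (hζ : ζ ∈ strip) (hne : ¬ SamePoint m ζ ζ₁) :
    F (φ ζ) = q ζ * (starRingEnd ℂ η * (1 / (Real.pi * I * deriv φ ζ₁ * q ζ₁)) *
      (exp ((ζ - ζ₁) / 2) * kern m r (ζ - ζ₁)) -
      η * starRingEnd ℂ (1 / (Real.pi * I * deriv φ ζ₁ * q ζ₁)) *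
      (exp ((ζ - starRingEnd ℂ ζ₁) / 2) * kern m r (ζ - starRingEnd ℂ ζ₁))) := by
  have hπ := Real.pi_pos
  have hc₁ := strip_subset_closedStrip hζ₁
  have hq₁ : ∀ {z}, z ∈ strip → q z ≠ 0 := fun hz => hq _ (by linarith [hz.1]) hz.2
  have hφ₁ := hφ.deriv_ne_zero hζ₁
  obtain ⟨u, v, hs, hu, hu₁⟩ := hF.exists_section hφ hζ₁ hm
  set A : ℂ := starRingEnd ℂ η * (1 / (Real.pi * I * deriv φ ζ₁ * q ζ₁)) with hA
  have h1 := hs.div hqp (fun z hz => hφ.deriv_ne_zero hz) hq hp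
  have h2 := isRealSection_poleSection hm r A ζ₁
  have hmult : -(Real.exp (m / 2) * Real.exp (2 * m - 2 * ζ₁.re)) / Real.exp (r - m / 2) =
      -Real.exp (3 * m - r - 2 * ζ₁.re) := by
    rw [← Real.exp_add, neg_div, ← Real.exp_sub]
    ring_nf
  rw [hmult, sub_zero] at h1
  have h3 := h1.sub h2
  have hder : deriv (zeroFactor m ζ₁) ζ₁ =
      deriv (theta m) 0 * eTheta m (ζ₁ - starRingEnd ℂ ζ₁) := by
    have hd : ∀ w, HasDerivAt (fun z => eTheta m (z - w)) (deriv (eTheta m) (ζ₁ - w)) ζ₁ :=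
      fun w => ((differentiable_eTheta hm (ζ₁ - w)).hasDerivAt).comp_sub_const ζ₁ w
    have e : zeroFactor m ζ₁ = fun z => eTheta m (z - ζ₁) * eTheta m (z - starRingEnd ℂ ζ₁) := by
      ext z; exact zeroFactor_of_mem_strip hζ₁ z
    rw [e, ((hd ζ₁).fun_mul (hd _)).deriv, sub_self, deriv_eTheta_zero hm]
    simp [eTheta, theta_zero]
  -- The constant `A` is chosen to match the residues at `ζ₁`; the difference is then divisible by
  -- `zeroFactor`.
  have hzero : u ζ₁ / q ζ₁ - poleSection m r A ζ₁ ζ₁ = 0 := by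
    have e0 : eTheta m 0 = 0 := by simp [eTheta, theta_zero]
    rw [hu₁, hder, poleSection, sub_self, eKern_zero hm, e0, hA]
    have := hq₁ hζ₁
    have := I_ne_zero
    have : (Real.pi : ℂ) ≠ 0 := by exact_mod_cast hπ.ne'
    field_simp
    ring
  obtain ⟨u', v', h4, h5, -⟩ := h3.exists_div_zeroFactor hm (w := ζ₁)
    (neg_ne_zero.2 (Real.exp_pos _).ne') continuousOn_const hc₁ (fun _ => hzero)
    (fun _ => by
      have h6 := h3.eq_mul ζ₁ hζ₁
      rw [mul_one] at h6
      rw [h6, hzero]) (Real.exp_pos (2 * m - 2 * ζ₁.re)).ne' (zeroFactor_add_ofReal hm hζ₁)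
  rw [sub_self] at h4
  -- After division the degree is zero and the multiplier still negative, which forces the
  -- difference to vanish.
  have h6 := h4.eq_zero_of_neg hm (div_neg_of_neg_of_pos (neg_lt_zero.2 (Real.exp_pos _))
    (Real.exp_pos _)) hζ
  have h7 := h5 ζ (by linarith [hζ.1]) hζ.2
  rw [h6, zero_mul, sub_eq_zero, div_eq_iff (hq₁ hζ), hu ζ hζ hne, zeroFactor_of_mem_strip hζ₁,
    poleSection, eKern_eq hm r (sub_notMem_of_not_samePoint hm hζ hζ₁ hne),
    eKern_eq hm r (sub_conj_notMem hm hζ hζ₁)] at h7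
  have n1 : eTheta m (ζ - ζ₁) ≠ 0 := by
    rw [Ne, eTheta_eq_zero_iff hm]; exact sub_notMem_of_not_samePoint hm hζ hζ₁ hne
  have n2 : eTheta m (ζ - starRingEnd ℂ ζ₁) ≠ 0 := by
    rw [Ne, eTheta_eq_zero_iff hm]; exact sub_conj_notMem hm hζ hζ₁
  have hAc : starRingEnd ℂ A =
      η * starRingEnd ℂ (1 / (Real.pi * I * deriv φ ζ₁ * q ζ₁)) := by
    rw [hA, map_mul, conj_conj]
  rw [← hAc]
  have n3 := exp_ne_zero (ζ / 2)
  refine mul_right_cancel₀ (mul_ne_zero (mul_ne_zero I_ne_zero n3) (mul_ne_zero n1 n2)) ?_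
  linear_combination h7

theorem signConj_ne_zero {s : Bool} {w : ℂ} (h : w ≠ 0) : signConj s w ≠ 0 := by
  cases s <;> simpa [signConj]

/-- The coupling function is, up to a gauge factor, the kernel. -/
theorem exists_coupling_eq (hm : 0 < m) (hφ : IsUniformization m φ Ω) {f : ℂ → ℂ → ℂ → ℂ}
    (hf : ∀ η : ℂ, ∀ z₁ ∈ Ω, IsBVPSolution φ Ω η z₁ (f η z₁)) :
    ∃ r : ℝ, ∃ g : ℂ → ℂ, (∀ z ∈ strip, g z ≠ 0) ∧ ∀ s₁ s₂ : Bool, ∀ z₁ ∈ strip, ∀ z₂ ∈ strip,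
      ¬ SamePoint m z₂ z₁ → coupling f s₁ s₂ (φ z₁) (φ z₂) * signConj s₂ (deriv φ z₂) =
        2 / (Real.pi * I) * sgn s₂ * (signConj s₂ (g z₂) / signConj s₁ (g z₁)) *
          kern m r (signConj s₂ z₂ - signConj s₁ z₁) := by
  obtain ⟨q, p, C, hqp, hC, hq, hp⟩ := exists_nonvanishing_section hm hφ (hf 1)
  -- The multiplier of `q` fixes the parameter of the kernel, so that `poleSection` has exactly the
  -- multiplier of `u / q`.
  set r : ℝ := m / 2 + Real.log C with hr
  have hCr : C = Real.exp (r - m / 2) := by rw [hr, add_sub_cancel_left, Real.exp_log hC]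
  rw [hCr] at hqp
  have hq₁ : ∀ {z}, z ∈ strip → q z ≠ 0 := fun hz => hq _ (by linarith [hz.1, Real.pi_pos]) hz.2
  refine ⟨r, fun z => q z * deriv φ z * exp (z / 2), fun z hz =>
    mul_ne_zero (mul_ne_zero (hq₁ hz) (hφ.deriv_ne_zero hz)) (exp_ne_zero _), ?_⟩
  intro s₁ s₂ z₁ hz₁ z₂ hz₂ hne
  have hval : ∀ η, _ := fun η =>
    (hf η (φ z₁) (hφ.mem hz₁)).eq_kern hm hφ hqp hq hp hz₁ hz₂ hne
  have hπ : (Real.pi : ℂ) ≠ 0 := by exact_mod_cast Real.pi_ne_zero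
  have hI := I_ne_zero
  have hII := I_mul_I
  have hq1 := hq₁ hz₁
  have hd1 := hφ.deriv_ne_zero hz₁
  have hqc := (map_ne_zero (starRingEnd ℂ)).2 hq1
  have hdc := (map_ne_zero (starRingEnd ℂ)).2 hd1
  -- The combination `f^{[1]} + i f^{[i]}` keeps the part proportional to `η̄` and kills the part
  -- proportional to `η`; in `e2` it is the other way round.
  have e1 : coupling f true true (φ z₁) (φ z₂) = 2 * q z₂ * (1 / (Real.pi * I * deriv φ z₁ * q z₁)) *
      (exp ((z₂ - z₁) / 2) * kern m r (z₂ - z₁)) := by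
    rw [coupling, hval, hval, conj_I, map_one]
    linear_combination (q z₂ * (1 / (Real.pi * I * deriv φ z₁ * q z₁)) *
      (exp ((z₂ - z₁) / 2) * kern m r (z₂ - z₁)) * (-1) - q z₂ * starRingEnd ℂ
      (1 / (Real.pi * I * deriv φ z₁ * q z₁)) * (exp ((z₂ - starRingEnd ℂ z₁) / 2) *
      kern m r (z₂ - starRingEnd ℂ z₁))) * hII
  have e2 : coupling f false true (φ z₁) (φ z₂) =
      -2 * q z₂ * starRingEnd ℂ (1 / (Real.pi * I * deriv φ z₁ * q z₁)) *
      (exp ((z₂ - starRingEnd ℂ z₁) / 2) * kern m r (z₂ - starRingEnd ℂ z₁)) := by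
    rw [coupling, hval, hval, conj_I, map_one]
    linear_combination (q z₂ * (1 / (Real.pi * I * deriv φ z₁ * q z₁)) *
      (exp ((z₂ - z₁) / 2) * kern m r (z₂ - z₁)) + q z₂ * starRingEnd ℂ
      (1 / (Real.pi * I * deriv φ z₁ * q z₁)) * (exp ((z₂ - starRingEnd ℂ z₁) / 2) *
      kern m r (z₂ - starRingEnd ℂ z₁))) * hII
  have e3 : coupling f true false (φ z₁) (φ z₂) =
      starRingEnd ℂ (coupling f false true (φ z₁) (φ z₂)) := rfl
  have e4 : coupling f false false (φ z₁) (φ z₂) =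
      starRingEnd ℂ (coupling f true true (φ z₁) (φ z₂)) := rfl
  have x1 : exp ((z₂ - z₁) / 2) = exp (z₂ / 2) / exp (z₁ / 2) := by rw [sub_div, exp_sub]
  have x2 : exp ((z₂ - starRingEnd ℂ z₁) / 2) = exp (z₂ / 2) / starRingEnd ℂ (exp (z₁ / 2)) := by
    rw [sub_div, exp_sub, ← exp_conj, map_div₀, conj_ofNat]
  have hx := exp_ne_zero (z₁ / 2)
  have hxc := (map_ne_zero (starRingEnd ℂ)).2 hx
  have g1 : coupling f true true (φ z₁) (φ z₂) * deriv φ z₂ = 2 / (Real.pi * I) *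
      (q z₂ * deriv φ z₂ * exp (z₂ / 2) / (q z₁ * deriv φ z₁ * exp (z₁ / 2))) *
      kern m r (z₂ - z₁) := by
    rw [e1, x1]
    field_simp
  have g2 : coupling f false true (φ z₁) (φ z₂) * deriv φ z₂ = 2 / (Real.pi * I) *
      (q z₂ * deriv φ z₂ * exp (z₂ / 2) / starRingEnd ℂ (q z₁ * deriv φ z₁ * exp (z₁ / 2))) *
      kern m r (z₂ - starRingEnd ℂ z₁) := by
    rw [e2, x2]
    simp only [map_div₀, map_mul, map_one, conj_ofReal, conj_I]
    field_simp
  cases s₁ <;> cases s₂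
  · have := congrArg (starRingEnd ℂ) g1
    simp only [signConj, sgn, if_false, Bool.false_eq_true]
    rw [e4, ← map_mul, g1]
    rw [← map_sub, kern_conj hm]
    simp only [map_mul, map_div₀, conj_ofReal, conj_I, conj_ofNat]
    field_simp
  · simp only [signConj, sgn, if_true, if_false, Bool.false_eq_true]
    rw [g2]
    ring
  · simp only [signConj, sgn, if_true, if_false, Bool.false_eq_true]
    rw [e3, ← map_mul, g2]
    have : starRingEnd ℂ z₂ - z₁ = starRingEnd ℂ (z₂ - starRingEnd ℂ z₁) := by simp
    rw [this, kern_conj hm]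
    simp only [map_mul, map_div₀, conj_ofReal, conj_I, conj_ofNat, conj_conj]
    field_simp
  · simp only [signConj, sgn, if_true]
    rw [g1]
    ring

end

section

/-! ### Product measures -/

section product

variable {ι : Type*} [Fintype ι] [DecidableEq ι] {E : Type*} [MeasurableSpace E]
  (ν : Measure E) [IsProbabilityMeasure ν]

/-- Independence in the form of resampling: drawing the coordinates outside `B` from a second copy
does not change the law. Factorization and iterated integration both follow from it. -/
theorem measurePreserving_piecewise (B : Finset ι) :
    MeasurePreserving (fun p : (ι → E) × (ι → E) => B.piecewise p.1 p.2)
      ((Measure.pi fun _ : ι => ν).prod (Measure.pi fun _ : ι => ν)) (Measure.pi fun _ : ι => ν) := by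
  have hmeas : Measurable fun p : (ι → E) × (ι → E) => B.piecewise p.1 p.2 := by
    refine measurable_pi_iff.2 fun i => ?_
    by_cases h : i ∈ B
    · simp only [Finset.piecewise, h, if_true]; fun_prop
    · simp only [Finset.piecewise, h, if_false]; fun_prop
  refine ⟨hmeas, (Measure.pi_eq fun s hs => ?_).symm⟩
  rw [Measure.map_apply hmeas (MeasurableSet.univ_pi hs)]
  have : (fun p : (ι → E) × (ι → E) => B.piecewise p.1 p.2) ⁻¹' univ.pi s =
      (univ.pi fun i => if i ∈ B then s i else univ) ×ˢ
        (univ.pi fun i => if i ∈ B then univ else s i) := by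
    ext p
    simp only [mem_preimage, Set.mem_pi, mem_univ, true_implies, mem_prod, ← forall_and]
    refine forall_congr' fun i => ?_
    by_cases h : i ∈ B <;> simp [Finset.piecewise, h]
  rw [this, Measure.prod_prod, Measure.pi_pi, Measure.pi_pi, ← Finset.prod_mul_distrib]
  refine Finset.prod_congr rfl fun i _ => ?_
  by_cases h : i ∈ B <;> simp [h]

variable [TopologicalSpace E] [SecondCountableTopology E] [BorelSpace E]

/-- Functions of disjoint sets of coordinates are uncorrelated. -/
theorem integral_mul_of_disjoint {f g : (ι → E) → ℂ} (hf : Continuous f) (hg : Continuous g)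
    (B : Finset ι) (hfB : ∀ x y : ι → E, (∀ i ∈ B, x i = y i) → f x = f y)
    (hgB : ∀ x y : ι → E, (∀ i, i ∉ B → x i = y i) → g x = g y) :
    ∫ x, f x * g x ∂(Measure.pi fun _ : ι => ν) =
      (∫ x, f x ∂(Measure.pi fun _ : ι => ν)) * ∫ x, g x ∂(Measure.pi fun _ : ι => ν) := by
  have h := measurePreserving_piecewise (ι := ι) ν B
  have hc : Continuous fun x => f x * g x := hf.mul hg
  rw [← integral_prod_mul f g]
  conv_lhs => rw [← h.map_eq, integral_map h.measurable.aemeasurable hc.aestronglyMeasurable]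
  congr 1
  ext p
  congr 1
  · exact hfB _ _ fun i hi => by simp [Finset.piecewise, hi]
  · exact hgB _ _ fun i hi => by simp [Finset.piecewise, hi]

/-- Integration with respect to one coordinate first. -/
theorem integral_eq_integral_update {f : (ι → E) → ℂ} (hf : Continuous f)
    (hi : Integrable f (Measure.pi fun _ : ι => ν)) (k : ι) :
    ∫ x, f x ∂(Measure.pi fun _ : ι => ν) =
      ∫ x, (∫ a, f (Function.update x k a) ∂ν) ∂(Measure.pi fun _ : ι => ν) := by
  have h := measurePreserving_piecewise (ι := ι) ν ({k}ᶜ)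
  conv_lhs => rw [← h.map_eq, integral_map h.measurable.aemeasurable hf.aestronglyMeasurable]
  rw [integral_prod (fun p : (ι → E) × (ι → E) => f (({k}ᶜ : Finset ι).piecewise p.1 p.2))
    (h.integrable_comp_of_integrable hi)]
  congr 1
  ext x
  have he := measurePreserving_eval (fun _ : ι => ν) k
  conv_rhs => rw [← he.map_eq]
  rw [integral_map he.measurable.aemeasurable]
  · congr 1
    ext y
    congr 1
    ext i
    by_cases h : i = k
    · subst h; simp [Finset.piecewise]
    · simp [Finset.piecewise, h]
  · exact (hf.comp (continuous_const.update k continuous_id)).aestronglyMeasurable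

end product

/-! ### The cube with signs -/

/-- The uniform measure on the two signs. -/
def signMeasure : Measure Bool := (2⁻¹ : ENNReal) • (Measure.dirac true + Measure.dirac false)

instance : IsProbabilityMeasure signMeasure := by
  refine ⟨?_⟩
  simp [signMeasure]
  exact ENNReal.inv_two_add_inv_two

/-- The uniform measure on the unit interval. -/
def unitMeasure : Measure ℝ := volume.restrict (Icc 0 1)

instance : IsProbabilityMeasure unitMeasure := ⟨by simp [unitMeasure]⟩

/-- The uniform measure on pairs of a sign and a point of the unit interval. -/
def signedUnit : Measure (Bool × ℝ) := signMeasure.prod unitMeasure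

instance : IsProbabilityMeasure signedUnit := by unfold signedUnit; infer_instance

/-- The product of the measures `signedUnit`. -/
def signedCube (ι : Type*) [Fintype ι] : Measure (ι → Bool × ℝ) :=
  Measure.pi fun _ => signedUnit

instance (ι : Type*) [Fintype ι] : IsProbabilityMeasure (signedCube ι) := by
  unfold signedCube; infer_instance

theorem signMeasure_real_singleton (s : Bool) : signMeasure.real {s} = 1 / 2 := by
  cases s <;> simp [signMeasure, Measure.real]

theorem integral_signedUnit {F : Bool × ℝ → ℂ} (hF : Integrable F signedUnit) :
    ∫ ω, F ω ∂signedUnit =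
      1 / 2 * ((∫ t in Icc (0 : ℝ) 1, F (true, t)) + ∫ t in Icc (0 : ℝ) 1, F (false, t)) := by
  rw [signedUnit, integral_prod _ hF, integral_fintype (Integrable.of_finite)]
  simp [signMeasure_real_singleton, unitMeasure, mul_add]

section cube

variable {ι : Type} [Fintype ι] [DecidableEq ι]

omit [DecidableEq ι] in
theorem restrict_Icc_eq_pi :
    (volume : Measure (ι → ℝ)).restrict (Icc 0 1) = Measure.pi fun _ => unitMeasure := by
  rw [unitMeasure, ← Measure.restrict_pi_pi, volume_pi]
  congr 1
  rw [Set.pi_univ_Icc]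
  rfl

omit [DecidableEq ι] in
theorem pi_signMeasure_real_singleton (s : ι → Bool) :
    (Measure.pi fun _ : ι => signMeasure).real {s} = (1 / 2) ^ Fintype.card ι := by
  rw [Measure.real, ← Set.univ_pi_singleton, Measure.pi_pi, ENNReal.toReal_prod]
  have : ∀ i, (signMeasure {s i}).toReal = 1 / 2 := fun i => signMeasure_real_singleton _
  simp [this]

/-- Each sign pattern has probability `2⁻ⁿ`, so the sum over signs of integrals over the cube
becomes one expectation under a product measure. -/
theorem integral_signedCube {F : (ι → Bool × ℝ) → ℂ} (hF : Integrable F (signedCube ι)) :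
    (∀ s : ι → Bool, IntegrableOn (fun t : ι → ℝ => F fun k => (s k, t k)) (Icc 0 1)) ∧
    ∫ ω, F ω ∂signedCube ι = (1 / 2) ^ Fintype.card ι * ∑ s : ι → Bool,
      ∫ t in Icc (0 : ι → ℝ) 1, F fun k => (s k, t k) := by
  have h := measurePreserving_arrowProdEquivProdArrow Bool ℝ ι (fun _ => signMeasure)
    (fun _ => unitMeasure)
  have h' := h.symm
  have e : ∀ p, (MeasurableEquiv.arrowProdEquivProdArrow Bool ℝ ι).symm p =
      fun k => (p.1 k, p.2 k) := fun p => rfl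
  have h1 : Integrable (F ∘ (MeasurableEquiv.arrowProdEquivProdArrow Bool ℝ ι).symm)
      ((Measure.pi fun _ : ι => signMeasure).prod (Measure.pi fun _ : ι => unitMeasure)) :=
    (h'.integrable_comp_emb (MeasurableEquiv.measurableEmbedding _)).2 hF
  have h2 : ∫ ω, F ω ∂signedCube ι = ∫ p, (F ∘
      (MeasurableEquiv.arrowProdEquivProdArrow Bool ℝ ι).symm) p
      ∂((Measure.pi fun _ : ι => signMeasure).prod (Measure.pi fun _ : ι => unitMeasure)) :=
    (h'.integral_comp (MeasurableEquiv.measurableEmbedding _) F).symm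
  have h3 := h1.prod_right_ae
  refine ⟨fun s => ?_, ?_⟩
  · rw [IntegrableOn, restrict_Icc_eq_pi]
    have h4 := (ae_iff_of_countable.1 h3) s
    refine h4 ?_
    intro h0
    have := pi_signMeasure_real_singleton s
    rw [Measure.real, h0, ENNReal.toReal_zero] at this
    exact absurd this (by positivity)
  · rw [h2, integral_prod _ h1, integral_fintype (Integrable.of_finite), Finset.mul_sum]
    refine Finset.sum_congr rfl fun s _ => ?_
    rw [pi_signMeasure_real_singleton, restrict_Icc_eq_pi]
    simp [e]

/-- Clamping of the interval coordinates to the unit interval. -/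
def clampUnit (ω : ι → Bool × ℝ) : ι → Bool × ℝ :=
  fun k => ((ω k).1, projIcc (0 : ℝ) 1 zero_le_one (ω k).2)

omit [DecidableEq ι] in
-- A continuous function that only sees clamped times is bounded by its maximum over a compact set,
-- so no support of the measure has to be tracked.
theorem integrable_signedCube {F : (ι → Bool × ℝ) → ℂ} (hF : Continuous F)
    (hc : ∀ ω, F ω = F (clampUnit ω)) : Integrable F (signedCube ι) := by
  have hK : IsCompact (univ.pi fun _ : ι => (univ : Set Bool) ×ˢ Icc (0 : ℝ) 1) :=
    isCompact_univ_pi fun _ => isCompact_univ.prod isCompact_Icc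
  obtain ⟨C, hC⟩ := hK.exists_bound_of_continuousOn hF.continuousOn
  refine Integrable.of_bound hF.aestronglyMeasurable C (Eventually.of_forall fun ω => ?_)
  rw [hc]
  refine hC _ fun k _ => ⟨mem_univ _, ?_⟩
  exact (projIcc (0 : ℝ) 1 zero_le_one (ω k).2).2

end cube

end

section

/-! ### Moments of determinants -/

theorem continuous_signConj (s : Bool) : Continuous (signConj s) := by
  cases s
  · exact continuous_conj.congr fun w => by simp [signConj]
  · exact continuous_id.congr fun w => by simp [signConj]

theorem signConj_mul (s : Bool) (v w : ℂ) : signConj s (v * w) = signConj s v * signConj s w := by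
  cases s <;> simp [signConj]

/-- In the doubled torus a point and the conjugate of another can coincide only on a boundary line,
and there the two original points already coincide on the cylinder. -/
theorem signConj_sub_notMem {m : ℝ} (hm : 0 < m) {z w : ℂ} (hz : z ∈ closedStrip)
    (hw : w ∈ closedStrip) (h : ¬ SamePoint m z w) (s s' : Bool) :
    signConj s z - signConj s' w ∉ (periods m hm).lattice := by
  have hπ := Real.pi_pos
  obtain ⟨hz0, hz1⟩ := hz
  obtain ⟨hw0, hw1⟩ := hw
  rw [mem_periods_iff hm]
  rintro ⟨k, l, hkl⟩
  have hre := congrArg Complex.re hkl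
  have him := congrArg Complex.im hkl
  have hre' : z.re - w.re = k * m := by
    cases s <;> cases s' <;> simpa [signConj] using hre
  suffices him' : z.im = w.im by
    refine h ⟨k, Complex.ext ?_ ?_⟩
    · simp; linarith
    · simp [him']
  have hl1 : (l : ℝ) < 2 ∧ (-2 : ℝ) < l := by
    cases s <;> cases s' <;> simp [signConj] at him <;> constructor <;> nlinarith
  have hl2 : l < 2 ∧ -2 < l := by exact_mod_cast hl1
  obtain rfl | rfl | rfl : l = -1 ∨ l = 0 ∨ l = 1 := by omega
  all_goals
    cases s <;> cases s' <;> simp [signConj] at him <;> linarith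

section moments

variable {m : ℝ} (hm : 0 < m) {ι : Type} [Fintype ι] [DecidableEq ι]
  {x W : ι → Bool × ℝ → ℂ}

/-- The expectation of the determinant at random points `x k` with weights `W k`, `k ∈ X`. -/
def detMoment (m r : ℝ) (x W : ι → Bool × ℝ → ℂ) (X : Finset ι) : ℂ :=
  ∫ ω, (∏ k ∈ X, W k (ω k)) * kernDet m r (fun k => x k (ω k)) X ∂signedCube ι

/-- The expectation of the joint cumulants at random points `x k` with weights `W k`, `k ∈ B`. -/
def cumMoment (r : ℝ) (x W : ι → Bool × ℝ → ℂ) (B : Finset ι) : ℂ :=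
  ∫ ω, (∏ k ∈ B, W k (ω k)) * cum hm r (fun k => x k (ω k)) B ∂signedCube ι

theorem continuousOn_wp : ContinuousOn (wp m hm) ((periods m hm).lattice : Set ℂ)ᶜ :=
  ((periods m hm).differentiableOn_weierstrassP).continuousOn

omit [DecidableEq ι] [Fintype ι] in
theorem continuous_wp_sub (hxc : ∀ k, Continuous (x k))
    (hx : ∀ j k, j ≠ k → ∀ a b, x k a - x j b ∉ (periods m hm).lattice) {j k : ι} (hjk : j ≠ k) :
    Continuous fun ω : ι → Bool × ℝ => wp m hm (x k (ω k) - x j (ω j)) :=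
  (continuousOn_wp hm).comp_continuous (by fun_prop) fun ω => hx j k hjk _ _

theorem continuous_kernDet (hxc : ∀ k, Continuous (x k))
    (hx : ∀ j k, j ≠ k → ∀ a b, x k a - x j b ∉ (periods m hm).lattice) (r : ℝ) (X : Finset ι) :
    Continuous fun ω : ι → Bool × ℝ => kernDet m r (fun k => x k (ω k)) X := by
  refine Continuous.matrix_det (continuous_matrix fun j k => ?_)
  simp only [kernMatrix, Matrix.of_apply]
  split_ifs with h1 h2 h3
  · exact continuous_const
  · rw [continuous_iff_continuousAt]
    intro ω
    exact (differentiableAt_kern hm r (hx j k h2 _ _)).continuousAt.comp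
      (f := fun ω : ι → Bool × ℝ => x k (ω k) - x j (ω j))
      (((hxc k).comp (continuous_apply k)).sub
        ((hxc j).comp (continuous_apply j))).continuousAt
  · exact continuous_const
  · exact continuous_const

omit [Fintype ι] in
theorem continuous_cum (hxc : ∀ k, Continuous (x k))
    (hx : ∀ j k, j ≠ k → ∀ a b, x k a - x j b ∉ (periods m hm).lattice) (r : ℝ) (B : Finset ι) :
    Continuous fun ω : ι → Bool × ℝ => cum hm r (fun k => x k (ω k)) B := by
  unfold cum pairSum
  split_ifs with h
  · refine continuous_const.add (continuous_const.mul (continuous_finsetSum _ fun j hj =>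
      continuous_finsetSum _ fun k hk => ?_))
    exact continuous_wp_sub hm hxc hx (Finset.ne_of_mem_erase hk).symm
  · exact continuous_const

theorem kernDet_congr (r : ℝ) {x y : ι → ℂ} {X : Finset ι} (h : ∀ k ∈ X, x k = y k) :
    kernDet m r x X = kernDet m r y X := by
  unfold kernDet
  congr 1
  ext j k
  simp only [kernMatrix, Matrix.of_apply]
  split_ifs with h1
  · rfl
  · rw [h j h1.1, h k h1.2]
  · rfl
  · rfl

omit [Fintype ι] in
theorem cum_congr (r : ℝ) {x y : ι → ℂ} {B : Finset ι} (h : ∀ k ∈ B, x k = y k) :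
    cum hm r x B = cum hm r y B := by
  unfold cum pairSum
  split_ifs
  · congr 2
    refine Finset.sum_congr rfl fun j hj => Finset.sum_congr rfl fun k hk => ?_
    beta_reduce
    rw [h j hj, h k (Finset.mem_of_mem_erase hk)]
  · rfl

theorem detMoment_empty (r : ℝ) : detMoment m r x W ∅ = 1 := by
  simp [detMoment, kernDet_empty]

/-- In the pointwise recursion each summand is a product of functions of disjoint groups of
independent points, so its expectation factorizes. -/
theorem detMoment_insert (hxc : ∀ k, Continuous (x k)) (hWc : ∀ k, Continuous (W k))
    (hx : ∀ j k, j ≠ k → ∀ a b, x k a - x j b ∉ (periods m hm).lattice)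
    (hxp : ∀ k s t, x k (s, projIcc (0 : ℝ) 1 zero_le_one t) = x k (s, t))
    (hWp : ∀ k s t, W k (s, projIcc (0 : ℝ) 1 zero_le_one t) = W k (s, t))
    (r : ℝ) {X : Finset ι} {y : ι} (hy : y ∉ X) :
    detMoment m r x W (insert y X) =
      ∑ B ∈ X.powerset, cumMoment hm r x W (insert y B) * detMoment m r x W (X \ B) := by
  have cW : ∀ B : Finset ι, Continuous fun ω : ι → Bool × ℝ => ∏ k ∈ B, W k (ω k) := fun B =>
    continuous_finsetProd _ fun k _ => (hWc k).comp (continuous_apply k)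
  have c1 : ∀ B, Continuous fun ω : ι → Bool × ℝ =>
      (∏ k ∈ B, W k (ω k)) * cum hm r (fun k => x k (ω k)) B :=
    fun B => (cW B).mul (continuous_cum hm hxc hx r B)
  have c2 : ∀ B, Continuous fun ω : ι → Bool × ℝ =>
      (∏ k ∈ B, W k (ω k)) * kernDet m r (fun k => x k (ω k)) B :=
    fun B => (cW B).mul (continuous_kernDet hm hxc hx r B)
  have key : ∀ ω : ι → Bool × ℝ,
      (∏ k ∈ insert y X, W k (ω k)) * kernDet m r (fun k => x k (ω k)) (insert y X) =
      ∑ B ∈ X.powerset, ((∏ k ∈ insert y B, W k (ω k)) * cum hm r (fun k => x k (ω k)) (insert y B)) *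
        ((∏ k ∈ X \ B, W k (ω k)) * kernDet m r (fun k => x k (ω k)) (X \ B)) := by
    intro ω
    rw [kernDet_insert_eq_sum hm (fun j k h => hx j k h _ _) r hy, Finset.mul_sum]
    refine Finset.sum_congr rfl fun B hB => ?_
    have hBX := Finset.mem_powerset.1 hB
    rw [Finset.prod_insert hy, Finset.prod_insert fun h => hy (hBX h),
      ← Finset.prod_sdiff hBX]
    ring
  rw [detMoment]
  simp_rw [key]
  rw [integral_finsetSum]
  · refine Finset.sum_congr rfl fun B hB => ?_
    have hBX := Finset.mem_powerset.1 hB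
    refine integral_mul_of_disjoint signedUnit (c1 _) (c2 _) (insert y B) ?_ ?_
    · intro ω ω' h
      rw [Finset.prod_congr rfl fun k hk => by rw [h k hk],
        cum_congr hm r fun k hk => by rw [h k hk]]
    · intro ω ω' h
      have h' : ∀ k ∈ X \ B, ω k = ω' k := fun k hk => by
        rw [Finset.mem_sdiff] at hk
        refine h k fun hk' => ?_
        rcases Finset.mem_insert.1 hk' with rfl | hk'
        · exact hy hk.1
        · exact hk.2 hk'
      rw [Finset.prod_congr rfl fun k hk => by rw [h' k hk],
        kernDet_congr r fun k hk => by rw [h' k hk]]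
  · intro B _
    refine integrable_signedCube ((c1 _).mul (c2 _)) fun ω => ?_
    simp only [clampUnit, hxp, hWp]

theorem integral_prod_signedCube (W : ι → Bool × ℝ → ℂ) (B : Finset ι) :
    ∫ ω, ∏ k ∈ B, W k (ω k) ∂signedCube ι = ∏ k ∈ B, ∫ ω, W k ω ∂signedUnit := by
  have h := integral_fintype_prod_eq_prod (𝕜 := ℂ) (μ := fun _ : ι => signedUnit)
    (fun k ω => if k ∈ B then W k ω else 1)
  have e : ∀ ω : ι → Bool × ℝ, ∏ k, (if k ∈ B then W k (ω k) else 1) = ∏ k ∈ B, W k (ω k) :=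
    fun ω => by rw [Finset.prod_ite_mem, Finset.univ_inter]
  simp_rw [e] at h
  rw [signedCube, h]
  trans ∏ k, if k ∈ B then ∫ ω, W k ω ∂signedUnit else 1
  · refine Finset.prod_congr rfl fun k _ => ?_
    split_ifs <;> simp
  · rw [Finset.prod_ite_mem, Finset.univ_inter]

/-- Away from pairs the cumulant does not depend on the points, and only the weights are integrated.
-/
theorem cumMoment_of_card_ne_two (r : ℝ) {B : Finset ι} (hB : B.card ≠ 2) :
    cumMoment hm r x W B = cumCoeff hm r B.card * ∏ k ∈ B, ∫ ω, W k ω ∂signedUnit := by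
  rw [cumMoment]
  simp only [cum, pairSum, if_neg hB, add_zero]
  rw [integral_mul_const, integral_prod_signedCube, mul_comm]

end moments

end

section

/-! ### Integration along paths -/

/-- The point at time `t` of a path or of its complex conjugate, extended by constants. -/
def extPoint (γ : ℝ → ℂ) (ω : Bool × ℝ) : ℂ :=
  signConj ω.1 (γ (projIcc (0 : ℝ) 1 zero_le_one ω.2))

/-- The velocity of a path or of its complex conjugate, with sign and normalization. -/
def extWeight (γ : ℝ → ℂ) (ω : Bool × ℝ) : ℂ :=
  1 / (Real.pi * I) * sgn ω.1 *
    signConj ω.1 (derivWithin γ (Icc 0 1) (projIcc (0 : ℝ) 1 zero_le_one ω.2))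

theorem continuous_of_sections {F : Bool × ℝ → ℂ} (h : ∀ s, Continuous fun t => F (s, t)) :
    Continuous F := continuous_prod_of_discrete_left.2 h

theorem integrable_signedUnit {F : Bool × ℝ → ℂ} (hF : Continuous F)
    (hc : ∀ s t, F (s, projIcc (0 : ℝ) 1 zero_le_one t) = F (s, t)) : Integrable F signedUnit := by
  have hK : IsCompact ((univ : Set Bool) ×ˢ Icc (0 : ℝ) 1) := isCompact_univ.prod isCompact_Icc
  obtain ⟨C, hC⟩ := hK.exists_bound_of_continuousOn hF.continuousOn
  refine Integrable.of_bound hF.aestronglyMeasurable C (Eventually.of_forall fun ω => ?_)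
  rw [← hc]
  exact hC _ ⟨mem_univ _, (projIcc (0 : ℝ) 1 zero_le_one ω.2).2⟩

theorem hasDerivAt_signConj {γ : ℝ → ℂ} {γ' : ℂ} {t : ℝ} (h : HasDerivAt γ γ' t) (s : Bool) :
    HasDerivAt (fun t => signConj s (γ t)) (signConj s γ') t := by
  cases s
  · change HasDerivAt (fun t => starRingEnd ℂ (γ t)) (starRingEnd ℂ γ') t
    exact (conjCLE : ℂ →L[ℝ] ℂ).hasFDerivAt.comp_hasDerivAt t h
  · simpa [signConj] using h

/-- The derivative of the logarithm of the absolute value. -/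
theorem hasDerivAt_log_norm {g : ℝ → ℂ} {g' : ℂ} {t : ℝ} (h : HasDerivAt g g' t) (h0 : g t ≠ 0) :
    HasDerivAt (fun s => Real.log ‖g s‖) (g' / g t).re t := by
  have h1 : HasDerivAt (fun s => g s / g t) (g' / g t) t := h.div_const _
  have h2 := h1.clog_real (by rw [div_self h0]; exact one_mem_slitPlane)
  rw [div_self h0, div_one] at h2
  have h3 := (reCLM.hasFDerivAt.comp_hasDerivAt t h2).add_const (Real.log ‖g t‖)
  refine h3.congr_of_eventuallyEq ?_
  filter_upwards [h.continuousAt.eventually_ne h0] with s hs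
  simp only [Function.comp_apply, reCLM_apply, log_re, norm_div]
  rw [Real.log_div (norm_ne_zero_iff.2 hs) (norm_ne_zero_iff.2 h0)]
  ring

/-! ### The expected weight along a single path. -/

section path

variable {γ : ℝ → ℂ} (hγ : ContDiffOn ℝ 1 γ (Icc 0 1))
include hγ

theorem hasDerivAt_of_contDiffOn {t : ℝ} (ht : t ∈ Ioo (0 : ℝ) 1) :
    HasDerivAt γ (derivWithin γ (Icc 0 1) t) t :=
  ((hγ.differentiableOn (by simp)) t (Ioo_subset_Icc_self ht)).hasDerivWithinAt.hasDerivAt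
    (Icc_mem_nhds ht.1 ht.2)

theorem continuous_comp_projIcc : Continuous fun t => γ (projIcc (0 : ℝ) 1 zero_le_one t) :=
  hγ.continuousOn.comp_continuous (continuous_subtype_val.comp continuous_projIcc)
    fun t => (projIcc (0 : ℝ) 1 zero_le_one t).2

theorem continuous_extPoint : Continuous (extPoint γ) :=
  continuous_of_sections fun s => (continuous_signConj s).comp (continuous_comp_projIcc hγ)

theorem continuous_extWeight : Continuous (extWeight γ) := by
  refine continuous_of_sections fun s => Continuous.mul (f := fun _ : ℝ => 1 / (Real.pi * I) * sgn s)
    (g := fun t => signConj s (derivWithin γ (Icc 0 1) (projIcc (0 : ℝ) 1 zero_le_one t)))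
    continuous_const ((continuous_signConj s).comp ?_)
  exact (hγ.continuousOn_derivWithin (uniqueDiffOn_Icc zero_lt_one) le_rfl).comp_continuous
    (continuous_subtype_val.comp continuous_projIcc) fun t => (projIcc (0 : ℝ) 1 zero_le_one t).2

omit hγ in
theorem extPoint_projIcc (s : Bool) (t : ℝ) :
    extPoint γ (s, projIcc (0 : ℝ) 1 zero_le_one t) = extPoint γ (s, t) := by
  simp only [extPoint, projIcc_val]

omit hγ in
theorem extWeight_projIcc (s : Bool) (t : ℝ) :
    extWeight γ (s, projIcc (0 : ℝ) 1 zero_le_one t) = extWeight γ (s, t) := by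
  simp only [extWeight, projIcc_val]

omit hγ in
theorem extPoint_of_mem (s : Bool) {t : ℝ} (ht : t ∈ Icc (0 : ℝ) 1) :
    extPoint γ (s, t) = signConj s (γ t) := by
  rw [extPoint, projIcc_of_mem zero_le_one ht]

omit hγ in
theorem extWeight_of_mem (s : Bool) {t : ℝ} (ht : t ∈ Icc (0 : ℝ) 1) :
    extWeight γ (s, t) = 1 / (Real.pi * I) * sgn s * signConj s (derivWithin γ (Icc 0 1) t) := by
  rw [extWeight, projIcc_of_mem zero_le_one ht]

/-- The fundamental theorem of calculus along a path and its complex conjugate. -/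
theorem integral_extWeight_mul {H H' : ℂ → ℂ}
    (hH : ∀ s, ∀ t ∈ Icc (0 : ℝ) 1, HasDerivAt H (H' (signConj s (γ t))) (signConj s (γ t)))
    (hc : Continuous fun ω => H' (extPoint γ ω)) :
    ∫ ω, extWeight γ ω * H' (extPoint γ ω) ∂signedUnit = 1 / (2 * Real.pi * I) *
      ((H (γ 1) - H (γ 0)) - (H (starRingEnd ℂ (γ 1)) - H (starRingEnd ℂ (γ 0)))) := by
  have hF : Continuous fun ω => extWeight γ ω * H' (extPoint γ ω) :=
    (continuous_extWeight hγ).mul hc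
  rw [integral_signedUnit (integrable_signedUnit hF fun s t => by
    simp only [extPoint_projIcc, extWeight_projIcc])]
  have key : ∀ s, ∫ t in Icc (0 : ℝ) 1, extWeight γ (s, t) * H' (extPoint γ (s, t)) =
      1 / (Real.pi * I) * sgn s * (H (signConj s (γ 1)) - H (signConj s (γ 0))) := by
    intro s
    rw [integral_Icc_eq_integral_Ioc, ← intervalIntegral.integral_of_le zero_le_one]
    have hcont : ContinuousOn (fun t => H (signConj s (γ t))) (Icc 0 1) := fun t ht =>
      ContinuousAt.comp_continuousWithinAt (f := fun t => signConj s (γ t))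
        (hH s t ht).continuousAt
        (((continuous_signConj s).comp_continuousOn hγ.continuousOn) t ht)
    have hFs : Continuous fun t => extWeight γ (s, t) * H' (extPoint γ (s, t)) :=
      hF.comp (by fun_prop)
    have := intervalIntegral.integral_eq_sub_of_hasDeriv_right (a := 0) (b := 1)
      (f := fun t => 1 / (Real.pi * I) * sgn s * H (signConj s (γ t)))
      (f' := fun t => extWeight γ (s, t) * H' (extPoint γ (s, t)))
      (by rw [uIcc_of_le zero_le_one]; exact continuousOn_const.mul hcont)
      (fun t ht => by
        rw [min_eq_left zero_le_one, max_eq_right zero_le_one] at ht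
        have ht' := Ioo_subset_Icc_self ht
        have h1 := (hH s t ht').comp t (hasDerivAt_signConj (hasDerivAt_of_contDiffOn hγ ht) s)
        refine (h1.const_mul (1 / (Real.pi * I) * sgn s)).hasDerivWithinAt.congr_deriv ?_
        rw [extWeight_of_mem s ht', extPoint_of_mem s ht']
        ring) (hFs.intervalIntegrable _ _)
    rw [this]
    ring
  rw [key, key]
  simp only [sgn, signConj, if_true, if_false, Bool.false_eq_true]
  have := I_ne_zero
  have : (Real.pi : ℂ) ≠ 0 := by exact_mod_cast Real.pi_ne_zero
  field_simp
  ring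

/-- With the signs, the two conjugate paths contribute `(γ 1 - conj (γ 1)) / (2πi) = Im (γ 1) / π`;
the starting point cancels because it is real. -/
theorem integral_extWeight (h0 : (γ 0).im = 0) :
    ∫ ω, extWeight γ ω ∂signedUnit = (hmTop (γ 1) : ℂ) := by
  have h := integral_extWeight_mul hγ (H := fun z => z) (H' := fun _ => 1)
    (fun s t _ => hasDerivAt_id' _) continuous_const
  simp only [mul_one] at h
  have e0 : starRingEnd ℂ (γ 0) = γ 0 := conj_eq_iff_im.2 h0
  have e1 : γ 1 - starRingEnd ℂ (γ 1) = 2 * (γ 1).im * I := by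
    rw [sub_conj]; push_cast; ring
  rw [h, e0, hmTop]
  have := I_ne_zero
  have hπ : (Real.pi : ℂ) ≠ 0 := by exact_mod_cast Real.pi_ne_zero
  push_cast
  field_simp
  linear_combination e1

end path

/-- The regularized Green's function with zero boundary values, up to normalization. -/
def pairLog (m : ℝ) (z w : ℂ) : ℝ :=
  Real.log ‖theta m (w - z)‖ - Real.log ‖theta m (starRingEnd ℂ w - z)‖

/-! ### The double integral of the pair term. -/

section pair

variable {m : ℝ} (hm : 0 < m)

include hm in
theorem norm_theta_conj_sub (z w : ℂ) :
    ‖theta m (starRingEnd ℂ w - z)‖ = ‖theta m (w - starRingEnd ℂ z)‖ := by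
  have : starRingEnd ℂ w - z = starRingEnd ℂ (w - starRingEnd ℂ z) := by simp
  rw [this, theta_conj hm, Complex.norm_conj]

theorem norm_theta_sub_comm (z w : ℂ) : ‖theta m (w - z)‖ = ‖theta m (z - w)‖ := by
  rw [← neg_sub z w, theta_neg, norm_neg]

include hm in
theorem pairLog_comm (z w : ℂ) : pairLog m z w = pairLog m w z := by
  rw [pairLog, pairLog, norm_theta_sub_comm z w, norm_theta_conj_sub hm,
    norm_theta_sub_comm (starRingEnd ℂ z)]

include hm in
theorem pairLog_of_im_eq_zero {z : ℂ} (hz : z.im = 0) (w : ℂ) : pairLog m z w = 0 := by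
  rw [pairLog, norm_theta_conj_sub hm, conj_eq_iff_im.2 hz, sub_self]

/-- On the top line `w̄ + 2πi = w`, and adding `2πi` only changes the sign of `theta`. -/
theorem pairLog_of_im_eq_pi {w : ℂ} (hw : w.im = Real.pi) (z : ℂ) : pairLog m z w = 0 := by
  have : starRingEnd ℂ w + 2 * Real.pi * I = w := by
    apply Complex.ext <;> simp [hw]; ring
  rw [pairLog, ← norm_neg (theta m (starRingEnd ℂ w - z)), ← theta_add_two_pi_I]
  have e : starRingEnd ℂ w - z + 2 * Real.pi * I = w - z := by linear_combination this
  rw [e, sub_self]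

/-- The two conjugate paths combine to twice a real part, which is the derivative of `-pairLog`
along `γ`. No branch of `log θ` is needed, and the value at the real starting point is zero. -/
theorem integral_extWeight_mul_thetaLog {γ : ℝ → ℂ} (hγ : ContDiffOn ℝ 1 γ (Icc 0 1))
    (h0 : (γ 0).im = 0) {w : ℂ} (h : ∀ s s', ∀ t ∈ Icc (0 : ℝ) 1,
      signConj s' w - signConj s (γ t) ∉ (periods m hm).lattice) :
    ∫ ω, extWeight γ ω * (thetaLog m (w - extPoint γ ω) -
      thetaLog m (starRingEnd ℂ w - extPoint γ ω)) ∂signedUnit =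
      -(1 / (Real.pi * I)) * pairLog m (γ 1) w := by
  have hext : ∀ s' ω, signConj s' w - extPoint γ ω ∉ (periods m hm).lattice := fun s' ω =>
    h ω.1 s' _ (projIcc (0 : ℝ) 1 zero_le_one ω.2).2
  have hcl : ∀ s', Continuous fun ω => thetaLog m (signConj s' w - extPoint γ ω) := fun s' =>
    continuous_iff_continuousAt.2 fun ω => (analyticAt_thetaLog hm (hext s' ω)).continuousAt.comp
      (f := fun ω => signConj s' w - extPoint γ ω)
      (continuous_const.sub (continuous_extPoint hγ)).continuousAt
  have hF : Continuous fun ω => extWeight γ ω * (thetaLog m (w - extPoint γ ω) -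
      thetaLog m (starRingEnd ℂ w - extPoint γ ω)) :=
    (continuous_extWeight hγ).mul ((hcl true).sub (hcl false))
  have hi := integrable_signedUnit hF fun s t => by simp only [extPoint_projIcc, extWeight_projIcc]
  rw [integral_signedUnit hi]
  have hint : ∀ s, IntegrableOn (fun t => extWeight γ (s, t) * (thetaLog m (w - extPoint γ (s, t)) -
      thetaLog m (starRingEnd ℂ w - extPoint γ (s, t)))) (Icc 0 1) := fun s =>
    (hF.comp (by fun_prop : Continuous fun t : ℝ => (s, t))).integrableOn_Icc
  rw [← integral_add (hint true) (hint false)]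
  -- Conjugation exchanges the two values of `thetaLog`, and this sign compensates the sign in the
  -- weight. So, apart from the common factor `1/(πi)`, the summands are conjugate.
  have hreal : ∀ t ∈ Icc (0 : ℝ) 1, extWeight γ (true, t) * (thetaLog m (w - extPoint γ (true, t)) -
      thetaLog m (starRingEnd ℂ w - extPoint γ (true, t))) +
      extWeight γ (false, t) * (thetaLog m (w - extPoint γ (false, t)) -
      thetaLog m (starRingEnd ℂ w - extPoint γ (false, t))) = 1 / (Real.pi * I) * 2 *
      (((derivWithin γ (Icc 0 1) t * (thetaLog m (w - γ t) -
        thetaLog m (starRingEnd ℂ w - γ t))).re : ℝ) : ℂ) := by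
    intro t ht
    rw [extWeight_of_mem _ ht, extWeight_of_mem _ ht, extPoint_of_mem _ ht, extPoint_of_mem _ ht,
      re_eq_add_conj]
    have e1 : thetaLog m (w - starRingEnd ℂ (γ t)) =
        starRingEnd ℂ (thetaLog m (starRingEnd ℂ w - γ t)) := by
      rw [← thetaLog_conj hm]; simp
    have e2 : thetaLog m (starRingEnd ℂ w - starRingEnd ℂ (γ t)) =
        starRingEnd ℂ (thetaLog m (w - γ t)) := by
      rw [← thetaLog_conj hm]; simp
    simp only [sgn, signConj, if_true, if_false, Bool.false_eq_true]
    rw [e1, e2]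
    simp only [map_mul, map_sub]
    ring
  rw [setIntegral_congr_fun measurableSet_Icc hreal, integral_const_mul, integral_complex_ofReal]
  have hderiv : ∀ s', ∀ t ∈ Icc (0 : ℝ) 1, theta m (signConj s' w - γ t) ≠ 0 := fun s' t ht =>
    theta_ne_zero hm (h true s' t ht)
  have hL : ∀ s', ∀ t ∈ Ioo (0 : ℝ) 1,
      HasDerivAt (fun t => Real.log ‖theta m (signConj s' w - γ t)‖)
      (-(derivWithin γ (Icc 0 1) t * thetaLog m (signConj s' w - γ t)).re) t := by
    intro s' t ht
    have h1 := (differentiable_theta hm (signConj s' w - γ t)).hasDerivAt.comp t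
      ((hasDerivAt_of_contDiffOn hγ ht).const_sub (signConj s' w))
    refine (hasDerivAt_log_norm h1 (hderiv s' t (Ioo_subset_Icc_self ht))).congr_deriv ?_
    rw [← neg_re, Function.comp_apply, thetaLog]
    congr 1
    ring
  have hLc : ∀ s', ContinuousOn (fun t => Real.log ‖theta m (signConj s' w - γ t)‖) (Icc 0 1) :=
    fun s' => ContinuousOn.log (((differentiable_theta hm).continuous.comp_continuousOn
      (continuousOn_const.sub hγ.continuousOn)).norm) fun t ht =>
        norm_ne_zero_iff.2 (hderiv s' t ht)
  have hR : Continuous fun t => (extWeight γ (true, t) * (thetaLog m (w - extPoint γ (true, t)) -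
      thetaLog m (starRingEnd ℂ w - extPoint γ (true, t))) * (Real.pi * I)).re := by
    have : Continuous fun t : ℝ => ((true, t) : Bool × ℝ) := by fun_prop
    exact continuous_re.comp ((hF.comp this).mul continuous_const)
  have hcongr : EqOn (fun t => (derivWithin γ (Icc 0 1) t * (thetaLog m (w - γ t) -
        thetaLog m (starRingEnd ℂ w - γ t))).re) (fun t => (extWeight γ (true, t) *
        (thetaLog m (w - extPoint γ (true, t)) -
      thetaLog m (starRingEnd ℂ w - extPoint γ (true, t))) * (Real.pi * I)).re) (Icc 0 1) := by
    intro t ht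
    beta_reduce
    rw [extWeight_of_mem _ ht, extPoint_of_mem _ ht]
    congr 1
    simp only [sgn, signConj, if_true]
    have := I_ne_zero
    have : (Real.pi : ℂ) ≠ 0 := by exact_mod_cast Real.pi_ne_zero
    field_simp
  have hmain : ∫ t in Icc (0 : ℝ) 1, (derivWithin γ (Icc 0 1) t * (thetaLog m (w - γ t) -
        thetaLog m (starRingEnd ℂ w - γ t))).re = -pairLog m (γ 1) w := by
    rw [setIntegral_congr_fun measurableSet_Icc hcongr, integral_Icc_eq_integral_Ioc,
      ← intervalIntegral.integral_of_le zero_le_one]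
    have := intervalIntegral.integral_eq_sub_of_hasDeriv_right (a := 0) (b := 1)
      (f := fun t => -pairLog m (γ t) w)
      (f' := fun t => (extWeight γ (true, t) *
        (thetaLog m (w - extPoint γ (true, t)) -
      thetaLog m (starRingEnd ℂ w - extPoint γ (true, t))) * (Real.pi * I)).re)
      (by rw [uIcc_of_le zero_le_one]; exact ((hLc true).sub (hLc false)).neg)
      (fun t ht => by
        rw [min_eq_left zero_le_one, max_eq_right zero_le_one] at ht
        refine ((hL true t ht).fun_sub (hL false t ht)).fun_neg.hasDerivWithinAt.congr_deriv ?_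
        refine Eq.trans ?_ (hcongr (Ioo_subset_Icc_self ht))
        simp only [signConj, if_true, if_false, Bool.false_eq_true, mul_sub, sub_re]
        ring) (hR.intervalIntegrable _ _)
    rw [this, pairLog_of_im_eq_zero hm h0]
    ring
  rw [hmain]
  push_cast
  ring

end pair

end

section

/-! ### Moments and cumulants -/

section corrSum

variable {ι : Type} [DecidableEq ι]

/-- The moments with given cumulants. -/
def corrSum (κ : Finset ι → ℂ) (s : Finset ι) : ℂ :=
  ∑ P : Finpartition s, ∏ B ∈ P.parts, κ B

theorem corrSum_empty (κ : Finset ι → ℂ) : corrSum κ ∅ = 1 := by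
  have : ∀ P : Finpartition (∅ : Finset ι), P.parts = ∅ := fun P => P.parts_eq_empty_iff.2 rfl
  rw [corrSum]
  simp only [this, Finset.prod_empty, Finset.sum_const, Finset.card_univ]
  have e : Fintype.card (Finpartition (∅ : Finset ι)) = 1 :=
    Fintype.card_eq_one_iff.2 ⟨Finpartition.empty _, fun P => Finpartition.ext (by rw [this, this])⟩
  simp [e]

/-- Partitions are sorted by the block that contains `y`, which is `insert y B`; the rest is a
partition of `X \ B`. -/
theorem corrSum_insert (κ : Finset ι → ℂ) {X : Finset ι} {y : ι} (hy : y ∉ X) :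
    corrSum κ (insert y X) = ∑ B ∈ X.powerset, κ (insert y B) * corrSum κ (X \ B) := by
  have hnot : ∀ {B : Finset ι} (Q : Finpartition (X \ B)) {C : Finset ι}, C ∈ Q.parts → y ∉ C :=
    fun Q C hC h => hy (Finset.mem_sdiff.1 (Q.le hC h)).1
  have hyB : ∀ {B : Finset ι}, B ∈ X.powerset → y ∉ B :=
    fun hB h => hy (Finset.mem_powerset.1 hB h)
  simp only [corrSum, Finset.mul_sum]
  rw [← Finset.sum_sigma X.powerset (fun _ => Finset.univ)
    (fun p : Σ B : Finset ι, Finpartition (X \ B) => κ (insert y p.1) * ∏ B ∈ p.2.parts, κ B)]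
  symm
  refine Finset.sum_bij (fun p hp => p.2.extend (b := insert y p.1) (c := insert y X)
    (Finset.insert_ne_empty _ _) ?_ ?_) (fun _ _ => Finset.mem_univ _) ?_ ?_ ?_
  · rw [Finset.disjoint_insert_right]
    exact ⟨fun h => hy (Finset.mem_sdiff.1 h).1, Finset.sdiff_disjoint⟩
  · have hB := Finset.mem_powerset.1 (Finset.mem_sigma.1 hp).1
    ext a
    have := @hB a
    simp only [Finset.sup_eq_union, Finset.mem_union, Finset.mem_sdiff, Finset.mem_insert]
    tauto
  · rintro ⟨B, Q⟩ hp ⟨B', Q'⟩ hp' h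
    have h1 := congrArg Finpartition.parts h
    simp only [Finpartition.extend] at h1
    have hB : y ∉ B := hyB (Finset.mem_sigma.1 hp).1
    have hB' : y ∉ B' := hyB (Finset.mem_sigma.1 hp').1
    have h2 : insert y B ∈ insert (insert y B') Q'.parts := h1 ▸ Finset.mem_insert_self _ _
    have h3 : insert y B = insert y B' := (Finset.mem_insert.1 h2).resolve_right fun h =>
      hnot Q' h (Finset.mem_insert_self _ _)
    have h4 : B = B' := by
      rw [← Finset.erase_insert hB, h3, Finset.erase_insert hB']
    subst h4
    have hn : ∀ Q : Finpartition (X \ B), insert y B ∉ Q.parts := fun Q h =>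
      hnot Q h (Finset.mem_insert_self _ _)
    have h5 : Q = Q' := Finpartition.ext (by
      rw [← Finset.erase_insert (hn Q), h1, Finset.erase_insert (hn Q')])
    rw [h5]
  · intro P _
    obtain ⟨C, ⟨hC, hyC⟩, huniq⟩ := P.existsUnique_mem (Finset.mem_insert_self y X)
    have hsup : (P.parts.erase C).sup id = X \ C.erase y := by
      ext a
      simp only [Finset.mem_sup, Finset.mem_erase, id, Finset.mem_sdiff]
      constructor
      · rintro ⟨D, ⟨h1, h2⟩, h3⟩
        have hd : Disjoint D C := P.disjoint h2 hC h1
        have hay : a ≠ y := by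
          rintro rfl
          exact Finset.disjoint_left.1 hd h3 hyC
        exact ⟨(Finset.mem_insert.1 (P.le h2 h3)).resolve_left hay,
          fun h => Finset.disjoint_left.1 hd h3 h.2⟩
      · rintro ⟨h1, h2⟩
        obtain ⟨D, ⟨hD, haD⟩, -⟩ := P.existsUnique_mem (Finset.mem_insert_of_mem (a := a) (b := y) h1)
        refine ⟨D, ⟨?_, hD⟩, haD⟩
        rintro rfl
        exact h2 ⟨fun h => hy (h ▸ h1), haD⟩
    refine ⟨⟨C.erase y, P.ofSubset (Finset.erase_subset _ _) hsup⟩, ?_, ?_⟩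
    · refine Finset.mem_sigma.2 ⟨Finset.mem_powerset.2 fun a ha => ?_, Finset.mem_univ _⟩
      exact (Finset.mem_insert.1 (P.le hC (Finset.mem_of_mem_erase ha))).resolve_left
        (Finset.ne_of_mem_erase ha)
    · refine Finpartition.ext ?_
      simp only [Finpartition.extend, Finpartition.ofSubset_parts, Finset.insert_erase hyC,
        Finset.insert_erase hC]
  · rintro ⟨B, Q⟩ hp
    simp only [Finpartition.extend]
    rw [Finset.prod_insert fun h => hnot Q h (Finset.mem_insert_self _ _)]

/-- The recursion of moments and cumulants determines the moments. -/
theorem eq_corrSum {κ' : Type} [DecidableEq κ'] (e : κ' ↪ ι) (κ : Finset ι → ℂ)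
    {J : Finset κ' → ℂ} (h0 : J ∅ = 1) (h : ∀ X y, y ∉ X →
      J (insert y X) = ∑ B ∈ X.powerset, κ ((insert y B).map e) * J (X \ B)) (X : Finset κ') :
    J X = corrSum κ (X.map e) := by
  induction X using Finset.strongInduction with
  | H X ih =>
    rcases X.eq_empty_or_nonempty with rfl | ⟨y, hy⟩
    · rw [h0, Finset.map_empty, corrSum_empty]
    · have hy' := Finset.notMem_erase y X
      rw [← Finset.insert_erase hy, h _ _ hy', Finset.map_insert, corrSum_insert κ (by simp)]
      have hinj : Function.Injective fun B : Finset κ' => B.map e := Finset.map_injective e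
      have hp : ((X.erase y).map e).powerset =
          (X.erase y).powerset.map ⟨fun B => B.map e, hinj⟩ := by
        ext C
        simp only [Finset.mem_powerset, Finset.mem_map, Function.Embedding.coeFn_mk,
          Finset.subset_map_iff]
        constructor
        · rintro ⟨u, h1, rfl⟩; exact ⟨u, h1, rfl⟩
        · rintro ⟨u, h1, rfl⟩; exact ⟨u, h1, rfl⟩
      rw [hp, Finset.sum_map]
      refine Finset.sum_congr rfl fun B _ => ?_
      have hlt : X.erase y \ B ⊂ X :=
        Finset.ssubset_of_subset_of_ssubset Finset.sdiff_subset (Finset.erase_ssubset hy)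
      rw [ih _ hlt, Finset.map_insert, Finset.map_sdiff]
      rfl

/-- The Ursell functions are the cumulants. -/
theorem ursell_eq {H κ : Finset ι → ℂ} (hH : ∀ s, H s = corrSum κ s) :
    ∀ s : Finset ι, s.Nonempty → ursell H s = κ s := by
  intro s
  induction s using Finset.strongInduction with
  | H s ih =>
    intro hs
    rw [ursell, hH]
    have hterm : ∀ P : {P : Finpartition s // P.parts ≠ {s}},
        ∏ B : {B : Finset ι // B ∈ P.1.parts}, ursell H B.1 = ∏ B ∈ P.1.parts, κ B := by
      intro P
      rw [Finset.prod_coe_sort P.1.parts fun B => ursell H B]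
      refine Finset.prod_congr rfl fun B hB => ih B ?_ (P.1.nonempty_of_mem_parts hB)
      refine (P.1.le hB).lt_of_ne ?_
      rintro rfl
      exact absurd (card_lt_of_mem_parts P.1 hB P.2) (lt_irrefl _)
    rw [Finset.sum_congr rfl fun P _ => hterm P, corrSum,
      ← Finset.sum_subtype (Finset.univ.filter fun P : Finpartition s => P.parts ≠ {s})
        (fun P => by simp) (fun P => ∏ B ∈ P.parts, κ B),
      ← Finset.sum_filter_add_sum_filter_not Finset.univ
        (fun P : Finpartition s => P.parts ≠ {s}), add_sub_cancel_left]
    have : (Finset.univ.filter fun P : Finpartition s => ¬ P.parts ≠ {s}) =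
        {Finpartition.indiscrete hs.ne_empty} := by
      ext P
      simp only [Finset.mem_filter, Finset.mem_univ, true_and, not_not, Finset.mem_singleton]
      constructor
      · intro h; exact Finpartition.ext (by rw [h, Finpartition.indiscrete_parts])
      · rintro rfl; rfl
    rw [this, Finset.sum_singleton, Finpartition.indiscrete_parts, Finset.prod_singleton]

end corrSum

end

section

/-! ### Correlation functions as path integrals -/

section correlations

variable {m : ℝ} {φ : ℂ → ℂ} {Ω : Set ℂ} {f : ℂ → ℂ → ℂ → ℂ} {r : ℝ}
  {ι : Type} [Fintype ι] [DecidableEq ι] {z : ι → ℂ} {γ : ι → ℝ → ℂ}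

/-- The gauge factors conjugate the matrix by a diagonal one and drop out. Of `4⁻ⁿ`, the factors `2`
from the couplings leave `2⁻ⁿ`, the probability of a sign pattern. -/
theorem formA_eq {g : ℂ → ℂ} (hg : ∀ z ∈ strip, g z ≠ 0)
    (hc : ∀ s₁ s₂ : Bool, ∀ z₁ ∈ strip, ∀ z₂ ∈ strip, ¬ SamePoint m z₂ z₁ →
      coupling f s₁ s₂ (φ z₁) (φ z₂) * signConj s₂ (deriv φ z₂) =
        2 / (Real.pi * I) * sgn s₂ * (signConj s₂ (g z₂) / signConj s₁ (g z₁)) *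
          kern m r (signConj s₂ z₂ - signConj s₁ z₁))
    (v : ι → ℂ) (hz : ∀ k, z k ∈ strip) (hd : ∀ j k, j ≠ k → ¬ SamePoint m (z j) (z k)) :
    formA φ f z v = (1 / 2) ^ Fintype.card ι * ∑ s : ι → Bool,
      (∏ k, 1 / (Real.pi * I) * sgn (s k) * signConj (s k) (v k)) *
        kernDet m r (fun k => signConj (s k) (z k)) Finset.univ := by
  rw [formA, Finset.mul_sum, Finset.mul_sum]
  refine Finset.sum_congr rfl fun s _ => ?_
  set M : Matrix ι ι ℂ := Matrix.of fun j k : ι =>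
    if j ≠ k then coupling f (s j) (s k) (φ (z j)) (φ (z k)) else 0 with hM
  set G : ι → ℂ := fun k => signConj (s k) (g (z k)) with hG
  have hG0 : ∀ k, G k ≠ 0 := fun k => signConj_ne_zero (hg _ (hz k))
  set K := kernMatrix m r (fun k => signConj (s k) (z k)) Finset.univ with hK
  have hmat : (Matrix.of fun j k => signConj (s k) (deriv φ (z k)) * M j k) =
      Matrix.of fun j k => (2 / (Real.pi * I) * sgn (s k) * G k) *
        (Matrix.of fun j k => (1 / G j) * K j k) j k := by
    ext j k
    simp only [hM, hK, kernMatrix, Matrix.of_apply, Finset.mem_univ, and_self, if_true]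
    by_cases h : j = k
    · simp [h]
    · rw [if_pos h, if_neg h, mul_comm (signConj _ _), hc _ _ _ (hz j) _ (hz k) (hd k j (Ne.symm h))]
      simp only [hG]
      ring
  have h1 := congrArg Matrix.det hmat
  rw [Matrix.det_mul_row, Matrix.det_mul_row, Matrix.det_mul_column] at h1
  have h2 : (∏ k, signConj (s k) (deriv φ (z k) * v k)) =
      (∏ k, signConj (s k) (deriv φ (z k))) * ∏ k, signConj (s k) (v k) := by
    rw [← Finset.prod_mul_distrib]
    exact Finset.prod_congr rfl fun k _ => signConj_mul _ _ _
  have h3 : ((1 : ℂ) / 4) ^ Fintype.card ι * ((∏ k, 2 / (Real.pi * I) * sgn (s k) * G k) *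
      ((∏ k, 1 / G k) * ∏ k, signConj (s k) (v k))) =
      (1 / 2) ^ Fintype.card ι * ∏ k, 1 / (Real.pi * I) * sgn (s k) * signConj (s k) (v k) := by
    rw [← Finset.prod_mul_distrib, ← Finset.prod_mul_distrib, Fintype.card, ← Finset.prod_const,
      ← Finset.prod_const, ← Finset.prod_mul_distrib, ← Finset.prod_mul_distrib]
    refine Finset.prod_congr rfl fun k _ => ?_
    have := hG0 k
    field_simp
    norm_num
  rw [h2, kernDet, ← hK]
  linear_combination ((1 : ℂ) / 4) ^ Fintype.card ι * (∏ k, signConj (s k) (v k)) * h1 + K.det * h3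

namespace IsPathFamily

variable (hγ : IsPathFamily m z γ)
include hγ

omit [Fintype ι] [DecidableEq ι] in
theorem mem_closedStrip (k : ι) {t : ℝ} (ht : t ∈ Icc (0 : ℝ) 1) : γ k t ∈ closedStrip := by
  have hcl : IsClosed closedStrip :=
    (isClosed_le continuous_const continuous_im).inter (isClosed_le continuous_im continuous_const)
  have h1 : ContinuousWithinAt (γ k) (Ioo 0 1) t :=
    ((hγ.contDiffOn k).continuousOn t ht).mono Ioo_subset_Icc_self
  have h2 := h1.mem_closure (by rwa [closure_Ioo zero_ne_one]) (t := closedStrip)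
    fun s hs => strip_subset_closedStrip (hγ.inside k s hs)
  rwa [hcl.closure_eq] at h2

omit [Fintype ι] [DecidableEq ι] in
theorem isDistinctTuple : IsDistinctTuple m z := by
  have h1 : (1 : ℝ) ∈ Icc (0 : ℝ) 1 := ⟨zero_le_one, le_rfl⟩
  refine ⟨fun k => ?_, fun j k hjk => ?_⟩
  · rw [← hγ.target k]; exact hγ.mem_closedStrip k h1
  · rw [← hγ.target j, ← hγ.target k]; exact hγ.disjoint j k hjk 1 h1 1 h1

omit [Fintype ι] [DecidableEq ι] in
theorem signConj_sub_notMem (hm : 0 < m) {j k : ι} (hjk : j ≠ k) (s s' : Bool) {t t' : ℝ}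
    (ht : t ∈ Icc (0 : ℝ) 1) (ht' : t' ∈ Icc (0 : ℝ) 1) :
    signConj s (γ k t) - signConj s' (γ j t') ∉ (periods m hm).lattice :=
  DimerCylinder.signConj_sub_notMem hm (hγ.mem_closedStrip k ht) (hγ.mem_closedStrip j ht')
    (hγ.disjoint k j hjk.symm t ht t' ht') s s'

omit [Fintype ι] [DecidableEq ι] in
theorem extPoint_sub_notMem (hm : 0 < m) {j k : ι} (hjk : j ≠ k) (a b : Bool × ℝ) :
    extPoint (γ k) a - extPoint (γ j) b ∉ (periods m hm).lattice :=
  hγ.signConj_sub_notMem hm hjk _ _ (projIcc (0 : ℝ) 1 zero_le_one a.2).2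
    (projIcc (0 : ℝ) 1 zero_le_one b.2).2

/-- Disjoint paths keep the kernel away from its poles, so its side of the identity extends
continuously to the closed cube. This gives integrability although nothing is assumed about `φ'` at
the boundary. -/
theorem pathIntegral_eq (hm : 0 < m) {g : ℂ → ℂ} (hg : ∀ z ∈ strip, g z ≠ 0)
    (hc : ∀ s₁ s₂ : Bool, ∀ z₁ ∈ strip, ∀ z₂ ∈ strip, ¬ SamePoint m z₂ z₁ →
      coupling f s₁ s₂ (φ z₁) (φ z₂) * signConj s₂ (deriv φ z₂) =
        2 / (Real.pi * I) * sgn s₂ * (signConj s₂ (g z₂) / signConj s₁ (g z₁)) *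
          kern m r (signConj s₂ z₂ - signConj s₁ z₁)) :
    IntegrableOn (pathIntegrand φ f γ) (Icc (0 : ι → ℝ) 1) ∧ pathIntegral φ f γ =
      detMoment m r (fun k => extPoint (γ k)) (fun k => extWeight (γ k)) Finset.univ := by
  set F : (ι → Bool × ℝ) → ℂ := fun ω => (∏ k, extWeight (γ k) (ω k)) *
    kernDet m r (fun k => extPoint (γ k) (ω k)) Finset.univ with hF
  have hFc : Continuous F := (continuous_finsetProd _ fun k _ =>
    (continuous_extWeight (hγ.contDiffOn k)).comp (continuous_apply k)).mul
    (continuous_kernDet hm (x := fun k => extPoint (γ k))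
      (fun k => continuous_extPoint (hγ.contDiffOn k))
      (fun j k h a b => hγ.extPoint_sub_notMem hm h a b) r Finset.univ)
  have hFi : Integrable F (signedCube ι) := integrable_signedCube hFc fun ω => by
    simp only [hF, clampUnit, extPoint_projIcc, extWeight_projIcc]
  obtain ⟨h1, h2⟩ := integral_signedCube hFi
  -- The identity holds on the open cube, where the paths are inside the strip and `deriv` agrees
  -- with `derivWithin`; the boundary is a null set.
  have hae : pathIntegrand φ f γ =ᵐ[volume.restrict (Icc (0 : ι → ℝ) 1)]
      fun t => (1 / 2) ^ Fintype.card ι * ∑ s : ι → Bool, F fun k => (s k, t k) := by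
    have he : (univ.pi fun k : ι => Ioo ((0 : ι → ℝ) k) ((1 : ι → ℝ) k)) =ᵐ[volume]
        Icc (0 : ι → ℝ) 1 := Measure.univ_pi_Ioo_ae_eq_Icc
    rw [← Measure.restrict_congr_set he]
    refine ae_restrict_of_forall_mem (MeasurableSet.univ_pi fun _ => measurableSet_Ioo) fun t ht => ?_
    have ht' : ∀ k, t k ∈ Ioo (0 : ℝ) 1 := fun k => ht k (mem_univ k)
    have hI := fun k => Ioo_subset_Icc_self (ht' k)
    rw [pathIntegrand, formA_eq hg hc _ (fun k => hγ.inside k _ (ht' k))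
      (fun j k h => hγ.disjoint j k h _ (hI j) _ (hI k))]
    congr 1
    refine Finset.sum_congr rfl fun s _ => ?_
    simp only [hF, extPoint_of_mem _ (hI _), extWeight_of_mem _ (hI _),
      (hasDerivAt_of_contDiffOn (hγ.contDiffOn _) (ht' _)).deriv]
  have hi : IntegrableOn (fun t : ι → ℝ => (1 / 2 : ℂ) ^ Fintype.card ι *
      ∑ s : ι → Bool, F fun k => (s k, t k)) (Icc 0 1) :=
    (integrable_finsetSum _ fun s _ => h1 s).const_mul _
  refine ⟨Integrable.congr hi hae.symm, ?_⟩
  rw [pathIntegral, integral_congr_ae hae, integral_const_mul,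
    integral_finsetSum _ fun s _ => h1 s, ← h2]
  rfl

end IsPathFamily

/-- The joint cumulants of the heights at the points `z k`. -/
def blockCum (hm : 0 < m) (r c : ℝ) (z : ι → ℂ) (B : Finset ι) : ℂ :=
  cumCoeff hm r B.card * ∏ k ∈ B, (hmTop (z k) : ℂ) + pairSum (fun j k =>
    -(c : ℂ) * hmTop (z j) * hmTop (z k) - 1 / (2 * Real.pi ^ 2) * pairLog m (z j) (z k)) B

/-- Writing `℘ = -c - Z'` makes the variable part a derivative. Integration over point `k` gives
`Z`, then over point `j` gives `pairLog`; the constant `c` multiplies the two harmonic measures. -/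
theorem IsPathFamily.cumMoment_pair (hγ : IsPathFamily m z γ) (hm : 0 < m) {c : ℝ}
    (hc : ∀ u, u ∉ (periods m hm).lattice → deriv (thetaLog m) u = -wp m hm u - c)
    {j k : ι} (hjk : j ≠ k) :
    cumMoment hm r (fun k => extPoint (γ k)) (fun k => extWeight (γ k)) {j, k} =
      cumCoeff hm r 2 * (hmTop (z j) * hmTop (z k)) +
      (-(c : ℂ) * hmTop (z j) * hmTop (z k) - 1 / (2 * Real.pi ^ 2) * pairLog m (z j) (z k)) := by
  have hx := fun a b => hγ.extPoint_sub_notMem hm hjk a b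
  have hWc := fun k => continuous_extWeight (hγ.contDiffOn k)
  have hxc := fun k => continuous_extPoint (hγ.contDiffOn k)
  have hT : ∀ u, u ∉ (periods m hm).lattice → HasDerivAt (thetaLog m) (-wp m hm u - c) u :=
    fun u hu => by
      rw [← hc u hu]; exact (analyticAt_thetaLog hm hu).differentiableAt.hasDerivAt
  have cP : Continuous fun ω : ι → Bool × ℝ => ∏ i ∈ ({j, k} : Finset ι), extWeight (γ i) (ω i) :=
    continuous_finsetProd _ fun i _ => (hWc i).comp (continuous_apply i)
  have hP := integral_prod_signedCube (fun k => extWeight (γ k)) {j, k}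
  have hW : ∀ i, ∫ ω, extWeight (γ i) ω ∂signedUnit = (hmTop (z i) : ℂ) := fun i => by
    rw [integral_extWeight (hγ.contDiffOn i) (hγ.source i), hγ.target]
  rw [Finset.prod_pair hjk, hW, hW] at hP
  set F : (ι → Bool × ℝ) → ℂ := fun ω => extWeight (γ j) (ω j) * (extWeight (γ k) (ω k) *
    (-wp m hm (extPoint (γ k) (ω k) - extPoint (γ j) (ω j)) - c)) with hF
  have hFc : Continuous F := by
    have h1 : Continuous fun ω : ι → Bool × ℝ =>
        wp m hm (extPoint (γ k) (ω k) - extPoint (γ j) (ω j)) :=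
      (continuousOn_wp hm).comp_continuous (((hxc k).comp (continuous_apply k)).sub
        ((hxc j).comp (continuous_apply j))) fun ω => hx _ _
    exact ((hWc j).comp (continuous_apply j)).mul (((hWc k).comp (continuous_apply k)).mul
      (h1.neg.sub continuous_const))
  have hFi : Integrable F (signedCube ι) := integrable_signedCube hFc fun ω => by
    simp only [hF, clampUnit, extPoint_projIcc, extWeight_projIcc]
  have hPi : Integrable (fun ω : ι → Bool × ℝ => ∏ i ∈ ({j, k} : Finset ι), extWeight (γ i) (ω i))
      (signedCube ι) := integrable_signedCube cP fun ω => by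
    simp only [clampUnit, extWeight_projIcc]
  have hFint : ∫ ω, F ω ∂signedCube ι =
      1 / (2 * Real.pi ^ 2) * pairLog m (z j) (z k) := by
    rw [signedCube, integral_eq_integral_update signedUnit hFc hFi k]
    have hinner : ∀ ω : ι → Bool × ℝ, ∫ a, F (Function.update ω k a) ∂signedUnit =
        ∏ i ∈ ({j} : Finset ι), 1 / (2 * Real.pi * I) * (extWeight (γ j) (ω i) *
          (thetaLog m (z k - extPoint (γ j) (ω i)) -
            thetaLog m (starRingEnd ℂ (z k) - extPoint (γ j) (ω i)))) := by
      intro ω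
      simp only [hF, Function.update_self, Function.update_of_ne hjk, Finset.prod_singleton]
      rw [integral_const_mul]
      have := integral_extWeight_mul (hγ.contDiffOn k)
        (H := fun u => thetaLog m (u - extPoint (γ j) (ω j)))
        (H' := fun u => -wp m hm (u - extPoint (γ j) (ω j)) - c)
        (fun s t ht => (hT _ (hγ.signConj_sub_notMem hm hjk s (ω j).1 ht
          (projIcc (0 : ℝ) 1 zero_le_one (ω j).2).2)).comp_sub_const _ _)
        (((continuousOn_wp hm).comp_continuous ((hxc k).sub continuous_const)
          fun a => hx _ _).neg.sub continuous_const)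
      rw [this, conj_eq_iff_im.2 (hγ.source k), hγ.target]
      ring
    simp_rw [hinner]
    have := integral_prod_signedCube (ι := ι) (fun _ a => 1 / (2 * Real.pi * I) *
      (extWeight (γ j) a * (thetaLog m (z k - extPoint (γ j) a) -
            thetaLog m (starRingEnd ℂ (z k) - extPoint (γ j) a)))) {j}
    rw [signedCube] at this
    rw [this, Finset.prod_singleton, integral_const_mul,
      integral_extWeight_mul_thetaLog hm (hγ.contDiffOn j) (hγ.source j) fun s s' t ht => by
        rw [← hγ.target k]
        exact hγ.signConj_sub_notMem hm hjk s' s ⟨zero_le_one, le_rfl⟩ ht, hγ.target]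
    have h0 : (Real.pi : ℂ) ≠ 0 := by exact_mod_cast Real.pi_ne_zero
    have hI := I_ne_zero
    field_simp
    rw [I_sq]
    ring
  have hcum : ∀ ω : ι → Bool × ℝ, (∏ i ∈ ({j, k} : Finset ι), extWeight (γ i) (ω i)) *
      cum hm r (fun i => extPoint (γ i) (ω i)) {j, k} =
      (cumCoeff hm r 2 - c) * (∏ i ∈ ({j, k} : Finset ι), extWeight (γ i) (ω i)) - F ω := by
    intro ω
    rw [cum, Finset.card_pair hjk, pairSum_pair _ hjk (by rw [← wp_neg, neg_sub]),
      Finset.prod_pair hjk]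
    simp only [hF]
    ring
  rw [cumMoment]
  simp_rw [hcum]
  rw [integral_sub (hPi.const_mul _) hFi, integral_const_mul, hP, hFint]
  ring

theorem IsPathFamily.cumMoment_eq (hγ : IsPathFamily m z γ) (hm : 0 < m) {c : ℝ}
    (hc : ∀ u, u ∉ (periods m hm).lattice → deriv (thetaLog m) u = -wp m hm u - c)
    (B : Finset ι) :
    cumMoment hm r (fun k => extPoint (γ k)) (fun k => extWeight (γ k)) B =
      blockCum hm r c z B := by
  by_cases hB : B.card = 2
  · obtain ⟨j, k, hjk, rfl⟩ := Finset.card_eq_two.1 hB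
    rw [hγ.cumMoment_pair hm hc hjk, blockCum, hB, Finset.prod_pair hjk, pairSum_pair _ hjk]
    rw [pairLog_comm hm]
    ring
  · rw [cumMoment_of_card_ne_two hm r hB, blockCum, pairSum, if_neg hB, add_zero]
    congr 1
    refine Finset.prod_congr rfl fun k _ => ?_
    rw [integral_extWeight (hγ.contDiffOn k) (hγ.source k), hγ.target]

theorem IsPathFamily.detMoment_eq (hγ : IsPathFamily m z γ) (hm : 0 < m) {c : ℝ}
    (hc : ∀ u, u ∉ (periods m hm).lattice → deriv (thetaLog m) u = -wp m hm u - c) :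
    detMoment m r (fun k => extPoint (γ k)) (fun k => extWeight (γ k)) Finset.univ =
      corrSum (blockCum hm r c z) Finset.univ := by
  have h := eq_corrSum (Function.Embedding.refl ι) (blockCum hm r c z)
    (J := detMoment m r (fun k => extPoint (γ k)) fun k => extWeight (γ k))
    (detMoment_empty r) (fun X y hy => by
      rw [detMoment_insert hm (fun k => continuous_extPoint (hγ.contDiffOn k))
        (fun k => continuous_extWeight (hγ.contDiffOn k))
        (fun j k h a b => hγ.extPoint_sub_notMem hm h a b) (fun k s t => extPoint_projIcc s t)
        (fun k s t => extWeight_projIcc s t) r hy]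
      refine Finset.sum_congr rfl fun B _ => ?_
      rw [hγ.cumMoment_eq hm hc, Finset.map_refl]) Finset.univ
  rwa [Finset.map_refl] at h

omit [Fintype ι] in
theorem blockCum_map {κ : Type} [DecidableEq κ] (hm : 0 < m) (r c : ℝ) (z : ι → ℂ) (e : κ ↪ ι)
    (B : Finset κ) : blockCum hm r c z (B.map e) = blockCum hm r c (fun k => z (e k)) B := by
  simp only [blockCum, pairSum, Finset.card_map, Finset.prod_map, Finset.sum_map,
    ← Finset.map_erase]

omit [Fintype ι] in
-- The correlations of a subfamily are indexed by a subtype, while Ursell functions use subsets of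
-- one index type. Both sides satisfy the same recursion.
theorem corrSum_blockCum_map {κ : Type} [DecidableEq κ] [Fintype κ] (hm : 0 < m) (r c : ℝ)
    (z : ι → ℂ) (e : κ ↪ ι) : corrSum (blockCum hm r c fun k => z (e k)) Finset.univ =
      corrSum (blockCum hm r c z) (Finset.univ.map e) := by
  refine eq_corrSum e (blockCum hm r c z) (corrSum_empty _) (fun X y hy => ?_) _
  simp_rw [blockCum_map]
  exact corrSum_insert _ hy

end correlations

end

section

/-! ### The derivatives of the Weierstrass function -/

section weierstrass

variable {m : ℝ} (hm : 0 < m)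

theorem analyticOnNhd_wp : AnalyticOnNhd ℂ (wp m hm) ((periods m hm).lattice : Set ℂ)ᶜ :=
  (periods m hm).analyticOnNhd_weierstrassP

theorem deriv_wp_sq {u : ℂ} (hu : u ∉ (periods m hm).lattice) :
    deriv (wp m hm) u ^ 2 =
      4 * wp m hm u ^ 3 - (periods m hm).g₂ * wp m hm u - (periods m hm).g₃ := by
  have := (periods m hm).derivWeierstrassP_sq u hu
  rwa [← PeriodPair.deriv_weierstrassP] at this

theorem isPreconnected_compl_periods : IsPreconnected ((periods m hm).lattice : Set ℂ)ᶜ := by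
  have hc : ((periods m hm).lattice : Set ℂ).Countable := by
    refine (Set.countable_range fun p : ℤ × ℤ => (p.1 : ℂ) * m + p.2 * (2 * Real.pi * I)).mono ?_
    intro u hu
    obtain ⟨k, l, h⟩ := (mem_periods_iff hm).1 hu
    exact ⟨(k, l), h.symm⟩
  exact (hc.isConnected_compl_of_one_lt_rank
    (rank_real_complex ▸ Nat.one_lt_ofNat)).isPreconnected

/-- Differentiating the cubic relation gives `℘' (℘'' - 6 ℘² + g₂/2) = 0` on a connected set, so one
analytic factor vanishes identically. The degenerate alternative need not be excluded, as the
conclusion drawn from it is trivial. -/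
theorem deriv_wp_eq_zero_or_deriv_deriv_wp :
    (∀ u, u ∉ (periods m hm).lattice → deriv (wp m hm) u = 0) ∨
    ∀ u, u ∉ (periods m hm).lattice →
      deriv (deriv (wp m hm)) u = 6 * wp m hm u ^ 2 - (periods m hm).g₂ / 2 := by
  have h0 := analyticOnNhd_wp hm
  have h1 := h0.deriv
  have h2 := h1.deriv
  have hE : AnalyticOnNhd ℂ (fun u => deriv (deriv (wp m hm)) u -
      (6 * wp m hm u ^ 2 - (periods m hm).g₂ / 2)) ((periods m hm).lattice : Set ℂ)ᶜ :=
    h2.sub ((analyticOnNhd_const.mul (h0.pow 2)).sub analyticOnNhd_const)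
  refine (AnalyticOnNhd.eq_zero_or_eq_zero_of_mul_eq_zero h1 hE (fun u hu => ?_)
    (isPreconnected_compl_periods hm)).imp id fun h u hu => sub_eq_zero.1 (h u hu)
  have d0 := (h0 u hu).differentiableAt.hasDerivAt
  have d1 := (h1 u hu).differentiableAt.hasDerivAt
  have hl := d1.fun_pow 2
  have hr := (((d0.fun_pow 3).const_mul 4).fun_sub (d0.const_mul (periods m hm).g₂)).sub_const
    (periods m hm).g₃
  have he : (fun u => deriv (wp m hm) u ^ 2) =ᶠ[𝓝 u] fun u =>
      4 * wp m hm u ^ 3 - (periods m hm).g₂ * wp m hm u - (periods m hm).g₃ := by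
    filter_upwards [(isOpen_compl_periods hm).mem_nhds hu] with v hv
    exact deriv_wp_sq hm hv
  have := hl.unique (hr.congr_of_eventuallyEq he)
  push_cast at this
  linear_combination (1 / 2 : ℂ) * this

/-- The derivatives of `℘` at a point are determined by the first two. -/
theorem iteratedDeriv_wp_congr {u v : ℂ} (hu : u ∉ (periods m hm).lattice)
    (hv : v ∉ (periods m hm).lattice) (h0 : wp m hm u = wp m hm v)
    (h1 : deriv (wp m hm) u = deriv (wp m hm) v) (n : ℕ) :
    iteratedDeriv n (wp m hm) u = iteratedDeriv n (wp m hm) v := by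
  have hΛ := isOpen_compl_periods hm
  rcases deriv_wp_eq_zero_or_deriv_deriv_wp hm with h | h
  · cases n with
    | zero => simpa using h0
    | succ n =>
      have key : ∀ w, w ∉ (periods m hm).lattice → iteratedDeriv (n + 1) (wp m hm) w = 0 := by
        intro w hw
        rw [iteratedDeriv_succ', Filter.EventuallyEq.iteratedDeriv_eq n (g := fun _ => 0)]
        · simp
        · filter_upwards [hΛ.mem_nhds hw] with x hx
          exact h x hx
      rw [key u hu, key v hv]
  -- The form `P(℘) + Q(℘) ℘'` is stable under differentiation by the equations for `℘'²` and `℘''`.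
  · suffices key : ∃ P Q : Polynomial ℂ, ∀ w, w ∉ (periods m hm).lattice →
        iteratedDeriv n (wp m hm) w =
          P.eval (wp m hm w) + Q.eval (wp m hm w) * deriv (wp m hm) w by
      obtain ⟨P, Q, hPQ⟩ := key
      rw [hPQ u hu, hPQ v hv, h0, h1]
    induction n with
    | zero => exact ⟨Polynomial.X, 0, fun w _ => by simp⟩
    | succ n ih =>
      obtain ⟨P, Q, hPQ⟩ := ih
      refine ⟨Polynomial.derivative Q * (4 * Polynomial.X ^ 3 -
        Polynomial.C (periods m hm).g₂ * Polynomial.X - Polynomial.C (periods m hm).g₃) +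
        Q * (6 * Polynomial.X ^ 2 - Polynomial.C ((periods m hm).g₂ / 2)),
        Polynomial.derivative P, fun w hw => ?_⟩
      have d0 := (analyticOnNhd_wp hm w hw).differentiableAt.hasDerivAt
      have d1 := ((analyticOnNhd_wp hm).deriv w hw).differentiableAt.hasDerivAt
      have e : iteratedDeriv n (wp m hm) =ᶠ[𝓝 w] fun w =>
          P.eval (wp m hm w) + Q.eval (wp m hm w) * deriv (wp m hm) w := by
        filter_upwards [hΛ.mem_nhds hw] with x hx
        exact hPQ x hx
      have dP : HasDerivAt (fun w => P.eval (wp m hm w))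
          ((Polynomial.derivative P).eval (wp m hm w) * deriv (wp m hm) w) w :=
        (P.hasDerivAt (wp m hm w)).comp w d0
      have dQ : HasDerivAt (fun w => Q.eval (wp m hm w))
          ((Polynomial.derivative Q).eval (wp m hm w) * deriv (wp m hm) w) w :=
        (Q.hasDerivAt (wp m hm w)).comp w d0
      rw [iteratedDeriv_succ, e.deriv_eq, (dP.fun_add (dQ.fun_mul d1)).deriv, h w hw]
      have := deriv_wp_sq hm hw
      simp only [Polynomial.eval_add, Polynomial.eval_mul, Polynomial.eval_sub, Polynomial.eval_pow,
        Polynomial.eval_X, Polynomial.eval_C, Polynomial.eval_ofNat]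
      linear_combination (Polynomial.derivative Q).eval (wp m hm w) * this

end weierstrass

/-! ### Existence of paths and the correlation functions -/

section correlations

variable {m : ℝ} {ι : Type}

/-- Families of pairwise distinct points are the end points of non-intersecting paths. -/
theorem IsDistinctTuple.exists_isPathFamily [Finite ι] {z : ι → ℂ} (hz : IsDistinctTuple m z) :
    ∃ γ : ι → ℝ → ℂ, IsPathFamily m z γ := by
  have hπ := Real.pi_gt_three
  -- All paths run along lines of the common direction `α + i`. Lines through two different end
  -- points, modulo `m`, coincide only for countably many slopes, which are avoided.
  obtain ⟨α, hα⟩ : ∃ α : ℝ, α ∉ Set.range fun p : ι × ι × ℤ =>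
      ((z p.1).re - (z p.2.1).re - p.2.2 * m) / ((z p.1).im - (z p.2.1).im) := by
    obtain ⟨α, hα⟩ := ((Set.countable_range fun p : ι × ι × ℤ =>
      ((z p.1).re - (z p.2.1).re - p.2.2 * m) /
        ((z p.1).im - (z p.2.1).im)).dense_compl ℝ).nonempty
    exact ⟨α, hα⟩
  -- A point on the bottom needs an excursion: its path goes up along the line and back, to height
  -- at most `1/4 < π`.
  set ρ : ι → ℝ → ℝ := fun k t =>
    if (z k).im = 0 then -(t * (1 - t)) else (z k).im * (1 - t) with hρ
  have him : ∀ k t, (z k - ρ k t * (α + I)).im = (z k).im - ρ k t := fun k t => by simp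
  have hre : ∀ k t, (z k - ρ k t * (α + I)).re = (z k).re - ρ k t * α := fun k t => by simp
  refine ⟨fun k t => z k - ρ k t * (α + I), ⟨fun k => ?_, fun k => ?_, fun k t ht => ?_, fun k => ?_,
    fun j k hjk s _ t _ => ?_⟩⟩
  · have : ContDiff ℝ 1 (ρ k) := by
      by_cases h : (z k).im = 0
      · simp only [hρ, h, if_true]; fun_prop
      · simp only [hρ, h, if_false]; fun_prop
    refine ContDiff.contDiffOn (contDiff_const.sub (ContDiff.mul ?_ contDiff_const))
    exact ofRealCLM.contDiff.comp this
  · rw [him]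
    by_cases h : (z k).im = 0 <;> simp [hρ, h]
  · have h1 := (hz.1 k).1
    have h2 := (hz.1 k).2
    have h3 := ht.1
    have h4 := ht.2
    change _ ∧ _
    rw [him]
    by_cases h : (z k).im = 0
    · simp only [hρ, h, if_true]
      constructor <;> nlinarith
    · simp only [hρ, h, if_false]
      have h5 : 0 < (z k).im := lt_of_le_of_ne h1 (Ne.symm h)
      constructor <;> nlinarith
  · simp [hρ]
  · rintro ⟨l, hl⟩
    have e1 := congrArg Complex.re hl
    have e2 := congrArg Complex.im hl
    simp only [add_im, add_re, him, hre] at e1 e2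
    have e3 : ((l : ℂ) * m).re = l * m := by simp
    have e4 : ((l : ℂ) * m).im = 0 := by simp
    rw [e3] at e1
    rw [e4] at e2
    by_cases h : (z j).im = (z k).im
    · have h5 : ρ j s = ρ k t := by linarith
      rw [h5] at e1
      refine hz.2 j k hjk ⟨l, Complex.ext ?_ ?_⟩
      · simp; linarith
      · simp [h]
    · refine hα ⟨(j, k, l), ?_⟩
      have h6 : (z j).im - (z k).im ≠ 0 := sub_ne_zero.2 h
      rw [div_eq_iff h6]
      have : (z j).im - (z k).im = ρ j s - ρ k t := by linarith
      rw [this]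
      linarith

end correlations

end

/-! ### Evaluation of the correlation functions and of the moments at the top. -/

section

section correlations

variable {m : ℝ} (hm : 0 < m) {φ : ℂ → ℂ} {f : ℂ → ℂ → ℂ → ℂ} {r c : ℝ}

/-- The coupling function agrees with the kernel with parameter `r` up to a gauge factor. -/
def IsKernelGauge (m r : ℝ) (φ : ℂ → ℂ) (f : ℂ → ℂ → ℂ → ℂ) (g : ℂ → ℂ) : Prop :=
  (∀ z ∈ strip, g z ≠ 0) ∧ ∀ s₁ s₂ : Bool, ∀ z₁ ∈ strip, ∀ z₂ ∈ strip,
    ¬ SamePoint m z₂ z₁ → coupling f s₁ s₂ (φ z₁) (φ z₂) * signConj s₂ (deriv φ z₂) =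
      2 / (Real.pi * I) * sgn s₂ * (signConj s₂ (g z₂) / signConj s₁ (g z₁)) *
        kern m r (signConj s₂ z₂ - signConj s₁ z₁)

variable {g : ℂ → ℂ} (hg : IsKernelGauge m r φ f g)
  (hc : ∀ u, u ∉ (periods m hm).lattice → deriv (thetaLog m) u = -wp m hm u - c)
include hg hc

theorem IsPathFamily.pathIntegral_eq_corrSum {ι : Type} [Fintype ι] [DecidableEq ι] {z : ι → ℂ}
    {γ : ι → ℝ → ℂ} (hγ : IsPathFamily m z γ) :
    pathIntegral φ f γ = corrSum (blockCum hm r c z) Finset.univ := by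
  rw [(hγ.pathIntegral_eq hm hg.1 hg.2).2, hγ.detMoment_eq hm hc]

/-- The arbitrary choice of paths in `heightCorr` is harmless, since the value of the integral only
involves the end points. -/
theorem heightCorr_eq {ι : Type} [Fintype ι] [DecidableEq ι] {z : ι → ℂ}
    (hz : IsDistinctTuple m z) :
    heightCorr m φ f z = corrSum (blockCum hm r c z) Finset.univ := by
  have h := hz.exists_isPathFamily
  rw [heightCorr, dif_pos h]
  exact h.choose_spec.pathIntegral_eq_corrSum hm hg hc

/-- The correlations of all subfamilies are moments with cumulants `blockCum`, so the Ursell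
function of the full set is its cumulant. From three points on there is no pair term. -/
theorem connectedCorr_eq {n : ℕ} (hn : 3 ≤ n) {z : Fin n → ℂ} (hz : IsDistinctTuple m z) :
    connectedCorr m φ f z = cumCoeff hm r n * ∏ k, (hmTop (z k) : ℂ) := by
  have hne : (Finset.univ : Finset (Fin n)).Nonempty := ⟨⟨0, by omega⟩, Finset.mem_univ _⟩
  rw [connectedCorr, ursell_eq (κ := blockCum hm r c z) (fun s => ?_) _ hne]
  · rw [blockCum, pairSum, Finset.card_univ, Fintype.card_fin, if_neg (by omega), add_zero]
  · rw [heightCorr_eq hm hg hc (z := fun k : s => z k)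
      ⟨fun k => hz.1 k, fun j k h => hz.2 j k fun h' => h (Subtype.ext h')⟩]
    have := corrSum_blockCum_map hm r c z (Function.Embedding.subtype fun k => k ∈ s)
    rw [Finset.univ_eq_attach] at this ⊢
    refine this.trans ?_
    congr 1
    exact Finset.attach_map_val

omit hg hc in
theorem corrSum_singleton {ι : Type} [DecidableEq ι] {κ : Finset ι → ℂ} (j : ι) :
    corrSum κ {j} = κ {j} := by
  have h := corrSum_insert κ (Finset.notMem_empty j)
  simpa [corrSum_empty] using h

omit hg hc in
-- First cumulants vanish, so moments and cumulants agree up to order three; this is why `M₂` and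
-- `M₃` show the coefficients directly.
theorem corrSum_pair {ι : Type} [DecidableEq ι] {κ : Finset ι → ℂ} (h1 : ∀ j, κ {j} = 0) {j k : ι}
    (hjk : j ≠ k) : corrSum κ {j, k} = κ {j, k} := by
  have h := corrSum_insert κ (X := {k}) (y := j) (by simpa using hjk)
  rw [h, ← insert_empty_eq k, Finset.sum_powerset_insert (Finset.notMem_empty k)]
  simp [h1, corrSum_empty]

omit hg hc in
theorem corrSum_triple {ι : Type} [DecidableEq ι] {κ : Finset ι → ℂ} (h1 : ∀ j, κ {j} = 0)
    {i j k : ι} (hij : i ≠ j) (hik : i ≠ k) (hjk : j ≠ k) :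
    corrSum κ {i, j, k} = κ {i, j, k} := by
  have h := corrSum_insert κ (X := {j, k}) (y := i) (by simp [hij, hik])
  have e1 : ({j, k} : Finset ι) \ {k} = {j} := by ext x; simp; grind
  have e2 : ({k} : Finset ι) \ {j} = {k} := by ext x; simp; grind
  have e3 : ({k} : Finset ι) \ {j, k} = ∅ := by ext x; simp; tauto
  rw [h, Finset.sum_powerset_insert (by simpa using hjk), ← insert_empty_eq k,
    Finset.sum_powerset_insert (Finset.notMem_empty k),
    Finset.sum_powerset_insert (Finset.notMem_empty k)]
  simp [h1, corrSum_empty, e1, e2, e3, corrSum_singleton]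

omit hg hc in
theorem blockCum_singleton {ι : Type} [DecidableEq ι] (z : ι → ℂ) (j : ι) :
    blockCum hm r c z {j} = 0 := by
  simp [blockCum, pairSum, cumCoeff]

omit hg hc in
theorem hmTop_of_im_eq_pi {z : ℂ} (hz : z.im = Real.pi) : hmTop z = 1 := by
  rw [hmTop, hz, div_self Real.pi_ne_zero]

theorem isTopMoment_two : IsTopMoment m φ f 2 (-wp m hm (midPoint r) - c) := by
  intro z hz htop
  rw [heightCorr_eq hm hg hc hz, show (Finset.univ : Finset (Fin 2)) = {0, 1} from rfl,
    corrSum_pair (blockCum_singleton hm z) (by decide), blockCum, Finset.card_pair (by decide),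
    pairSum_pair _ (by decide)]
  · simp [hmTop_of_im_eq_pi (htop _), pairLog_of_im_eq_pi (htop _), cumCoeff]
    ring
  · simp [hmTop_of_im_eq_pi (htop _), pairLog_of_im_eq_pi (htop _)]

theorem isTopMoment_three : IsTopMoment m φ f 3 (deriv (wp m hm) (midPoint r)) := by
  intro z hz htop
  have h3 : (Finset.univ : Finset (Fin 3)).card = 3 := rfl
  rw [heightCorr_eq hm hg hc hz]
  have := corrSum_triple (blockCum_singleton hm z (r := r) (c := c)) (i := 0) (j := 1) (k := 2)
    (by decide) (by decide) (by decide)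
  rw [show (Finset.univ : Finset (Fin 3)) = {0, 1, 2} from rfl, this,
    show ({0, 1, 2} : Finset (Fin 3)) = Finset.univ from rfl, blockCum, pairSum, h3]
  simp [hmTop_of_im_eq_pi (htop _), cumCoeff]

omit hg hc in
-- Equally spaced points show that `IsTopMoment` is not vacuous, so the moments at the top are
-- unique.
theorem exists_top_tuple (hm : 0 < m) (n : ℕ) :
    ∃ z : Fin n → ℂ, IsDistinctTuple m z ∧ ∀ k, (z k).im = Real.pi := by
  refine ⟨fun k => ((m * (k / n : ℝ) : ℝ) : ℂ) + Real.pi * I, ⟨fun k => ?_, fun j k hjk => ?_⟩,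
    fun k => by simp⟩
  · have : (((m * (k / n : ℝ) : ℝ) : ℂ) + Real.pi * I).im = Real.pi := by simp
    exact ⟨by rw [this]; exact Real.pi_pos.le, by rw [this]⟩
  · rintro ⟨l, hl⟩
    have h1 := congrArg Complex.re hl
    simp only [add_re, ofReal_re, mul_re, ofReal_im, I_re, mul_zero, I_im, zero_mul, sub_zero,
      intCast_re, intCast_im, add_zero] at h1
    have hn : (0 : ℝ) < n := by exact_mod_cast (Nat.zero_le _).trans_lt j.2
    field_simp at h1
    have h2 : ((j : ℕ) : ℤ) = (k : ℕ) + l * n := by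
      have : ((j : ℕ) : ℝ) = (k : ℕ) + l * n := by linarith
      exact_mod_cast this
    have hj : ((j : ℕ) : ℤ) < n := by exact_mod_cast j.2
    have hk : ((k : ℕ) : ℤ) < n := by exact_mod_cast k.2
    have hj0 : (0 : ℤ) ≤ (j : ℕ) := by positivity
    have hk0 : (0 : ℤ) ≤ (k : ℕ) := by positivity
    have hn' : (0 : ℤ) < n := by exact_mod_cast hn
    have hl0 : l = 0 := by
      have a1 : l < 1 := by nlinarith
      have a2 : -1 < l := by nlinarith
      omega
    rw [hl0] at h2
    exact hjk (Fin.ext (by omega))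

omit hg hc in
theorem zPoint_eq_midPoint (m μ : ℝ) : zPoint m μ = midPoint ((1 / 2 - μ) * m) := by
  rw [zPoint, midPoint]; push_cast; ring

omit hg hc in
theorem exists_zPoint_eq (hm : 0 < m) (r : ℝ) : ∃ μ : ℝ, zPoint m μ = midPoint r :=
  ⟨1 / 2 - r / m, by rw [zPoint_eq_midPoint]; congr 1; have := hm.ne'; field_simp; ring⟩

theorem exists_isParameter : ∃ μ : ℝ, IsParameter m hm φ f c μ := by
  obtain ⟨μ, hμ⟩ := exists_zPoint_eq hm r
  refine ⟨μ, ?_, ?_⟩ <;> rw [hμ]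
  · exact isTopMoment_two hm hg hc
  · exact isTopMoment_three hm hg hc

/-- The parameter is not assumed to give `z_μ = b`. It gives equal values of `℘` and `℘'`, and these
determine all higher derivatives. -/
theorem IsParameter.wpCoeff_eq {μ : ℝ} (hμ : IsParameter m hm φ f c μ) {n : ℕ} (hn : 3 ≤ n) :
    wpCoeff m hm μ n = cumCoeff hm r n := by
  obtain ⟨z₂, hz₂, ht₂⟩ := exists_top_tuple hm 2
  obtain ⟨z₃, hz₃, ht₃⟩ := exists_top_tuple hm 3
  have h2 := (hμ.1 z₂ hz₂ ht₂).symm.trans (isTopMoment_two hm hg hc z₂ hz₂ ht₂)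
  have h3 := (hμ.2 z₃ hz₃ ht₃).symm.trans (isTopMoment_three hm hg hc z₃ hz₃ ht₃)
  obtain ⟨n, rfl⟩ : ∃ k, n = k + 2 := ⟨n - 2, by omega⟩
  rw [wpCoeff, cumCoeff, Nat.add_sub_cancel, show n + 2 - 1 = n + 1 by omega,
    iteratedDeriv_wp_congr hm ?_ (midPoint_notMem hm r) (by linear_combination -h2) h3]
  rw [zPoint_eq_midPoint]
  exact midPoint_notMem hm _

end correlations

end

section

/-! ### Wirtinger derivatives -/

theorem wirtinger_eq_of_hasFDerivAt {F : ℂ → ℂ} {L : ℂ →L[ℝ] ℂ} {z : ℂ} (h : HasFDerivAt F L z)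
    (s : Bool) : wirtinger s F z = 1 / 2 * (L 1 - sgn s * I * L I) := by
  rw [wirtinger, h.fderiv]

theorem hasFDerivAt_log_norm {h : ℂ → ℂ} {h' z : ℂ} (hh : HasDerivAt h h' z) (h0 : h z ≠ 0) :
    HasFDerivAt (fun w => Real.log ‖h w‖) (reCLM.comp
      ((ContinuousLinearMap.toSpanSingleton ℂ (h' / h z)).restrictScalars ℝ)) z := by
  have h1 : HasDerivAt (fun w => h w / h z) (h' / h z) z := hh.div_const _
  have h2 := h1.clog (by rw [div_self h0]; exact one_mem_slitPlane)
  rw [div_self h0, div_one] at h2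
  have h3 := (reCLM.hasFDerivAt.comp z (h2.hasFDerivAt.restrictScalars ℝ)).add_const
    (Real.log ‖h z‖)
  refine h3.congr_of_eventuallyEq ?_
  filter_upwards [hh.continuousAt.eventually_ne h0] with w hw
  simp only [Function.comp_apply, reCLM_apply, log_re, norm_div]
  rw [Real.log_div (norm_ne_zero_iff.2 hw) (norm_ne_zero_iff.2 h0)]
  ring

/-- Wirtinger derivatives of the logarithm of the absolute value of a quotient. -/
theorem wirtinger_log_norm_sub {h₁ h₂ : ℂ → ℂ} {h₁' h₂' z : ℂ} (hh₁ : HasDerivAt h₁ h₁' z)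
    (hh₂ : HasDerivAt h₂ h₂' z) (h₁0 : h₁ z ≠ 0) (h₂0 : h₂ z ≠ 0) (a : ℝ) (s : Bool) :
    wirtinger s (fun w => ((a * (Real.log ‖h₁ w‖ - Real.log ‖h₂ w‖) : ℝ) : ℂ)) z =
      a / 2 * signConj s (h₁' / h₁ z - h₂' / h₂ z) := by
  have h := ((hasFDerivAt_log_norm hh₁ h₁0).fun_sub (hasFDerivAt_log_norm hh₂ h₂0)).const_mul a
  have h' := ofRealCLM.hasFDerivAt.comp z h
  rw [show (fun w => ((a * (Real.log ‖h₁ w‖ - Real.log ‖h₂ w‖) : ℝ) : ℂ)) =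
    ofRealCLM ∘ (fun w => a * (Real.log ‖h₁ w‖ - Real.log ‖h₂ w‖)) from rfl,
    wirtinger_eq_of_hasFDerivAt h']
  set q₁ := h₁' / h₁ z
  set q₂ := h₂' / h₂ z
  cases s <;> apply Complex.ext <;> simp [sgn, signConj] <;> ring

/-- Wirtinger derivatives of the difference of a holomorphic and an antiholomorphic function. -/
theorem wirtinger_sub_conj {h k : ℂ → ℂ} {h' k' z : ℂ} (hh : HasDerivAt h h' z)
    (hk : HasDerivAt k k' (starRingEnd ℂ z)) (a : ℂ) (s : Bool) :
    wirtinger s (fun w => a * (h w - k (starRingEnd ℂ w))) z = if s then a * h' else -(a * k') := by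
  have h1 := hh.hasFDerivAt.restrictScalars ℝ
  have h2 := (hk.hasFDerivAt.restrictScalars ℝ).comp z (conjCLE : ℂ →L[ℝ] ℂ).hasFDerivAt
  refine (wirtinger_eq_of_hasFDerivAt ((h1.fun_sub h2).const_mul a) s).trans ?_
  have hI := I_mul_I
  cases s
  · simp [sgn]
    linear_combination (a / 2 * (h' + k')) * hI
  · simp [sgn]
    linear_combination (-a / 2 * (h' + k')) * hI

end

section

/-! ### The Green's function -/

section green

variable {m : ℝ} (hm : 0 < m)

/-- The Green's function of the straight cylinder. -/
def greenFn (m : ℝ) (z w : ℂ) : ℝ :=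
  -(2 * Real.pi)⁻¹ * Real.log (‖theta m (w - z)‖ / ‖theta m (starRingEnd ℂ w - z)‖)

include hm in
theorem norm_theta_add_ofReal (u : ℂ) :
    ‖theta m (u + m)‖ = Real.exp (u.re + m / 2) * ‖theta m u‖ := by
  rw [theta_add_ofReal hm, norm_mul, norm_neg, norm_exp]
  congr 2
  simp

include hm in
theorem norm_theta_div_add_ofReal {u v : ℂ} (h : u.re = v.re) :
    ‖theta m (u + m)‖ / ‖theta m (v + m)‖ = ‖theta m u‖ / ‖theta m v‖ := by
  rw [norm_theta_add_ofReal hm, norm_theta_add_ofReal hm, h,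
    mul_div_mul_left _ _ (Real.exp_pos _).ne']

include hm in
theorem greenFn_eq_log {z w : ℂ} (h1 : theta m (w - z) ≠ 0)
    (h2 : theta m (w - starRingEnd ℂ z) ≠ 0) :
    greenFn m z w = -(2 * Real.pi)⁻¹ *
      (Real.log ‖theta m (w - z)‖ - Real.log ‖theta m (w - starRingEnd ℂ z)‖) := by
  rw [greenFn, norm_theta_conj_sub hm, Real.log_div (norm_ne_zero_iff.2 h1) (norm_ne_zero_iff.2 h2)]

include hm in
theorem theta_sub_ne_zero {z w : ℂ} (hz : z ∈ closedStrip) (hw : w ∈ closedStrip)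
    (h : ¬ SamePoint m w z) : theta m (w - z) ≠ 0 ∧ theta m (w - starRingEnd ℂ z) ≠ 0 :=
  ⟨theta_ne_zero hm (signConj_sub_notMem hm hw hz h true true),
    theta_ne_zero hm (signConj_sub_notMem hm hw hz h true false)⟩

include hm in
-- Positivity is `norm_theta_sub_lt`. The boundary values vanish because of the symmetries of
-- `pairLog` on the two lines, and the singularity comes from the simple zero of `theta`.
theorem isGreenFunction_greenFn : IsGreenFunction m (greenFn m) where
  periodic_left z w := by
    rw [greenFn, greenFn]
    congr 2
    -- The quotient stands inside the logarithm, so periodicity holds at all points, including those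
    -- where `theta` vanishes.
    rw [← norm_theta_div_add_ofReal hm (u := w - (z + m)) (by simp)]
    congr 3 <;> ring
  periodic_right z w := by
    rw [greenFn, greenFn]
    congr 2
    rw [← norm_theta_div_add_ofReal hm (u := w - z) (by simp)]
    congr 3
    · ring
    · simp; ring
  pos z hz w hw h := by
    obtain ⟨h1, h2⟩ := norm_theta_sub_lt hm hz hw h
    rw [← norm_theta_conj_sub hm] at h2
    have h3 : Real.log (‖theta m (w - z)‖ / ‖theta m (starRingEnd ℂ w - z)‖) < 0 :=
      Real.log_neg (div_pos h1 (h1.trans h2)) ((div_lt_one (h1.trans h2)).2 h2)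
    exact mul_pos_of_neg_of_neg (neg_lt_zero.2 (by positivity)) h3
  harmonic z hz w hw := by
    obtain ⟨hw, hne⟩ := hw
    have hz' := strip_subset_closedStrip hz
    have hT := differentiable_theta hm
    have ha : ∀ a, AnalyticAt ℂ (fun w => theta m (w - a)) w := fun a =>
      Differentiable.analyticAt (hT.comp (differentiable_id.sub_const a)) w
    obtain ⟨n1, n2⟩ := theta_sub_ne_zero hm hz' (strip_subset_closedStrip hw) hne
    refine (InnerProductSpace.harmonicAt_congr_nhds ?_).2
      ((((ha z).harmonicAt_log_norm n1).sub ((ha (starRingEnd ℂ z)).harmonicAt_log_norm n2)).const_smul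
        (c := -(2 * Real.pi)⁻¹))
    filter_upwards [(ha z).continuousAt.eventually_ne n1,
      (ha (starRingEnd ℂ z)).continuousAt.eventually_ne n2] with x h1 h2
    rw [greenFn_eq_log hm h1 h2]
    rfl
  singularity z hz := by
    have hT := differentiable_theta hm
    have hz' := strip_subset_closedStrip hz
    have n2 : theta m (z - starRingEnd ℂ z) ≠ 0 := theta_ne_zero hm (sub_conj_notMem hm hz hz)
    have hd : HasDerivAt (fun w => theta m (w - z)) (deriv (theta m) 0) z := by
      have : HasDerivAt (theta m) (deriv (theta m) 0) (z - z) := by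
        rw [sub_self]; exact (hT 0).hasDerivAt
      exact this.comp_sub_const z z
    have hc : ContinuousAt (fun w => theta m (w - starRingEnd ℂ z)) z :=
      (hT.continuous.comp (continuous_id.sub continuous_const)).continuousAt
    have l1 := (((hd.tendsto_slope).norm.log (norm_ne_zero_iff.2 (deriv_theta_zero_ne_zero hm))).sub
      ((hc.tendsto.mono_left nhdsWithin_le_nhds).norm.log (norm_ne_zero_iff.2 n2))).const_mul
      (-(2 * Real.pi)⁻¹)
    refine (Tendsto.isBigO_one ℝ l1).congr' ?_ EventuallyEq.rfl
    filter_upwards [self_mem_nhdsWithin, hd.eventually_ne (deriv_theta_zero_ne_zero hm) (c := 0),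
      (hc.eventually_ne n2).filter_mono nhdsWithin_le_nhds] with w h1 h2 h3
    have h1 : w - z ≠ 0 := sub_ne_zero.2 h1
    rw [greenFn_eq_log hm h2 h3, slope_def_field, sub_self, theta_zero, sub_zero, norm_div,
      Real.log_div (norm_ne_zero_iff.2 h2) (norm_ne_zero_iff.2 h1)]
    ring
  boundary z hz p hp := by
    have hT := differentiable_theta hm
    have hpi := Real.pi_pos
    have hp' : p ∈ closedStrip := by
      rcases hp with h | h
      · exact ⟨h.ge, h.le.trans hpi.le⟩
      · exact ⟨hpi.le.trans h.ge, h.le⟩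
    have hne : ¬ SamePoint m p z := not_samePoint_of_im_ne (by
      rcases hp with h | h <;> rw [h]
      · exact hz.1.ne
      · exact hz.2.ne')
    obtain ⟨n1, n2⟩ := theta_sub_ne_zero hm (strip_subset_closedStrip hz) hp' hne
    have hc : ∀ a, ContinuousAt (fun w => theta m (w - a)) p := fun a =>
      (hT.continuous.comp (continuous_id.sub continuous_const)).continuousAt
    have l1 := ((((hc z).tendsto.norm.log (norm_ne_zero_iff.2 n1)).sub
      ((hc (starRingEnd ℂ z)).tendsto.norm.log (norm_ne_zero_iff.2 n2))).const_mul
      (-(2 * Real.pi)⁻¹)).mono_left (nhdsWithin_le_nhds (s := strip))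
    have e0 : Real.log ‖theta m (p - z)‖ - Real.log ‖theta m (p - starRingEnd ℂ z)‖ = 0 := by
      rw [← norm_theta_conj_sub hm]
      rcases hp with h | h
      · have := pairLog_of_im_eq_zero hm h z
        rw [pairLog_comm hm] at this
        exact this
      · exact pairLog_of_im_eq_pi h z
    rw [e0, mul_zero] at l1
    refine l1.congr' ?_
    filter_upwards [((hc z).eventually_ne n1).filter_mono nhdsWithin_le_nhds,
      ((hc (starRingEnd ℂ z)).eventually_ne n2).filter_mono nhdsWithin_le_nhds] with x h1 h2
    rw [greenFn_eq_log hm h1 h2]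

include hm in
theorem wirtinger_greenFn {z w : ℂ} (hz : z ∈ strip) (hw : w ∈ strip) (h : ¬ SamePoint m w z)
    (s : Bool) : wirtinger s (fun w => (greenFn m z w : ℂ)) w =
      -(4 * Real.pi)⁻¹ * sgn s * (thetaLog m (signConj s w - z) -
        thetaLog m (signConj s w - starRingEnd ℂ z)) := by
  have hT := differentiable_theta hm
  obtain ⟨n1, n2⟩ := theta_sub_ne_zero hm (strip_subset_closedStrip hz)
    (strip_subset_closedStrip hw) h
  have hd : ∀ a, HasDerivAt (fun w => theta m (w - a)) (deriv (theta m) (w - a)) w := fun a =>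
    (hT (w - a)).hasDerivAt.comp_sub_const w a
  have he : (fun w => (greenFn m z w : ℂ)) =ᶠ[𝓝 w] fun w => ((-(2 * Real.pi)⁻¹ *
      (Real.log ‖theta m (w - z)‖ - Real.log ‖theta m (w - starRingEnd ℂ z)‖) : ℝ) : ℂ) := by
    filter_upwards [(hd z).continuousAt.eventually_ne n1,
      (hd (starRingEnd ℂ z)).continuousAt.eventually_ne n2] with x h1 h2
    rw [greenFn_eq_log hm h1 h2]
  have hcongr : wirtinger s (fun w => (greenFn m z w : ℂ)) w = wirtinger s (fun w =>
      ((-(2 * Real.pi)⁻¹ * (Real.log ‖theta m (w - z)‖ -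
        Real.log ‖theta m (w - starRingEnd ℂ z)‖) : ℝ) : ℂ)) w := by
    rw [wirtinger, wirtinger, he.fderiv_eq]
  rw [hcongr, wirtinger_log_norm_sub (hd z) (hd _) n1 n2]
  change _ * signConj s (thetaLog m (w - z) - thetaLog m (w - starRingEnd ℂ z)) = _
  cases s
  · simp only [signConj, sgn, if_false, Bool.false_eq_true]
    rw [map_sub, ← thetaLog_conj hm, ← thetaLog_conj hm]
    simp only [map_sub, conj_conj]
    push_cast
    ring
  · simp only [signConj, sgn, if_true]
    push_cast
    ring

/-- As a function of `z₁` the first derivative is a holomorphic minus an antiholomorphic function,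
both built from `Z`. A second derivative turns `Z` into `-℘ - c`, so the constant is the one in the
path integrals. -/
theorem isGreenConstant {c : ℝ}
    (hc : ∀ u, u ∉ (periods m hm).lattice → deriv (thetaLog m) u = -wp m hm u - c) :
    IsGreenConstant m hm c := by
  refine ⟨greenFn m, isGreenFunction_greenFn hm, fun s₁ s₂ z₁ hz₁ z₂ hz₂ hne => ?_⟩
  have he : (fun w₁ => wirtinger s₂ (fun w₂ => (greenFn m w₁ w₂ : ℂ)) z₂) =ᶠ[𝓝 z₁] fun w₁ =>
      -(4 * Real.pi)⁻¹ * sgn s₂ * (thetaLog m (signConj s₂ z₂ - w₁) -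
        thetaLog m (signConj s₂ z₂ - starRingEnd ℂ w₁)) := by
    have h1 : ¬ SamePoint m z₁ z₂ := fun ⟨l, hl⟩ => hne ⟨-l, by rw [hl]; push_cast; ring⟩
    filter_upwards [isOpen_strip.mem_nhds hz₁,
      (isClosed_samePoint hm.ne' z₂).isOpen_compl.mem_nhds h1] with w hw hw'
    exact wirtinger_greenFn hm hw hz₂
      (fun ⟨l, hl⟩ => hw' ⟨-l, by rw [hl]; push_cast; ring⟩) s₂
  have hcongr : wirtinger s₁ (fun w₁ => wirtinger s₂ (fun w₂ => (greenFn m w₁ w₂ : ℂ)) z₂) z₁ =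
      wirtinger s₁ (fun w₁ => -(4 * Real.pi)⁻¹ * sgn s₂ * (thetaLog m (signConj s₂ z₂ - w₁) -
        thetaLog m (signConj s₂ z₂ - starRingEnd ℂ w₁))) z₁ := by
    rw [wirtinger, he.fderiv_eq, wirtinger]
  have hn : ∀ s, signConj s₂ z₂ - signConj s z₁ ∉ (periods m hm).lattice := fun s =>
    signConj_sub_notMem hm (strip_subset_closedStrip hz₂) (strip_subset_closedStrip hz₁) hne _ _
  have hd : ∀ s, HasDerivAt (fun w => thetaLog m (signConj s₂ z₂ - w))
      (-(-wp m hm (signConj s₂ z₂ - signConj s z₁) - c)) (signConj s z₁) := fun s => by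
    have := (analyticAt_thetaLog hm (hn s)).differentiableAt.hasDerivAt
    rw [hc _ (hn s)] at this
    exact this.comp_const_sub (signConj s₂ z₂) (signConj s z₁)
  have hπ : (Real.pi : ℂ) ≠ 0 := by exact_mod_cast Real.pi_ne_zero
  have hd₁ : HasDerivAt _ _ z₁ := hd true
  have hd₂ : HasDerivAt _ _ (starRingEnd ℂ z₁) := hd false
  rw [hcongr, wirtinger_sub_conj hd₁ hd₂]
  cases s₁ <;> simp only [sgn, signConj, if_true, if_false, Bool.false_eq_true] <;>
    push_cast <;> field_simp <;> ring

end green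

end

section

/-! ### The cumulants of the discrete Gaussian -/

section gaussian

/-- The sum over `k ∈ ℤ` of `exp (-m k² / 2 + k u)`. -/
def gaussTheta (m : ℝ) (u : ℂ) : ℂ :=
  jacobiTheta₂ (u / (2 * Real.pi * I)) (m / (2 * Real.pi) * I)

variable {m : ℝ} (hm : 0 < m)

include hm in
theorem gaussTheta_im_pos : 0 < ((m / (2 * Real.pi) * I : ℂ)).im := by
  have : (m / (2 * Real.pi) * I : ℂ) = ((m / (2 * Real.pi) : ℝ) : ℂ) * I := by push_cast; ring
  rw [this, Complex.re_ofReal_mul |> fun _ => Complex.im_ofReal_mul]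
  simp only [I_im, mul_one]
  positivity

include hm in
theorem hasSum_gaussTheta (u : ℂ) :
    HasSum (fun k : ℤ => exp (-(1 / 2) * m * (k : ℂ) ^ 2 + k * u)) (gaussTheta m u) := by
  refine (hasSum_jacobiTheta₂_term _ (gaussTheta_im_pos hm)).congr_fun fun k => ?_
  rw [jacobiTheta₂_term]
  congr 1
  have := Real.pi_ne_zero
  field_simp
  rw [I_sq]
  ring

include hm in
theorem differentiable_gaussTheta : Differentiable ℂ (gaussTheta m) := fun u =>
  DifferentiableAt.comp u (f := fun u => u / (2 * Real.pi * I))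
    (g := fun z => jacobiTheta₂ z (m / (2 * Real.pi) * I))
    (differentiableAt_jacobiTheta₂_fst (u / (2 * Real.pi * I)) (gaussTheta_im_pos hm))
    (by fun_prop)

theorem gaussTheta_neg (u : ℂ) : gaussTheta m (-u) = gaussTheta m u := by
  rw [gaussTheta, neg_div, jacobiTheta₂_neg_left, gaussTheta]

theorem gaussTheta_add_two_pi_I (u : ℂ) : gaussTheta m (u + 2 * Real.pi * I) = gaussTheta m u := by
  rw [gaussTheta, add_div, div_self two_pi_I_ne_zero, jacobiTheta₂_add_left, gaussTheta]

theorem gaussTheta_add_ofReal (u : ℂ) :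
    gaussTheta m (u + m) = exp (u + m / 2) * gaussTheta m u := by
  have hpi : (Real.pi : ℂ) ≠ 0 := by exact_mod_cast Real.pi_ne_zero
  rw [← gaussTheta_neg (u + m), gaussTheta,
    show -(u + m) / (2 * Real.pi * I) = -u / (2 * Real.pi * I) + m / (2 * Real.pi) * I by
      field_simp
      rw [I_sq]
      ring, jacobiTheta₂_add_left', ← gaussTheta_neg u, gaussTheta]
  congr 2
  field_simp
  rw [I_sq]
  ring

/-- Evenness and the two quasi-periods map the half period to itself with the factor `exp (πi) =
-1`. -/
theorem gaussTheta_eq_zero : gaussTheta m (m / 2 + Real.pi * I) = 0 := by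
  have h1 := gaussTheta_add_ofReal (m := m) (-(m / 2 + Real.pi * I) + 2 * Real.pi * I)
  rw [gaussTheta_add_two_pi_I, gaussTheta_neg,
    show -(m / 2 + Real.pi * I) + 2 * Real.pi * I + m = m / 2 + Real.pi * I by ring,
    show -(m / 2 + Real.pi * I) + 2 * Real.pi * I + m / 2 = Real.pi * I by ring, exp_pi_mul_I]
    at h1
  linear_combination h1 / 2

include hm in
-- Multiplied by `exp (-u/2)`, the Gaussian sum has the quasi-periods of the shifted `theta` and
-- vanishes at its zeros, so the quotient is constant.
theorem exists_gaussTheta_eq : ∃ C : ℂ, ∀ u : ℂ,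
    gaussTheta m u = C * exp (u / 2) * theta m (u - (m / 2 + Real.pi * I)) := by
  set u₀ : ℂ := m / 2 + Real.pi * I with hu₀
  have hT := differentiable_theta hm
  have hN1 : ∀ u : ℂ, gaussTheta m (u + m) * exp (-(u + m) / 2) =
      1 * exp u * (gaussTheta m u * exp (-u / 2)) := fun u => by
    rw [gaussTheta_add_ofReal, show u + m / 2 = u + (m / 2 : ℂ) by ring,
      show -(u + m) / 2 = -u / 2 + -(m / 2 : ℂ) by ring, exp_add, exp_add, exp_neg (m / 2 : ℂ)]
    field_simp [exp_ne_zero]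
  have hN2 : ∀ u : ℂ, gaussTheta m (u + 2 * Real.pi * I) * exp (-(u + 2 * Real.pi * I) / 2) =
      1 * (-1) * (gaussTheta m u * exp (-u / 2)) := fun u => by
    rw [gaussTheta_add_two_pi_I, show -(u + 2 * Real.pi * I) / 2 = -u / 2 - Real.pi * I by ring,
      exp_sub, exp_pi_mul_I]
    ring
  have hzero : ∀ l ∈ (periods m hm).lattice, gaussTheta m (u₀ + l) = 0 := by
    have h1 : ∀ u, gaussTheta m (u + m) = 0 ↔ gaussTheta m u = 0 := fun u => by
      rw [gaussTheta_add_ofReal, mul_eq_zero, or_iff_right (exp_ne_zero _)]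
    intro l hl
    have := apply_add_of_mem_periods (g := fun z => gaussTheta m z = 0) hm
      (fun z => propext (h1 z)) (fun z => by rw [gaussTheta_add_two_pi_I]) u₀ hl
    exact this.mpr gaussTheta_eq_zero
  obtain ⟨C, hC, -⟩ := exists_eq_const_mul_of_quasiperiodic hm
    (N := fun u => gaussTheta m u * exp (-u / 2)) (Q := fun u => theta m (u - u₀))
    ((differentiable_gaussTheta hm).mul (by fun_prop)) (hT.comp (by fun_prop))
    (fun z hz => by
      have hl := (theta_eq_zero_iff hm _).1 hz
      refine ⟨?_, ?_⟩
      · have := hzero _ hl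
        rw [add_sub_cancel] at this
        change gaussTheta m z * exp (-z / 2) = 0
        rw [this, zero_mul]
      · rw [deriv_comp_sub_const]
        exact theta_simple_zeros hm _ hz)
    (a := 1) (b := 1) (by simp) (by simp) (r := exp) (s := fun _ => -1) continuous_exp
    continuous_const exp_ne_zero (by simp)
    (fun z => by
      rw [show z + m - u₀ = z - u₀ + m by ring, theta_add_ofReal hm, hu₀,
        show z - (m / 2 + Real.pi * I) + m / 2 = z - Real.pi * I by ring, exp_sub, exp_pi_mul_I]
      ring)
    hN1
    (fun z => by
      rw [show z + 2 * Real.pi * I - u₀ = z - u₀ + 2 * Real.pi * I by ring, theta_add_two_pi_I]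
      ring)
    hN2
  refine ⟨C, fun u => ?_⟩
  have h := hC u
  have : exp (-u / 2) * exp (u / 2) = 1 := by rw [← exp_add]; simp [← add_div]
  linear_combination (exp (u / 2)) * h - gaussTheta m u * this

include hm in
theorem hasSum_gaussWeight_mul_exp (μ t a : ℝ) :
    HasSum (fun k : ℤ => gaussWeight m μ k * Real.exp (t * (k - a)))
      (Real.exp (-(1 / 2) * m * μ ^ 2 - t * a) * (gaussTheta m (m * μ + t : ℝ)).re) := by
  have h := (Complex.hasSum_re (hasSum_gaussTheta hm (m * μ + t : ℝ))).mul_left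
    (Real.exp (-(1 / 2) * m * μ ^ 2 - t * a))
  refine h.congr_fun fun k => ?_
  rw [show (-(1 / 2) * m * (k : ℂ) ^ 2 + k * ((m * μ + t : ℝ) : ℂ)) =
      ((-(1 / 2) * m * (k : ℝ) ^ 2 + k * (m * μ + t) : ℝ) : ℂ) by push_cast; ring, ← ofReal_exp,
    ofReal_re, gaussWeight, ← Real.exp_add, ← Real.exp_add]
  congr 1
  ring

include hm in
theorem gaussTheta_ofReal (u : ℝ) : ((gaussTheta m u).re : ℂ) = gaussTheta m u := by
  have h := hasSum_gaussTheta hm u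
  have h2 := Complex.hasSum_ofReal.2 (Complex.hasSum_re h)
  refine h2.unique (h.congr_fun fun k => ?_)
  rw [show (-(1 / 2) * m * (k : ℂ) ^ 2 + k * (u : ℂ)) =
      ((-(1 / 2) * m * (k : ℝ) ^ 2 + k * u : ℝ) : ℂ) by push_cast; ring, ← ofReal_exp, ofReal_re]

theorem gaussWeight_pos (m μ : ℝ) (k : ℤ) : 0 < gaussWeight m μ k := Real.exp_pos _

include hm in
theorem gaussZ_pos (μ : ℝ) : 0 < gaussZ m μ := by
  have h := (hasSum_gaussWeight_mul_exp hm μ 0 0).summable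
  simp only [zero_mul, Real.exp_zero, mul_one] at h
  exact h.tsum_pos (fun k => (gaussWeight_pos m μ k).le) 0 (gaussWeight_pos m μ 0)

include hm in
theorem hasSum_mgf (μ t : ℝ) :
    HasSum (fun k : ℤ => gaussWeight m μ k / gaussZ m μ * Real.exp (t * (k - gaussShift m μ)))
      (ProbabilityTheory.mgf id (discreteGaussian m μ) t) := by
  set a := gaussShift m μ
  have hs : Summable
      (fun k : ℤ => gaussWeight m μ k / gaussZ m μ * Real.exp (t * (k - a))) := by
    refine ((hasSum_gaussWeight_mul_exp hm μ t a).summable.div_const (gaussZ m μ)).congr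
      fun k => ?_
    ring
  have hw : ∀ k, 0 ≤ gaussWeight m μ k / gaussZ m μ := fun k =>
    div_nonneg (gaussWeight_pos m μ k).le (gaussZ_pos hm μ).le
  have hnn : ∀ k : ℤ, 0 ≤ gaussWeight m μ k / gaussZ m μ * Real.exp (t * (k - a)) := fun k =>
    mul_nonneg (hw k) (Real.exp_pos _).le
  convert hs.hasSum using 1
  rw [ProbabilityTheory.mgf, integral_eq_lintegral_of_nonneg_ae
    (Eventually.of_forall fun x => (Real.exp_pos _).le) (by fun_prop), discreteGaussian,
    lintegral_sum_measure]
  simp only [id, lintegral_smul_measure]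
  rw [← ENNReal.toReal_ofReal (tsum_nonneg hnn), ENNReal.ofReal_tsum_of_nonneg hnn hs]
  congr 2
  funext k
  rw [lintegral_dirac, smul_eq_mul, ENNReal.ofReal_mul (hw k)]

include hm in
theorem mgf_pos (μ t : ℝ) : 0 < ProbabilityTheory.mgf id (discreteGaussian m μ) t := by
  have h := hasSum_mgf hm μ t
  have hp : ∀ k : ℤ,
      0 < gaussWeight m μ k / gaussZ m μ * Real.exp (t * (k - gaussShift m μ)) := fun k =>
    mul_pos (div_pos (gaussWeight_pos m μ k) (gaussZ_pos hm μ)) (Real.exp_pos _)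
  rw [← h.tsum_eq]
  exact h.summable.tsum_pos (fun k => (hp k).le) 0 (hp 0)

include hm in
-- Completing the square evaluates the Gaussian sum at `u = mμ + t`, and `mμ - (m/2 + πi) = -z_μ`.
-- Normalization and centering only affect `K` and `b`.
theorem exists_mgf_eq (μ : ℝ) : ∃ K b : ℂ, ∀ t : ℝ,
    (ProbabilityTheory.mgf id (discreteGaussian m μ) t : ℂ) =
      K * exp (b * t) * theta m (-zPoint m μ + t) := by
  obtain ⟨C, hC⟩ := exists_gaussTheta_eq hm
  refine ⟨(gaussZ m μ : ℂ)⁻¹ * exp (-(1 / 2) * m * μ ^ 2) * C * exp (m * μ / 2),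
    1 / 2 - gaussShift m μ, fun t => ?_⟩
  have h := ((hasSum_gaussWeight_mul_exp hm μ t (gaussShift m μ)).div_const (gaussZ m μ)).unique
    ((hasSum_mgf hm μ t).congr_fun fun k => by ring)
  rw [← h]
  rw [ofReal_div, ofReal_mul, gaussTheta_ofReal hm, hC, zPoint,
    show ((m * μ + t : ℝ) : ℂ) - (m / 2 + Real.pi * I) =
      -((1 / 2 - μ) * m + Real.pi * I) + t by push_cast; ring, div_eq_mul_inv]
  push_cast
  have e : exp (-(1 / 2) * m * μ ^ 2 - t * gaussShift m μ) * exp ((m * μ + t : ℂ) / 2) =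
      exp (-(1 / 2) * m * μ ^ 2) * exp (m * μ / 2) * exp ((1 / 2 - gaussShift m μ) * t) := by
    rw [← exp_add, ← exp_add, ← exp_add]
    congr 1
    ring
  linear_combination (C * theta m (-((1 / 2 - μ) * m + Real.pi * I) + t) *
    (gaussZ m μ : ℂ)⁻¹) * e

theorem hasDerivAt_of_hasDerivAt_ofReal {g : ℝ → ℝ} {w : ℂ} {t : ℝ}
    (h : HasDerivAt (fun s => (g s : ℂ)) w t) : HasDerivAt g w.re t ∧ (w.re : ℂ) = w := by
  have h1 : HasDerivAt g w.re t := by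
    exact reCLM.hasFDerivAt.comp_hasDerivAt t h
  exact ⟨h1, h1.ofReal_comp.unique h⟩

/-- A real function that is the restriction of a holomorphic one to a horizontal line inherits its
derivatives, which are therefore real there. -/
theorem ofReal_iteratedDeriv_eq {g : ℝ → ℝ} {W : ℂ → ℂ} {p : ℂ} {U : Set ℂ}
    (hW : AnalyticOnNhd ℂ W U) (hp : ∀ t : ℝ, p + t ∈ U) (h : ∀ t : ℝ, (g t : ℂ) = W (p + t))
    (n : ℕ) (t : ℝ) : ((iteratedDeriv n g t : ℝ) : ℂ) = iteratedDeriv n W (p + t) := by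
  induction n generalizing t with
  | zero => simpa using h t
  | succ n ih =>
    have ha : HasDerivAt (iteratedDeriv n W) (iteratedDeriv (n + 1) W (p + t)) (p + t) := by
      rw [iteratedDeriv_succ]
      have := hW.iterated_deriv n _ (hp t)
      rw [← iteratedDeriv_eq_iterate] at this
      exact this.differentiableAt.hasDerivAt
    have hb : HasDerivAt (fun s : ℝ => ((iteratedDeriv n g s : ℝ) : ℂ))
        (iteratedDeriv (n + 1) W (p + t)) t := by
      have := (ha.comp_const_add p (t : ℂ)).comp_ofReal
      exact this.congr_of_eventuallyEq (Eventually.of_forall fun s => ih s)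
    obtain ⟨h1, h2⟩ := hasDerivAt_of_hasDerivAt_ofReal hb
    rw [iteratedDeriv_succ, h1.deriv, h2]

theorem neg_zPoint_add_notMem (μ t : ℝ) : -zPoint m μ + t ∉ (periods m hm).lattice := by
  rw [show -zPoint m μ + t = -midPoint ((1 / 2 - μ) * m - t) by
    rw [zPoint_eq_midPoint, midPoint, midPoint]
    push_cast
    ring]
  exact neg_notMem hm (midPoint_notMem hm _)

include hm in
theorem exists_deriv_cgf_eq (μ : ℝ) : ∃ b : ℂ, ∀ t : ℝ,
    ((deriv (ProbabilityTheory.cgf id (discreteGaussian m μ)) t : ℝ) : ℂ) =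
      b + thetaLog m (-zPoint m μ + t) := by
  obtain ⟨K, b, hK⟩ := exists_mgf_eq hm μ
  refine ⟨b, fun t => ?_⟩
  have hpos := mgf_pos hm μ t
  set M := ProbabilityTheory.mgf id (discreteGaussian m μ)
  have hT := ((differentiable_theta hm) (-zPoint m μ + t)).hasDerivAt
  have h1 : HasDerivAt (fun s : ℂ => K * exp (b * s) * theta m (-zPoint m μ + s))
      (K * (exp (b * t) * (b * 1)) * theta m (-zPoint m μ + t) +
        K * exp (b * t) * deriv (theta m) (-zPoint m μ + t)) t :=
    ((((hasDerivAt_id (t : ℂ)).const_mul b).cexp).const_mul K).fun_mul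
      (hT.comp_const_add (-zPoint m μ) (t : ℂ))
  obtain ⟨h2, h3⟩ := hasDerivAt_of_hasDerivAt_ofReal
    (h1.comp_ofReal.congr_of_eventuallyEq (Eventually.of_forall fun s => hK s))
  have h4 := (h2.log hpos.ne').deriv
  change ((deriv (fun s => Real.log (M s)) t : ℝ) : ℂ) = _
  have hM0 : (M t : ℂ) ≠ 0 := by exact_mod_cast hpos.ne'
  have hth := theta_ne_zero hm (neg_zPoint_add_notMem hm μ t)
  rw [h4, ofReal_div, h3, div_eq_iff hM0, hK, thetaLog]
  field_simp

/-- From order three on, the constants `b` and `c` have been differentiated away and the cumulant is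
`-℘^{(n-2)}(-z_μ)`; evenness of `℘` supplies the sign. -/
theorem wpCoeff_eq_gaussCumulant (μ : ℝ) {n : ℕ} (hn : 3 ≤ n) :
    wpCoeff m hm μ n = (gaussCumulant m μ n : ℂ) := by
  obtain ⟨c, hc⟩ := exists_deriv_thetaLog_eq hm
  obtain ⟨b, hb⟩ := exists_deriv_cgf_eq hm μ
  obtain ⟨k, rfl⟩ : ∃ k, n = k + 3 := ⟨n - 3, by omega⟩
  set g := deriv (ProbabilityTheory.cgf id (discreteGaussian m μ)) with hg
  have hΛ := isOpen_compl_periods hm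
  have hW : AnalyticOnNhd ℂ (fun u => b + thetaLog m u) ((periods m hm).lattice : Set ℂ)ᶜ :=
    fun u hu => analyticAt_const.add (analyticAt_thetaLog hm hu)
  have h1 := ofReal_iteratedDeriv_eq hW (fun t => neg_zPoint_add_notMem hm μ t) hb (k + 2) 0
  rw [gaussCumulant, iteratedDeriv_succ', ← hg, h1, ofReal_zero, add_zero]
  have hz : -zPoint m μ ∈ ((periods m hm).lattice : Set ℂ)ᶜ := by
    simpa using neg_zPoint_add_notMem hm μ 0
  have e1 : deriv (fun u => b + thetaLog m u) =ᶠ[𝓝 (-zPoint m μ)] fun u => -wp m hm u - c := by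
    filter_upwards [hΛ.mem_nhds hz] with u hu
    rw [deriv_const_add, hc u hu]
  have e2 : deriv (fun u => -wp m hm u - c) = fun u => -deriv (wp m hm) u := by
    funext u
    rw [deriv_sub_const, deriv.fun_neg]
  have e3 : deriv (deriv (fun u => b + thetaLog m u)) =ᶠ[𝓝 (-zPoint m μ)]
      fun u => -deriv (wp m hm) u := e2 ▸ e1.deriv
  rw [iteratedDeriv_succ', iteratedDeriv_succ', e3.iteratedDeriv_eq, iteratedDeriv_fun_neg,
    ← iteratedDeriv_succ', wpCoeff]
  have e4 := iteratedDeriv_comp_neg (k + 1) (wp m hm) (zPoint m μ)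
  simp only [wp_neg] at e4
  rw [show k + 3 - 2 = k + 1 by omega, show k + 3 - 1 = k + 2 by omega, smul_eq_mul] at *
  rw [show (fun x => wp m hm x) = wp m hm from rfl] at e4
  have hsq : ((-1 : ℂ) ^ (k + 1)) * (-1) ^ (k + 1) = 1 := by
    rw [← mul_pow]; simp
  rw [e4, pow_succ]
  linear_combination (-iteratedDeriv (k + 1) (wp m hm) (-zPoint m μ)) * hsq

end gaussian

end

end DimerCylinder

end

theorem corollary3p11 (m : ℝ) (hm : 0 < m) (Ω : Set ℂ) (φ : ℂ → ℂ)
    (hφ : IsUniformization m φ Ω) (f : ℂ → ℂ → ℂ → ℂ)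
    (hf : ∀ η : ℂ, ∀ z₁ ∈ Ω, IsBVPSolution φ Ω η z₁ (f η z₁)) :
    -- the integrals defining the correlation functions converge, whatever the paths
    (∀ (ι : Type) [Fintype ι] [DecidableEq ι] (z : ι → ℂ) (γ : ι → ℝ → ℂ),
      IsPathFamily m z γ →
        IntegrableOn (pathIntegrand φ f γ) (Icc (0 : ι → ℝ) 1) ∧
        pathIntegral φ f γ = heightCorr m φ f z) ∧
    -- the connected correlation functions
    (∃ c : ℝ, IsGreenConstant m hm c ∧
      (∃ μ : ℝ, IsParameter m hm φ f c μ) ∧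
      ∀ μ : ℝ, IsParameter m hm φ f c μ → ∀ n : ℕ, 3 ≤ n →
        ∀ z : Fin n → ℂ, IsDistinctTuple m z →
          connectedCorr m φ f z = wpCoeff m hm μ n * ∏ k, (hmTop (z k) : ℂ)) ∧
    -- the coefficients are the cumulants of the centered discrete Gaussian
    (∀ μ : ℝ, ∀ n : ℕ, 3 ≤ n → wpCoeff m hm μ n = (gaussCumulant m μ n : ℂ)) := by
  obtain ⟨c, hc⟩ := exists_deriv_thetaLog_eq hm
  obtain ⟨r, g, hg⟩ := exists_coupling_eq hm hφ hf
  have hg : IsKernelGauge m r φ f g := hg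
  refine ⟨fun ι _ _ z γ hγ => ⟨(hγ.pathIntegral_eq hm hg.1 hg.2).1, ?_⟩,
    ⟨c, isGreenConstant hm hc, exists_isParameter hm hg hc, fun μ hμ n hn z hz => ?_⟩,
    fun μ n hn => wpCoeff_eq_gaussCumulant hm μ hn⟩
  · exact (hγ.pathIntegral_eq_corrSum hm hg hc).trans
      (heightCorr_eq hm hg hc hγ.isDistinctTuple).symm
  · rw [connectedCorr_eq hm hg hc hn hz, hμ.wpCoeff_eq hm hg hc hn]
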